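/- Let $\mathbf{k}$ be a field of characteristic $0$. Operads are symmetric operads in graded $\mathbf{k}$-vector spaces, and $\Gamma(E)$ denotes the free operad on a graded $\Sigma$-module $E$. Let $\widetilde{Ass}=\Gamma(\mu)/(\mu\circ_1\mu+\mu\circ_2\mu)$ be the operad of anti-associative algebras, where $\mu$ is one binary operation of degree $0$ without symmetry. A minimal model of $\widetilde{Ass}$ is a morphism of dg-operads $\rho:(\Gamma(E),\partial)\to(\widetilde{Ass},0)$ that induces an isomorphism on homology, where $\partial$ has degree $-1$, $E(0)=E(1)=0$ and the image of $\partial$ consists of decomposable elements. **(1)** $\widetilde{Ass}$ has a minimal model $\rho:(\Gamma(E),\partial)\to(\widetilde{Ass},0)$ in which each $E(a)$ is the free graded $\mathbf{k}[\Sigma_a]$-module on a finite set of homogeneous generators, such that * in arity $2$ there is one generator $\mu_2$, of degree $0$, and $\rho(\mu_2)=\mu$; * in arity $3$ there is one generator $\mu_3$, of degree $1$; * in arity $4$ there are no generators; * in arity $5$ there are exactly four generators $\mu_5^1,\mu_5^2,\mu_5^3,\mu_5^4$, all of degree $2$; * all generators of arity $a\ge 6$ have degree $>2$ (so that $\mu_2,\mu_3,\mu_5^1,\dots,\mu_5^4$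 are the only generators of degree $\le 2$); the Euler characteristics $\chi(E(a))=\sum_x(-1)^{\deg x}$ (the sum over the generators $x$ of arity $a$) are $\chi(E(6))=-14$, $\chi(E(7))=30$, $\chi(E(8))=-33$, $\chi(E(9))=-55$. The differential is given on these generators by $\partial\mu_2=0$, $\partial\mu_3=\mu_2\circ_1\mu_2+\mu_2\circ_2\mu_2$ and $$\begin{aligned} \partial\mu_5^1={}&(\mu_2\circ_2\mu_3)\circ_4\mu_2-(\mu_3\circ_3\mu_2)\circ_4\mu_2+(\mu_2\circ_1\mu_2)\circ_3\mu_3-(\mu_3\circ_1\mu_2)\circ_3\mu_2\\&+(\mu_2\circ_1\mu_3)\circ_1\mu_2-(\mu_3\circ_1\mu_2)\circ_1\mu_2+(\mu_2\circ_1\mu_3)\circ_4\mu_2-(\mu_3\circ_2\mu_2)\circ_4\mu_2,\\ \partial\mu_5^2={}&(\mu_3\circ_1\mu_2)\circ_1\mu_2-(\mu_2\circ_1\mu_3)\circ_1\mu_2+(\mu_2\circ_1\mu_3)\circ_3\mu_2-(\mu_3\circ_2\mu_2)\circ_3\mu_2\\&+(\mu_2\circ_2\mu_3)\circ_3\mu_2-(\mu_3\circ_3\mu_2)\circ_3\mu_2+(\mu_2\circ_1\mu_2)\circ_3\mu_3-(\mu_3\circ_1\mu_2)\circ_4\mu_2,\\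 \partial\mu_5^3={}&(\mu_3\circ_2\mu_2)\circ_4\mu_2-(\mu_2\circ_2\mu_3)\circ_2\mu_2+(\mu_3\circ_2\mu_2)\circ_2\mu_2-(\mu_2\circ_1\mu_2)\circ_2\mu_3\\&+(\mu_2\circ_1\mu_3)\circ_3\mu_2-(\mu_2\circ_1\mu_3)\circ_1\mu_2+(\mu_2\circ_1\mu_2)\circ_1\mu_3-(\mu_3\circ_1\mu_2)\circ_2\mu_2,\\ \partial\mu_5^4={}&(\mu_3\circ_1\mu_2)\circ_3\mu_2-(\mu_3\circ_3\mu_2)\circ_3\mu_2+(\mu_2\circ_2\mu_3)\circ_3\mu_2-(\mu_3\circ_2\mu_2)\circ_3\mu_2\\&+(\mu_2\circ_1\mu_2)\circ_2\mu_3-(\mu_2\circ_1\mu_3)\circ_2\mu_2+(\mu_2\circ_1\mu_2)\circ_1\mu_3-(\mu_2\circ_1\mu_3)\circ_1\mu_2. \end{aligned}$$ Each $\partial\mu_5^i$ comes from a closed edge path of even length in the associahedron $K_5$: there are edges $e_1,\dots,e_8$ of $K_5$ that form a closed path of length $8$ with $\partial\mu_5^i=\sum_{j=1}^{8}(-1)^{j+1}x_{e_j}$.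 Here the vertices of $K_5$ are the full binary bracketings of $5$ dots, its edges are the bracketings with two binary brackets and one ternary bracket, the endpoints of an edge are obtained by replacing the ternary bracket $(xyz)$ by $((xy)z)$ and by $(x(yz))$, and $x_e\in\Gamma(E)(5)$ is the composition obtained from $e$ by reading binary brackets as $\mu_2$ and the ternary bracket as $\mu_3$. **(2)** Let $V$ be a $\mathbf{k}$-vector space with a bilinear anti-associative product, $a(bc)+(ab)c=0$ for all $a,b,c\in V$. There is exactly one operad morphism $\alpha:\widetilde{Ass}\to\mathrm{End}_V$ that sends $\mu$ to the product. Put $\beta=\alpha\rho$. The deformation complex of this algebra is $C^1\xrightarrow{\delta^1}C^2\xrightarrow{\delta^2}C^3\xrightarrow{\delta^3}C^4\to\cdots$, where $C^1=\mathrm{Hom}(V,V)$, where $C^{p+2}$ for $p\ge 0$ is the space of derivations $\theta:\Gamma(E)\to\mathrm{End}_V$ over $\beta$ of degree $-p$, with $\delta^{p+2}\theta=\theta\circ\partial$, and where $\delta^1\varphi$ is the inner derivation $x\mapsto\sum_j\beta(x)\circ_j\varphi-\varphi\circ\beta(x)$. For all $p$, restriction to the generators is a bijection from $C^{p+2}$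 to $\prod_x\mathrm{Hom}(V^{\otimes q(x)},V)$, the product over the generators $x$ of degree $p$ in (1), where $q(x)$ is the arity of $x$. In particular, evaluation at $\mu_2$, at $\mu_3$ and at $(\mu_5^1,\dots,\mu_5^4)$ gives $$C^1=\mathrm{Hom}(V,V),\quad C^2=\mathrm{Hom}(V^{\otimes 2},V),\quad C^3=\mathrm{Hom}(V^{\otimes 3},V),\quad C^4=\mathrm{Hom}(V^{\otimes 5},V)^{\oplus 4}.$$ Under these identifications, for $\varphi\in C^1$, $f\in C^2$, $g\in C^3$ and $a,b,c,d,e\in V$, $$\delta^1(\varphi)(a,b)=a\varphi(b)-\varphi(ab)+\varphi(a)b,\qquad \delta^2(f)(a,b,c)=af(b,c)+f(ab,c)+f(a,bc)+f(a,b)c,$$ and $\delta^3(g)=(\delta^3_1(g),\delta^3_2(g),\delta^3_3(g),\delta^3_4(g))$ with $$\begin{aligned} \delta^3_1(g)(a,b,c,d,e)={}&a\,g(b,c,de)-g(a,b,c(de))+(ab)g(c,d,e)-g(ab,cd,e)\\&+g(ab,c,d)e-g((ab)c,d,e)+g(a,b,c)(de)-g(a,bc,de),\\ \delta^3_2(g)(a,b,c,d,e)={}&g((ab)c,d,e)-g(ab,c,d)e+g(a,b,cd)e-g(a,b(cd),e)\\&+a\,g(b,cd,e)-g(a,b,(cd)e)+(ab)g(c,d,e)-g(ab,c,de),\\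 \delta^3_3(g)(a,b,c,d,e)={}&g(a,bc,de)-a\,g(bc,d,e)+g(a,(bc)d,e)-(a\,g(b,c,d))e\\&+g(a,b,cd)e-g(ab,c,d)e+(g(a,b,c)d)e-g(a(bc),d,e),\\ \delta^3_4(g)(a,b,c,d,e)={}&g(ab,cd,e)-g(a,b,(cd)e)+a\,g(b,cd,e)-g(a,b(cd),e)\\&+(a\,g(b,c,d))e-g(a,bc,d)e+(g(a,b,c)d)e-g(ab,c,d)e. \end{aligned}$$ -/

import Mathlib

namespace AntiAss

universe u v w

noncomputable section

/-- The sign `(-1)^n` as a scalar. -/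
def ksign (k : Type u) [Field k] (n : ℤ) : k := ((n.negOnePow : ℤ) : k)

theorem ksign_add (k : Type u) [Field k] (m n : ℤ) :
    ksign k (m + n) = ksign k m * ksign k n := by
  simp [ksign, Int.negOnePow_add]

theorem ksign_eq (k : Type u) [Field k] {m n : ℤ} (h : Even (m - n)) :
    ksign k m = ksign k n := by
  unfold ksign
  rw [(Int.negOnePow_eq_iff m n).2 h]

@[simp] theorem ksign_zero (k : Type u) [Field k] : ksign k 0 = 1 := by
  simp [ksign]

/-- Where the inputs of `x` (other than the `i`-th) and the inputs of `y` go in `x ∘_i y`. -/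
def slotFun {m : ℕ} (i : Fin m) (n : ℕ) : {a : Fin m // a ≠ i} ⊕ Fin n → Fin (m + n - 1)
  | .inl a => ⟨if a.1 < i then a.1 else a.1 + n - 1, by
      have := a.1.2; have := i.2; have h := a.2
      have : (a.1 : ℕ) ≠ i := fun e => h (Fin.ext e)
      split <;> rename_i h' <;> simp only [Fin.lt_def] at h' <;> omega⟩
  | .inr b => ⟨i + b, by have := i.2; have := b.2; omega⟩

theorem slotFun_bijective {m : ℕ} (i : Fin m) (n : ℕ) : Function.Bijective (slotFun i n) := by
  have hi := i.2
  constructor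
  · intro a b h
    rcases a with ⟨a, ha⟩ | a <;> rcases b with ⟨b, hb⟩ | b <;>
      simp only [slotFun, Fin.lt_def, Fin.ext_iff] at h <;>
      simp only [Sum.inl.injEq, Sum.inr.injEq, Subtype.mk.injEq, Fin.ext_iff, reduceCtorEq] <;>
      try have ha' : (a : ℕ) ≠ i := fun e => ha (Fin.ext e)
    · have hb' : (b : ℕ) ≠ i := fun e => hb (Fin.ext e)
      split_ifs at h <;> omega
    · have := b.2
      split_ifs at h <;> omega
    · have hb' : (b : ℕ) ≠ i := fun e => hb (Fin.ext e)
      have := a.2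
      split_ifs at h <;> omega
    · omega
  · intro c
    have hc := c.2
    by_cases h1 : (c : ℕ) < i
    · exact ⟨.inl ⟨⟨c, by omega⟩, by simp [Fin.ext_iff]; omega⟩, by simp [slotFun, Fin.lt_def, h1]⟩
    · by_cases h2 : (c : ℕ) < i + n
      · refine ⟨.inr ⟨c - i, by omega⟩, ?_⟩
        simp only [slotFun, Fin.ext_iff]; omega
      · refine ⟨.inl ⟨⟨c + 1 - n, by omega⟩, ?_⟩, ?_⟩
        · simp only [ne_eq, Fin.ext_iff]; omega
        · simp only [slotFun, Fin.ext_iff, Fin.lt_def]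
          split_ifs <;> omega

/-- The inputs of `x ∘_i y`, for `x` with `m` inputs and `y` with `n` inputs: inputs of `x` before
the `i`-th, then the inputs of `y`, then the inputs of `x` after the `i`-th. -/
def slot {m : ℕ} (i : Fin m) (n : ℕ) : {a : Fin m // a ≠ i} ⊕ Fin n ≃ Fin (m + n - 1) :=
  Equiv.ofBijective _ (slotFun_bijective i n)

/-- The block permutation `σ ∘_i τ`. -/
def blockPerm {m m' n n' : ℕ} (σ : Fin m ≃ Fin m') (i : Fin m) (τ : Fin n ≃ Fin n') :
    Fin (m + n - 1) ≃ Fin (m' + n' - 1) :=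
  (slot i n).symm.trans
    ((Equiv.sumCongr (σ.subtypeEquiv (fun a => by simp)) τ).trans (slot (σ i) n'))

theorem blockPerm_slot {m m' n n' : ℕ} (σ : Fin m ≃ Fin m') (i : Fin m) (τ : Fin n ≃ Fin n')
    (s : {a : Fin m // a ≠ i} ⊕ Fin n) : blockPerm σ i τ (slot i n s) =
      slot (σ i) n' (s.map (fun a => ⟨σ a.1, fun h => a.2 (σ.injective h)⟩) τ) := by
  rcases s with s | s <;> simp [blockPerm, Equiv.subtypeEquiv]

theorem slot_inl_val {m : ℕ} (i : Fin m) (n : ℕ) (a : {a : Fin m // a ≠ i}) :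
    (slot i n (.inl a) : ℕ) = if (a.1 : ℕ) < (i : ℕ) then (a.1 : ℕ) else (a.1 : ℕ) + n - 1 := rfl

theorem slot_inr_val {m : ℕ} (i : Fin m) (n : ℕ) (b : Fin n) :
    (slot i n (.inr b) : ℕ) = i + b := rfl

section
variable {m n l : ℕ} (i : Fin m) (j : Fin n)

theorem nested_outer (h) (a : Fin m) (ha : a ≠ i) (h') :
    finCongr h (slot (slot i n (.inr j)) l (.inl ⟨slot i n (.inl ⟨a, ha⟩), h'⟩)) =
      slot i (n + l - 1) (.inl ⟨a, ha⟩) := by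
  have := i.2; have := j.2
  have ha' : (a : ℕ) ≠ i := fun e => ha (Fin.ext e)
  simp only [slot_inl_val, slot_inr_val, Fin.ext_iff, finCongr_apply, Fin.val_cast]
  split_ifs <;> omega

theorem nested_middle (h) (b : Fin n) (hb : b ≠ j) (h') :
    finCongr h (slot (slot i n (.inr j)) l (.inl ⟨slot i n (.inr b), h'⟩)) =
      slot i (n + l - 1) (.inr (slot j l (.inl ⟨b, hb⟩))) := by
  have := i.2; have := j.2
  have hb' : (b : ℕ) ≠ j := fun e => hb (Fin.ext e)
  simp only [slot_inl_val, slot_inr_val, Fin.ext_iff, finCongr_apply, Fin.val_cast,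
    add_lt_add_iff_left]
  split_ifs <;> omega

theorem nested_inner (h) (c : Fin l) :
    finCongr h (slot (slot i n (.inr j)) l (.inr c)) =
      slot i (n + l - 1) (.inr (slot j l (.inr c))) := by
  simp only [slot_inr_val, Fin.ext_iff, finCongr_apply, Fin.val_cast]
  omega

end

section
variable {m n l : ℕ} (i j : Fin m) (hij : i < j)

theorem parallel_outer (h) (a : Fin m) (ha : a ≠ i) (ha' : a ≠ j) (h₁ h₂) :
    finCongr h (slot (slot i n (.inl ⟨j, hij.ne'⟩)) l (.inl ⟨slot i n (.inl ⟨a, ha⟩), h₁⟩)) =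
      slot (slot j l (.inl ⟨i, hij.ne⟩)) n (.inl ⟨slot j l (.inl ⟨a, ha'⟩), h₂⟩) := by
  have := i.2; have := j.2; have := Fin.lt_def.1 hij
  have hai : (a : ℕ) ≠ i := fun e => ha (Fin.ext e)
  have haj : (a : ℕ) ≠ j := fun e => ha' (Fin.ext e)
  simp only [slot_inl_val, Fin.ext_iff, finCongr_apply, Fin.val_cast]
  split_ifs <;> omega

theorem parallel_left (h) (b : Fin n) (h₁) :
    finCongr h (slot (slot i n (.inl ⟨j, hij.ne'⟩)) l (.inl ⟨slot i n (.inr b), h₁⟩)) =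
      slot (slot j l (.inl ⟨i, hij.ne⟩)) n (.inr b) := by
  have := i.2; have := j.2; have := Fin.lt_def.1 hij; have := b.2
  simp only [slot_inl_val, slot_inr_val, Fin.ext_iff, finCongr_apply, Fin.val_cast]
  split_ifs <;> omega

theorem parallel_right (h) (c : Fin l) (h₁) :
    finCongr h (slot (slot i n (.inl ⟨j, hij.ne'⟩)) l (.inr c)) =
      slot (slot j l (.inl ⟨i, hij.ne⟩)) n (.inl ⟨slot j l (.inr c), h₁⟩) := by
  have := i.2; have := j.2; have := Fin.lt_def.1 hij; have := c.2
  simp only [slot_inl_val, slot_inr_val, Fin.ext_iff, finCongr_apply, Fin.val_cast]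
  split_ifs <;> omega

end

/-- The grading of a vector space that is concentrated in degree zero. -/
def trivGr (k : Type u) [Field k] (M : Type v) [AddCommGroup M] [Module k M] (d : ℤ) :
    Submodule k M := if d = 0 then ⊤ else ⊥

theorem trivGr_isInternal (k : Type u) [Field k] (M : Type v) [AddCommGroup M] [Module k M] :
    DirectSum.IsInternal (trivGr k M) := by
  rw [DirectSum.isInternal_submodule_iff_iSupIndep_and_iSup_eq_top]
  constructor
  · intro i
    by_cases h : i = 0
    · have : (⨆ j, ⨆ (_ : j ≠ i), trivGr k M j) = ⊥ := by
        simp only [iSup_eq_bot]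
        intro j hj
        rw [trivGr, if_neg (by rintro rfl; exact hj h.symm)]
      rw [this]; exact disjoint_bot_right
    · rw [trivGr, if_neg h]; exact disjoint_bot_left
  · refine eq_top_iff.2 (le_trans ?_ (le_iSup _ (0 : ℤ)))
    simp [trivGr]

/-- A (symmetric, unital) graded operad over `k`, given by its partial compositions. A bijection of
inputs acts by relabelling, so that `relabel σ` for a permutation `σ` of `Fin n` is the action of
the symmetric group (written on the left), and `relabel (finCongr h)` only identifies arities. -/
structure Operad (k : Type u) [Field k] where
  obj : ℕ → Type v
  [addCommGroup : ∀ n, AddCommGroup (obj n)]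
  [module : ∀ n, Module k (obj n)]
  gr : ∀ n, ℤ → Submodule k (obj n)
  gr_isInternal : ∀ n, DirectSum.IsInternal (gr n)
  relabel : ∀ {m n : ℕ}, (Fin m ≃ Fin n) → obj m →ₗ[k] obj n
  relabel_refl : ∀ {n : ℕ} (x : obj n), relabel (Equiv.refl _) x = x
  relabel_trans : ∀ {l m n : ℕ} (σ : Fin l ≃ Fin m) (τ : Fin m ≃ Fin n) (x : obj l),
    relabel (σ.trans τ) x = relabel τ (relabel σ x)
  relabel_mem : ∀ {m n : ℕ} (σ : Fin m ≃ Fin n) {p : ℤ} {x : obj m},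
    x ∈ gr m p → relabel σ x ∈ gr n p
  one : obj 1
  one_mem : one ∈ gr 1 0
  comp : ∀ {m n : ℕ} (_ : Fin m), obj m →ₗ[k] obj n →ₗ[k] obj (m + n - 1)
  comp_mem : ∀ {m n : ℕ} (i : Fin m) {p q : ℤ} {x : obj m} {y : obj n},
    x ∈ gr m p → y ∈ gr n q → comp i x y ∈ gr (m + n - 1) (p + q)
  comp_relabel : ∀ {m m' n n' : ℕ} (σ : Fin m ≃ Fin m') (τ : Fin n ≃ Fin n') (i : Fin m)
    (x : obj m) (y : obj n),
    comp (σ i) (relabel σ x) (relabel τ y) = relabel (blockPerm σ i τ) (comp i x y)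
  one_comp : ∀ {n : ℕ} (x : obj n),
    relabel (finCongr (by omega)) (comp (0 : Fin 1) one x) = x
  comp_one : ∀ {m : ℕ} (i : Fin m) (x : obj m),
    relabel (finCongr (by omega)) (comp i x one) = x
  /-- `(x ∘_i y) ∘_{i-1+j} z = x ∘_i (y ∘_j z)` -/
  comp_nested : ∀ {m n l : ℕ} (i : Fin m) (j : Fin n) (x : obj m) (y : obj n) (z : obj l),
    relabel (finCongr (by have := i.2; have := j.2; omega))
      (comp (slot i n (.inr j)) (comp i x y) z) = comp i x (comp j y z)
  /-- `(x ∘_i y) ∘_{j-1+n} z = ± (x ∘_j z) ∘_i y` for `i < j` -/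
  comp_parallel : ∀ {m n l : ℕ} (i j : Fin m) (hij : i < j) (x : obj m) {p q : ℤ}
    {y : obj n} {z : obj l}, y ∈ gr n p → z ∈ gr l q →
    relabel (finCongr (by have := i.2; have := j.2; omega))
      (comp (slot i n (.inl ⟨j, hij.ne'⟩)) (comp i x y) z) =
      ksign k (p * q) • comp (slot j l (.inl ⟨i, hij.ne⟩)) (comp j x z) y

attribute [instance] Operad.addCommGroup Operad.module

end
end AntiAss
namespace AntiAss

universe u v w

/-- Planar rooted trees whose vertices with `a` inputs are decorated by elements of `X a` and whose
leaves are labelled by elements of `α`. -/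
inductive Tree (X : ℕ → Type v) (α : Type) : Type v
  | leaf : α → Tree X α
  | node {a : ℕ} : X a → (Fin a → Tree X α) → Tree X α

namespace Tree

variable {X : ℕ → Type v} {α β γ : Type}

/-- Substitution of trees for the leaves. -/
def bind : Tree X α → (α → Tree X β) → Tree X β
  | leaf a, f => f a
  | node x c, f => node x fun i => (c i).bind f

/-- The vertices and the leaves of a tree, in planar (depth-first) order. -/
def word : Tree X α → List ((Σ a, X a) ⊕ α)
  | leaf a => [.inr a]
  | node x c => .inl ⟨_, x⟩ :: (List.ofFn fun i => (c i).word).flatten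

/-- The number of vertices. -/
def size : Tree X α → ℕ
  | leaf _ => 0
  | node _ c => 1 + ∑ i, (c i).size

/-- The labels of the leaves, in planar order. -/
def labels (t : Tree X α) : List α := t.word.filterMap Sum.getRight?

/-- Every label occurs exactly once. -/
def IsLinear (t : Tree X α) : Prop := t.labels.Nodup ∧ ∀ a, a ∈ t.labels

/-- The total degree of the vertices in a word. -/
def wordDeg (deg : ∀ a, X a → ℤ) : List ((Σ a, X a) ⊕ α) → ℤ
  | [] => 0
  | .inl g :: w => deg g.1 g.2 + wordDeg deg w
  | .inr _ :: w => wordDeg deg w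

/-- The total degree of the vertices behind the label `a` in a word. -/
def wordAfter [DecidableEq α] (deg : ∀ a, X a → ℤ) (a : α) : List ((Σ a, X a) ⊕ α) → ℤ
  | [] => 0
  | .inl _ :: w => wordAfter deg a w
  | .inr b :: w => if b = a then wordDeg deg w else wordAfter deg a w

/-- The degree of a tree: the sum of the degrees of its vertices. -/
def degree (deg : ∀ a, X a → ℤ) (t : Tree X α) : ℤ := wordDeg deg t.word

/-- The sum of the degrees of the vertices that follow the leaf `a` in planar order. -/
def after [DecidableEq α] (deg : ∀ a, X a → ℤ) (t : Tree X α) (a : α) : ℤ :=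
  wordAfter deg a t.word

theorem bind_bind (t : Tree X α) (f : α → Tree X β) (g : β → Tree X γ) :
    (t.bind f).bind g = t.bind fun a => (f a).bind g := by
  induction t with
  | leaf a => rfl
  | node x c ih => simp only [bind]; congr 1; funext i; exact ih i

theorem bind_leaf (t : Tree X α) : t.bind leaf = t := by
  induction t with
  | leaf a => rfl
  | node x c ih => simp only [bind]; congr 1; funext i; exact ih i

theorem word_bind (t : Tree X α) (f : α → Tree X β) :
    (t.bind f).word = t.word.flatMap (Sum.elim (fun g => [.inl g]) fun a => (f a).word) := by
  induction t with
  | leaf a => simp [bind, word]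
  | node x c ih =>
    simp only [bind, word, ih, List.flatMap_cons, Sum.elim_inl, List.singleton_append]
    congr 1
    generalize (Sum.elim (fun g => [Sum.inl g]) fun a => (f a).word :
      (Σ a, X a) ⊕ α → List ((Σ a, X a) ⊕ β)) = F
    rw [List.flatMap_def, List.map_flatten, List.flatten_flatten, List.map_map, List.map_ofFn]
    rfl

theorem labels_bind (t : Tree X α) (f : α → Tree X β) :
    (t.bind f).labels = t.labels.flatMap fun a => (f a).labels := by
  unfold labels
  rw [word_bind]
  induction t.word with
  | nil => rfl
  | cons y w ih =>
    rcases y with y | y <;> simp [List.filterMap_append, List.filterMap_cons, ih]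

@[simp] theorem labels_leaf (a : α) : (leaf a : Tree X α).labels = [a] := rfl

section words
variable (deg : ∀ a, X a → ℤ)

theorem wordDeg_append (u v : List ((Σ a, X a) ⊕ α)) :
    wordDeg deg (u ++ v) = wordDeg deg u + wordDeg deg v := by
  induction u with
  | nil => simp [wordDeg]
  | cons y w ih => rcases y with y | y <;> simp [wordDeg, ih, add_assoc]

theorem wordDeg_relabel (f : α → β) (u : List ((Σ a, X a) ⊕ α)) :
    wordDeg deg (u.flatMap (Sum.elim (fun g => [.inl g]) fun a => [.inr (f a)])) =
      wordDeg deg u := by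
  induction u with
  | nil => simp [wordDeg]
  | cons y w ih => rcases y with y | y <;> simp [wordDeg, ih]

variable [DecidableEq α] [DecidableEq β]

theorem wordAfter_relabel {f : α → β} (hf : Function.Injective f) (a : α)
    (u : List ((Σ a, X a) ⊕ α)) :
    wordAfter deg (f a) (u.flatMap (Sum.elim (fun g => [.inl g]) fun a => [.inr (f a)])) =
      wordAfter deg a u := by
  induction u with
  | nil => simp [wordAfter]
  | cons y w ih => rcases y with y | y <;> simp [wordAfter, ih, hf.eq_iff, wordDeg_relabel]

theorem wordAfter_append_of_notMem (a : α) {u : List ((Σ a, X a) ⊕ α)} (v)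
    (h : .inr a ∉ u) : wordAfter deg a (u ++ v) = wordAfter deg a v := by
  induction u with
  | nil => rfl
  | cons y w ih =>
    rcases y with y | y
    · simp [wordAfter, ih (by simpa using h)]
    · simp only [List.mem_cons, Sum.inr.injEq, not_or] at h
      simp [wordAfter, ih h.2, Ne.symm h.1]

theorem wordAfter_append_of_mem (a : α) {u : List ((Σ a, X a) ⊕ α)} (v)
    (h : .inr a ∈ u) : wordAfter deg a (u ++ v) = wordAfter deg a u + wordDeg deg v := by
  induction u with
  | nil => simp at h
  | cons y w ih =>
    rcases y with y | y
    · simp [wordAfter, ih (by simpa using h)]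
    · by_cases hy : y = a
      · simp [wordAfter, hy, wordDeg_append]
      · simp only [List.mem_cons, Sum.inr.injEq, Ne.symm hy, false_or] at h
        simp [wordAfter, ih h, hy]

end words

theorem mem_labels {t : Tree X α} {a : α} : a ∈ t.labels ↔ .inr a ∈ t.word := by
  simp [labels, List.mem_filterMap]

theorem IsLinear.split {t : Tree X α} (h : t.IsLinear) (a : α) :
    ∃ u v, t.word = u ++ .inr a :: v ∧ .inr a ∉ u ∧ .inr a ∉ v := by
  obtain ⟨u, v, e⟩ := List.append_of_mem (mem_labels.1 (h.2 a))
  have hn := h.1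
  rw [labels, e, List.filterMap_append, List.filterMap_cons] at hn
  simp only [Sum.getRight?_inr] at hn
  rw [List.nodup_middle, List.nodup_cons] at hn
  refine ⟨u, v, e, fun hu => hn.1 ?_, fun hv => hn.1 ?_⟩
  · exact List.mem_append_left _ (List.mem_filterMap.2 ⟨_, hu, rfl⟩)
  · exact List.mem_append_right _ (List.mem_filterMap.2 ⟨_, hv, rfl⟩)

/-- Relabelling of the leaves. -/
def map (f : α → β) (t : Tree X α) : Tree X β := t.bind fun a => leaf (f a)

theorem isLinear_map {t : Tree X α} (h : t.IsLinear) (e : α ≃ β) : (t.map e).IsLinear := by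
  have : (t.map e).labels = t.labels.map e := by
    rw [map, labels_bind]
    induction t.labels <;> simp_all
  rw [IsLinear, this]
  refine ⟨h.1.map e.injective, fun b => ?_⟩
  exact List.mem_map.2 ⟨e.symm b, h.2 _, by simp⟩

theorem degree_map (deg : ∀ a, X a → ℤ) (t : Tree X α) (f : α → β) :
    (t.map f).degree deg = t.degree deg := by
  rw [degree, map, word_bind]; exact wordDeg_relabel deg f _

theorem after_map [DecidableEq α] [DecidableEq β] (deg : ∀ a, X a → ℤ) (t : Tree X α) {f : α → β}
    (hf : Function.Injective f) (a : α) : (t.map f).after deg (f a) = t.after deg a := by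
  rw [after, map, word_bind]; exact wordAfter_relabel deg hf a _

section graft
variable {m n l : ℕ}

/-- What is substituted for the leaf `a` in a grafting at the leaf `i`. -/
noncomputable def plug (i : Fin m) (t : Tree X (Fin n)) (a : Fin m) : Tree X (Fin (m + n - 1)) :=
  if h : a = i then t.map fun b => slot i n (.inr b) else leaf (slot i n (.inl ⟨a, h⟩))

/-- Grafting of the tree `t` on the leaf `i` of the tree `s`. -/
noncomputable def graft (i : Fin m) (s : Tree X (Fin m)) (t : Tree X (Fin n)) : Tree X (Fin (m + n - 1)) :=
  s.bind (plug i t)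

theorem labels_map (t : Tree X α) (f : α → β) : (t.map f).labels = t.labels.map f := by
  rw [map, labels_bind]
  induction t.labels <;> simp_all

theorem plug_self (i : Fin m) (t : Tree X (Fin n)) :
    plug i t i = t.map fun b => slot i n (.inr b) := dif_pos rfl

theorem plug_ne {i a : Fin m} (t : Tree X (Fin n)) (h : a ≠ i) :
    plug i t a = leaf (slot i n (.inl ⟨a, h⟩)) := dif_neg h

theorem mem_labels_plug (i : Fin m) {t : Tree X (Fin n)} (ht : t.IsLinear) (a : Fin m)
    (s : {a : Fin m // a ≠ i} ⊕ Fin n) :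
    slot i n s ∈ (plug i t a).labels ↔ Sum.elim (fun a => a.1) (fun _ => i) s = a := by
  by_cases h : a = i
  · subst h
    rw [plug_self, labels_map]
    rcases s with s | s
    · simp [s.2]
    · simp [ht.2]
  · rw [plug_ne t h]
    rcases s with s | s
    · simp [Subtype.ext_iff]
    · simp [Ne.symm h]

theorem isLinear_graft (i : Fin m) {s : Tree X (Fin m)} {t : Tree X (Fin n)} (hs : s.IsLinear)
    (ht : t.IsLinear) : (graft i s t).IsLinear := by
  rw [IsLinear, graft, labels_bind]
  constructor
  · rw [List.nodup_flatMap]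
    constructor
    · intro a _
      by_cases h : a = i
      · subst h
        rw [plug_self, labels_map]
        exact ht.1.map fun b c h => by simpa using h
      · simp [plug_ne t h]
    · refine hs.1.imp fun {a b} hab => ?_
      intro c ha hb
      obtain ⟨c, rfl⟩ := (slot i n).surjective c
      rw [mem_labels_plug i ht] at ha hb
      exact hab (ha.symm.trans hb)
  · intro c
    obtain ⟨c, rfl⟩ := (slot i n).surjective c
    exact List.mem_flatMap.2 ⟨_, hs.2 _, (mem_labels_plug i ht _ c).2 rfl⟩

theorem map_graft {m' n' : ℕ} (σ : Fin m ≃ Fin m') (τ : Fin n ≃ Fin n') (i : Fin m)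
    (s : Tree X (Fin m)) (t : Tree X (Fin n)) :
    graft (σ i) (s.map σ) (t.map τ) = (graft i s t).map (blockPerm σ i τ) := by
  simp only [graft, map, bind_bind]
  congr 1; funext a
  by_cases h : a = i
  · subst h
    simp only [bind, plug_self, map, bind_bind]
    congr 1; funext b
    simp [blockPerm_slot]
  · simp only [bind, plug_ne t h, plug_ne _ (σ.injective.ne h), blockPerm_slot]
    rfl

theorem graft_nested (i : Fin m) (j : Fin n) (s : Tree X (Fin m)) (t : Tree X (Fin n))
    (r : Tree X (Fin l)) (h) :
    (graft (slot i n (.inr j)) (graft i s t) r).map (finCongr h) = graft i s (graft j t r) := by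
  simp only [graft, map, bind_bind]
  congr 1; funext a
  by_cases ha : a = i
  · subst ha
    simp only [plug_self, map, bind_bind]
    congr 1; funext b
    by_cases hb : b = j
    · subst hb
      simp only [bind, plug_self, map, bind_bind, nested_inner]
    · rw [plug_ne r hb]
      simp only [bind]
      rw [plug_ne r (by simpa using hb)]
      simp only [bind, nested_middle _ _ _ b hb]
  · simp only [plug_ne _ ha, bind]
    rw [plug_ne r (by simp)]
    simp only [bind, nested_outer]

theorem graft_parallel {i j : Fin m} (hij : i < j) (s : Tree X (Fin m)) (t : Tree X (Fin n))
    (r : Tree X (Fin l)) (h) :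
    (graft (slot i n (.inl ⟨j, hij.ne'⟩)) (graft i s t) r).map (finCongr h) =
      graft (slot j l (.inl ⟨i, hij.ne⟩)) (graft j s r) t := by
  simp only [graft, map, bind_bind]
  congr 1; funext a
  by_cases hi : a = i
  · subst hi
    rw [plug_self, plug_ne r hij.ne]
    simp only [map, bind_bind, bind]
    rw [plug_self]
    simp only [map]
    congr 1; funext b
    rw [plug_ne r (by simp)]
    simp only [bind]
    rw [parallel_left a j hij h b]
  · by_cases hj : a = j
    · subst hj
      rw [plug_self, plug_ne t hi]
      simp only [map, bind_bind, bind]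
      rw [plug_self]
      simp only [map, bind_bind]
      congr 1; funext c
      rw [plug_ne t (by simp)]
      simp only [bind]
      rw [parallel_right i a hij h c]
    · rw [plug_ne t hi, plug_ne r hj]
      simp only [bind]
      rw [plug_ne r (by simpa using hj), plug_ne t (by simpa using hi)]
      simp only [bind]
      rw [parallel_outer i j hij h a hi hj]

theorem word_graft (i : Fin m) {s : Tree X (Fin m)} (t : Tree X (Fin n)) {u v}
    (e : s.word = u ++ .inr i :: v) (hu : .inr i ∉ u) (hv : .inr i ∉ v) :
    ∃ u' v' : List ((Σ a, X a) ⊕ Fin (m + n - 1)), (graft i s t).word =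
      u' ++ (t.map fun b => slot i n (.inr b)).word ++ v' ∧
      (∀ deg, wordDeg deg u' = wordDeg deg u ∧ wordDeg deg v' = wordDeg deg v) ∧
      (∀ b, .inr (slot i n (.inr b)) ∉ u' ∧ .inr (slot i n (.inr b)) ∉ v') ∧
      ∀ (a : Fin m) (ha : a ≠ i),
        (.inr (slot i n (.inl ⟨a, ha⟩)) ∈ u' ↔ .inr a ∈ u) ∧
        (.inr (slot i n (.inl ⟨a, ha⟩)) ∈ v' ↔ .inr a ∈ v) ∧
        ∀ deg, wordAfter deg (slot i n (.inl ⟨a, ha⟩)) u' = wordAfter deg a u ∧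
          wordAfter deg (slot i n (.inl ⟨a, ha⟩)) v' = wordAfter deg a v := by
  have key : ∀ w : List ((Σ a, X a) ⊕ Fin m), .inr i ∉ w →
      ∃ w' : List ((Σ a, X a) ⊕ Fin (m + n - 1)),
        w.flatMap (Sum.elim (fun g => [.inl g]) fun a => (plug i t a).word) = w' ∧
        (∀ deg, wordDeg deg w' = wordDeg deg w) ∧ (∀ b, .inr (slot i n (.inr b)) ∉ w') ∧
        ∀ (a : Fin m) (ha : a ≠ i), (.inr (slot i n (.inl ⟨a, ha⟩)) ∈ w' ↔ .inr a ∈ w) ∧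
        ∀ deg, wordAfter deg (slot i n (.inl ⟨a, ha⟩)) w' = wordAfter deg a w := by
    intro w hw
    induction w with
    | nil => exact ⟨[], rfl, by simp [wordDeg], by simp, by simp [wordAfter]⟩
    | cons y w ih =>
      obtain ⟨w', e, h1, h2, h3⟩ := ih fun h => hw (List.mem_cons_of_mem _ h)
      rcases y with y | y
      · refine ⟨.inl y :: w', by simp [e], by simp [wordDeg, h1], by simp [h2], ?_⟩
        intro a ha
        exact ⟨by simp [h3 a ha], by simp [wordAfter, h3 a ha]⟩
      · have hy : y ≠ i := fun h => hw (by simp [h])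
        refine ⟨.inr (slot i n (.inl ⟨y, hy⟩)) :: w', by simp [e, plug_ne t hy, word],
          by simp [wordDeg, h1], by simp [h2], ?_⟩
        intro a ha
        exact ⟨by simp [h3 a ha], by simp [wordAfter, h3 a ha, h1]⟩
  obtain ⟨u', eu, u1, u2, u3⟩ := key u hu
  obtain ⟨v', ev, v1, v2, v3⟩ := key v hv
  refine ⟨u', v', ?_, fun d => ⟨u1 d, v1 d⟩, fun b => ⟨u2 b, v2 b⟩, fun a ha =>
    ⟨(u3 a ha).1, (v3 a ha).1, fun d => ⟨(u3 a ha).2 d, (v3 a ha).2 d⟩⟩⟩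
  rw [graft, word_bind, e, List.flatMap_append, List.flatMap_cons, eu, ev]
  simp [plug_self]

variable (deg : ∀ a, X a → ℤ)

theorem degree_graft (i : Fin m) {s : Tree X (Fin m)} (hs : s.IsLinear) (t : Tree X (Fin n)) :
    (graft i s t).degree deg = s.degree deg + t.degree deg := by
  obtain ⟨u, v, e, hu, hv⟩ := hs.split i
  obtain ⟨u', v', e', h1, -⟩ := word_graft i t e hu hv
  have := degree_map deg t fun b => slot i n (.inr b)
  simp only [degree] at this
  simp only [degree, e', e, wordDeg_append, wordDeg, (h1 deg).1, (h1 deg).2, this]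
  ring

theorem after_graft_inr (i : Fin m) (j : Fin n) {s : Tree X (Fin m)} (hs : s.IsLinear)
    {t : Tree X (Fin n)} (ht : t.IsLinear) :
    (graft i s t).after deg (slot i n (.inr j)) = t.after deg j + s.after deg i := by
  obtain ⟨u, v, e, hu, hv⟩ := hs.split i
  obtain ⟨u', v', e', h1, h2, -⟩ := word_graft i t e hu hv
  have h3 : Function.Injective fun b : Fin n => slot i n (.inr b) := fun b c h => by simpa using h
  have h4 := after_map deg t h3 j
  have h5 : .inr (slot i n (.inr j)) ∈ (t.map fun b => slot i n (.inr b)).word := by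
    rw [← mem_labels, labels_map]
    exact List.mem_map.2 ⟨j, ht.2 j, rfl⟩
  simp only [after] at h4
  simp only [after]
  rw [e', List.append_assoc, wordAfter_append_of_notMem deg _ _ (h2 j).1,
    wordAfter_append_of_mem deg _ _ h5, h4, e, wordAfter_append_of_notMem deg _ _ hu, (h1 deg).2]
  simp [wordAfter]

theorem after_graft_inl {i j : Fin m} (hij : i ≠ j) {s : Tree X (Fin m)} (hs : s.IsLinear) :
    (∀ {n : ℕ} (t : Tree X (Fin n)),
      (graft i s t).after deg (slot i n (.inl ⟨j, hij.symm⟩)) = s.after deg j) ∧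
    (∀ {n : ℕ} (t : Tree X (Fin n)),
      (graft j s t).after deg (slot j n (.inl ⟨i, hij⟩)) = s.after deg i + t.degree deg) ∨
    (∀ {n : ℕ} (t : Tree X (Fin n)), (graft i s t).after deg (slot i n (.inl ⟨j, hij.symm⟩)) =
      s.after deg j + t.degree deg) ∧
    (∀ {n : ℕ} (t : Tree X (Fin n)),
      (graft j s t).after deg (slot j n (.inl ⟨i, hij⟩)) = s.after deg i) := by
  have main : ∀ {i j : Fin m} (hij : i ≠ j) {u v}, s.word = u ++ .inr i :: v → .inr i ∉ u →
      .inr i ∉ v → ∀ {n : ℕ} (t : Tree X (Fin n)),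
      (.inr j ∈ u → (graft i s t).after deg (slot i n (.inl ⟨j, hij.symm⟩)) =
        s.after deg j + t.degree deg) ∧
      (.inr j ∉ u → (graft i s t).after deg (slot i n (.inl ⟨j, hij.symm⟩)) = s.after deg j) := by
    intro i j hij u v e hu hv n t
    obtain ⟨u', v', e', h1, -, h3⟩ := word_graft i t e hu hv
    have h4 := degree_map deg t fun b => slot i n (.inr b)
    obtain ⟨h5, -, h6⟩ := h3 j hij.symm
    simp only [degree] at h4
    simp only [after, e', List.append_assoc]
    constructor
    · intro hj
      rw [wordAfter_append_of_mem deg _ _ (h5.2 hj), (h6 deg).1, e,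
        wordAfter_append_of_mem deg _ _ hj, wordDeg_append, h4, (h1 deg).2]
      simp only [wordDeg, degree]; ring
    · intro hj
      have h7 : .inr (slot i n (.inl ⟨j, hij.symm⟩)) ∉
          (t.map fun b => slot i n (.inr b)).word := by
        rw [← mem_labels, labels_map]; simp
      rw [wordAfter_append_of_notMem deg _ _ (fun h => hj (h5.1 h)),
        wordAfter_append_of_notMem deg _ _ h7, (h6 deg).2, e,
        wordAfter_append_of_notMem deg _ _ hj]
      simp [wordAfter, hij]
  obtain ⟨u, v, e, hu, hv⟩ := hs.split i
  obtain ⟨u', v', e', hu', hv'⟩ := hs.split j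
  have h1 := fun {n} (t : Tree X (Fin n)) => main hij e hu hv t
  have h2 := fun {n} (t : Tree X (Fin n)) => main hij.symm e' hu' hv' t
  have h3 : .inr j ∈ u ↔ .inr i ∉ u' := by
    have hc := e.symm.trans e'
    rw [List.append_eq_append_iff] at hc
    rcases hc with ⟨w, h, h'⟩ | ⟨w, h, h'⟩
    · rcases w with _ | ⟨y, w⟩
      · simp only [List.nil_append, List.cons.injEq, Sum.inr.injEq] at h'
        exact absurd h'.1 hij
      · simp only [List.cons_append, List.cons.injEq] at h'
        obtain ⟨rfl, h'⟩ := h'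
        have h4 : .inr i ∈ u' := by rw [h]; simp
        have h5 : .inr j ∉ u := fun hh => hu' (by rw [h]; exact List.mem_append_left _ hh)
        simp [h4, h5]
    · rcases w with _ | ⟨y, w⟩
      · simp only [List.nil_append, List.cons.injEq, Sum.inr.injEq] at h'
        exact absurd h'.1.symm hij
      · simp only [List.cons_append, List.cons.injEq] at h'
        obtain ⟨rfl, h'⟩ := h'
        have h4 : .inr j ∈ u := by rw [h]; simp
        have h5 : .inr i ∉ u' := fun hh => hu (by rw [h]; exact List.mem_append_left _ hh)
        simp [h4, h5]
  by_cases hj : .inr j ∈ u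
  · exact .inr ⟨fun t => (h1 t).1 hj, fun t => (h2 t).2 (h3.1 hj)⟩
  · exact .inl ⟨fun t => (h1 t).2 hj, fun t => (h2 t).1 (not_not.1 fun h => hj (h3.2 h))⟩

end graft

end Tree

end AntiAss
namespace AntiAss

universe u v w

noncomputable section

/-- Decorated planar trees whose leaves are labelled bijectively by `Fin n`. -/
@[ext] structure LinTree (X : ℕ → Type v) (n : ℕ) : Type v where
  tree : Tree X (Fin n)
  isLinear : tree.IsLinear

namespace LinTree

variable {X : ℕ → Type v}

def map {m n : ℕ} (σ : Fin m ≃ Fin n) (t : LinTree X m) : LinTree X n :=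
  ⟨t.tree.map σ, Tree.isLinear_map t.isLinear σ⟩

def graft {m n : ℕ} (i : Fin m) (s : LinTree X m) (t : LinTree X n) : LinTree X (m + n - 1) :=
  ⟨s.tree.graft i t.tree, Tree.isLinear_graft i s.isLinear t.isLinear⟩

/-- The tree without vertices. -/
def unit : LinTree X 1 := ⟨.leaf 0, by simp [Tree.IsLinear, Fin.forall_fin_one]⟩

/-- The tree with one vertex `x`, its inputs being numbered in planar order. -/
def corolla {a : ℕ} (x : X a) : LinTree X a :=
  ⟨.node x fun i => .leaf i, by
    have : (Tree.node x fun i => Tree.leaf i : Tree X (Fin a)).labels = List.finRange a := by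
      have h : (List.ofFn fun i : Fin a => [(Sum.inr i : (Σ a, X a) ⊕ Fin a)]).flatten =
          (List.finRange a).map Sum.inr := by
        rw [List.ofFn_eq_map, ← List.flatMap_def]
        induction List.finRange a <;> simp_all
      simp only [Tree.labels, Tree.word, h, List.filterMap_cons, Sum.getRight?_inl]
      induction List.finRange a <;> simp_all
    rw [Tree.IsLinear, this]
    exact ⟨List.nodup_finRange a, List.mem_finRange⟩⟩

end LinTree

section
variable (k : Type u) [Field k] (X : ℕ → Type v) (deg : ∀ a, X a → ℤ)

/-- Trees of degree `d` span the component of degree `d` of the free operad. -/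
def treeGr (n : ℕ) (d : ℤ) : Submodule k (LinTree X n →₀ k) :=
  Finsupp.supported k k {t | t.tree.degree deg = d}

theorem treeGr_isInternal (n : ℕ) : DirectSum.IsInternal (treeGr k X deg n) := by
  rw [DirectSum.isInternal_submodule_iff_iSupIndep_and_iSup_eq_top]
  constructor
  · intro i
    have h : (⨆ j, ⨆ _ : j ≠ i, treeGr k X deg n j) ≤
        Finsupp.supported k k {t : LinTree X n | t.tree.degree deg ≠ i} :=
      iSup₂_le fun j hj => Finsupp.supported_mono fun t ht => by
        simp only [Set.mem_ofPred_eq] at ht ⊢; rwa [ht]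
    refine Disjoint.mono_right h (Finsupp.disjoint_supported_supported ?_)
    rw [Set.disjoint_left]
    exact fun t ht h => h ht
  · change (⨆ j, Finsupp.supported k k {t : LinTree X n | t.tree.degree deg = j}) = ⊤
    rw [← Finsupp.supported_iUnion]
    convert Finsupp.supported_univ
    ext t; simp

variable {k X deg} in
theorem treeGr_induction {n : ℕ} {d : ℤ}
    {P : (x : LinTree X n →₀ k) → x ∈ treeGr k X deg n d → Prop}
    (single : ∀ (t : LinTree X n) (ht : t.tree.degree deg = d),
      P (Finsupp.single t 1) (Finsupp.single_mem_supported k 1 ht))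
    (zero : P 0 (Submodule.zero_mem _))
    (add : ∀ x y hx hy, P x hx → P y hy → P (x + y) (Submodule.add_mem _ hx hy))
    (smul : ∀ (c : k) x hx, P x hx → P (c • x) (Submodule.smul_mem _ c hx))
    {x : LinTree X n →₀ k} (hx : x ∈ treeGr k X deg n d) : P x hx := by
  have hx' := hx
  rw [treeGr, Finsupp.supported_eq_span_single] at hx'
  suffices ∃ h, P x h from this.2
  clear hx
  induction hx' using Submodule.span_induction with
  | mem x h => obtain ⟨t, ht, rfl⟩ := h; exact ⟨_, single t ht⟩
  | zero => exact ⟨_, zero⟩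
  | add x y _ _ hx hy => exact ⟨_, add x y _ _ hx.2 hy.2⟩
  | smul c x _ hx => exact ⟨_, smul c x _ hx.2⟩

/-- The composition `s ∘_i t` of two trees: the grafting, with the Koszul sign of moving the
vertices of `t` past those vertices of `s` that follow the leaf `i`. -/
def treeComp {m n : ℕ} (i : Fin m) (s : LinTree X m) (t : LinTree X n) :
    LinTree X (m + n - 1) →₀ k :=
  Finsupp.single (s.graft i t) (ksign k (t.tree.degree deg * s.tree.after deg i))

/-- The free operad on the `Σ`-module with `k[Σ_a] ⊗ k^(X a)` in arity `a`, that is, with the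
elements of `X a` as free generators of arity `a`, of the degrees `deg`. -/
def freeOperad : Operad.{u, max u v} k where
  obj n := LinTree X n →₀ k
  gr := treeGr k X deg
  gr_isInternal := treeGr_isInternal k X deg
  relabel σ := Finsupp.lmapDomain k k (LinTree.map σ)
  relabel_refl {n} x := by
    have : (LinTree.map (Equiv.refl _) : LinTree X n → LinTree X n) = id := by
      funext t; exact LinTree.ext (Tree.bind_leaf t.tree)
    simp [this]
  relabel_trans {l m n} σ τ x := by
    have : (LinTree.map (σ.trans τ) : LinTree X l → LinTree X n) = LinTree.map τ ∘ LinTree.map σ := by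
      funext t
      exact LinTree.ext (by simp [LinTree.map, Tree.map, Tree.bind_bind, Tree.bind])
    simp only [Finsupp.lmapDomain_apply, this, Finsupp.mapDomain_comp]
  relabel_mem σ p x hx := by
    induction hx using treeGr_induction with
    | single t ht =>
      simp only [Finsupp.lmapDomain_apply, Finsupp.mapDomain_single]
      exact Finsupp.single_mem_supported k _ ((Tree.degree_map deg t.tree σ).trans ht)
    | zero => simp
    | add x y _ _ hx hy => rw [map_add]; exact Submodule.add_mem _ hx hy
    | smul c x _ hx => rw [map_smul]; exact Submodule.smul_mem _ c hx
  one := Finsupp.single LinTree.unit 1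
  one_mem := Finsupp.single_mem_supported k _ (by
    simp [LinTree.unit, Tree.degree, Tree.word, Tree.wordDeg])
  comp i := Finsupp.linearCombination k fun s =>
    Finsupp.linearCombination k fun t => treeComp k X deg i s t
  comp_mem i p q x y hx hy := by
    induction hx using treeGr_induction with
    | single s hs =>
      induction hy using treeGr_induction with
      | single t ht =>
        simp only [Finsupp.linearCombination_single, one_smul, treeComp]
        exact Finsupp.single_mem_supported k _
          ((Tree.degree_graft deg i s.isLinear t.tree).trans (by rw [hs, ht]))
      | zero => simp
      | add x y _ _ hx hy => rw [map_add]; exact Submodule.add_mem _ hx hy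
      | smul c x _ hx => rw [map_smul]; exact Submodule.smul_mem _ c hx
    | zero => simp
    | add x y _ _ hx hy => rw [map_add]; exact Submodule.add_mem _ hx hy
    | smul c x _ hx => rw [map_smul]; exact Submodule.smul_mem _ c hx
  comp_relabel σ τ i x y := by
    induction x using Finsupp.induction_linear with
    | zero => simp
    | add x x' hx hx' => simp only [map_add, LinearMap.add_apply, hx, hx']
    | single s c =>
      induction y using Finsupp.induction_linear with
      | zero => simp
      | add x x' hx hx' => simp only [map_add, hx, hx']
      | single t d =>
        simp only [Finsupp.lmapDomain_apply, Finsupp.mapDomain_single,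
          Finsupp.linearCombination_single, LinearMap.smul_apply, treeComp, Finsupp.smul_single]
        have h1 : (s.map σ).graft (σ i) (t.map τ) = (s.graft i t).map (blockPerm σ i τ) :=
          LinTree.ext (Tree.map_graft σ τ i s.tree t.tree)
        have h2 : (t.map τ).tree.degree deg = t.tree.degree deg := Tree.degree_map deg t.tree τ
        have h3 : (s.map σ).tree.after deg (σ i) = s.tree.after deg i :=
          Tree.after_map deg s.tree σ.injective i
        rw [h1, h2, h3]
  one_comp x := by
    induction x using Finsupp.induction_linear with
    | zero => simp
    | add x x' hx hx' => simp only [map_add, hx, hx']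
    | single t d =>
      simp only [Finsupp.lmapDomain_apply, Finsupp.mapDomain_single,
          Finsupp.linearCombination_single, LinearMap.smul_apply, treeComp, Finsupp.smul_single]
      congr 1
      · refine LinTree.ext ?_
        simp only [LinTree.map, LinTree.graft, LinTree.unit, Tree.graft, Tree.bind, Tree.plug_self,
          Tree.map, Tree.bind_bind]
        conv_rhs => rw [← Tree.bind_leaf t.tree]
        congr 1; funext a
        congr 1
        simp [Fin.ext_iff, slot_inr_val]
      · simp [LinTree.unit, Tree.after, Tree.word, Tree.wordAfter, Tree.wordDeg]
  comp_one i x := by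
    induction x using Finsupp.induction_linear with
    | zero => simp
    | add x x' hx hx' => simp only [map_add, LinearMap.add_apply, hx, hx']
    | single t d =>
      simp only [Finsupp.lmapDomain_apply, Finsupp.mapDomain_single,
          Finsupp.linearCombination_single, LinearMap.smul_apply, treeComp, Finsupp.smul_single]
      congr 1
      · refine LinTree.ext ?_
        simp only [LinTree.map, LinTree.graft, LinTree.unit, Tree.graft, Tree.map, Tree.bind_bind]
        conv_rhs => rw [← Tree.bind_leaf t.tree]
        congr 1; funext a
        by_cases h : a = i
        · subst h
          simp only [Tree.plug_self, Tree.map, Tree.bind, Tree.leaf.injEq, Fin.ext_iff]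
          exact slot_inr_val a 1 0
        · simp only [Tree.plug_ne _ h, Tree.bind, Tree.leaf.injEq, Fin.ext_iff]
          refine (slot_inl_val i 1 ⟨a, h⟩).trans ?_
          split_ifs <;> simp
      · simp [LinTree.unit, Tree.degree, Tree.word, Tree.wordDeg]
  comp_nested i j x y z := by
    induction x using Finsupp.induction_linear with
    | zero => simp
    | add x x' hx hx' => simp only [map_add, LinearMap.add_apply, hx, hx']
    | single s c =>
      induction y using Finsupp.induction_linear with
      | zero => simp
      | add x x' hx hx' => simp only [map_add, LinearMap.add_apply, hx, hx']
      | single t d =>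
        induction z using Finsupp.induction_linear with
        | zero => simp
        | add x x' hx hx' => simp only [map_add, hx, hx']
        | single r e =>
          simp only [Finsupp.lmapDomain_apply, Finsupp.mapDomain_single,
            Finsupp.linearCombination_single, LinearMap.smul_apply, treeComp, Finsupp.smul_single,
            smul_eq_mul]
          congr 1
          · exact LinTree.ext (Tree.graft_nested i j s.tree t.tree r.tree _)
          · have h1 : (s.graft i t).tree.after deg (slot i _ (.inr j)) = _ :=
              Tree.after_graft_inr deg i j s.isLinear t.isLinear
            have h2 : (t.graft j r).tree.degree deg = _ := Tree.degree_graft deg j t.isLinear r.tree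
            rw [h1, h2, add_mul, mul_add, ksign_add, ksign_add]
            ring
  comp_parallel i j hij x p q y z hy hz := by
    induction x using Finsupp.induction_linear with
    | zero => simp
    | add x x' hx hx' => simp only [map_add, LinearMap.add_apply, hx, hx', smul_add]
    | single s c =>
      induction hy using treeGr_induction with
      | zero => simp
      | add x x' _ _ hx hx' => simp only [map_add, LinearMap.add_apply, hx, hx', smul_add]
      | smul a x _ hx => simp only [map_smul, LinearMap.smul_apply, hx, smul_comm a]
      | single t ht =>
        induction hz using treeGr_induction with
        | zero => simp
        | add x x' _ _ hx hx' => simp only [map_add, LinearMap.add_apply, hx, hx', smul_add]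
        | smul a x _ hx => simp only [map_smul, LinearMap.smul_apply, hx, smul_comm a]
        | single r hr =>
          simp only [Finsupp.lmapDomain_apply, Finsupp.mapDomain_single,
            Finsupp.linearCombination_single, LinearMap.smul_apply, treeComp, Finsupp.smul_single,
            smul_eq_mul, one_mul]
          have h0 : ((s.graft i t).graft (slot i _ (.inl ⟨j, hij.ne'⟩)) r).map
              (finCongr (by have := i.2; have := j.2; omega)) =
              (s.graft j r).graft (slot j _ (.inl ⟨i, hij.ne⟩)) t :=
            LinTree.ext (Tree.graft_parallel hij s.tree t.tree r.tree _)
          rw [h0]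
          congr 1
          rw [← ht, ← hr]
          rcases Tree.after_graft_inl deg hij.ne s.isLinear with ⟨h1, h2⟩ | ⟨h1, h2⟩
          · have h1 : (s.graft i t).tree.after deg (slot i _ (.inl ⟨j, hij.ne'⟩)) = _ := h1 t.tree
            have h2 : (s.graft j r).tree.after deg (slot j _ (.inl ⟨i, hij.ne⟩)) = _ := h2 r.tree
            rw [h1, h2]
            have : ksign k (t.tree.degree deg * r.tree.degree deg) *
                ksign k (t.tree.degree deg * r.tree.degree deg) = 1 := by
              rw [← ksign_add, ksign_eq k (n := 0) (by simp), ksign_zero]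
            rw [mul_add, ksign_add]
            linear_combination (-(c * ksign k (t.tree.degree deg * s.tree.after deg i) *
              ksign k (r.tree.degree deg * s.tree.after deg j))) * this
          · have h1 : (s.graft i t).tree.after deg (slot i _ (.inl ⟨j, hij.ne'⟩)) = _ := h1 t.tree
            have h2 : (s.graft j r).tree.after deg (slot j _ (.inl ⟨i, hij.ne⟩)) = _ := h2 r.tree
            rw [h1, h2, mul_add, ksign_add, mul_comm (r.tree.degree deg) (t.tree.degree deg)]
            ring

/-- The generators of the free operad. -/
def gen {X : ℕ → Type v} {deg : ∀ a, X a → ℤ} {a : ℕ} (x : X a) : (freeOperad k X deg).obj a :=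
  Finsupp.single (LinTree.corolla x) 1

/-- The decomposable elements of the free operad: combinations of trees with at least two
vertices. -/
def decomposables (n : ℕ) : Submodule k ((freeOperad k X deg).obj n) :=
  Finsupp.supported k k {t : LinTree X n | 2 ≤ t.tree.size}

end

end

end AntiAss
namespace AntiAss

universe u v w

noncomputable section

variable {k : Type u} [Field k]

/-- Morphisms of graded operads. -/
structure Operad.Hom (P : Operad.{u, v} k) (Q : Operad.{u, w} k) where
  app : ∀ n, P.obj n →ₗ[k] Q.obj n
  app_mem : ∀ {n : ℕ} {p : ℤ} {x : P.obj n}, x ∈ P.gr n p → app n x ∈ Q.gr n p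
  app_relabel : ∀ {m n : ℕ} (σ : Fin m ≃ Fin n) (x : P.obj m),
    app n (P.relabel σ x) = Q.relabel σ (app m x)
  app_one : app 1 P.one = Q.one
  app_comp : ∀ {m n : ℕ} (i : Fin m) (x : P.obj m) (y : P.obj n),
    app _ (P.comp i x y) = Q.comp i (app m x) (app n y)

/-- The composition of morphisms of operads, in diagrammatic order. -/
def Operad.Hom.trans {P Q R : Operad k} (f : P.Hom Q) (g : Q.Hom R) : P.Hom R where
  app n := g.app n ∘ₗ f.app n
  app_mem hx := g.app_mem (f.app_mem hx)
  app_relabel σ x := by simp [f.app_relabel, g.app_relabel]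
  app_one := by simp [f.app_one, g.app_one]
  app_comp i x y := by simp [f.app_comp, g.app_comp]

/-- A differential (of degree `-1`) on a graded operad; an operad with a differential is a
dg-operad. -/
structure Operad.Differential (P : Operad.{u, v} k) where
  d : ∀ n, P.obj n →ₗ[k] P.obj n
  d_mem : ∀ {n : ℕ} {p : ℤ} {x : P.obj n}, x ∈ P.gr n p → d n x ∈ P.gr n (p - 1)
  d_relabel : ∀ {m n : ℕ} (σ : Fin m ≃ Fin n) (x : P.obj m),
    d n (P.relabel σ x) = P.relabel σ (d m x)
  d_comp : ∀ {m n : ℕ} (i : Fin m) {p : ℤ} {x : P.obj m} (y : P.obj n), x ∈ P.gr m p →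
    d _ (P.comp i x y) = P.comp i (d m x) y + ksign k p • P.comp i x (d n y)
  d_d : ∀ {n : ℕ} (x : P.obj n), d n (d n x) = 0

/-- The zero differential. -/
def Operad.Differential.zero (P : Operad.{u, v} k) : P.Differential where
  d _ := 0
  d_mem _ := by simp
  d_relabel _ _ := by simp
  d_comp _ _ _ _ _ := by simp
  d_d _ := by simp

/-- `f` is a morphism of dg-operads that induces an isomorphism of the homologies. -/
structure Operad.Hom.IsQuasiIso {P : Operad.{u, v} k} {Q : Operad.{u, w} k} (f : P.Hom Q)
    (dP : P.Differential) (dQ : Q.Differential) : Prop where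
  comm : ∀ (n : ℕ) (x : P.obj n), f.app n (dP.d n x) = dQ.d n (f.app n x)
  injective : ∀ (n : ℕ) (x : P.obj n), dP.d n x = 0 → (∃ y, f.app n x = dQ.d n y) →
    ∃ z, x = dP.d n z
  surjective : ∀ (n : ℕ) (y : Q.obj n), dQ.d n y = 0 →
    ∃ x, dP.d n x = 0 ∧ ∃ z, f.app n x = y + dQ.d n z

/-- `ρ : (Γ(E), ∂) → (P, 0)` is a minimal model of the operad `P`. Here `E` is the `Σ`-module which
is free on the generators `X`. -/
structure IsMinimalModel {X : ℕ → Type v} {deg : ∀ a, X a → ℤ} (P : Operad.{u, w} k)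
    (dR : (freeOperad k X deg).Differential) (ρ : (freeOperad k X deg).Hom P) : Prop where
  two_le : ∀ a, a < 2 → IsEmpty (X a)
  quasiIso : ρ.IsQuasiIso dR (.zero P)
  minimal : ∀ (n : ℕ) (x : (freeOperad k X deg).obj n), dR.d n x ∈ decomposables k X deg n

/-! ### Quotients -/

/-- The operadic ideal generated by the relations `R`. -/
inductive Operad.InIdeal (P : Operad.{u, v} k) (R : ∀ n, P.obj n → Prop) :
    ∀ n, P.obj n → Prop
  | of {n : ℕ} (x : P.obj n) : R n x → P.InIdeal R n x
  | zero (n : ℕ) : P.InIdeal R n 0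
  | add {n : ℕ} (x y : P.obj n) : P.InIdeal R n x → P.InIdeal R n y → P.InIdeal R n (x + y)
  | smul {n : ℕ} (c : k) (x : P.obj n) : P.InIdeal R n x → P.InIdeal R n (c • x)
  | relabel {m n : ℕ} (σ : Fin m ≃ Fin n) (x : P.obj m) :
      P.InIdeal R m x → P.InIdeal R n (P.relabel σ x)
  | comp_left {m n : ℕ} (i : Fin m) (x : P.obj m) (y : P.obj n) :
      P.InIdeal R m x → P.InIdeal R (m + n - 1) (P.comp i x y)
  | comp_right {m n : ℕ} (i : Fin m) (x : P.obj m) (y : P.obj n) :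
      P.InIdeal R n y → P.InIdeal R (m + n - 1) (P.comp i x y)

def Operad.ideal (P : Operad.{u, v} k) (R : ∀ n, P.obj n → Prop) (n : ℕ) :
    Submodule k (P.obj n) where
  carrier := {x | P.InIdeal R n x}
  zero_mem' := .zero n
  add_mem' hx hy := .add _ _ hx hy
  smul_mem' c _ hx := .smul c _ hx

/-- The composition in the quotient by an ideal. -/
def Operad.quotComp (P : Operad.{u, v} k) (R : ∀ n, P.obj n → Prop) {m n : ℕ} (i : Fin m) :
    (P.obj m ⧸ P.ideal R m) →ₗ[k] (P.obj n ⧸ P.ideal R n) →ₗ[k]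
      (P.obj (m + n - 1) ⧸ P.ideal R (m + n - 1)) :=
  (P.ideal R m).liftQ
    ((P.ideal R n).liftQ ((P.comp i).compr₂ (P.ideal R (m + n - 1)).mkQ).flip (by
      intro y hy
      ext x
      exact (Submodule.Quotient.mk_eq_zero _).2 (InIdeal.comp_right i x y hy))).flip (by
    intro x hx
    rw [LinearMap.mem_ker]
    ext y
    exact (Submodule.Quotient.mk_eq_zero _).2 (InIdeal.comp_left i x y hx))

theorem Operad.quotComp_mk (P : Operad.{u, v} k) (R : ∀ n, P.obj n → Prop) {m n : ℕ} (i : Fin m)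
    (x : P.obj m) (y : P.obj n) :
    P.quotComp R i ((P.ideal R m).mkQ x) ((P.ideal R n).mkQ y) =
      (P.ideal R (m + n - 1)).mkQ (P.comp i x y) := rfl

/-- The quotient of an operad that is concentrated in degree zero by an operadic ideal. -/
def Operad.quotient (P : Operad.{u, v} k) (hP : ∀ n, P.gr n 0 = ⊤) (R : ∀ n, P.obj n → Prop) :
    Operad.{u, v} k where
  obj n := P.obj n ⧸ P.ideal R n
  gr n := trivGr k _
  gr_isInternal n := trivGr_isInternal k _
  relabel {m n} σ := (P.ideal R m).mapQ (P.ideal R n) (P.relabel σ)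
    fun x hx => .relabel σ x hx
  relabel_refl {n} x := by
    obtain ⟨x, rfl⟩ := (P.ideal R n).mkQ_surjective x
    exact congrArg (P.ideal R n).mkQ (P.relabel_refl x)
  relabel_trans {l m n} σ τ x := by
    obtain ⟨x, rfl⟩ := (P.ideal R l).mkQ_surjective x
    exact congrArg (P.ideal R n).mkQ (P.relabel_trans σ τ x)
  relabel_mem σ p x hx := by
    unfold trivGr at hx ⊢
    split_ifs at hx ⊢
    · trivial
    · rw [(Submodule.mem_bot k).1 hx]; simp
  one := (P.ideal R 1).mkQ P.one
  one_mem := by simp [trivGr]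
  comp i := P.quotComp R i
  comp_mem i p q x y hx hy := by
    unfold trivGr at hx hy ⊢
    split_ifs at hx with hp
    · split_ifs at hy with hq
      · simp [hp, hq]
      · rw [(Submodule.mem_bot k).1 hy]; simp
    · rw [(Submodule.mem_bot k).1 hx]; simp
  comp_relabel {m m' n n'} σ τ i x y := by
    obtain ⟨x, rfl⟩ := (P.ideal R m).mkQ_surjective x
    obtain ⟨y, rfl⟩ := (P.ideal R n).mkQ_surjective y
    exact congrArg (P.ideal R _).mkQ (P.comp_relabel σ τ i x y)
  one_comp {n} x := by
    obtain ⟨x, rfl⟩ := (P.ideal R n).mkQ_surjective x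
    exact congrArg (P.ideal R _).mkQ (P.one_comp x)
  comp_one {n} i x := by
    obtain ⟨x, rfl⟩ := (P.ideal R n).mkQ_surjective x
    exact congrArg (P.ideal R _).mkQ (P.comp_one i x)
  comp_nested {m n l} i j x y z := by
    obtain ⟨x, rfl⟩ := (P.ideal R m).mkQ_surjective x
    obtain ⟨y, rfl⟩ := (P.ideal R n).mkQ_surjective y
    obtain ⟨z, rfl⟩ := (P.ideal R l).mkQ_surjective z
    exact congrArg (P.ideal R _).mkQ (P.comp_nested i j x y z)
  comp_parallel {m n l} i j hij x p q y z hy hz := by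
    unfold trivGr at hy hz
    split_ifs at hy with hp
    · split_ifs at hz with hq
      · subst hp; subst hq
        obtain ⟨x, rfl⟩ := (P.ideal R m).mkQ_surjective x
        obtain ⟨y, rfl⟩ := (P.ideal R n).mkQ_surjective y
        obtain ⟨z, rfl⟩ := (P.ideal R l).mkQ_surjective z
        exact congrArg (P.ideal R _).mkQ (P.comp_parallel i j hij x (p := 0) (q := 0)
          (y := y) (z := z) (by simp [hP]) (by simp [hP]))
      · rw [(Submodule.mem_bot k).1 hz]; simp
    · rw [(Submodule.mem_bot k).1 hy]; simp

/-! ### The anti-associative operad -/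

/-- One generating operation, of arity two. -/
inductive BinaryGen : ℕ → Type
  | mu : BinaryGen 2

/-- The free operad on one binary operation of degree zero. -/
def magma (k : Type u) [Field k] : Operad.{u, u} k := freeOperad k BinaryGen fun _ _ => 0

theorem magma_gr (k : Type u) [Field k] (n : ℕ) : (magma k).gr n 0 = ⊤ := by
  have h : ∀ {α : Type} (w : List ((Σ a, BinaryGen a) ⊕ α)),
      Tree.wordDeg (fun _ _ => 0) w = 0 := by
    intro α w
    induction w with
    | nil => rfl
    | cons y w ih => rcases y with y | y <;> simp [Tree.wordDeg, ih]
  refine Eq.trans ?_ Finsupp.supported_univ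
  change Finsupp.supported k k _ = _
  congr 1
  ext t
  simp [Tree.degree, h]

/-- The relation `μ ∘_1 μ + μ ∘_2 μ`. -/
inductive AntiAssRel (k : Type u) [Field k] : ∀ n, (magma k).obj n → Prop
  | mk : AntiAssRel k 3 ((magma k).comp (0 : Fin 2) (gen k .mu) (gen k .mu) +
      (magma k).comp (1 : Fin 2) (gen k .mu) (gen k .mu))

/-- The operad for anti-associative algebras. -/
def antiAss (k : Type u) [Field k] : Operad.{u, u} k := (magma k).quotient (magma_gr k) (AntiAssRel k)

/-- The generating operation of the operad for anti-associative algebras. -/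
def antiAssMul (k : Type u) [Field k] : (antiAss k).obj 2 :=
  ((magma k).ideal (AntiAssRel k) 2).mkQ (gen k .mu)

/-! ### Endomorphism operads -/

section inputs
variable {V : Type w}

/-- The inputs of `f` in `f ∘_i g`. -/
def endInputs {m n : ℕ} (i : Fin m) (g : (Fin n → V) → V) (v : Fin (m + n - 1) → V) (a : Fin m) :
    V :=
  if h : a = i then g fun b => v (slot i n (.inr b)) else v (slot i n (.inl ⟨a, h⟩))

theorem endInputs_update_inl {m n : ℕ} (i : Fin m) (g : (Fin n → V) → V)
    (v : Fin (m + n - 1) → V) (a : {a : Fin m // a ≠ i}) (x : V) :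
    endInputs i g (Function.update v (slot i n (.inl a)) x) =
      Function.update (endInputs i g v) a.1 x := by
  funext c
  by_cases h : c = i
  · subst h
    simp [endInputs, Function.update_of_ne a.2.symm, Function.update_of_ne]
  · by_cases h' : c = a.1
    · subst h'
      simp [endInputs, a.2]
    · simp [endInputs, h, h', Function.update_of_ne, Subtype.ext_iff]

theorem endInputs_update_inr {m n : ℕ} (i : Fin m) (g : (Fin n → V) → V)
    (v : Fin (m + n - 1) → V) (b : Fin n) (x : V) :
    endInputs i g (Function.update v (slot i n (.inr b)) x) =
      Function.update (endInputs i g v) i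
        (g (Function.update (fun b => v (slot i n (.inr b))) b x)) := by
  funext c
  by_cases h : c = i
  · subst h
    simp only [endInputs, dite_true, Function.update_self]
    congr 1; funext b'
    by_cases h : b' = b
    · subst h; simp
    · simp [h, Function.update_of_ne]
  · simp [endInputs, h, Function.update_of_ne]

end inputs

section endomorphisms
variable (k) (V : Type w) [AddCommGroup V] [Module k V]

/-- The composition `f ∘_i g` of multilinear maps. -/
def endComp {m n : ℕ} (i : Fin m) (f : MultilinearMap k (fun _ : Fin m => V) V)
    (g : MultilinearMap k (fun _ : Fin n => V) V) :
    MultilinearMap k (fun _ : Fin (m + n - 1) => V) V where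
  toFun v := f (endInputs i g v)
  map_update_add' {inst} v c x y := by
    rw [Subsingleton.elim inst (instDecidableEqFin _)]
    obtain ⟨c | c, rfl⟩ := (slot i n).surjective c
    · simp only [endInputs_update_inl, f.map_update_add]
    · simp only [endInputs_update_inr, g.map_update_add, f.map_update_add]
  map_update_smul' {inst} v c x y := by
    rw [Subsingleton.elim inst (instDecidableEqFin _)]
    obtain ⟨c | c, rfl⟩ := (slot i n).surjective c
    · simp only [endInputs_update_inl, f.map_update_smul]
    · simp only [endInputs_update_inr, g.map_update_smul, f.map_update_smul]

theorem endInputs_eq_update {m n : ℕ} (i : Fin m) (g : (Fin n → V) → V)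
    (v : Fin (m + n - 1) → V) : endInputs i g v =
      Function.update (endInputs i (fun _ => 0) v) i (g fun b => v (slot i n (.inr b))) := by
  funext c
  by_cases h : c = i
  · subst h; simp [endInputs]
  · simp [endInputs, h]

/-- The endomorphism operad of a vector space (in degree zero). -/
def endOperad : Operad.{u, w} k where
  obj n := MultilinearMap k (fun _ : Fin n => V) V
  gr n := trivGr k _
  gr_isInternal n := trivGr_isInternal k _
  relabel σ :=
    { toFun := fun f => f.domDomCongr σ
      map_add' := fun f g => rfl
      map_smul' := fun c f => rfl }
  relabel_refl f := rfl
  relabel_trans σ τ f := rfl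
  relabel_mem σ p x hx := by
    unfold trivGr at hx ⊢
    split_ifs at hx ⊢
    · trivial
    · rw [(Submodule.mem_bot k).1 hx]; simp
  one := MultilinearMap.ofSubsingleton k V V 0 LinearMap.id
  one_mem := by simp [trivGr]
  comp i := LinearMap.mk₂ k (endComp k V i)
    (fun f f' g => rfl) (fun c f g => rfl)
    (fun f g g' => by
      ext v
      change f (endInputs i _ v) = f (endInputs i _ v) + f (endInputs i _ v)
      rw [endInputs_eq_update, endInputs_eq_update (g := g), endInputs_eq_update (g := g'),
        add_apply, f.map_update_add])
    (fun c f g => by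
      ext v
      change f (endInputs i _ v) = c • f (endInputs i _ v)
      rw [endInputs_eq_update, endInputs_eq_update (g := g),
        smul_apply, f.map_update_smul])
  comp_mem i p q x y hx hy := by
    unfold trivGr at hx hy ⊢
    split_ifs at hx with hp
    · split_ifs at hy with hq
      · simp [hp, hq]
      · rw [(Submodule.mem_bot k).1 hy]; simp
    · rw [(Submodule.mem_bot k).1 hx]; simp
  comp_relabel σ τ i f g := by
    ext v
    change f (fun a => endInputs (σ i) _ v (σ a)) = f (endInputs i g fun c => v (blockPerm σ i τ c))
    congr 1; funext a
    by_cases h : a = i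
    · subst h
      simp only [endInputs, dite_true]
      refine congrArg g (funext fun b => ?_)
      exact congrArg v (blockPerm_slot σ a τ (.inr b)).symm
    · simp only [endInputs, h, σ.injective.ne h, dite_false]
      exact congrArg v (blockPerm_slot σ i τ (.inl ⟨a, h⟩)).symm
  one_comp {n} f := by
    ext v
    change f (fun b => v (finCongr _ (slot (0 : Fin 1) n (.inr b)))) = f v
    congr 1; funext b; congr 1
    simp [Fin.ext_iff, slot_inr_val]
  comp_one {m} i f := by
    ext v
    change f (endInputs i _ fun c => v (finCongr _ c)) = f v
    congr 1; funext a
    by_cases h : a = i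
    · subst h
      simp only [endInputs, dite_true]
      exact congrArg v (Fin.ext (slot_inr_val a 1 0))
    · simp only [endInputs, h, dite_false]
      congr 1
      refine Fin.ext ((slot_inl_val i 1 ⟨a, h⟩).trans ?_)
      split_ifs <;> simp
  comp_nested {m n l} i j x y z := by
    ext v
    change x (endInputs i _ (endInputs _ _ fun c => v (finCongr _ c))) = x (endInputs i _ v)
    congr 1; funext a
    by_cases h : a = i
    · subst h
      simp only [endInputs, dite_true]
      change y _ = y _
      congr 1; funext b
      by_cases hb : b = j
      · subst hb
        simp only [endInputs, dite_true]
        congr 1; funext c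
        rw [nested_inner]
      · simp only [endInputs, hb, dite_false]
        rw [dif_neg (by simpa using hb), nested_middle _ _ _ b hb]
    · simp only [endInputs, h, dite_false]
      rw [dif_neg (by simp), nested_outer]
  comp_parallel {m n l} i j hij x p q y z hy hz := by
    unfold trivGr at hy hz
    split_ifs at hy with hp
    · split_ifs at hz with hq
      · subst hp; subst hq
        rw [mul_zero, ksign_zero, one_smul]
        ext v
        change x (endInputs i _ (endInputs _ _ fun c => v (finCongr _ c))) =
          x (endInputs j _ (endInputs _ _ v))
        congr 1; funext a
        by_cases hi : a = i
        · subst hi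
          simp only [endInputs, dite_true, hij.ne, dite_false]
          change y _ = y _
          congr 1; funext b
          rw [dif_neg (by simp), parallel_left a j hij]
        · by_cases hj : a = j
          · subst hj
            simp only [endInputs, dite_true, hi, dite_false]
            change z _ = z _
            congr 1; funext c
            rw [dif_neg (by simp), parallel_right i a hij]
          · simp only [endInputs, hi, hj, dite_false]
            rw [dif_neg (by simpa using hj), dif_neg (by simpa using hi),
              parallel_outer i j hij _ a hi hj]
      · rw [(Submodule.mem_bot k).1 hz]; simp
    · rw [(Submodule.mem_bot k).1 hy]; simp

end endomorphisms

end

end AntiAss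
namespace AntiAss

universe u v w

noncomputable section

variable {k : Type u} [Field k]

/-! ### The deformation complex -/

/-- The derivations of degree `-p` from `P` to the `P`-module `Q`, the module structure being given
by a morphism `β : P → Q`. -/
def derivations {P : Operad.{u, v} k} {Q : Operad.{u, w} k} (β : P.Hom Q) (p : ℤ) :
    Submodule k (∀ n, P.obj n →ₗ[k] Q.obj n) where
  carrier := {θ |
    (∀ (n : ℕ) (d : ℤ) (x : P.obj n), x ∈ P.gr n d → θ n x ∈ Q.gr n (d - p)) ∧
    (∀ (m n : ℕ) (σ : Fin m ≃ Fin n) (x : P.obj m),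
      θ n (P.relabel σ x) = Q.relabel σ (θ m x)) ∧
    ∀ (m n : ℕ) (i : Fin m) (d : ℤ) (x : P.obj m) (y : P.obj n), x ∈ P.gr m d →
      θ _ (P.comp i x y) =
        Q.comp i (θ m x) (β.app n y) + ksign k (p * d) • Q.comp i (β.app m x) (θ n y)}
  zero_mem' := by simp
  add_mem' {θ θ'} h h' := by
    refine ⟨fun n d x hx => Submodule.add_mem _ (h.1 n d x hx) (h'.1 n d x hx), ?_, ?_⟩
    · intro m n σ x
      simp [h.2.1, h'.2.1]
    · intro m n i d x y hx
      simp only [Pi.add_apply, LinearMap.add_apply, h.2.2 m n i d x y hx, h'.2.2 m n i d x y hx,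
        map_add, smul_add]
      abel
  smul_mem' c θ h := by
    refine ⟨fun n d x hx => Submodule.smul_mem _ c (h.1 n d x hx), ?_, ?_⟩
    · intro m n σ x
      simp [h.2.1]
    · intro m n i d x y hx
      simp only [Pi.smul_apply, LinearMap.smul_apply, h.2.2 m n i d x y hx, map_smul, smul_add,
        smul_comm c]

/-- The differential `θ ↦ θ ∘ ∂` of the deformation complex, for a morphism `β : (P, ∂) → (Q, 0)`
of dg-operads. -/
def delta {P : Operad.{u, v} k} {Q : Operad.{u, w} k} {β : P.Hom Q} (dP : P.Differential)
    (hβ : ∀ n x, β.app n (dP.d n x) = 0) (p : ℤ) :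
    derivations β p →ₗ[k] derivations β (p + 1) where
  toFun θ := ⟨fun n => θ.1 n ∘ₗ dP.d n, by
    obtain ⟨θ, h1, h2, h3⟩ := θ
    refine ⟨?_, ?_, ?_⟩
    · intro n d x hx
      have := h1 n _ _ (dP.d_mem hx)
      rwa [show d - 1 - p = d - (p + 1) by ring] at this
    · intro m n σ x
      simp [dP.d_relabel, h2]
    · intro m n i d x y hx
      simp only [LinearMap.comp_apply, dP.d_comp i y hx, map_add, map_smul,
        h3 m n i _ _ _ (dP.d_mem hx), h3 m n i _ _ _ hx, hβ, map_zero, LinearMap.zero_apply,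
        smul_zero, add_zero, zero_add, smul_smul, ← ksign_add]
      congr 3
      ring⟩
  map_add' θ θ' := rfl
  map_smul' c θ := rfl

theorem delta_delta {P : Operad.{u, v} k} {Q : Operad.{u, w} k} {β : P.Hom Q}
    (dP : P.Differential) (hβ : ∀ n x, β.app n (dP.d n x) = 0) (p : ℤ) (θ : derivations β p) :
    delta dP hβ (p + 1) (delta dP hβ p θ) = 0 := by
  refine Subtype.ext (funext fun n => LinearMap.ext fun x => ?_)
  change θ.1 n (dP.d n (dP.d n x)) = 0
  rw [dP.d_d, map_zero]

section
variable {V : Type w} [AddCommGroup V] [Module k V]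

/-- The value of an element of the endomorphism operad. -/
def endEval {n : ℕ} (f : (endOperad k V).obj n) (v : Fin n → V) : V :=
  DFunLike.coe (F := MultilinearMap k (fun _ : Fin n => V) V) f v

theorem endComp_apply {m n : ℕ} (i : Fin m) (f : MultilinearMap k (fun _ : Fin m => V) V)
    (g : MultilinearMap k (fun _ : Fin n => V) V) (v) :
    endComp k V i f g v = f (endInputs i g v) := rfl

/-- `f ↦ ∑ j, f ∘_j φ - φ ∘ f`. -/
def innerEnd (φ : V →ₗ[k] V) (n : ℕ) : MultilinearMap k (fun _ : Fin n => V) V →ₗ[k]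
    MultilinearMap k (fun _ : Fin n => V) V where
  toFun f := (∑ j : Fin n, f.compLinearMap (Function.update (fun _ => LinearMap.id) j φ)) -
    φ.compMultilinearMap f
  map_add' f g := by
    ext v
    simp [Finset.sum_add_distrib]
    abel
  map_smul' c f := by
    ext v
    simp [Finset.smul_sum, smul_sub]

theorem innerEnd_apply (φ : V →ₗ[k] V) {n : ℕ} (f : MultilinearMap k (fun _ : Fin n => V) V)
    (v : Fin n → V) :
    innerEnd φ n f v = ∑ j, f (Function.update v j (φ (v j))) - φ (f v) := by
  simp only [innerEnd, LinearMap.coe_mk, AddHom.coe_mk, sub_apply,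
    sum_apply, MultilinearMap.compLinearMap_apply,
    LinearMap.compMultilinearMap_apply]
  congr 1
  refine Finset.sum_congr rfl fun j _ => ?_
  congr 1; funext a
  by_cases h : a = j
  · subst h; simp
  · simp [h]

theorem innerEnd_domDomCongr (φ : V →ₗ[k] V) {m n : ℕ} (σ : Fin m ≃ Fin n)
    (f : MultilinearMap k (fun _ : Fin m => V) V) :
    innerEnd φ n (f.domDomCongr σ) = (innerEnd φ m f).domDomCongr σ := by
  ext v
  simp only [innerEnd_apply, MultilinearMap.domDomCongr_apply]
  congr 1
  rw [← Equiv.sum_comp σ]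
  refine Finset.sum_congr rfl fun j _ => ?_
  congr 1; funext a
  by_cases h : a = j
  · subst h; simp
  · simp [h]

theorem innerEnd_comp (φ : V →ₗ[k] V) {m n : ℕ} (i : Fin m)
    (f : MultilinearMap k (fun _ : Fin m => V) V) (g : MultilinearMap k (fun _ : Fin n => V) V) :
    innerEnd φ _ (endComp k V i f g) =
      endComp k V i (innerEnd φ m f) g + endComp k V i f (innerEnd φ n g) := by
  ext v
  have h0 : endInputs i g v i = g fun b => v (slot i n (.inr b)) := by simp [endInputs]
  have h1 : endInputs i (innerEnd φ n g) v = Function.update (endInputs i g v) i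
      (∑ b, g (Function.update (fun b => v (slot i n (.inr b))) b
        (φ (v (slot i n (.inr b))))) - φ (endInputs i g v i)) := by
    rw [endInputs_eq_update, endInputs_eq_update (g := g), Function.update_idem,
      innerEnd_apply, Function.update_self]
  have h2 : ∀ j : Fin m, (h : j ≠ i) → endInputs i g v j = v (slot i n (.inl ⟨j, h⟩)) :=
    fun j h => by simp [endInputs, h]
  rw [innerEnd_apply, add_apply]
  simp only [endComp_apply]
  rw [h1, innerEnd_apply, f.map_update_sub, f.map_update_sum, ← Equiv.sum_comp (slot i n),
    Fintype.sum_sum_type]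
  simp only [endInputs_update_inl, endInputs_update_inr]
  rw [← Finset.sum_add_sum_compl {i} fun j => f (Function.update (endInputs i g v) j
    (φ (endInputs i g v j)))]
  rw [Finset.sum_singleton]
  have h3 : ∑ j ∈ ({i} : Finset (Fin m))ᶜ, f (Function.update (endInputs i g v) j
      (φ (endInputs i g v j))) = ∑ a : {a : Fin m // a ≠ i},
        f (Function.update (endInputs i g v) a.1 (φ (v (slot i n (.inl a))))) := by
    rw [Finset.sum_subtype (p := fun a => a ≠ i) _ (by simp)]
    exact Finset.sum_congr rfl fun a _ => by rw [h2 a.1 a.2]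
  rw [h3]
  abel

/-- The first differential of the deformation complex: `φ` is sent to the inner derivation
`x ↦ ∑ j, β(x) ∘_j φ - φ ∘ β(x)`. -/
def delta₁ {P : Operad.{u, v} k} (β : P.Hom (endOperad k V)) :
    (V →ₗ[k] V) →ₗ[k] derivations β 0 where
  toFun φ := ⟨fun n => innerEnd φ n ∘ₗ β.app n, by
    refine ⟨?_, ?_, ?_⟩
    · intro n d x hx
      have h := β.app_mem hx
      rw [sub_zero]
      change β.app n x ∈ trivGr k _ d at h
      change innerEnd φ n (β.app n x) ∈ trivGr k _ d
      unfold trivGr at h ⊢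
      split_ifs at h ⊢
      · trivial
      · rw [(Submodule.mem_bot k).1 h]; exact (Submodule.mem_bot k).2 (map_zero _)
    · intro m n σ x
      exact (congrArg (innerEnd φ n) (β.app_relabel σ x)).trans (innerEnd_domDomCongr φ σ _)
    · intro m n i d x y _
      rw [zero_mul, ksign_zero, one_smul]
      exact (congrArg (innerEnd φ _) (β.app_comp i x y)).trans (innerEnd_comp φ i _ _)⟩
  map_add' φ ψ := by
    refine Subtype.ext (funext fun n => LinearMap.ext fun x => ?_)
    refine MultilinearMap.ext fun v => ?_
    change innerEnd (φ + ψ) n _ v = innerEnd φ n _ v + innerEnd ψ n _ v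
    simp only [innerEnd_apply, LinearMap.add_apply, MultilinearMap.map_update_add,
      Finset.sum_add_distrib]
    abel
  map_smul' c φ := by
    refine Subtype.ext (funext fun n => LinearMap.ext fun x => ?_)
    refine MultilinearMap.ext fun v => ?_
    change innerEnd (c • φ) n _ v = c • innerEnd φ n _ v
    simp only [innerEnd_apply, LinearMap.smul_apply, MultilinearMap.map_update_smul, smul_sub,
      Finset.smul_sum]

theorem delta_delta₁ {P : Operad.{u, v} k} {β : P.Hom (endOperad k V)} (dP : P.Differential)
    (hβ : ∀ n x, β.app n (dP.d n x) = 0) (φ : V →ₗ[k] V) :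
    delta dP hβ 0 (delta₁ β φ) = 0 := by
  refine Subtype.ext (funext fun n => LinearMap.ext fun x => ?_)
  change innerEnd φ n (β.app n (dP.d n x)) = 0
  rw [hβ]; exact map_zero _

end

theorem IsMinimalModel.app_d {X : ℕ → Type v} {deg : ∀ a, X a → ℤ} {P : Operad k}
    {dR : (freeOperad k X deg).Differential} {ρ : (freeOperad k X deg).Hom P}
    (h : IsMinimalModel P dR ρ) {Q : Operad.{u, w} k} (α : P.Hom Q) (n : ℕ)
    (x : (freeOperad k X deg).obj n) : (ρ.trans α).app n (dR.d n x) = 0 := by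
  change α.app n (ρ.app n (dR.d n x)) = 0
  rw [h.quasiIso.comm]
  exact map_zero _

/-! ### Bracketings and edge paths in associahedra -/

/-- Nested bracketings with binary and ternary brackets. -/
inductive Bracketing : Type
  | dot : Bracketing
  | two : Bracketing → Bracketing → Bracketing
  | three : Bracketing → Bracketing → Bracketing → Bracketing

namespace Bracketing

/-- The number of dots. -/
def length : Bracketing → ℕ
  | dot => 1
  | two x y => x.length + y.length
  | three x y z => x.length + y.length + z.length

/-- The number of ternary brackets. -/
def ternaries : Bracketing → ℕ
  | dot => 0
  | two x y => x.ternaries + y.ternaries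
  | three x y z => x.ternaries + y.ternaries + z.ternaries + 1

/-- The two ways to replace the ternary bracket by binary ones, for a bracketing with exactly one
ternary bracket. -/
def endpoints : Bracketing → Set Bracketing
  | dot => ∅
  | two x y => (fun z => two z y) '' x.endpoints ∪ (fun z => two x z) '' y.endpoints
  | three x y z => {two (two x y) z, two x (two y z)}

/-- `b` is an edge of the associahedron `K_n`, whose vertices are the bracketings of `n` dots by
binary brackets. -/
def IsEdge (n : ℕ) (b : Bracketing) : Prop := b.length = n ∧ b.ternaries = 1

/-- The edges `e 0, …, e (r - 1)` of `K_n` form a closed path, through the vertices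
`w 0, w 1, …, w r = w 0`. -/
def IsClosedEdgePath (n : ℕ) {r : ℕ} [NeZero r] (e : Fin r → Bracketing) : Prop :=
  ∃ w : Fin r → Bracketing, ∀ j, (e j).IsEdge n ∧ (e j).endpoints = {w j, w (j + 1)}

/-- The value of a bracketing in an operad, the brackets being interpreted as `m₂` and `m₃`. -/
def eval {P : Operad.{u, v} k} (m₂ : P.obj 2) (m₃ : P.obj 3) : ∀ b : Bracketing, P.obj b.length
  | dot => P.one
  | two x y => P.relabel (finCongr (by simp only [length]; omega))
      (P.comp ⟨0, by omega⟩ (P.comp ⟨1, by omega⟩ m₂ (y.eval m₂ m₃)) (x.eval m₂ m₃))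
  | three x y z => P.relabel (finCongr (by simp only [length]; omega))
      (P.comp ⟨0, by omega⟩ (P.comp ⟨1, by omega⟩ (P.comp ⟨2, by omega⟩ m₃ (z.eval m₂ m₃))
        (y.eval m₂ m₃)) (x.eval m₂ m₃))

/-- The element `x_e` of `P(n)` that belongs to a bracketing `e` of `n` dots. -/
def elem {P : Operad.{u, v} k} (m₂ : P.obj 2) (m₃ : P.obj 3) (n : ℕ) (e : Bracketing) : P.obj n :=
  if h : e.length = n then P.relabel (finCongr h) (e.eval m₂ m₃) else 0

end Bracketing

/-! ### Formulas -/

/-- The composition `x ∘_i y`, the inputs of `x` being numbered from `1`. -/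
def Operad.circ {P : Operad.{u, v} k} {m n : ℕ} (x : P.obj m) (i : ℕ) (y : P.obj n)
    (hi : 1 ≤ i ∧ i ≤ m := by decide) : P.obj (m + n - 1) :=
  P.comp ⟨i - 1, by omega⟩ x y

notation:70 x:70 " ∘[" i "] " y:71 => Operad.circ x i y

/-- The elements `∂ μ₅¹, …, ∂ μ₅⁴`, for `m₂ = μ₂` and `m₃ = μ₃`. -/
def quintic {P : Operad.{u, v} k} (m₂ : P.obj 2) (m₃ : P.obj 3) : Fin 4 → P.obj 5 := ![
    (m₂ ∘[2] m₃) ∘[4] m₂ - (m₃ ∘[3] m₂) ∘[4] m₂ + (m₂ ∘[1] m₂) ∘[3] m₃ - (m₃ ∘[1] m₂) ∘[3] m₂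
      + (m₂ ∘[1] m₃) ∘[1] m₂ - (m₃ ∘[1] m₂) ∘[1] m₂ + (m₂ ∘[1] m₃) ∘[4] m₂
      - (m₃ ∘[2] m₂) ∘[4] m₂,
    (m₃ ∘[1] m₂) ∘[1] m₂ - (m₂ ∘[1] m₃) ∘[1] m₂ + (m₂ ∘[1] m₃) ∘[3] m₂ - (m₃ ∘[2] m₂) ∘[3] m₂
      + (m₂ ∘[2] m₃) ∘[3] m₂ - (m₃ ∘[3] m₂) ∘[3] m₂ + (m₂ ∘[1] m₂) ∘[3] m₃
      - (m₃ ∘[1] m₂) ∘[4] m₂,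
    (m₃ ∘[2] m₂) ∘[4] m₂ - (m₂ ∘[2] m₃) ∘[2] m₂ + (m₃ ∘[2] m₂) ∘[2] m₂ - (m₂ ∘[1] m₂) ∘[2] m₃
      + (m₂ ∘[1] m₃) ∘[3] m₂ - (m₂ ∘[1] m₃) ∘[1] m₂ + (m₂ ∘[1] m₂) ∘[1] m₃
      - (m₃ ∘[1] m₂) ∘[2] m₂,
    (m₃ ∘[1] m₂) ∘[3] m₂ - (m₃ ∘[3] m₂) ∘[3] m₂ + (m₂ ∘[2] m₃) ∘[3] m₂ - (m₃ ∘[2] m₂) ∘[3] m₂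
      + (m₂ ∘[1] m₂) ∘[2] m₃ - (m₂ ∘[1] m₃) ∘[2] m₂ + (m₂ ∘[1] m₂) ∘[1] m₃
      - (m₂ ∘[1] m₃) ∘[1] m₂]

end

end AntiAss

open AntiAss

universe u v

/-! The model is built arity by arity. The boundary of `μ₃` is the sum, not the difference, of the
two bracketings of three letters, so an edge of an associahedron has the sum of its two ends as
boundary. This makes cycles of odd length useful. In the pentagon `K₄`, a suitably signed sum of the
five edges has boundary twice a chosen vertex (`IsLow.dA_root`). As `2` is invertible, every
bracketing of at least four letters is a boundary, which says that products of four elements vanish,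
and arity four needs no generators. The associahedron `K₅` has 14 vertices and 21 edges, and the
boundary from edges to vertices is onto. This leaves a space of cycles of dimension seven: three
cycles are the boundaries of the compositions of `μ₃` with itself, and the four closed paths of
length eight, killed by `μ₅¹, …, μ₅⁴`, complete them to a basis (`IsLow.arity_five_injective`).

The main point is that no homology of degree zero or one remains in higher arities, so that all
further generators have degree greater than two. A contraction of a binary tree is such a signed
pentagon, formed anywhere in the tree. Two contractions of the same tree differ by a boundary
(`IsLow.fill_unique`): a contraction inside a branch can be moved to the root, and contractions at
the root can be compared, by finitely many identities between bracketings of five letters. Twice an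
edge is the sum of contractions of its two ends (`IsLow.edge_fill`). Hence twice a cycle of degree
one is, up to boundaries, the contraction of its own boundary, which is zero
(`IsLow.edge_mem_boundaries`). All this uses only `μ₂`, `μ₃` and the `μ₅ⁱ`. The inductive step
`Pre.Good.step` then adds one generator of arity `n` for each element of a homogeneous basis of the
homology in arity `n` of the operad built so far. This homology is finite dimensional since there
are only finitely many trees with `n` leaves, and it lives in degrees greater than one by
`exact_low`.

Three general facts support this. Morphisms from a free operad are prescribed on generators
(`freeHom`). Derivations are morphisms to the operad of dual numbers, so they are prescribed on
generators as well (`exists_derivation`). Finally, since the generators carry free actions of the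
symmetric groups and their boundaries are planar, the symmetric operad splits into copies of a
complex of trees without labels (`forget`, `label`, `part`), and homology is computed there.

For the Euler characteristics, exactness in arities at least four makes the supertrace of the
identity vanish (`trace_eq_zero_of_exact`). So the generating series of the Euler characteristics of
the trees is `f = X + X² + X³`, up to the order considered. Cutting trees at the root gives `f = X +
∑ χ(E(a)) fᵃ`, and this determines the `χ(E(a))` recursively.

In the deformation complex, `End_V` is concentrated in degree zero. A derivation of degree `-p`
therefore vanishes on generators of degree other than `p` and is arbitrary on the others; the
formulas for the differentials come from evaluating it on the boundaries of `μ₃` and `μ₅ⁱ`. -/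

namespace AntiAss

universe w

noncomputable section

variable {k : Type u} [Field k]

/-! ### Operations of arbitrary arity -/

namespace Operad

variable (Q : Operad.{u, w} k)

/-- An element of an operad together with its arity. -/
structure Tot : Type w where
  fst : ℕ
  snd : Q.obj fst

variable {Q}

/-- Identifications of equal arities become plain equalities of total elements. The operad axioms
thus take a form without transports, in which words can be evaluated step by step. -/
theorem tot_ext {m n : ℕ} (h : m = n) (z : Q.obj m) :
    (⟨n, Q.relabel (finCongr h) z⟩ : Q.Tot) = ⟨m, z⟩ := by
  subst h
  rw [show finCongr (rfl : m = m) = Equiv.refl _ from rfl, Q.relabel_refl]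

/-- The composition `x ∘_i y` (inputs numbered from `0`), which is zero if `x` has no `i`-th input. -/
def tcomp (i : ℕ) (x y : Q.Tot) : Q.Tot :=
  if h : i < x.1 then ⟨x.1 + y.1 - 1, Q.comp ⟨i, h⟩ x.2 y.2⟩ else ⟨x.1, 0⟩

theorem tcomp_fst {i : ℕ} {x : Q.Tot} (h : i < x.1) (y : Q.Tot) :
    (tcomp i x y).1 = x.1 + y.1 - 1 := by
  simp [tcomp, h]

/-- The strict inequality `i < j` pays for the input that is lost when `y` has arity zero; the
default value of `tcomp` keeps the arity of `x`. -/
theorem lt_tcomp_fst {i j : ℕ} {x : Q.Tot} (hij : i < j) (h : i < x.1) (y : Q.Tot) :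
    i < (tcomp j x y).1 := by
  unfold tcomp; split_ifs <;> simp only <;> omega

theorem tcomp_of_lt {i m n : ℕ} (h : i < m) (x : Q.obj m) (y : Q.obj n) :
    tcomp i (⟨m, x⟩ : Q.Tot) ⟨n, y⟩ = ⟨m + n - 1, Q.comp ⟨i, h⟩ x y⟩ := by
  simp [tcomp, h]

theorem tcomp_of_le {i : ℕ} {x : Q.Tot} (h : x.1 ≤ i) (y : Q.Tot) :
    tcomp i x y = ⟨x.1, 0⟩ := by
  simp [tcomp, Nat.not_lt.2 h]

/-- Scalar multiplication. -/
def tsmul (c : k) (x : Q.Tot) : Q.Tot := ⟨x.1, c • x.2⟩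

theorem tsmul_tsmul (c d : k) (x : Q.Tot) : tsmul c (tsmul d x) = tsmul (c * d) x := by
  simp only [tsmul, mul_smul]; rfl

@[simp] theorem tsmul_one (x : Q.Tot) : tsmul (1 : k) x = x := by
  obtain ⟨m, x⟩ := x; simp [tsmul]

theorem tcomp_tsmul_left (i : ℕ) (c : k) (x y : Q.Tot) :
    tcomp i (tsmul c x) y = tsmul c (tcomp i x y) := by
  obtain ⟨m, x⟩ := x
  by_cases h : i < m
  · rw [tsmul, tcomp_of_lt h, map_smul]
    change _ = tsmul c (tcomp i ⟨m, x⟩ ⟨y.1, y.2⟩)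
    rw [tcomp_of_lt h]; rfl
  · rw [tcomp_of_le (x := tsmul c ⟨m, x⟩) (by simpa [tsmul] using h),
      tcomp_of_le (by simpa using h)]
    simp [tsmul]
    rfl

theorem tcomp_nested {i j : ℕ} {x y : Q.Tot} (hi : i < x.1) (hj : j < y.1) (z : Q.Tot) :
    tcomp (i + j) (tcomp i x y) z = tcomp i x (tcomp j y z) := by
  obtain ⟨m, x⟩ := x
  obtain ⟨n, y⟩ := y
  obtain ⟨l, z⟩ := z
  simp only at hi hj
  rw [tcomp_of_lt hi, tcomp_of_lt hj, tcomp_of_lt hi, tcomp_of_lt (by omega),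
    ← Q.comp_nested ⟨i, hi⟩ ⟨j, hj⟩ x y z, tot_ext]
  rfl

/-- No upper bound on `j` is required: if `x` has no `j`-th input, both sides are the zero element
of the same arity, by the default value of `tcomp`. -/
theorem tcomp_parallel {i j : ℕ} {x y z : Q.Tot} (hij : i < j) (hi : i < x.1)
    {p q : ℤ} (hy : y.2 ∈ Q.gr y.1 p) (hz : z.2 ∈ Q.gr z.1 q) :
    tcomp (j + y.1 - 1) (tcomp i x y) z =
      tsmul (ksign k (p * q)) (tcomp i (tcomp j x z) y) := by
  obtain ⟨m, x⟩ := x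
  obtain ⟨n, y⟩ := y
  obtain ⟨l, z⟩ := z
  simp only at hi hy hz ⊢
  by_cases hj : j < m
  · rw [tcomp_of_lt hi, tcomp_of_lt hj, tcomp_of_lt (by omega), tcomp_of_lt (by omega)]
    have h := Q.comp_parallel ⟨i, hi⟩ ⟨j, hj⟩ hij x hy hz
    have e1 : slot (⟨i, hi⟩ : Fin m) n (.inl ⟨⟨j, hj⟩, (Fin.lt_def.2 hij).ne'⟩) =
        ⟨j + n - 1, by omega⟩ := by
      rw [Fin.ext_iff, slot_inl_val]; simp; omega
    have e2 : slot (⟨j, hj⟩ : Fin m) l (.inl ⟨⟨i, hi⟩, (Fin.lt_def.2 hij).ne⟩) =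
        ⟨i, by omega⟩ := by
      rw [Fin.ext_iff, slot_inl_val]; simp; omega
    rw [e1, e2] at h
    simp only [tsmul]
    rw [← h, tot_ext]
  · rw [tcomp_of_lt hi, tcomp_of_le (x := ⟨m, x⟩) (by simp; omega), tcomp_of_le (by simp; omega),
      tcomp_of_lt hi]
    simp only [tsmul, map_zero, LinearMap.zero_apply, smul_zero]

theorem tcomp_one {i : ℕ} {x : Q.Tot} (hi : i < x.1) : tcomp i x ⟨1, Q.one⟩ = x := by
  obtain ⟨m, x⟩ := x
  rw [tcomp_of_lt hi]
  conv_rhs => rw [← Q.comp_one ⟨i, hi⟩ x]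
  rw [tot_ext]

theorem one_tcomp (x : Q.Tot) : tcomp 0 ⟨1, Q.one⟩ x = x := by
  obtain ⟨m, x⟩ := x
  rw [tcomp_of_lt (by omega)]
  conv_rhs => rw [← Q.one_comp x]
  rw [tot_ext]
  rfl

theorem tcomp_mem (i : ℕ) {x y : Q.Tot} {p q : ℤ} (hx : x.2 ∈ Q.gr x.1 p)
    (hy : y.2 ∈ Q.gr y.1 q) : (tcomp i x y).2 ∈ Q.gr (tcomp i x y).1 (p + q) := by
  obtain ⟨m, x⟩ := x
  by_cases h : i < m
  · obtain ⟨n, y⟩ := y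
    rw [tcomp_of_lt h]
    exact Q.comp_mem _ hx hy
  · rw [tcomp_of_le (by simpa using h)]
    exact Submodule.zero_mem _

/-- The element of arity `n` that is behind an element of arbitrary arity. -/
def Tot.cast {n : ℕ} (x : Q.Tot) (h : x.1 = n) : Q.obj n := Q.relabel (finCongr h) x.2

theorem Tot.cast_congr {n : ℕ} {x y : Q.Tot} (e : x = y) (h : x.1 = n) :
    x.cast h = y.cast (e ▸ h) := by subst e; rfl

theorem Tot.mk_cast {n : ℕ} (x : Q.Tot) (h : x.1 = n) : (⟨n, x.cast h⟩ : Q.Tot) = x :=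
  tot_ext h x.2

theorem Tot.cast_mk {n : ℕ} (x : Q.obj n) (h : n = n) : Tot.cast (Q := Q) ⟨n, x⟩ h = x :=
  Q.relabel_refl x

theorem Tot.cast_eq_iff {n : ℕ} (x : Q.Tot) (h : x.1 = n) (y : Q.obj n) :
    x.cast h = y ↔ x = ⟨n, y⟩ := by
  constructor
  · rintro rfl; exact (x.mk_cast h).symm
  · rintro rfl; exact cast_mk y _

end Operad

/-! ### Evaluation of words and trees -/

open Operad

section run

variable {X : ℕ → Type v} {α β : Type} {Q : Operad.{u, w} k} (f : ∀ a, X a → Q.obj a)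

/-- The number of leaves in a word. -/
def leaves (w : List ((Σ a, X a) ⊕ α)) : ℕ := (w.filterMap Sum.getRight?).length

@[simp] theorem leaves_nil : leaves ([] : List ((Σ a, X a) ⊕ α)) = 0 := rfl

@[simp] theorem leaves_inl (g) (w : List ((Σ a, X a) ⊕ α)) : leaves (.inl g :: w) = leaves w := rfl

@[simp] theorem leaves_inr (a) (w : List ((Σ a, X a) ⊕ α)) :
    leaves (.inr a :: w) = leaves w + 1 := rfl

@[simp] theorem leaves_append (w w' : List ((Σ a, X a) ⊕ α)) :
    leaves (w ++ w') = leaves w + leaves w' := by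
  simp [leaves]

/-- Reading a word from left to right, starting with `z`, whose inputs before the `s`-th are
already filled: vertices are composed into the `s`-th input, leaves leave this input open. -/
def run : List ((Σ a, X a) ⊕ α) → ℕ → Q.Tot → Q.Tot
  | [], _, z => z
  | .inl g :: w, s, z => run w s (tcomp s z ⟨g.1, f g.1 g.2⟩)
  | .inr _ :: w, s, z => run w (s + 1) z

/-- The value of a tree in an operad. -/
def ev (t : Tree X α) : Q.Tot := run f t.word 0 ⟨1, Q.one⟩

theorem run_append (w w' : List ((Σ a, X a) ⊕ α)) (s : ℕ) (z : Q.Tot) :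
    run f (w ++ w') s z = run f w' (s + leaves w) (run f w s z) := by
  induction w generalizing s z with
  | nil => rfl
  | cons y w ih =>
    rcases y with y | y
    · simp [run, ih]
    · simp only [List.cons_append, run, ih, leaves_inr]
      congr 1; omega

theorem run_tsmul (w : List ((Σ a, X a) ⊕ α)) (s : ℕ) (c : k) (z : Q.Tot) :
    run f w s (tsmul c z) = tsmul c (run f w s z) := by
  induction w generalizing s z with
  | nil => rfl
  | cons y w ih => rcases y with y | y <;> simp [run, ih, tcomp_tsmul_left]

variable {f} {deg : ∀ a, X a → ℤ} (hf : ∀ a (x : X a), f a x ∈ Q.gr a (deg a x))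

include hf in
theorem run_mem (w : List ((Σ a, X a) ⊕ α)) (s : ℕ) {z : Q.Tot} {p : ℤ}
    (hz : z.2 ∈ Q.gr z.1 p) :
    (run f w s z).2 ∈ Q.gr (run f w s z).1 (p + Tree.wordDeg deg w) := by
  induction w generalizing s z p with
  | nil => rw [Tree.wordDeg, add_zero]; exact hz
  | cons y w ih =>
    rcases y with y | y
    · have := ih s (tcomp_mem s hz (y := ⟨y.1, f y.1 y.2⟩) (hf y.1 y.2))
      rwa [add_assoc] at this
    · exact ih (s + 1) hz

include hf in
theorem ev_mem (t : Tree X α) : (ev f t).2 ∈ Q.gr (ev f t).1 (t.degree deg) := by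
  have := run_mem hf t.word 0 (z := ⟨1, Q.one⟩) Q.one_mem
  rwa [zero_add] at this

include hf in
-- An operation in a finished input `i` commutes with everything that is still to be composed into
-- the later inputs. Each vertex of `w` passes `T` once and contributes its Koszul sign.
theorem run_parallel (w : List ((Σ a, X a) ⊕ α)) {i s : ℕ} (his : i < s) {z T : Q.Tot} {q : ℤ}
    (hz : i < z.1) (hT : T.2 ∈ Q.gr T.1 q) :
    run f w (s + T.1 - 1) (tcomp i z T) =
      tsmul (ksign k (q * Tree.wordDeg deg w)) (tcomp i (run f w s z) T) := by
  induction w generalizing s z with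
  | nil => simp [run, Tree.wordDeg]
  | cons y w ih =>
    rcases y with y | y
    · simp only [run, Tree.wordDeg]
      rw [tcomp_parallel (z := ⟨y.1, f y.1 y.2⟩) his hz hT (hf y.1 y.2), run_tsmul,
        ih his (lt_tcomp_fst his hz _), tsmul_tsmul, mul_add, ksign_add]
    · simp only [run, Tree.wordDeg]
      rw [← ih (by omega) hz]
      congr 1; omega

theorem word_node {a : ℕ} (x : X a) (c : Fin a → Tree X α) :
    (Tree.node x c).word = .inl ⟨_, x⟩ :: ((List.ofFn c).map Tree.word).flatten := by
  rw [List.map_ofFn]; rfl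

/-- The number of leaves of a tree. -/
def Tree.len (t : Tree X α) : ℕ := leaves t.word

theorem Tree.length_labels (t : Tree X α) : t.labels.length = t.len := rfl

variable (f) in
-- A forest that fills consecutive inputs of `y` can be read before or after `y` is composed into
-- `z`; nested associativity is used once for each tree. The hypothesis on the trees of `L` is the
-- inductive assumption of `run_tree`, and the count of inputs is carried along because the arity of
-- a tree is obtained from it.
theorem run_forest (L : List (Tree X α))
    (hL : ∀ t ∈ L, (ev f t).1 = t.len ∧ ∀ s (z : Q.Tot), s < z.1 →
      run f t.word s z = tcomp s z (ev f t)) {i j : ℕ} {z y : Q.Tot} (hi : i < z.1)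
    (hj : j + L.length ≤ y.1) :
    run f (L.map Tree.word).flatten (i + j) (tcomp i z y) =
      tcomp i z (run f (L.map Tree.word).flatten j y) ∧
    (run f (L.map Tree.word).flatten j y).1 + L.length =
      y.1 + leaves (L.map Tree.word).flatten := by
  induction L generalizing j y with
  | nil => simp [run]
  | cons t L ih =>
    obtain ⟨h1, h2⟩ := hL t (by simp)
    simp only [List.length_cons] at hj
    simp only [List.map_cons, List.flatten_cons, run_append]
    have h3 : (tcomp j y (ev f t)).1 = y.1 + t.len - 1 := by rw [tcomp_fst (by omega), h1]
    have ih' := ih (fun t ht => hL t (by simp [ht])) (j := j + t.len) (y := tcomp j y (ev f t))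
      (by rw [h3]; omega)
    rw [h2 (i + j) _ (by rw [tcomp_fst hi]; omega), h2 j y (by omega),
      tcomp_nested hi (by omega), leaves_append]
    change run f _ (i + j + t.len) _ = tcomp i z (run f _ (j + t.len) _) ∧
      (run f _ (j + t.len) _).1 + _ = _ + (t.len + _)
    refine ⟨by rw [add_assoc]; exact ih'.1, ?_⟩
    have := ih'.2
    rw [h3] at this
    simp only [List.length_cons]
    omega

variable (f) in
-- By nested associativity, the word of a tree acts inside a larger word like a single vertex
-- decorated by the value of the tree.
theorem run_tree (t : Tree X α) : (ev f t).1 = t.len ∧ ∀ s (z : Q.Tot), s < z.1 →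
    run f t.word s z = tcomp s z (ev f t) := by
  induction t with
  | leaf a => exact ⟨rfl, fun s z hs => (tcomp_one hs).symm⟩
  | @node a x c ih =>
    have hL : ∀ t ∈ List.ofFn c, (ev f t).1 = t.len ∧ ∀ s (z : Q.Tot), s < z.1 →
        run f t.word s z = tcomp s z (ev f t) := by
      intro t ht
      obtain ⟨i, rfl⟩ := (List.mem_ofFn' _ _).1 ht
      exact ih i
    have he : ev f (Tree.node x c) =
        run f ((List.ofFn c).map Tree.word).flatten 0 ⟨a, f a x⟩ := by
      rw [ev, word_node]
      simp only [run]
      rw [one_tcomp]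
    refine ⟨?_, fun s z hs => ?_⟩
    · have := (run_forest f _ hL (i := 0) (j := 0) (z := ⟨1, Q.one⟩) (y := ⟨a, f a x⟩) (by simp)
        (by simp)).2
      rw [he, Tree.len, word_node, leaves_inl]
      simp only [List.length_ofFn] at this
      omega
    · rw [he, word_node]
      simp only [run]
      exact (run_forest f _ hL (i := s) (j := 0) (z := z) (y := ⟨a, f a x⟩) hs
        (by simp)).1

variable (f) in
theorem lt_run_forest (L : List (Tree X α))
    (hL : ∀ t ∈ L, ∀ u y v, t.word = u ++ y :: v → ∀ s (z : Q.Tot), s < z.1 →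
      s + leaves u < (run f u s z).1) {u y v} (e : (L.map Tree.word).flatten = u ++ y :: v)
    {j : ℕ} {z : Q.Tot} (hj : j + L.length ≤ z.1) : j + leaves u < (run f u j z).1 := by
  induction L generalizing u j z with
  | nil => simp at e
  | cons t L ih =>
    simp only [List.length_cons] at hj
    rw [List.map_cons, List.flatten_cons, List.append_eq_append_iff] at e
    rcases e with ⟨w, rfl, e⟩ | ⟨w, e, e'⟩
    · rw [run_append, leaves_append, (run_tree f t).2 j z (by omega), ← add_assoc]
      refine ih (fun t ht => hL t (by simp [ht])) e ?_
      have := (run_tree f t).1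
      rw [tcomp_fst (by omega), this, Tree.len]; omega
    · rcases w with _ | ⟨y', w⟩
      · simp only [List.append_nil, List.nil_append] at e e'
        subst e
        rw [(run_tree f t).2 j z (by omega), tcomp_fst (by omega), (run_tree f t).1, Tree.len]
        rcases L with _ | ⟨t', L⟩
        · simp at e'
        · simp only [List.length_cons] at hj; omega
      · simp only [List.cons_append, List.cons.injEq] at e'
        exact hL t (by simp) u y' w e j z (by omega)

variable (f) in
-- Before each letter of the word of a tree, an input is open at the current position. This is what
-- allows another tree to be composed there when a word is cut in the middle, as happens in a
-- grafting.
theorem lt_run_tree (t : Tree X α) : ∀ u y v, t.word = u ++ y :: v → ∀ s (z : Q.Tot), s < z.1 →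
    s + leaves u < (run f u s z).1 := by
  induction t with
  | leaf a =>
    intro u y v e s z hs
    rcases u with _ | ⟨y', u⟩
    · simpa [run] using hs
    · simp [Tree.word] at e
  | @node a x c ih =>
    intro u y v e s z hs
    rcases u with _ | ⟨y', u⟩
    · simpa [run] using hs
    · rw [word_node, List.cons_append, List.cons.injEq] at e
      obtain ⟨rfl, e⟩ := e
      simp only [leaves_inl, run]
      refine lt_run_forest f (List.ofFn c) ?_ e ?_
      · intro t ht
        obtain ⟨i, rfl⟩ := (List.mem_ofFn' _ _).1 ht
        exact ih i
      · rw [tcomp_fst hs, List.length_ofFn]; simp only; omega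

variable (f) in
theorem run_relabel (g : α → β) (w : List ((Σ a, X a) ⊕ α)) (s : ℕ) (z : Q.Tot) :
    run f (w.flatMap (Sum.elim (fun g => [.inl g]) fun a => [.inr (g a)])) s z = run f w s z := by
  induction w generalizing s z with
  | nil => rfl
  | cons y w ih => rcases y with y | y <;> simp [run, ih]

variable (f) in
theorem ev_map (g : α → β) (t : Tree X α) : ev f (t.map g) = ev f t := by
  rw [ev, Tree.map, Tree.word_bind]; exact run_relabel f g _ _ _

variable (f) in
-- Away from the leaf `i`, grafting only renames leaves, and the evaluation ignores names.
theorem run_plug {m n : ℕ} (i : Fin m) (t : Tree X (Fin n)) (w : List ((Σ a, X a) ⊕ Fin m))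
    (h : .inr i ∉ w) (s : ℕ) (z : Q.Tot) :
    run f (w.flatMap (Sum.elim (fun g => [.inl g]) fun a => (Tree.plug i t a).word)) s z =
      run f w s z ∧
    leaves (w.flatMap (Sum.elim (fun g => [.inl g]) fun a => (Tree.plug i t a).word)) =
      leaves w := by
  induction w generalizing s z with
  | nil => exact ⟨rfl, rfl⟩
  | cons y w ih =>
    rcases y with y | y
    · have := ih (by simpa using h)
      simp only [List.flatMap_cons, Sum.elim_inl, List.singleton_append, run, leaves_inl]
      exact this _ _
    · simp only [List.mem_cons, Sum.inr.injEq, not_or] at h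
      have := ih h.2
      simp only [List.flatMap_cons, Sum.elim_inr, Tree.plug_ne t (Ne.symm h.1), Tree.word,
        List.singleton_append, run, leaves_inr]
      exact ⟨(this _ _).1, by rw [(this s z).2]⟩

include hf in
-- The word of `s` is cut at the leaf `i` into `u` and `v`, and the grafting puts the word of `t`
-- between them. After `u` has been read, the value of `t` is composed into the current input.
-- Moving it past `v` to the end costs the degree of `t` times the degree of `v`, which is the sign
-- built into `treeComp`.
theorem ev_graft {m n : ℕ} (i : Fin m) {s : Tree X (Fin m)} (t : Tree X (Fin n))
    (hs : s.labels = List.finRange m) :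
    ev f (Tree.graft i s t) = tsmul (ksign k (t.degree deg * s.after deg i))
      (tcomp i (ev f s) (ev f t)) := by
  have hlin : s.IsLinear := by
    rw [Tree.IsLinear, hs]; exact ⟨List.nodup_finRange m, List.mem_finRange⟩
  obtain ⟨u, v, e, hu, hv⟩ := hlin.split i
  -- The labels of `s` are in natural order, so exactly `i` leaves precede the leaf `i`, and the
  -- position reached by the evaluation is the input `i`.
  have hi : leaves u = i := by
    have h1 : s.labels = u.filterMap Sum.getRight? ++ i :: v.filterMap Sum.getRight? := by
      rw [Tree.labels, e]; simp
    rw [hs] at h1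
    have h2 := congrArg (fun l => l[leaves u]?) h1
    have h3 : leaves u < m := by
      have := congrArg List.length h1
      simp only [List.length_finRange, List.length_append, List.length_cons] at this
      simp only [leaves]; omega
    simp only [leaves, List.getElem?_append_right le_rfl, Nat.sub_self, List.getElem?_cons_zero]
      at h2
    rw [List.getElem?_eq_getElem (by rw [List.length_finRange]; exact h3)] at h2
    simp only [List.getElem_finRange, Option.some.injEq, Fin.ext_iff] at h2
    exact h2
  have hafter : s.after deg i = Tree.wordDeg deg v := by
    rw [Tree.after, e, Tree.wordAfter_append_of_notMem deg _ _ hu]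
    simp [Tree.wordAfter]
  have htm := run_tree f (t.map fun b => slot i n (.inr b))
  rw [ev_map] at htm
  have hlen : (t.map fun b => slot i n (.inr b)).len = t.len := by
    rw [← Tree.length_labels, Tree.labels_map, List.length_map]; rfl
  have hs1 := (run_tree f s).1
  have hsl : s.len = m := by rw [← Tree.length_labels, hs]; simp
  rw [ev, Tree.graft, Tree.word_bind, e, List.flatMap_append, List.flatMap_cons, run_append,
    run_append, (run_plug f i t u hu _ _).1, (run_plug f i t u hu 0 ⟨1, Q.one⟩).2]
  simp only [Sum.elim_inr, Tree.plug_self, zero_add]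
  have hz : (leaves u) < (run f u 0 ⟨1, Q.one⟩).1 := by
    have := lt_run_tree f s u _ v e 0 ⟨1, Q.one⟩ (by simp)
    omega
  rw [htm.2 _ _ hz, (run_plug f i t v hv _ _).1]
  change run f v (leaves u + (t.map fun b => slot i n (.inr b)).len) _ = _
  have h4 := run_parallel hf v (i := leaves u) (s := leaves u + 1) (by omega) hz (ev_mem hf t)
  rw [htm.1] at h4
  rw [show leaves u + 1 + (t.map fun b => slot i n (.inr b)).len - 1 =
    leaves u + (t.map fun b => slot i n (.inr b)).len by omega] at h4
  rw [h4, hafter, ← hi]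
  conv_rhs => rw [ev, e, run_append, zero_add]
  rfl

end run

end

end AntiAss

namespace AntiAss

universe w

noncomputable section

variable {k : Type u} [Field k]

open Operad

theorem ksign_mul_self (n : ℤ) : ksign k n * ksign k n = 1 := by
  rw [← ksign_add, ksign_eq k (n := 0) (by simp), ksign_zero]

/-! ### Planar trees -/

namespace LinTree

variable {X : ℕ → Type v} {n : ℕ}

/-- The labels of the leaves are in their natural order. -/
def Planar (t : LinTree X n) : Prop := t.tree.labels = List.finRange n

theorem labels_perm (t : LinTree X n) : t.tree.labels.Perm (List.finRange n) :=
  (List.perm_ext_iff_of_nodup t.isLinear.1 (List.nodup_finRange n)).2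
    fun a => by simp [t.isLinear.2 a]

theorem length_labels (t : LinTree X n) : t.tree.labels.length = n := by
  rw [t.labels_perm.length_eq, List.length_finRange]

theorem planar_iff (t : LinTree X n) : t.Planar ↔ t.tree.labels.Pairwise (· < ·) := by
  constructor
  · intro h
    rw [h]
    exact List.pairwise_lt_finRange n
  · intro h
    exact t.labels_perm.eq_of_pairwise (fun a b _ _ h1 h2 => absurd h1 (not_lt.2 h2.le)) h
      (List.pairwise_lt_finRange n)

/-- The labels of the leaves, as a permutation. -/
def perm (t : LinTree X n) : Fin n ≃ Fin n :=
  Equiv.ofBijective (fun i => t.tree.labels[(i : ℕ)]'(by rw [t.length_labels]; exact i.2))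
    (Finite.injective_iff_bijective.1 fun i j h => Fin.ext (by
      exact (t.isLinear.1.getElem_inj_iff).1 h))

theorem perm_apply (t : LinTree X n) (i : Fin n) :
    t.perm i = t.tree.labels[(i : ℕ)]'(by rw [t.length_labels]; exact i.2) := rfl

theorem perm_map {m : ℕ} (t : LinTree X n) (σ : Fin n ≃ Fin m) (i : Fin m) :
    (t.map σ).perm i = σ (t.perm (i.cast (Fin.equiv_iff_eq.1 ⟨σ⟩).symm)) := by
  simp only [perm_apply, map, Tree.labels_map, List.getElem_map, Fin.val_cast]

theorem Planar.perm {t : LinTree X n} (h : t.Planar) : t.perm = Equiv.refl _ := by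
  ext i
  rw [perm_apply]
  simp only [Planar] at h
  simp [h]

theorem map_map {l m : ℕ} (t : LinTree X l) (σ : Fin l ≃ Fin m) (τ : Fin m ≃ Fin n) :
    (t.map σ).map τ = t.map (σ.trans τ) :=
  LinTree.ext (by simp [map, Tree.map, Tree.bind_bind, Tree.bind])

theorem map_refl (t : LinTree X n) : t.map (Equiv.refl _) = t := LinTree.ext (Tree.bind_leaf t.tree)

/-- The planar tree behind a labelled tree. -/
def planarize (t : LinTree X n) : LinTree X n := t.map t.perm.symm

theorem planarize_map (t : LinTree X n) : t.planarize.map t.perm = t := by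
  rw [planarize, map_map, Equiv.symm_trans_self, map_refl]

theorem planar_planarize (t : LinTree X n) : t.planarize.Planar := by
  rw [Planar, planarize, map, Tree.labels_map]
  refine List.ext_getElem (by simp [t.length_labels]) fun i h1 h2 => ?_
  rw [List.getElem_map, List.getElem_finRange]
  rw [List.length_finRange] at h2
  exact t.perm.symm_apply_apply ⟨i, h2⟩

/-- `slot` numbers the inputs of a composition block by block from left to right, which is also the
planar order of the grafted tree. -/
theorem planar_graft {m : ℕ} (i : Fin m) {s : LinTree X m} {t : LinTree X n} (hs : s.Planar)
    (ht : t.Planar) : (s.graft i t).Planar := by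
  rw [planar_iff]
  have hs' := (planar_iff s).1 hs
  have ht' := (planar_iff t).1 ht
  change (Tree.graft i s.tree t.tree).labels.Pairwise _
  rw [Tree.graft, Tree.labels_bind, List.pairwise_flatMap]
  constructor
  · intro a _
    by_cases h : a = i
    · subst h
      rw [Tree.plug_self, Tree.labels_map, List.pairwise_map]
      refine ht'.imp fun {b c} hbc => ?_
      rw [Fin.lt_def, slot_inr_val, slot_inr_val]; exact Nat.add_lt_add_left hbc _
    · rw [Tree.plug_ne _ h]; simp
  · refine hs'.imp fun {a b} hab c hc d hd => ?_
    obtain ⟨c, rfl⟩ := (slot i n).surjective c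
    obtain ⟨d, rfl⟩ := (slot i n).surjective d
    rw [Tree.mem_labels_plug i t.isLinear] at hc hd
    subst hc; subst hd
    rw [Fin.lt_def] at hab ⊢
    rcases c with ⟨c, hc⟩ | c <;> rcases d with ⟨d, hd⟩ | d <;>
      simp only [slot_inl_val, slot_inr_val, Sum.elim_inl, Sum.elim_inr] at hab ⊢
    · have : (c : ℕ) ≠ i := fun e => hc (Fin.ext e)
      have : (d : ℕ) ≠ i := fun e => hd (Fin.ext e)
      split_ifs <;> omega
    · have := d.2
      split_ifs <;> omega
    · have : (d : ℕ) ≠ i := fun e => hd (Fin.ext e)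
      have := c.2
      split_ifs <;> omega
    · omega

theorem planar_unit : (unit : LinTree X 1).Planar := rfl

theorem labels_corolla {a : ℕ} (x : X a) : (corolla x).tree.labels = List.finRange a := by
  have h : (List.ofFn fun i : Fin a => [(Sum.inr i : (Σ a, X a) ⊕ Fin a)]).flatten =
      (List.finRange a).map Sum.inr := by
    rw [List.ofFn_eq_map, ← List.flatMap_def]
    induction List.finRange a <;> simp_all
  simp only [corolla, Tree.labels, Tree.word, h, List.filterMap_cons, Sum.getRight?_inl]
  induction List.finRange a <;> simp_all

theorem planar_corolla {a : ℕ} (x : X a) : (corolla x).Planar := labels_corolla x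

end LinTree

/-! ### The basis of a free operad -/

section basis

variable {X : ℕ → Type v} {deg : ∀ a, X a → ℤ}

/-- The basis of trees of a free operad. -/
def freeBasis (k : Type u) [Field k] (X : ℕ → Type v) (deg : ∀ a, X a → ℤ) (n : ℕ) :
    Module.Basis (LinTree X n) k ((freeOperad k X deg).obj n) :=
  Module.Basis.ofRepr (LinearEquiv.refl k (LinTree X n →₀ k))

/-- The basis element of the free operad that belongs to a tree. -/
def LinTree.elem (k : Type u) [Field k] (deg : ∀ a, X a → ℤ) {n : ℕ} (t : LinTree X n) :
    (freeOperad k X deg).obj n := freeBasis k X deg n t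

theorem free_induction {n : ℕ} {P : (freeOperad k X deg).obj n → Prop}
    (x : (freeOperad k X deg).obj n) (elem : ∀ t : LinTree X n, P (t.elem k deg)) (zero : P 0)
    (add : ∀ x y, P x → P y → P (x + y)) (smul : ∀ (c : k) x, P x → P (c • x)) : P x := by
  have := (freeBasis k X deg n).mem_span x
  induction this using Submodule.span_induction with
  | mem x h => obtain ⟨t, rfl⟩ := h; exact elem t
  | zero => exact zero
  | add x y _ _ hx hy => exact add x y hx hy
  | smul c x _ hx => exact smul c x hx

theorem free_gr_induction {n : ℕ} {d : ℤ} {P : (freeOperad k X deg).obj n → Prop}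
    {x : (freeOperad k X deg).obj n} (hx : x ∈ (freeOperad k X deg).gr n d)
    (elem : ∀ t : LinTree X n, t.tree.degree deg = d → P (t.elem k deg)) (zero : P 0)
    (add : ∀ x y, P x → P y → P (x + y)) (smul : ∀ (c : k) x, P x → P (c • x)) : P x := by
  have hx' : x ∈ treeGr k X deg n d := hx
  clear hx
  induction hx' using treeGr_induction with
  | single t ht => exact elem t ht
  | zero => exact zero
  | add x y h1 h2 hx hy => exact add x y hx hy
  | smul c x h hx => exact smul c x hx

theorem elem_mem {n : ℕ} {d : ℤ} {t : LinTree X n} (h : t.tree.degree deg = d) :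
    t.elem k deg ∈ (freeOperad k X deg).gr n d := Finsupp.single_mem_supported k 1 h

theorem comp_elem {m n : ℕ} (i : Fin m) (s : LinTree X m) (t : LinTree X n) :
    (freeOperad k X deg).comp i (s.elem k deg) (t.elem k deg) =
      ksign k (t.tree.degree deg * s.tree.after deg i) • (s.graft i t).elem k deg := by
  change (Finsupp.linearCombination k fun s => Finsupp.linearCombination k fun t =>
    treeComp k X deg i s t) (Finsupp.single s 1) (Finsupp.single t 1) =
    ksign k _ • (Finsupp.single _ 1 : LinTree X (m + n - 1) →₀ k)
  simp only [Finsupp.linearCombination_single, one_smul, Finsupp.smul_single, smul_eq_mul, mul_one]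
  rfl

theorem elem_graft {m n : ℕ} (i : Fin m) (s : LinTree X m) (t : LinTree X n) :
    (s.graft i t).elem k deg = ksign k (t.tree.degree deg * s.tree.after deg i) •
      (freeOperad k X deg).comp i (s.elem k deg) (t.elem k deg) := by
  rw [comp_elem, smul_smul, ksign_mul_self, one_smul]

theorem relabel_elem {m n : ℕ} (σ : Fin m ≃ Fin n) (s : LinTree X m) :
    (freeOperad k X deg).relabel σ (s.elem k deg) = (s.map σ).elem k deg :=
  Finsupp.mapDomain_single

theorem gen_eq {a : ℕ} (x : X a) : gen k x = (LinTree.corolla x).elem k deg := rfl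

theorem one_eq : (freeOperad k X deg).one = (LinTree.unit : LinTree X 1).elem k deg := rfl

end basis

/-! ### Morphisms from a free operad -/

section hom

variable {X : ℕ → Type v} {deg : ∀ a, X a → ℤ} {Q : Operad.{u, w} k} (f : ∀ a, X a → Q.obj a)

theorem ev_arity {n : ℕ} (t : LinTree X n) : (ev f t.tree).1 = n :=
  (run_tree f t.tree).1.trans t.length_labels

/-- The value of a labelled tree in an operad. -/
def val {n : ℕ} (t : LinTree X n) : Q.obj n := Q.relabel t.perm ((ev f t.tree).cast (ev_arity f t))

theorem val_map {m n : ℕ} (σ : Fin m ≃ Fin n) (t : LinTree X m) :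
    val f (t.map σ) = Q.relabel σ (val f t) := by
  obtain rfl : m = n := Fin.equiv_iff_eq.1 ⟨σ⟩
  have h1 : (t.map σ).perm = t.perm.trans σ := by
    ext i; rw [LinTree.perm_map]; rfl
  have h2 : ev f (t.map σ).tree = ev f t.tree := ev_map f σ t.tree
  rw [val, h1, Tot.cast_congr h2, relabel_trans]; rfl

theorem val_planar {n : ℕ} {t : LinTree X n} (h : t.Planar) :
    val f t = (ev f t.tree).cast (ev_arity f t) := by
  rw [val, h.perm, relabel_refl]

variable {f} (hf : ∀ a (x : X a), f a x ∈ Q.gr a (deg a x))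

include hf in
theorem val_mem {n : ℕ} (t : LinTree X n) : val f t ∈ Q.gr n (t.tree.degree deg) := by
  refine Q.relabel_mem _ ?_
  have h := ev_mem hf t.tree
  exact Q.relabel_mem _ h

include hf in
-- For planar trees this is `ev_graft`. In general both trees are relabelled planar trees, and the
-- equivariance of grafting on one side and of the composition of `Q` on the other reduces to that
-- case; degrees and signs do not see the labels.
theorem val_graft {m n : ℕ} (i : Fin m) (s : LinTree X m) (t : LinTree X n) :
    val f (s.graft i t) = ksign k (t.tree.degree deg * s.tree.after deg i) •
      Q.comp i (val f s) (val f t) := by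
  have key : ∀ (i : Fin m) (s : LinTree X m) (t : LinTree X n), s.Planar → t.Planar →
      val f (s.graft i t) = ksign k (t.tree.degree deg * s.tree.after deg i) •
        Q.comp i (val f s) (val f t) := by
    intro i s t hs ht
    rw [val_planar f (LinTree.planar_graft i hs ht), Tot.cast_eq_iff, val_planar f hs,
      val_planar f ht]
    change ev f (Tree.graft i s.tree t.tree) = _
    rw [ev_graft hf i t.tree hs]
    have h1 := (ev f s.tree).mk_cast (ev_arity f s)
    have h2 := (ev f t.tree).mk_cast (ev_arity f t)
    generalize (ev f s.tree).cast (ev_arity f s) = x at h1 ⊢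
    generalize (ev f t.tree).cast (ev_arity f t) = y at h2 ⊢
    rw [← h1, ← h2, tcomp_of_lt i.2]
    rfl
  obtain ⟨q, rfl⟩ := s.perm.surjective i
  have h1 : (s.planarize.map s.perm).graft (s.perm q) (t.planarize.map t.perm) =
      (s.planarize.graft q t.planarize).map (blockPerm s.perm q t.perm) :=
    LinTree.ext (Tree.map_graft s.perm t.perm q s.planarize.tree t.planarize.tree)
  rw [s.planarize_map, t.planarize_map] at h1
  rw [h1, val_map, key q _ _ s.planar_planarize t.planar_planarize, map_smul,
    ← Q.comp_relabel, ← val_map, ← val_map, s.planarize_map, t.planarize_map]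
  congr 2
  have h2 : t.planarize.tree.degree deg = t.tree.degree deg := Tree.degree_map deg _ _
  have h3 : s.planarize.tree.after deg q = s.tree.after deg (s.perm q) := by
    have := Tree.after_map deg s.planarize.tree s.perm.injective q
    rw [← this]
    exact congrArg (fun t => Tree.after deg t.tree (s.perm q)) s.planarize_map
  rw [h2, h3]

theorem val_corolla {a : ℕ} (x : X a) : val f (LinTree.corolla x) = f a x := by
  rw [val_planar f (LinTree.planar_corolla x), Tot.cast_eq_iff]
  have h : ∀ (L : List (Fin a)) (s : ℕ) (z : Q.Tot),
      run f (L.map Sum.inr : List ((Σ a, X a) ⊕ Fin a)) s z = z := by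
    intro L
    induction L with
    | nil => intros; rfl
    | cons b L ih => intro s z; exact ih _ _
  have h' : (List.ofFn fun i : Fin a => [(Sum.inr i : (Σ a, X a) ⊕ Fin a)]).flatten =
      (List.finRange a).map Sum.inr := by
    rw [List.ofFn_eq_map, ← List.flatMap_def]
    induction List.finRange a <;> simp_all
  simp only [ev, LinTree.corolla, Tree.word, run, h', one_tcomp, h]

variable (deg f) in
/-- The linear map from a free operad with given values on the generators. -/
def freeEval (n : ℕ) : (freeOperad k X deg).obj n →ₗ[k] Q.obj n :=
  (freeBasis k X deg n).constr k fun t => val f t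

variable (deg f) in
theorem freeEval_elem {n : ℕ} (t : LinTree X n) : freeEval deg f n (t.elem k deg) = val f t :=
  (freeBasis k X deg n).constr_basis k _ t

/-- The morphism from a free operad with given values on the generators. -/
def freeHom : (freeOperad k X deg).Hom Q where
  app := freeEval deg f
  app_mem {n p x} hx := by
    refine free_gr_induction (P := fun x => freeEval deg f n x ∈ Q.gr n p) hx (fun t ht => ?_) ?_ (fun x y hx hy => ?_) (fun c x hx => ?_)
    · rw [freeEval_elem, ← ht]; exact val_mem hf t
    · rw [map_zero]; exact Submodule.zero_mem _
    · rw [map_add]; exact Submodule.add_mem _ hx hy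
    · rw [map_smul]; exact Submodule.smul_mem _ c hx
  app_relabel {m n} σ x := by
    refine free_induction (P := fun x => freeEval deg f n ((freeOperad k X deg).relabel σ x) =
      Q.relabel σ (freeEval deg f m x)) x (fun t => ?_) ?_ (fun x y hx hy => ?_) (fun c x hx => ?_)
    · rw [relabel_elem, freeEval_elem, freeEval_elem, val_map]
    · simp only [map_zero]
    · simp only [map_add, hx, hy]
    · simp only [map_smul, hx]
  app_one := by
    rw [one_eq, freeEval_elem, val_planar f LinTree.planar_unit, Tot.cast_eq_iff]
    rfl
  app_comp {m n} i x y := by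
    refine free_induction (P := fun x => freeEval deg f _ ((freeOperad k X deg).comp i x y) =
      Q.comp i (freeEval deg f m x) (freeEval deg f n y)) x (fun s => ?_) ?_
      (fun x y hx hy => ?_) (fun c x hx => ?_)
    · refine free_induction (P := fun y => freeEval deg f _ ((freeOperad k X deg).comp i _ y) =
        Q.comp i _ (freeEval deg f n y)) y (fun t => ?_) ?_ (fun x y hx hy => ?_) (fun c x hx => ?_)
      · rw [comp_elem, map_smul, freeEval_elem, freeEval_elem, freeEval_elem, val_graft hf,
          smul_smul, ksign_mul_self, one_smul]
      · simp only [map_zero]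
      · simp only [map_add, hx, hy]
      · simp only [map_smul, hx]
    · simp only [map_zero, LinearMap.zero_apply]
    · simp only [map_add, hx, hy, LinearMap.add_apply]
    · simp only [map_smul, hx, LinearMap.smul_apply]

theorem freeHom_gen {a : ℕ} (x : X a) : (freeHom hf).app a (gen k x) = f a x := by
  change freeEval deg f a _ = _
  rw [gen_eq, freeEval_elem, val_corolla]

end hom

/-! ### Generation -/

section generation

variable {X : ℕ → Type v} {deg : ∀ a, X a → ℤ} {α : Type}
  {p : ∀ n, Submodule k ((freeOperad k X deg).obj n)}

/-- The vertices of a tree satisfy the predicate `V`. -/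
def Tree.All (V : ∀ a, X a → Prop) : Tree X α → Prop
  | .leaf _ => True
  | .node x c => V _ x ∧ ∀ i, (c i).All V

/-- A tree can be obtained from a planar tree in `p` by relabelling its leaves. -/
def IsPlanarIn (p : ∀ n, Submodule k ((freeOperad k X deg).obj n)) (t : Tree X α) : Prop :=
  ∃ (l : ℕ) (s : LinTree X l) (g : Fin l → α), s.Planar ∧ s.elem k deg ∈ p l ∧ s.tree.map g = t

variable (k deg) in
/-- The family `p` of subspaces contains the unit and is closed under compositions. -/
structure CompClosed (p : ∀ n, Submodule k ((freeOperad k X deg).obj n)) : Prop where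
  one : (freeOperad k X deg).one ∈ p 1
  comp : ∀ {m n} (i : Fin m) {x y}, x ∈ p m → y ∈ p n → (freeOperad k X deg).comp i x y ∈ p _

variable (hp : CompClosed k deg p)
include hp

/-- A simultaneous substitution is carried out one tree at a time. Grafting a nontrivial `f i` into
`s` leaves single leaves to be substituted in its block, so the total number of vertices still to be
substituted drops. -/
theorem isPlanarIn_bind {m : ℕ} {s : LinTree X m} (hs : s.Planar) (hps : s.elem k deg ∈ p m)
    {f : Fin m → Tree X α} (hf : ∀ a, IsPlanarIn p (f a)) : IsPlanarIn p (s.tree.bind f) := by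
  obtain ⟨N, hN⟩ : ∃ N, N = ∑ a, (f a).size := ⟨_, rfl⟩
  induction N using Nat.strong_induction_on generalizing m s f with
  | _ N ih =>
  by_cases h : ∀ a, (f a).size = 0
  · have : ∀ a, ∃ b, f a = .leaf b := by
      intro a
      have := h a
      rcases hfa : f a with b | ⟨x, c⟩
      · exact ⟨b, rfl⟩
      · rw [hfa] at this
        simp [Tree.size] at this
    choose g hg using this
    refine ⟨m, s, g, hs, hps, ?_⟩
    rw [Tree.map]; congr 1; funext a; rw [hg]
  · push Not at h
    obtain ⟨i, hi⟩ := h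
    obtain ⟨l, s', g, hs', hp', e⟩ := hf i
    -- What is left to substitute after the grafting at `i`: the other trees `f a`, and the labels
    -- `g b` in place of the leaves of the grafted planar tree.
    let F : {a : Fin m // a ≠ i} ⊕ Fin l → Tree X α := Sum.elim (fun a => f a.1) fun b => .leaf (g b)
    have hsum : ∑ c, (F ((slot i l).symm c)).size < N := by
      rw [Equiv.sum_comp (slot i l).symm fun c => (F c).size, Fintype.sum_sum_type, hN,
        Fintype.sum_eq_add_sum_subtype_ne _ i]
      simp only [F, Sum.elim_inl, Sum.elim_inr, Tree.size, Finset.sum_const_zero, add_zero]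
      omega
    have := ih _ hsum (s := s.graft i s') (f := fun c => F ((slot i l).symm c))
      (LinTree.planar_graft i hs hs')
      (by rw [elem_graft]; exact Submodule.smul_mem _ _ (hp.comp i hps hp')) (by
        intro c
        obtain ⟨c, rfl⟩ := (slot i l).surjective c
        rw [Equiv.symm_apply_apply]
        rcases c with a | b
        · exact hf a.1
        · exact ⟨1, LinTree.unit, fun _ => g b, LinTree.planar_unit, hp.one, rfl⟩) rfl
    convert this using 1
    simp only [LinTree.graft, Tree.graft, Tree.bind_bind]
    congr 1; funext a
    by_cases ha : a = i
    · subst ha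
      rw [Tree.plug_self, Tree.map, Tree.bind_bind, ← e, Tree.map]
      congr 1; funext b
      simp [Tree.bind, F]
    · rw [Tree.plug_ne _ ha]
      simp [Tree.bind, F]

theorem isPlanarIn (t : Tree X α) (ht : t.All fun a x => gen k x ∈ p a) : IsPlanarIn p t := by
  induction t with
  | leaf b => exact ⟨1, LinTree.unit, fun _ => b, LinTree.planar_unit, hp.one, rfl⟩
  | @node a x c ih =>
    exact isPlanarIn_bind hp (s := LinTree.corolla x) (LinTree.planar_corolla x) ht.1
      fun i => ih i (ht.2 i)

/-- Planar trees are obtained from the generators by compositions alone. As closure under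
relabelling is not assumed, this applies to families such as `pSpan`, unlike `tree_mem`. -/
theorem planar_mem {n : ℕ} {t : LinTree X n} (h : t.Planar)
    (ht : t.tree.All fun a x => gen k x ∈ p a) : t.elem k deg ∈ p n := by
  obtain ⟨l, s, g, hs, hps, e⟩ := isPlanarIn hp t.tree ht
  have h1 := congrArg Tree.labels e
  rw [Tree.labels_map, hs, h] at h1
  obtain rfl : l = n := by simpa using congrArg List.length h1
  have h2 : g = id := by
    funext i
    have := congrArg (fun L => L[(i : ℕ)]?) h1
    simpa using this
  rw [h2, Tree.map] at e
  obtain rfl : s = t := LinTree.ext ((Tree.bind_leaf s.tree).symm.trans e)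
  exact hps

theorem tree_mem (hrel : ∀ {n} (σ : Fin n ≃ Fin n) {x},
    x ∈ p n → (freeOperad k X deg).relabel σ x ∈ p n) {n : ℕ} (t : LinTree X n)
    (ht : t.tree.All fun a x => gen k x ∈ p a) : t.elem k deg ∈ p n := by
  obtain ⟨l, s, g, hs, hps, e⟩ := isPlanarIn hp t.tree ht
  have h1 := congrArg Tree.labels e
  rw [Tree.labels_map, hs] at h1
  obtain rfl : l = n := by
    have := congrArg List.length h1
    rwa [t.length_labels, List.length_map, List.length_finRange] at this
  have h2 : Function.Injective g := by
    have := t.isLinear.1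
    rw [← h1] at this
    exact (List.nodup_map_iff_inj_on (List.nodup_finRange _)).1 this |> fun h a b hab =>
      h a (List.mem_finRange a) b (List.mem_finRange b) hab
  have h3 := hrel (Equiv.ofBijective g (Finite.injective_iff_bijective.1 h2)) hps
  rw [relabel_elem] at h3
  convert h3
  exact LinTree.ext e.symm

/-- The induction principle of a free operad, on which the uniqueness of morphisms and of
derivations rests. -/
theorem eq_top_of_gen (hrel : ∀ {n} (σ : Fin n ≃ Fin n) {x},
    x ∈ p n → (freeOperad k X deg).relabel σ x ∈ p n)
    (hgen : ∀ a (x : X a), gen k x ∈ p a) {n : ℕ} (x : (freeOperad k X deg).obj n) : x ∈ p n := by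
  refine free_induction x (fun t => tree_mem hp hrel t ?_) (Submodule.zero_mem _)
    (fun _ _ => Submodule.add_mem _) (fun c _ => Submodule.smul_mem _ c)
  generalize t.tree = t
  induction t with
  | leaf => trivial
  | node x c ih => exact ⟨hgen _ _, ih⟩

end generation

/-- Two morphisms from a free operad agree if they agree on the generators. -/
theorem freeHom_ext {X : ℕ → Type v} {deg : ∀ a, X a → ℤ} {Q : Operad.{u, w} k}
    {f g : (freeOperad k X deg).Hom Q}
    (h : ∀ a (x : X a), f.app a (gen k x) = g.app a (gen k x)) (n : ℕ)
    (x : (freeOperad k X deg).obj n) : f.app n x = g.app n x := by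
  have := eq_top_of_gen (p := fun n => LinearMap.eqLocus (f.app n) (g.app n))
    ⟨by rw [LinearMap.mem_eqLocus, f.app_one, g.app_one], fun i x y hx hy => by
      rw [LinearMap.mem_eqLocus] at *
      rw [f.app_comp, g.app_comp, hx, hy]⟩
    (fun σ x hx => by
      rw [LinearMap.mem_eqLocus] at *
      rw [f.app_relabel, g.app_relabel, hx]) h x
  exact this

theorem Operad.Hom.ext' {P : Operad.{u, v} k} {Q : Operad.{u, w} k} {f g : P.Hom Q}
    (h : ∀ n x, f.app n x = g.app n x) : f = g := by
  obtain ⟨a, _, _, _, _⟩ := f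
  obtain ⟨b, _, _, _, _⟩ := g
  obtain rfl : a = b := funext fun n => LinearMap.ext (h n)
  rfl

end

end AntiAss

namespace AntiAss

universe w

noncomputable section

variable {k : Type u} [Field k]

open Operad

/-! ### Dual numbers and derivations -/

namespace Operad

variable (Q : Operad.{u, w} k)

/-- The operator that multiplies elements of degree `d` by `(-1)^(p d)`. -/
def sgn (p : ℤ) (n : ℕ) : Q.obj n →ₗ[k] Q.obj n :=
  (DirectSum.toModule k ℤ _ fun d => ksign k (p * d) • (Q.gr n d).subtype) ∘ₗ
    (LinearEquiv.ofBijective (DirectSum.coeLinearMap (Q.gr n)) (Q.gr_isInternal n)).symm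

variable {Q}

theorem sgn_of_mem (p : ℤ) {n : ℕ} {d : ℤ} {x : Q.obj n} (hx : x ∈ Q.gr n d) :
    Q.sgn p n x = ksign k (p * d) • x := by
  have h : (LinearEquiv.ofBijective (DirectSum.coeLinearMap (Q.gr n)) (Q.gr_isInternal n)).symm x =
      DirectSum.lof k ℤ (fun d => Q.gr n d) d ⟨x, hx⟩ := by
    rw [LinearEquiv.symm_apply_eq]
    exact (DirectSum.coeLinearMap_lof (Q.gr n) d ⟨x, hx⟩).symm
  rw [sgn, LinearMap.comp_apply, LinearEquiv.coe_coe, h, DirectSum.toModule_lof]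
  rfl

theorem gr_induction {n : ℕ} {P : Q.obj n → Prop} (x : Q.obj n)
    (mem : ∀ d x, x ∈ Q.gr n d → P x) (add : ∀ x y, P x → P y → P (x + y)) : P x := by
  have h : x ∈ ⨆ d, Q.gr n d := by
    rw [(Q.gr_isInternal n).submodule_iSup_eq_top]; trivial
  induction h using Submodule.iSup_induction' with
  | mem d x hx => exact mem d x hx
  | zero => exact mem 0 0 (Submodule.zero_mem _)
  | add x y _ _ hx hy => exact add x y hx hy

theorem sgn_relabel (p : ℤ) {m n : ℕ} (σ : Fin m ≃ Fin n) (x : Q.obj m) :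
    Q.sgn p n (Q.relabel σ x) = Q.relabel σ (Q.sgn p m x) := by
  induction x using gr_induction with
  | mem d x hx => rw [sgn_of_mem p hx, sgn_of_mem p (Q.relabel_mem σ hx), map_smul]
  | add x y hx hy => simp only [map_add, hx, hy]

theorem sgn_comp (p : ℤ) {m n : ℕ} (i : Fin m) (x : Q.obj m) (y : Q.obj n) :
    Q.sgn p _ (Q.comp i x y) = Q.comp i (Q.sgn p m x) (Q.sgn p n y) := by
  induction x using gr_induction with
  | mem d x hx =>
    induction y using gr_induction with
    | mem e y hy =>
      rw [sgn_of_mem p hx, sgn_of_mem p hy, sgn_of_mem p (Q.comp_mem i hx hy), mul_add, ksign_add]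
      simp only [map_smul, LinearMap.smul_apply, smul_smul]
      rw [mul_comm]
    | add x y hx hy => simp only [map_add, hx, hy]
  | add x y hx hy => simp only [map_add, LinearMap.add_apply, hx, hy]

theorem sgn_one (p : ℤ) : Q.sgn p 1 Q.one = Q.one := by
  rw [sgn_of_mem p Q.one_mem, mul_zero, ksign_zero, one_smul]

theorem isInternal_prod {M N : Type*} [AddCommGroup M] [Module k M] [AddCommGroup N] [Module k N]
    {A : ℤ → Submodule k M} {B : ℤ → Submodule k N} (hA : DirectSum.IsInternal A)
    (hB : DirectSum.IsInternal B) : DirectSum.IsInternal fun d => (A d).prod (B d) := by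
  rw [DirectSum.isInternal_submodule_iff_iSupIndep_and_iSup_eq_top] at *
  constructor
  · intro i
    have h : (⨆ j, ⨆ (_ : j ≠ i), (A j).prod (B j)) ≤
        (⨆ j, ⨆ (_ : j ≠ i), A j).prod (⨆ j, ⨆ (_ : j ≠ i), B j) :=
      iSup₂_le fun j hj => Submodule.prod_mono (le_iSup₂_of_le j hj le_rfl)
        (le_iSup₂_of_le j hj le_rfl)
    refine Disjoint.mono_right h ?_
    rw [disjoint_iff, Submodule.prod_inf_prod, disjoint_iff.1 (hA.1 i), disjoint_iff.1 (hB.1 i),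
      Submodule.prod_bot]
  · rw [eq_top_iff]
    rintro ⟨x, y⟩ -
    have h1 : (x, (0 : N)) ∈ ⨆ d, (A d).prod (B d) := by
      have h : x ∈ ⨆ d, A d := by rw [hA.2]; trivial
      induction h using Submodule.iSup_induction' with
      | mem d x hx => exact Submodule.mem_iSup_of_mem d ⟨hx, Submodule.zero_mem _⟩
      | zero => exact Submodule.zero_mem _
      | add x y _ _ hx hy => simpa using Submodule.add_mem _ hx hy
    have h2 : ((0 : M), y) ∈ ⨆ d, (A d).prod (B d) := by
      have h : y ∈ ⨆ d, B d := by rw [hB.2]; trivial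
      induction h using Submodule.iSup_induction' with
      | mem d x hx => exact Submodule.mem_iSup_of_mem d ⟨Submodule.zero_mem _, hx⟩
      | zero => exact Submodule.zero_mem _
      | add x y _ _ hx hy => simpa using Submodule.add_mem _ hx hy
    simpa using Submodule.add_mem _ h1 h2

theorem isInternal_shift {M : Type*} [AddCommGroup M] [Module k M]
    {A : ℤ → Submodule k M} (hA : DirectSum.IsInternal A) (p : ℤ) :
    DirectSum.IsInternal fun d => A (d - p) := by
  rw [DirectSum.isInternal_submodule_iff_iSupIndep_and_iSup_eq_top] at *
  refine ⟨hA.1.comp (Equiv.subRight p).injective, ?_⟩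
  rw [← hA.2]
  exact (Equiv.subRight p).iSup_comp (g := A)

variable (Q) in
/-- The operad `Q[ε]` with `ε² = 0` and `ε` of degree `p`; the second component of an element is the
coefficient of `ε`. -/
def dual (p : ℤ) : Operad.{u, w} k where
  obj n := Q.obj n × Q.obj n
  gr n d := (Q.gr n d).prod (Q.gr n (d - p))
  gr_isInternal n := isInternal_prod (Q.gr_isInternal n) (isInternal_shift (Q.gr_isInternal n) p)
  relabel σ := (Q.relabel σ).prodMap (Q.relabel σ)
  relabel_refl x := by simp [Q.relabel_refl]
  relabel_trans σ τ x := by simp [Q.relabel_trans]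
  relabel_mem σ _ _ hx := ⟨Q.relabel_mem σ hx.1, Q.relabel_mem σ hx.2⟩
  one := (Q.one, 0)
  one_mem := ⟨Q.one_mem, Submodule.zero_mem _⟩
  -- The coefficient of `ε` in `(x + ε x') ∘ (y + ε y')`. The operator `sgn` supplies the sign for
  -- moving `ε`, of degree `p`, past `x`.
  comp i := LinearMap.mk₂ k
    (fun x y => (Q.comp i x.1 y.1, Q.comp i x.2 y.1 + Q.comp i (Q.sgn p _ x.1) y.2))
    (fun x x' y => by ext <;> simp; abel) (fun c x y => by ext <;> simp)
    (fun x y y' => by ext <;> simp; abel) (fun c x y => by ext <;> simp)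
  comp_mem i a b x y hx hy := by
    refine ⟨Q.comp_mem i hx.1 hy.1, Submodule.add_mem _ ?_ ?_⟩
    · convert Q.comp_mem i hx.2 hy.1 using 1
      congr 1; ring
    · rw [sgn_of_mem p hx.1, map_smul, LinearMap.smul_apply]
      refine Submodule.smul_mem _ _ ?_
      convert Q.comp_mem i hx.1 hy.2 using 1
      congr 1; ring
  comp_relabel σ τ i x y := by
    simp [Q.comp_relabel, sgn_relabel]
  one_comp x := by
    ext
    · exact Q.one_comp x.1
    · simp [sgn_one, Q.one_comp]
  comp_one i x := by
    ext
    · exact Q.comp_one i x.1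
    · change Q.relabel _ (Q.comp i x.2 Q.one + Q.comp i (Q.sgn p _ x.1) 0) = x.2
      rw [map_zero, add_zero, Q.comp_one]
  comp_nested i j x y z := by
    ext
    · exact Q.comp_nested i j x.1 y.1 z.1
    · simp [Q.comp_nested, sgn_comp, add_assoc]
  comp_parallel i j hij x a b y z hy hz := by
    ext
    · exact Q.comp_parallel i j hij x.1 hy.1 hz.1
    · simp only [LinearMap.mk₂_apply, LinearMap.prodMap_apply, Prod.smul_snd, sgn_comp, map_add,
        LinearMap.add_apply, sgn_of_mem p hy.1, sgn_of_mem p hz.1, map_smul, LinearMap.smul_apply,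
        smul_add, smul_smul]
      -- There is one summand for `ε` at each of `x`, `y`, `z`. The components carrying `ε` have
      -- their degree lowered by `p`; the resulting exponents match modulo two.
      rw [Q.comp_parallel i j hij _ hy.1 hz.1, Q.comp_parallel i j hij _ hy.2 hz.1,
        Q.comp_parallel i j hij _ hy.1 hz.2, smul_smul, ← ksign_add, ← ksign_add,
        ksign_eq k (m := (a - p) * b) (n := a * b + p * b) (by ring_nf; simp),
        ksign_eq k (m := p * a + a * (b - p)) (n := a * b) (by ring_nf; simp)]
      abel

/-- The projection `Q[ε] → Q`. -/
def dualFst (p : ℤ) : (Q.dual p).Hom Q where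
  app _ := LinearMap.fst k _ _
  app_mem hx := hx.1
  app_relabel _ _ := rfl
  app_one := rfl
  app_comp _ _ _ := rfl

end Operad

section derivations

variable {P : Operad.{u, v} k} {Q : Operad.{u, w} k} {β : P.Hom Q} {p : ℤ}

theorem derivation_comp (θ : derivations β p) {m n : ℕ} (i : Fin m) (x : P.obj m) (y : P.obj n) :
    θ.1 _ (P.comp i x y) =
      Q.comp i (θ.1 m x) (β.app n y) + Q.comp i (β.app m (P.sgn p m x)) (θ.1 n y) := by
  induction x using gr_induction with
  | mem d x hx =>
    rw [θ.2.2.2 m n i d x y hx, sgn_of_mem p hx]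
    simp only [map_smul, LinearMap.smul_apply]
  | add x y hx hy =>
    simp only [map_add, LinearMap.add_apply, hx, hy]
    abel

/-- The Leibniz rule for `1 ∘ 1 = 1` gives `θ(1) = θ(1) + θ(1)`. -/
theorem derivation_one (θ : derivations β p) : θ.1 1 P.one = 0 := by
  have h := θ.2.2.1 _ _ (finCongr (by omega : 1 + 1 - 1 = 1)) (P.comp 0 P.one P.one)
  rw [P.one_comp, θ.2.2.2 1 1 0 0 _ _ P.one_mem, β.app_one, map_add, map_smul, Q.comp_one,
    Q.one_comp, mul_zero, ksign_zero, one_smul] at h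
  simpa using h

end derivations

theorem degree_corolla {X : ℕ → Type v} (deg : ∀ a, X a → ℤ) {a : ℕ} (x : X a) :
    (LinTree.corolla x).tree.degree deg = deg a x := by
  have h : (List.ofFn fun i : Fin a => [(Sum.inr i : (Σ a, X a) ⊕ Fin a)]).flatten =
      (List.finRange a).map Sum.inr := by
    rw [List.ofFn_eq_map, ← List.flatMap_def]
    induction List.finRange a <;> simp_all
  simp only [LinTree.corolla, Tree.degree, Tree.word, h, Tree.wordDeg]
  suffices ∀ L : List (Fin a),
      Tree.wordDeg deg (L.map Sum.inr : List ((Σ a, X a) ⊕ Fin a)) = 0 by rw [this, add_zero]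
  intro L
  induction L with
  | nil => rfl
  | cons b L ih => exact ih

theorem gen_mem {X : ℕ → Type v} {deg : ∀ a, X a → ℤ} {a : ℕ} (x : X a) :
    gen k x ∈ (freeOperad k X deg).gr a (deg a x) := elem_mem (degree_corolla deg x)

section freeDerivations

variable {X : ℕ → Type v} {deg : ∀ a, X a → ℤ} {Q : Operad.{u, w} k}
  {β : (freeOperad k X deg).Hom Q} {p : ℤ}

/-- Derivations of a free operad that agree on the generators are equal. -/
theorem derivation_ext {θ θ' : derivations β p}
    (h : ∀ a (x : X a), θ.1 a (gen k x) = θ'.1 a (gen k x)) : θ = θ' := by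
  refine Subtype.ext (funext fun n => LinearMap.ext fun x => ?_)
  exact eq_top_of_gen (p := fun n => LinearMap.eqLocus (θ.1 n) (θ'.1 n))
    ⟨by rw [LinearMap.mem_eqLocus, derivation_one, derivation_one], fun i x y hx hy => by
      rw [LinearMap.mem_eqLocus] at *
      rw [derivation_comp, derivation_comp, hx, hy]⟩
    (fun σ x hx => by
      rw [LinearMap.mem_eqLocus] at *
      rw [θ.2.2.1, θ'.2.2.1, hx]) h x

variable (β p) in
/-- There is a derivation with given values on the generators. -/
theorem exists_derivation (g : ∀ a, X a → Q.obj a)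
    (hg : ∀ a (x : X a), g a x ∈ Q.gr a (deg a x - p)) :
    ∃ θ : derivations β p, ∀ a (x : X a), θ.1 a (gen k x) = g a x := by
  -- A derivation `θ` over `β` is the same as a morphism `β + ε θ` to the dual numbers that lifts
  -- `β`, and a morphism may be prescribed on the generators. Its first component agrees with `β`
  -- because it does so on generators.
  obtain ⟨H, hH⟩ : ∃ H : (freeOperad k X deg).Hom (Q.dual p), ∀ a (x : X a),
      H.app a (gen k x) = (β.app a (gen k x), g a x) :=
    ⟨freeHom (Q := Q.dual p) (f := fun a x => (β.app a (gen k x), g a x))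
      fun a x => ⟨β.app_mem (gen_mem x), hg a x⟩, fun a x => freeHom_gen _ x⟩
  have h1 : ∀ n x, (H.app n x).1 = β.app n x := by
    intro n x
    refine freeHom_ext (f := H.trans (dualFst p)) (g := β) (fun a x => ?_) n x
    exact congrArg Prod.fst (hH a x)
  refine ⟨⟨fun n => LinearMap.snd k _ _ ∘ₗ H.app n, ?_, ?_, ?_⟩, fun a x =>
    congrArg Prod.snd (hH a x)⟩
  · intro n d x hx
    exact (H.app_mem hx).2
  · intro m n σ x
    exact congrArg Prod.snd (H.app_relabel σ x)
  · intro m n i d x y hx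
    refine (congrArg Prod.snd (H.app_comp i x y)).trans ?_
    change Q.comp i (H.app m x).2 (H.app n y).1 +
      Q.comp i (Q.sgn p m (H.app m x).1) (H.app n y).2 = _
    rw [h1, h1, sgn_of_mem p (β.app_mem hx), map_smul, LinearMap.smul_apply]
    rfl

end freeDerivations

end

end AntiAss

namespace AntiAss

universe w

noncomputable section

variable {k : Type u} [Field k]

open Operad

/-! ### Trees without labels -/

namespace Tree

variable {X : ℕ → Type v} {α β : Type}

/-- The tree without its labels. -/
def shape (t : Tree X α) : Tree X Unit := t.map fun _ => ()

theorem shape_map (f : α → β) (t : Tree X α) : (t.map f).shape = t.shape := by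
  simp [shape, map, bind_bind, bind]

theorem labels_node {a : ℕ} (x : X a) (c : Fin a → Tree X α) :
    (node x c).labels = (List.ofFn fun i => (c i).labels).flatten := by
  rw [labels, word_node, List.filterMap_cons, Sum.getRight?_inl, List.filterMap_flatten,
    List.map_map, List.map_ofFn]
  rfl

theorem len_eq (t : Tree X α) : t.len = t.labels.length := rfl

theorem len_node {a : ℕ} (x : X a) (c : Fin a → Tree X α) :
    (node x c).len = ∑ i, (c i).len := by
  rw [len_eq, labels_node, List.length_flatten, List.map_ofFn, List.sum_ofFn]
  rfl

@[simp] theorem len_leaf (b : α) : (leaf b : Tree X α).len = 1 := rfl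

theorem wordDeg_flatten (deg : ∀ a, X a → ℤ) (L : List (List ((Σ a, X a) ⊕ α))) :
    wordDeg deg L.flatten = (L.map (wordDeg deg)).sum := by
  induction L with
  | nil => rfl
  | cons y L ih => simp [wordDeg_append, ih]

theorem degree_node (deg : ∀ a, X a → ℤ) {a : ℕ} (x : X a) (c : Fin a → Tree X α) :
    (node x c).degree deg = deg a x + ∑ i, (c i).degree deg := by
  rw [degree, word_node, wordDeg, wordDeg_flatten, List.map_map, List.map_ofFn, List.sum_ofFn]
  rfl

@[simp] theorem degree_leaf (deg : ∀ a, X a → ℤ) (b : α) :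
    (leaf b : Tree X α).degree deg = 0 := rfl

theorem len_map (f : α → β) (t : Tree X α) : (t.map f).len = t.len := by
  rw [len_eq, labels_map, List.length_map]; rfl

theorem all_bind {V : ∀ a, X a → Prop} {t : Tree X α} {f : α → Tree X β} (ht : t.All V)
    (hf : ∀ a, (f a).All V) : (t.bind f).All V := by
  induction t with
  | leaf a => exact hf a
  | node x c ih => exact ⟨ht.1, fun i => ih i (ht.2 i)⟩

theorem all_map {V : ∀ a, X a → Prop} {t : Tree X α} {f : α → β} : (t.map f).All V ↔ t.All V := by
  induction t with
  | leaf a => exact Iff.rfl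
  | node x c ih => exact and_congr Iff.rfl (forall_congr' ih)

theorem All.imp {V W : ∀ a, X a → Prop} (h : ∀ a x, V a x → W a x) {t : Tree X α}
    (ht : t.All V) : t.All W := by
  induction t with
  | leaf a => trivial
  | node x c ih => exact ⟨h _ _ ht.1, fun i => ih i (ht.2 i)⟩

theorem all_graft {V : ∀ a, X a → Prop} {m n : ℕ} (i : Fin m) {s : Tree X (Fin m)}
    {t : Tree X (Fin n)} (hs : s.All V) (ht : t.All V) : (graft i s t).All V := by
  refine all_bind hs fun a => ?_
  by_cases h : a = i
  · subst h; rw [plug_self]; exact all_map.2 ht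
  · rw [plug_ne _ h]; trivial

/-- Equal shapes force corresponding branches to have equally many leaves, so the common list of
labels is cut at the same places. -/
theorem eq_of_shape_labels {t t' : Tree X α} (h : t.shape = t'.shape)
    (h' : t.labels = t'.labels) : t = t' := by
  induction t generalizing t' with
  | leaf a =>
    rcases t' with b | ⟨y, d⟩
    · simpa using h'
    · simp [shape, map, bind] at h
  | @node a x c ih =>
    rcases t' with b | ⟨y, d⟩
    · simp [shape, map, bind] at h
    · simp only [shape, map, bind, node.injEq] at h
      obtain ⟨rfl, h1, h2⟩ := h
      obtain rfl := eq_of_heq h1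
      have h2 := eq_of_heq h2
      congr 1
      funext i
      refine ih i (congrFun h2 i) ?_
      rw [labels_node, labels_node] at h'
      have h3 := List.eq_iff_flatten_eq.2 ⟨h', by
        rw [List.map_ofFn, List.map_ofFn]
        congr 1
        funext j
        have := congrArg len (congrFun h2 j)
        change ((c j).map fun _ => ()).len = ((d j).map fun _ => ()).len at this
        rw [len_map, len_map] at this
        exact this⟩
      exact congrFun (List.ofFn_injective h3) i

end Tree

/-- The linear combinations of some of the basis elements of a free operad. -/
def spanOf (k : Type u) [Field k] {X : ℕ → Type v} (deg : ∀ a, X a → ℤ) {n : ℕ}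
    (S : Set (LinTree X n)) : Submodule k ((freeOperad k X deg).obj n) :=
  Submodule.span k (LinTree.elem k deg '' S)

section

variable {X : ℕ → Type v} {deg : ∀ a, X a → ℤ}

theorem elem_mem_spanOf {n : ℕ} {S : Set (LinTree X n)} {t : LinTree X n} (h : t ∈ S) :
    t.elem k deg ∈ spanOf k deg S := Submodule.subset_span ⟨t, h, rfl⟩

theorem spanOf_induction {n : ℕ} {S : Set (LinTree X n)}
    {P : (freeOperad k X deg).obj n → Prop} {x : (freeOperad k X deg).obj n}
    (hx : x ∈ spanOf k deg S) (elem : ∀ t ∈ S, P (t.elem k deg)) (zero : P 0)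
    (add : ∀ x y, P x → P y → P (x + y)) (smul : ∀ (c : k) x, P x → P (c • x)) : P x := by
  induction hx using Submodule.span_induction with
  | mem x h => obtain ⟨t, ht, rfl⟩ := h; exact elem t ht
  | zero => exact zero
  | add x y _ _ hx hy => exact add x y hx hy
  | smul c x _ hx => exact smul c x hx

theorem spanOf_mono {n : ℕ} {S T : Set (LinTree X n)} (h : S ⊆ T) :
    spanOf k deg S ≤ spanOf k deg T := Submodule.span_mono (Set.image_mono h)

theorem compClosed_spanOf {S : ∀ n, Set (LinTree X n)} (one : LinTree.unit ∈ S 1)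
    (graft : ∀ {m n} (i : Fin m) {s : LinTree X m} {t : LinTree X n}, s ∈ S m → t ∈ S n →
      s.graft i t ∈ S _) : CompClosed k deg fun n => spanOf k deg (S n) := by
  refine ⟨elem_mem_spanOf one, fun {m n} i x y hx hy => ?_⟩
  refine spanOf_induction (P := fun x => (freeOperad k X deg).comp i x y ∈ spanOf k deg (S _)) hx
    (fun s hs => ?_) ?_ (fun x y hx hy => ?_) (fun c x hx => ?_)
  · refine spanOf_induction (P := fun y => (freeOperad k X deg).comp i _ y ∈ spanOf k deg (S _)) hy
      (fun t ht => ?_) ?_ (fun x y hx hy => ?_) (fun c x hx => ?_)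
    · rw [comp_elem]; exact Submodule.smul_mem _ _ (elem_mem_spanOf (graft i hs ht))
    · rw [map_zero]; exact Submodule.zero_mem _
    · rw [map_add]; exact Submodule.add_mem _ hx hy
    · rw [map_smul]; exact Submodule.smul_mem _ _ hx
  · rw [map_zero]; exact Submodule.zero_mem _
  · rw [map_add]; exact Submodule.add_mem _ hx hy
  · rw [map_smul]; exact Submodule.smul_mem _ _ hx

/-- The combinations of trees with vertices in `V`. -/
def vSpan (k : Type u) [Field k] (deg : ∀ a, X a → ℤ) (V : ∀ a, X a → Prop) (n : ℕ) :
    Submodule k ((freeOperad k X deg).obj n) := spanOf k deg {t : LinTree X n | t.tree.All V}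

/-- The combinations of planar trees with vertices in `V`. -/
def pSpan (k : Type u) [Field k] (deg : ∀ a, X a → ℤ) (V : ∀ a, X a → Prop) (n : ℕ) :
    Submodule k ((freeOperad k X deg).obj n) :=
  spanOf k deg {t : LinTree X n | t.Planar ∧ t.tree.All V}

theorem compClosed_vSpan (V : ∀ a, X a → Prop) : CompClosed k deg (vSpan k deg V) :=
  compClosed_spanOf (S := fun _ => {t | t.tree.All V}) trivial
    fun i _ _ hs ht => Tree.all_graft i hs ht

theorem compClosed_pSpan (V : ∀ a, X a → Prop) : CompClosed k deg (pSpan k deg V) :=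
  compClosed_spanOf (S := fun _ => {t | t.Planar ∧ t.tree.All V}) ⟨LinTree.planar_unit, trivial⟩
    fun i _ _ hs ht => ⟨LinTree.planar_graft i hs.1 ht.1, Tree.all_graft i hs.2 ht.2⟩

theorem relabel_vSpan (V : ∀ a, X a → Prop) {m n : ℕ} (σ : Fin m ≃ Fin n)
    {x : (freeOperad k X deg).obj m} (hx : x ∈ vSpan k deg V m) :
    (freeOperad k X deg).relabel σ x ∈ vSpan k deg V n := by
  refine spanOf_induction (P := fun x => (freeOperad k X deg).relabel σ x ∈ vSpan k deg V n) hx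
    (fun s hs => ?_) ?_ (fun x y hx hy => ?_) (fun c x hx => ?_)
  · rw [relabel_elem]; exact elem_mem_spanOf (Tree.all_map.2 hs)
  · rw [map_zero]; exact Submodule.zero_mem _
  · rw [map_add]; exact Submodule.add_mem _ hx hy
  · rw [map_smul]; exact Submodule.smul_mem _ _ hx

theorem all_corolla {V : ∀ a, X a → Prop} {a : ℕ} {x : X a} (h : V a x) :
    (LinTree.corolla x).tree.All V := ⟨h, fun _ => trivial⟩

/-! ### Planar labellings -/

theorem exists_planar_labelling (t : Tree X Unit) :
    ∃ s : LinTree X t.len, s.Planar ∧ s.tree.shape = t := by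
  -- Only the combinatorial part of `isPlanarIn` is of interest; the field, the degrees and the
  -- family of subspaces are placeholders.
  obtain ⟨l, s, g, hs, -, e⟩ := isPlanarIn (k := ℚ) (deg := fun _ _ => 0) (p := fun _ => ⊤)
    ⟨trivial, fun _ _ _ _ _ => trivial⟩ t (by
      induction t with
      | leaf => trivial
      | node x c ih => exact ⟨trivial, ih⟩)
  have h1 : s.tree.shape = t := by rw [← e]; rfl
  have h2 : l = t.len := by
    rw [← h1, Tree.shape, Tree.len_map, Tree.len_eq, s.length_labels]
  subst h2
  exact ⟨s, hs, h1⟩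

/-- The planar labelling of the leaves. -/
def Tree.lab (t : Tree X Unit) : LinTree X t.len := (exists_planar_labelling t).choose

theorem Tree.planar_lab (t : Tree X Unit) : t.lab.Planar := (exists_planar_labelling t).choose_spec.1

@[simp] theorem Tree.shape_lab (t : Tree X Unit) : t.lab.tree.shape = t :=
  (exists_planar_labelling t).choose_spec.2

theorem LinTree.len_shape {n : ℕ} (s : LinTree X n) : s.tree.shape.len = n := by
  rw [Tree.shape, Tree.len_map, Tree.len_eq, s.length_labels]

theorem LinTree.Planar.unique {n : ℕ} {s s' : LinTree X n} (hs : s.Planar) (hs' : s'.Planar)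
    (h : s.tree.shape = s'.tree.shape) : s = s' :=
  LinTree.ext (Tree.eq_of_shape_labels h (hs.trans hs'.symm))

theorem relabel_lab {n : ℕ} {s : LinTree X n} (hs : s.Planar) :
    (freeOperad k X deg).relabel (finCongr s.len_shape) (s.tree.shape.lab.elem k deg) =
      s.elem k deg := by
  have key : ∀ (t : Tree X Unit) (h : t.len = n), s.tree.shape = t →
      (freeOperad k X deg).relabel (finCongr h) (t.lab.elem k deg) = s.elem k deg := by
    rintro t rfl h
    rw [show finCongr (rfl : t.len = t.len) = Equiv.refl _ from rfl, relabel_refl,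
      hs.unique t.planar_lab (h.trans t.shape_lab.symm)]
  exact key _ _ rfl

/-- Forgetting the labels. -/
def forget (k : Type u) [Field k] (deg : ∀ a, X a → ℤ) (n : ℕ) :
    (freeOperad k X deg).obj n →ₗ[k] (Tree X Unit →₀ k) :=
  (freeBasis k X deg n).constr k fun t => Finsupp.single t.tree.shape 1

@[simp] theorem forget_elem {n : ℕ} (t : LinTree X n) :
    forget k deg n (t.elem k deg) = Finsupp.single t.tree.shape 1 :=
  (freeBasis k X deg n).constr_basis k _ t

theorem forget_relabel {m n : ℕ} (σ : Fin m ≃ Fin n) (x : (freeOperad k X deg).obj m) :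
    forget k deg n ((freeOperad k X deg).relabel σ x) = forget k deg m x := by
  induction x using free_induction with
  | elem t => rw [relabel_elem, forget_elem, forget_elem]; congr 1; exact Tree.shape_map σ t.tree
  | zero => simp only [map_zero]
  | add x y hx hy => simp only [map_add, hx, hy]
  | smul c x hx => simp only [map_smul, hx]

/-- Labelling the leaves in planar order. -/
def label (k : Type u) [Field k] (deg : ∀ a, X a → ℤ) (n : ℕ) :
    (Tree X Unit →₀ k) →ₗ[k] (freeOperad k X deg).obj n :=
  Finsupp.linearCombination k fun t => if h : t.len = n then
    (freeOperad k X deg).relabel (finCongr h) (t.lab.elem k deg) else 0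

theorem label_shape {n : ℕ} {s : LinTree X n} (hs : s.Planar) :
    label k deg n (Finsupp.single s.tree.shape 1) = s.elem k deg := by
  rw [label, Finsupp.linearCombination_single, one_smul, dif_pos s.len_shape, relabel_lab hs]

theorem label_of_len {n : ℕ} {t : Tree X Unit} (h : t.len = n) :
    ∃ s : LinTree X n, s.Planar ∧ s.tree.shape = t ∧
      label k deg n (Finsupp.single t 1) = s.elem k deg := by
  subst h
  refine ⟨t.lab, t.planar_lab, t.shape_lab, ?_⟩
  rw [label, Finsupp.linearCombination_single, one_smul, dif_pos rfl,
    show finCongr (rfl : t.len = t.len) = Equiv.refl _ from rfl, relabel_refl]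

/-- A planar tree is determined by its shape. Together with `forget_label`, this identifies planar
combinations with combinations of unlabelled trees, where arities need no casts and the complex can
be studied more easily. -/
theorem label_forget {n : ℕ} {V : ∀ a, X a → Prop} {x : (freeOperad k X deg).obj n}
    (hx : x ∈ pSpan k deg V n) : label k deg n (forget k deg n x) = x := by
  refine spanOf_induction (P := fun x => label k deg n (forget k deg n x) = x) hx
    (fun s hs => ?_) ?_ (fun x y hx hy => ?_) (fun c x hx => ?_)
  · rw [forget_elem, label_shape hs.1]
  · simp only [map_zero]
  · simp only [map_add, hx, hy]
  · simp only [map_smul, hx]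

/-- The combinations of trees with `n` leaves and with vertices in `V`. -/
def aSpan (k : Type u) [Field k] (V : ∀ a, X a → Prop) (n : ℕ) : Submodule k (Tree X Unit →₀ k) :=
  Finsupp.supported k k {t | t.len = n ∧ t.All V}

/-- The combinations of trees of degree `d`. -/
def aGr (k : Type u) [Field k] (deg : ∀ a, X a → ℤ) (d : ℤ) : Submodule k (Tree X Unit →₀ k) :=
  Finsupp.supported k k {t | t.degree deg = d}

theorem supported_induction {ι : Type*} {S : Set ι} {P : (ι →₀ k) → Prop} {x : ι →₀ k}
    (hx : x ∈ Finsupp.supported k k S) (single : ∀ t ∈ S, P (Finsupp.single t 1)) (zero : P 0)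
    (add : ∀ x y, P x → P y → P (x + y)) (smul : ∀ (c : k) x, P x → P (c • x)) : P x := by
  rw [Finsupp.supported_eq_span_single] at hx
  induction hx using Submodule.span_induction with
  | mem x h => obtain ⟨t, ht, rfl⟩ := h; exact single t ht
  | zero => exact zero
  | add x y _ _ hx hy => exact add x y hx hy
  | smul c x _ hx => exact smul c x hx

theorem label_mem {V : ∀ a, X a → Prop} {n : ℕ} {x : Tree X Unit →₀ k} (hx : x ∈ aSpan k V n) :
    label k deg n x ∈ pSpan k deg V n := by
  refine supported_induction (P := fun x => label k deg n x ∈ pSpan k deg V n) hx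
    (fun t ht => ?_) ?_ (fun x y hx hy => ?_) (fun c x hx => ?_)
  · obtain ⟨s, h1, h2, h3⟩ := label_of_len (k := k) (deg := deg) ht.1
    rw [h3]
    exact elem_mem_spanOf ⟨h1, Tree.all_map.1 (h2 ▸ ht.2 : s.tree.shape.All V)⟩
  · rw [map_zero]; exact Submodule.zero_mem _
  · rw [map_add]; exact Submodule.add_mem _ hx hy
  · rw [map_smul]; exact Submodule.smul_mem _ _ hx

theorem forget_label {V : ∀ a, X a → Prop} {n : ℕ} {x : Tree X Unit →₀ k}
    (hx : x ∈ aSpan k V n) : forget k deg n (label k deg n x) = x := by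
  refine supported_induction (P := fun x => forget k deg n (label k deg n x) = x) hx
    (fun t ht => ?_) ?_ (fun x y hx hy => ?_) (fun c x hx => ?_)
  · obtain ⟨s, h1, h2, h3⟩ := label_of_len (k := k) (deg := deg) ht.1
    rw [h3, forget_elem, h2]
  · simp only [map_zero]
  · simp only [map_add, hx, hy]
  · simp only [map_smul, hx]

theorem forget_mem_of_vSpan {V : ∀ a, X a → Prop} {n : ℕ} {x : (freeOperad k X deg).obj n}
    (hx : x ∈ vSpan k deg V n) : forget k deg n x ∈ aSpan k V n := by
  refine spanOf_induction (P := fun x => forget k deg n x ∈ aSpan k V n) hx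
    (fun s hs => ?_) ?_ (fun x y hx hy => ?_) (fun c x hx => ?_)
  · rw [forget_elem]; exact Finsupp.single_mem_supported k _ ⟨s.len_shape, Tree.all_map.2 hs⟩
  · rw [map_zero]; exact Submodule.zero_mem _
  · rw [map_add]; exact Submodule.add_mem _ hx hy
  · rw [map_smul]; exact Submodule.smul_mem _ _ hx

theorem pSpan_le_vSpan (V : ∀ a, X a → Prop) (n : ℕ) : pSpan k deg V n ≤ vSpan k deg V n :=
  spanOf_mono fun _ h => h.2

theorem forget_mem_gr {n : ℕ} {d : ℤ} {x : (freeOperad k X deg).obj n}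
    (hx : x ∈ (freeOperad k X deg).gr n d) : forget k deg n x ∈ aGr k deg d := by
  refine free_gr_induction (P := fun x => forget k deg n x ∈ aGr k deg d) hx
    (fun s hs => ?_) ?_ (fun x y hx hy => ?_) (fun c x hx => ?_)
  · rw [forget_elem]
    exact Finsupp.single_mem_supported k _ ((Tree.degree_map deg s.tree _).trans hs)
  · rw [map_zero]; exact Submodule.zero_mem _
  · rw [map_add]; exact Submodule.add_mem _ hx hy
  · rw [map_smul]; exact Submodule.smul_mem _ _ hx

theorem label_mem_gr {n : ℕ} {d : ℤ} {x : Tree X Unit →₀ k}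
    (hx : x ∈ aGr k deg d) : label k deg n x ∈ (freeOperad k X deg).gr n d := by
  refine supported_induction (P := fun x => label k deg n x ∈ (freeOperad k X deg).gr n d) hx
    (fun t ht => ?_) ?_ (fun x y hx hy => ?_) (fun c x hx => ?_)
  · by_cases h : t.len = n
    · obtain ⟨s, h1, h2, h3⟩ := label_of_len (k := k) (deg := deg) h
      rw [h3]
      refine elem_mem ?_
      rw [← Tree.degree_map deg s.tree fun _ => ()]
      change s.tree.shape.degree deg = d
      rw [h2]; exact ht
    · rw [label, Finsupp.linearCombination_single, dif_neg h, smul_zero]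
      exact Submodule.zero_mem _
  · rw [map_zero]; exact Submodule.zero_mem _
  · rw [map_add]; exact Submodule.add_mem _ hx hy
  · rw [map_smul]; exact Submodule.smul_mem _ _ hx

end

end

end AntiAss

/-! ### Derivations of degree `-1` of a free operad -/

namespace AntiAss

universe w

noncomputable section

variable {k : Type u} [Field k]

open Operad

/-- The identity morphism. -/
def Operad.Hom.id (P : Operad.{u, v} k) : P.Hom P where
  app _ := LinearMap.id
  app_mem h := h
  app_relabel _ _ := rfl
  app_one := rfl
  app_comp _ _ _ := rfl

section

variable {X : ℕ → Type v} {deg : ∀ a, X a → ℤ}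

/-- The derivations of degree `-1` of a free operad. -/
abbrev FreeDer (k : Type u) [Field k] {X : ℕ → Type v} (deg : ∀ a, X a → ℤ) :=
  derivations (Operad.Hom.id (freeOperad k X deg)) 1

variable (θ : FreeDer k deg)

theorem freeDer_comp {m n : ℕ} (i : Fin m) (x : (freeOperad k X deg).obj m)
    (y : (freeOperad k X deg).obj n) : θ.1 _ ((freeOperad k X deg).comp i x y) =
      (freeOperad k X deg).comp i (θ.1 m x) y +
        (freeOperad k X deg).comp i ((freeOperad k X deg).sgn 1 m x) (θ.1 n y) :=
  derivation_comp θ i x y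

theorem freeDer_mem {n : ℕ} {d : ℤ} {x : (freeOperad k X deg).obj n}
    (hx : x ∈ (freeOperad k X deg).gr n d) : θ.1 n x ∈ (freeOperad k X deg).gr n (d - 1) :=
  θ.2.1 n d x hx

theorem freeDer_relabel {m n : ℕ} (σ : Fin m ≃ Fin n) (x : (freeOperad k X deg).obj m) :
    θ.1 n ((freeOperad k X deg).relabel σ x) = (freeOperad k X deg).relabel σ (θ.1 m x) :=
  θ.2.2.1 m n σ x

theorem spanOf_sgn {S : ∀ n, Set (LinTree X n)} (p : ℤ) {n : ℕ} {x : (freeOperad k X deg).obj n}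
    (hx : x ∈ spanOf k deg (S n)) : (freeOperad k X deg).sgn p n x ∈ spanOf k deg (S n) := by
  refine spanOf_induction (P := fun x => (freeOperad k X deg).sgn p n x ∈ spanOf k deg (S n)) hx
    (fun s hs => ?_) ?_ (fun x y hx hy => ?_) (fun c x hx => ?_)
  · rw [sgn_of_mem p (elem_mem rfl)]; exact Submodule.smul_mem _ _ (elem_mem_spanOf hs)
  · rw [map_zero]; exact Submodule.zero_mem _
  · rw [map_add]; exact Submodule.add_mem _ hx hy
  · rw [map_smul]; exact Submodule.smul_mem _ _ hx

/-- A derivation that sends the generators in `V` to combinations of planar trees does so with all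
planar trees. -/
theorem freeDer_mem_pSpan {V W : ∀ a, X a → Prop} (hVW : ∀ a x, V a x → W a x)
    (h : ∀ a x, V a x → θ.1 a (gen k x) ∈ pSpan k deg W a) {n : ℕ}
    {z : (freeOperad k X deg).obj n} (hz : z ∈ pSpan k deg V n) : θ.1 n z ∈ pSpan k deg W n := by
  have hc : CompClosed k deg fun n => pSpan k deg W n ⊓ (pSpan k deg W n).comap (θ.1 n) := by
    refine ⟨⟨(compClosed_pSpan W).one, ?_⟩, fun {m n} i x y hx hy => ⟨?_, ?_⟩⟩
    · rw [SetLike.mem_coe, Submodule.mem_comap, derivation_one]; exact Submodule.zero_mem _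
    · exact (compClosed_pSpan W).comp i hx.1 hy.1
    · rw [SetLike.mem_coe, Submodule.mem_comap, freeDer_comp]
      exact Submodule.add_mem _ ((compClosed_pSpan W).comp i hx.2 hy.1)
        ((compClosed_pSpan W).comp i
          (spanOf_sgn (S := fun _ => {t | t.Planar ∧ t.tree.All W}) 1 hx.1) hy.2)
  refine spanOf_induction (P := fun z => θ.1 n z ∈ pSpan k deg W n) hz
    (fun s hs => ?_) ?_ (fun x y hx hy => ?_) (fun c x hx => ?_)
  · refine (planar_mem hc hs.1 (hs.2.imp fun a x hx => ⟨?_, h a x hx⟩)).2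
    exact elem_mem_spanOf ⟨LinTree.planar_corolla x, all_corolla (hVW a x hx)⟩
  · rw [map_zero]; exact Submodule.zero_mem _
  · rw [map_add]; exact Submodule.add_mem _ hx hy
  · rw [map_smul]; exact Submodule.smul_mem _ _ hx

theorem freeDer_mem_vSpan {V W : ∀ a, X a → Prop} (hVW : ∀ a x, V a x → W a x)
    (h : ∀ a x, V a x → θ.1 a (gen k x) ∈ vSpan k deg W a) {n : ℕ}
    {z : (freeOperad k X deg).obj n} (hz : z ∈ vSpan k deg V n) : θ.1 n z ∈ vSpan k deg W n := by
  have hc : CompClosed k deg fun n => vSpan k deg W n ⊓ (vSpan k deg W n).comap (θ.1 n) := by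
    refine ⟨⟨(compClosed_vSpan W).one, ?_⟩, fun {m n} i x y hx hy => ⟨?_, ?_⟩⟩
    · rw [SetLike.mem_coe, Submodule.mem_comap, derivation_one]; exact Submodule.zero_mem _
    · exact (compClosed_vSpan W).comp i hx.1 hy.1
    · rw [SetLike.mem_coe, Submodule.mem_comap, freeDer_comp]
      exact Submodule.add_mem _ ((compClosed_vSpan W).comp i hx.2 hy.1)
        ((compClosed_vSpan W).comp i
          (spanOf_sgn (S := fun _ => {t | t.tree.All W}) 1 hx.1) hy.2)
  refine spanOf_induction (P := fun z => θ.1 n z ∈ vSpan k deg W n) hz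
    (fun s hs => ?_) ?_ (fun x y hx hy => ?_) (fun c x hx => ?_)
  · refine (tree_mem hc (fun σ x hx => ⟨relabel_vSpan W σ hx.1, ?_⟩) s
      (hs.imp fun a x hx => ⟨?_, h a x hx⟩)).2
    · rw [SetLike.mem_coe, Submodule.mem_comap, freeDer_relabel]
      exact relabel_vSpan W σ hx.2
    · exact elem_mem_spanOf (all_corolla (hVW a x hx))
  · rw [map_zero]; exact Submodule.zero_mem _
  · rw [map_add]; exact Submodule.add_mem _ hx hy
  · rw [map_smul]; exact Submodule.smul_mem _ _ hx

/-- By this locality, derivations that belong to different stages of the construction can be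
compared on the trees that both stages know. -/
theorem freeDer_congr {θ θ' : FreeDer k deg} {V : ∀ a, X a → Prop}
    (h : ∀ a x, V a x → θ.1 a (gen k x) = θ'.1 a (gen k x)) {n : ℕ}
    {z : (freeOperad k X deg).obj n} (hz : z ∈ vSpan k deg V n) : θ.1 n z = θ'.1 n z := by
  have hc : CompClosed k deg fun n => LinearMap.eqLocus (θ.1 n) (θ'.1 n) :=
    ⟨by rw [LinearMap.mem_eqLocus, derivation_one, derivation_one], fun i x y hx hy => by
      rw [LinearMap.mem_eqLocus] at *
      rw [freeDer_comp, freeDer_comp, hx, hy]⟩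
  refine spanOf_induction (P := fun z => θ.1 n z = θ'.1 n z) hz
    (fun s hs => ?_) ?_ (fun x y hx hy => ?_) (fun c x hx => ?_)
  · refine tree_mem hc (fun σ x hx => ?_) s (hs.imp fun a x hx => h a x hx)
    rw [LinearMap.mem_eqLocus] at *
    rw [freeDer_relabel, freeDer_relabel, hx]
  · simp only [map_zero]
  · simp only [map_add, hx, hy]
  · simp only [map_smul, hx]

/-! ### The differential on trees without labels -/

/-- The derivation on trees without labels. -/
def dA : (Tree X Unit →₀ k) →ₗ[k] (Tree X Unit →₀ k) :=
  Finsupp.linearCombination k fun t => forget k deg t.len (θ.1 _ (t.lab.elem k deg))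

theorem dA_single (t : Tree X Unit) :
    dA θ (Finsupp.single t 1) = forget k deg t.len (θ.1 _ (t.lab.elem k deg)) := by
  rw [dA, Finsupp.linearCombination_single, one_smul]

/-- `dA` is defined through the planar labelling, but derivations commute with relabellings, so any
labelling gives the same result. -/
theorem dA_forget {n : ℕ} (z : (freeOperad k X deg).obj n) :
    dA θ (forget k deg n z) = forget k deg n (θ.1 n z) := by
  induction z using free_induction with
  | elem t =>
    have key : ∀ s : LinTree X n, s.Planar →
        dA θ (forget k deg n (s.elem k deg)) = forget k deg n (θ.1 n (s.elem k deg)) := by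
      intro s hs
      rw [forget_elem, dA_single]
      conv_rhs => rw [← relabel_lab hs, freeDer_relabel, forget_relabel]
    rw [← t.planarize_map, ← relabel_elem, forget_relabel, freeDer_relabel, forget_relabel]
    exact key _ t.planar_planarize
  | zero => simp only [map_zero]
  | add x y hx hy => simp only [map_add, hx, hy]
  | smul c x hx => simp only [map_smul, hx]

variable {θ} in
theorem dA_eq {V : ∀ a, X a → Prop} {n : ℕ} {x : Tree X Unit →₀ k} (hx : x ∈ aSpan k V n) :
    dA θ x = forget k deg n (θ.1 n (label k deg n x)) := by
  rw [← dA_forget, forget_label hx]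

theorem dA_mem_aSpan {V W : ∀ a, X a → Prop} (hVW : ∀ a x, V a x → W a x)
    (h : ∀ a x, V a x → θ.1 a (gen k x) ∈ vSpan k deg W a) {n : ℕ} {x : Tree X Unit →₀ k}
    (hx : x ∈ aSpan k V n) : dA θ x ∈ aSpan k W n := by
  rw [dA_eq hx]
  exact forget_mem_of_vSpan (freeDer_mem_vSpan θ hVW h (pSpan_le_vSpan _ _ (label_mem hx)))

/-- When the derivation has planar values on the generators in `V`, it preserves planarity of trees
with such vertices, so that nothing is lost by forgetting the labels. -/
theorem label_dA {V W : ∀ a, X a → Prop} (hVW : ∀ a x, V a x → W a x)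
    (h : ∀ a x, V a x → θ.1 a (gen k x) ∈ pSpan k deg W a) {n : ℕ} {x : Tree X Unit →₀ k}
    (hx : x ∈ aSpan k V n) : label k deg n (dA θ x) = θ.1 n (label k deg n x) := by
  rw [dA_eq hx]
  exact label_forget (freeDer_mem_pSpan θ hVW h (label_mem hx))

theorem mem_aSpan_single {V : ∀ a, X a → Prop} {n : ℕ} {t : Tree X Unit} (h : t.len = n)
    (h' : t.All V) : (Finsupp.single t 1 : Tree X Unit →₀ k) ∈ aSpan k V n :=
  Finsupp.single_mem_supported k _ ⟨h, h'⟩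

theorem all_true {α : Type} (t : Tree X α) : t.All fun _ _ => True := by
  induction t with
  | leaf => trivial
  | node x c ih => exact ⟨trivial, ih⟩

theorem dA_single_mem (t : Tree X Unit) :
    dA θ (Finsupp.single t 1) ∈
      Finsupp.supported k k {s | s.len = t.len ∧ s.degree deg = t.degree deg - 1} := by
  have h1 : dA θ (Finsupp.single t 1) ∈ aSpan k (fun _ _ => True) t.len :=
    dA_mem_aSpan θ (V := fun _ _ => True) (fun _ _ h => h)
      (fun a x _ => by
        refine free_induction (P := fun z => z ∈ vSpan k deg (fun _ _ => True) a) _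
          (fun t => elem_mem_spanOf (all_true _)) (Submodule.zero_mem _)
          (fun _ _ => Submodule.add_mem _) (fun c _ => Submodule.smul_mem _ c))
      (mem_aSpan_single rfl (all_true t))
  have h2 : dA θ (Finsupp.single t 1) ∈ aGr k deg (t.degree deg - 1) := by
    rw [dA_single]
    refine forget_mem_gr (freeDer_mem θ (elem_mem ?_))
    rw [← Tree.degree_map deg t.lab.tree fun _ => ()]
    exact congrArg _ t.shape_lab
  intro s hs
  exact ⟨(h1 hs).1, h2 hs⟩

theorem dA_mem_aGr {d : ℤ} {x : Tree X Unit →₀ k} (hx : x ∈ aGr k deg d) :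
    dA θ x ∈ aGr k deg (d - 1) := by
  refine supported_induction (P := fun x => dA θ x ∈ aGr k deg (d - 1)) hx
    (fun t ht s hs => ?_) ?_ (fun x y hx hy => ?_) (fun c x hx => ?_)
  · have := (dA_single_mem θ t hs).2
    rw [ht] at this
    exact this
  · rw [map_zero]; exact Submodule.zero_mem _
  · rw [map_add]; exact Submodule.add_mem _ hx hy
  · rw [map_smul]; exact Submodule.smul_mem _ _ hx

/-- The projection to the trees of a given number of leaves and a given degree. -/
def proj (k : Type u) [Field k] (deg : ∀ a, X a → ℤ) (n : ℕ) (d : ℤ) :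
    (Tree X Unit →₀ k) →ₗ[k] (Tree X Unit →₀ k) :=
  open Classical in
  Finsupp.linearCombination k fun t =>
    if t.len = n ∧ t.degree deg = d then Finsupp.single t 1 else 0

theorem proj_eq_self {n : ℕ} {d : ℤ} {x : Tree X Unit →₀ k}
    (hx : x ∈ Finsupp.supported k k {t : Tree X Unit | t.len = n ∧ t.degree deg = d}) :
    proj k deg n d x = x := by
  refine supported_induction (P := fun x => proj k deg n d x = x) hx
    (fun t ht => ?_) ?_ (fun x y hx hy => ?_) (fun c x hx => ?_)
  · rw [proj, Finsupp.linearCombination_single, one_smul]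
    exact if_pos ht
  · simp only [map_zero]
  · simp only [map_add, hx, hy]
  · simp only [map_smul, hx]

theorem proj_eq_zero {n : ℕ} {d : ℤ} {x : Tree X Unit →₀ k}
    (hx : x ∈ Finsupp.supported k k {t : Tree X Unit | ¬ (t.len = n ∧ t.degree deg = d)}) :
    proj k deg n d x = 0 := by
  refine supported_induction (P := fun x => proj k deg n d x = 0) hx
    (fun t ht => ?_) ?_ (fun x y hx hy => ?_) (fun c x hx => ?_)
  · rw [proj, Finsupp.linearCombination_single, one_smul]
    exact if_neg ht
  · simp only [map_zero]
  · simp only [map_add, hx, hy, add_zero]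
  · simp only [map_smul, hx, smul_zero]

theorem proj_mem {n : ℕ} {d : ℤ} {S : Set (Tree X Unit)} {x : Tree X Unit →₀ k}
    (hx : x ∈ Finsupp.supported k k S) : proj k deg n d x ∈
      Finsupp.supported k k (S ∩ {t : Tree X Unit | t.len = n ∧ t.degree deg = d}) := by
  refine supported_induction (P := fun x => proj k deg n d x ∈ Finsupp.supported k k
    (S ∩ {t : Tree X Unit | t.len = n ∧ t.degree deg = d})) hx
    (fun t ht => ?_) ?_ (fun x y hx hy => ?_) (fun c x hx => ?_)
  · rw [proj, Finsupp.linearCombination_single, one_smul]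
    split_ifs with h
    · exact Finsupp.single_mem_supported k _ ⟨ht, h⟩
    · exact Submodule.zero_mem _
  · rw [map_zero]; exact Submodule.zero_mem _
  · rw [map_add]; exact Submodule.add_mem _ hx hy
  · rw [map_smul]; exact Submodule.smul_mem _ _ hx

theorem finsupp_induction {ι : Type*} {P : (ι →₀ k) → Prop} (x : ι →₀ k)
    (single : ∀ t, P (Finsupp.single t 1)) (zero : P 0)
    (add : ∀ x y, P x → P y → P (x + y)) (smul : ∀ (c : k) x, P x → P (c • x)) : P x :=
  supported_induction (S := Set.univ) (by rw [Finsupp.supported_univ]; trivial)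
    (fun t _ => single t) zero add smul

/-- `dA` keeps the number of leaves and lowers the degree by one, hence respects the bigrading.
Cycles and their fillings can therefore be taken homogeneous. -/
theorem dA_proj (n : ℕ) (d : ℤ) (x : Tree X Unit →₀ k) :
    dA θ (proj k deg n d x) = proj k deg n (d - 1) (dA θ x) := by
  induction x using finsupp_induction with
  | single t =>
    have h := dA_single_mem θ t
    rw [proj, Finsupp.linearCombination_single, one_smul]
    split_ifs with ht
    · rw [proj_eq_self]
      rwa [ht.1, ht.2] at h
    · rw [map_zero, proj_eq_zero]
      intro s hs hs'
      have := h hs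
      exact ht ⟨this.1.symm.trans hs'.1, by have h1 := this.2; have h2 := hs'.2; omega⟩
  | zero => simp only [map_zero]
  | add x y hx hy => simp only [map_add, hx, hy]
  | smul c x hx => simp only [map_smul, hx]

/-! ### Substitution -/

/-- Substitution of trees for the inputs. -/
def sub {n : ℕ} (f : Fin n → Tree X Unit) :
    (freeOperad k X deg).obj n →ₗ[k] (Tree X Unit →₀ k) :=
  (freeBasis k X deg n).constr k fun t => Finsupp.single (t.tree.bind f) 1

theorem sub_elem {n : ℕ} (f : Fin n → Tree X Unit) (t : LinTree X n) :
    sub f (t.elem k deg) = Finsupp.single (t.tree.bind f) 1 :=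
  (freeBasis k X deg n).constr_basis k _ t

theorem sub_gen {n : ℕ} (f : Fin n → Tree X Unit) (x : X n) :
    sub (deg := deg) f (gen k x) = Finsupp.single (.node x f) 1 := by
  rw [gen_eq, sub_elem]; rfl

theorem sub_leaf {n : ℕ} (z : (freeOperad k X deg).obj n) :
    sub (fun _ => .leaf ()) z = forget k deg n z := by
  induction z using free_induction with
  | elem t => rw [sub_elem, forget_elem]; rfl
  | zero => simp only [map_zero]
  | add x y hx hy => simp only [map_add, hx, hy]
  | smul c x hx => simp only [map_smul, hx]

/-- What is substituted in `s` when `f` is substituted in the grafting of `t` on the input `i`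
of `s`. -/
def ins {m n : ℕ} (i : Fin m) (t : Tree X (Fin n)) (f : Fin (m + n - 1) → Tree X Unit)
    (a : Fin m) : Tree X Unit :=
  if h : a = i then t.bind fun b => f (slot i n (.inr b)) else f (slot i n (.inl ⟨a, h⟩))

theorem graft_bind {m n : ℕ} (i : Fin m) (s : Tree X (Fin m)) (t : Tree X (Fin n))
    (f : Fin (m + n - 1) → Tree X Unit) : (s.graft i t).bind f = s.bind (ins i t f) := by
  rw [Tree.graft, Tree.bind_bind]
  congr 1
  funext a
  by_cases h : a = i
  · subst h
    rw [Tree.plug_self, ins, dif_pos rfl, Tree.map, Tree.bind_bind]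
    rfl
  · rw [Tree.plug_ne _ h, ins, dif_neg h]
    rfl

/-- The grafted tree has degree zero, so it passes the later vertices without a sign, and composing
before substituting agrees with substituting more. -/
theorem sub_comp_elem {m n : ℕ} (i : Fin m) (w : (freeOperad k X deg).obj m) {t : LinTree X n}
    (ht : t.tree.degree deg = 0) (f : Fin (m + n - 1) → Tree X Unit) :
    sub f ((freeOperad k X deg).comp i w (t.elem k deg)) = sub (ins i t.tree f) w := by
  induction w using free_induction with
  | elem s =>
    rw [comp_elem, ht, zero_mul, ksign_zero, one_smul, sub_elem, sub_elem]
    exact congrArg (Finsupp.single · (1 : k)) (graft_bind i s.tree t.tree f)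
  | zero => simp only [map_zero, LinearMap.zero_apply]
  | add x y hx hy => simp only [map_add, LinearMap.add_apply, hx, hy]
  | smul c x hx => simp only [map_smul, LinearMap.smul_apply, hx]

theorem sub_elem_comp {m n : ℕ} (i : Fin m) {s : LinTree X m} (t : LinTree X n)
    (hs : s.tree.after deg i = 0) (f : Fin (m + n - 1) → Tree X Unit) :
    sub f ((freeOperad k X deg).comp i (s.elem k deg) (t.elem k deg)) =
      Finsupp.single (s.tree.bind (ins i t.tree f)) 1 := by
  rw [comp_elem, hs, mul_zero, ksign_zero, one_smul, sub_elem]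
  exact congrArg (Finsupp.single · (1 : k)) (graft_bind i s.tree t.tree f)

/-- The generators that are cycles of degree zero. -/
def IsClosedGen (a : ℕ) (x : X a) : Prop := deg a x = 0 ∧ θ.1 a (gen k x) = 0

theorem closed_lab {t : Tree X Unit} (h : t.All (IsClosedGen θ)) :
    t.lab.tree.degree deg = 0 ∧ θ.1 _ (t.lab.elem k deg) = 0 := by
  constructor
  · rw [← Tree.degree_map deg t.lab.tree fun _ => ()]
    change t.lab.tree.shape.degree deg = 0
    rw [t.shape_lab]
    induction t with
    | leaf => rfl
    | node x c ih =>
      rw [Tree.degree_node, h.1.1, Finset.sum_eq_zero fun i _ => ih i (h.2 i), add_zero]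
  · refine planar_mem (p := fun n => LinearMap.ker (θ.1 n))
      ⟨derivation_one θ, fun i x y hx hy => ?_⟩ t.planar_lab ?_
    · rw [LinearMap.mem_ker] at *
      rw [freeDer_comp, hx, hy, map_zero, map_zero, LinearMap.zero_apply, add_zero]
    · have : t.lab.tree.All (IsClosedGen θ) := by
        rw [← Tree.all_map (f := fun _ => ())]
        change t.lab.tree.shape.All _
        rwa [t.shape_lab]
      exact this.imp fun a x hx => hx.2

/-- The substituted trees are cycles of degree zero, so the Leibniz rule leaves only the term in
which `z` is differentiated, and that term carries no sign. The trees are grafted one at a time, by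
induction on the number of substituted vertices. -/
theorem dA_sub {n : ℕ} {f : Fin n → Tree X Unit} (hf : ∀ i, (f i).All (IsClosedGen θ))
    (z : (freeOperad k X deg).obj n) : dA θ (sub f z) = sub f (θ.1 n z) := by
  induction hN : ∑ i, (f i).size using Nat.strong_induction_on generalizing n with
  | _ N ih =>
  by_cases h : ∀ i, (f i).size = 0
  · have : f = fun _ => .leaf () := by
      funext i
      have := h i
      rcases hi : f i with _ | ⟨x, c⟩
      · rfl
      · rw [hi] at this; simp [Tree.size] at this
    rw [this, sub_leaf, sub_leaf, dA_forget]
  · push Not at h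
    obtain ⟨i, hi⟩ := h
    obtain ⟨h1, h2⟩ := closed_lab θ (hf i)
    -- The substitution that remains after `f i` has been grafted: the other trees are unchanged and
    -- the block of `f i` receives single leaves.
    let g : Fin (n + (f i).len - 1) → Tree X Unit := fun c =>
      Sum.elim (fun a : {a : Fin n // a ≠ i} => f a.1) (fun _ => .leaf ())
        ((slot i (f i).len).symm c)
    have hg1 : ∀ a, g (slot i _ (.inl a)) = f a.1 := fun a => by simp [g]
    have hg2 : ∀ b, g (slot i _ (.inr b)) = .leaf () := fun b => by simp [g]
    have hins : ins i (f i).lab.tree g = f := by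
      funext a
      by_cases ha : a = i
      · subst ha
        rw [ins, dif_pos rfl]
        simp only [hg2]
        exact (f a).shape_lab
      · rw [ins, dif_neg ha, hg1]
    have hgc : ∀ c, (g c).All (IsClosedGen θ) := by
      intro c
      obtain ⟨c, rfl⟩ := (slot i _).surjective c
      rcases c with c | c
      · rw [hg1]; exact hf _
      · rw [hg2]; trivial
    have hlt : ∑ c, (g c).size < N := by
      rw [← hN, ← Equiv.sum_comp (slot i _), Fintype.sum_sum_type]
      simp only [hg1, hg2, Tree.size, Finset.sum_const_zero, add_zero]
      rw [← Finset.sum_subtype (p := fun a => a ≠ i) {i}ᶜ (by simp) (fun a => (f a).size),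
        ← Finset.sum_add_sum_compl {i} fun a => (f a).size, Finset.sum_singleton]
      omega
    rw [← hins, ← sub_comp_elem i z h1 g, ← sub_comp_elem i _ h1 g, ih _ hlt hgc _ rfl,
      freeDer_comp, h2, map_zero, add_zero]

end

end

end AntiAss

/-! ### The generators `μ₂`, `μ₃`, `μ₅` and the boundaries of trees built from them -/

namespace AntiAss

universe w

noncomputable section

variable {k : Type u} [Field k]

open Operad

/-- Some generators of small arity. -/
structure Gens (X : ℕ → Type v) where
  two : X 2
  three : X 3
  five : Fin 4 → X 5

namespace Gens

variable {X : ℕ → Type v} {deg : ∀ a, X a → ℤ} (G : Gens X)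

/-- The tree with the vertex `μ₂` at the root. -/
def b (l r : Tree X Unit) : Tree X Unit := .node G.two ![l, r]

/-- The tree with the vertex `μ₃` at the root. -/
def m (x y z : Tree X Unit) : Tree X Unit := .node G.three ![x, y, z]

/-- The tree with a vertex `μ₅` at the root. -/
def q (i : Fin 4) (x y z u v : Tree X Unit) : Tree X Unit := .node (G.five i) ![x, y, z, u, v]

theorem node_two (f : Fin 2 → Tree X Unit) : .node G.two f = G.b (f 0) (f 1) :=
  congrArg _ (by funext i; fin_cases i <;> rfl)

theorem node_three (f : Fin 3 → Tree X Unit) : .node G.three f = G.m (f 0) (f 1) (f 2) :=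
  congrArg _ (by funext i; fin_cases i <;> rfl)

theorem b_congr {l l' r r' : Tree X Unit} (h : l = l') (h' : r = r') : G.b l r = G.b l' r' :=
  congrArg₂ _ h h'

theorem m_congr {x x' y y' z z' : Tree X Unit} (h : x = x') (h' : y = y') (h'' : z = z') :
    G.m x y z = G.m x' y' z' := by rw [h, h', h'']

/-- The trees with binary vertices `μ₂`. -/
inductive Bin : Tree X Unit → Prop
  | leaf : Bin (.leaf ())
  | b {l r : Tree X Unit} : Bin l → Bin r → Bin (G.b l r)

/-- The generators of `G`. -/
inductive Low : ∀ a, X a → Prop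
  | two : Low 2 G.two
  | three : Low 3 G.three
  | five (i : Fin 4) : Low 5 (G.five i)

variable {G}

theorem Low.b {l r : Tree X Unit} (hl : l.All G.Low) (hr : r.All G.Low) : (G.b l r).All G.Low :=
  ⟨.two, fun i => by fin_cases i <;> assumption⟩

theorem Low.m {x y z : Tree X Unit} (hx : x.All G.Low) (hy : y.All G.Low) (hz : z.All G.Low) :
    (G.m x y z).All G.Low :=
  ⟨.three, fun i => by fin_cases i <;> assumption⟩

theorem Low.q (i : Fin 4) {x y z u v : Tree X Unit} (hx : x.All G.Low) (hy : y.All G.Low)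
    (hz : z.All G.Low) (hu : u.All G.Low) (hv : v.All G.Low) : (G.q i x y z u v).All G.Low :=
  ⟨.five i, fun i => by fin_cases i <;> assumption⟩

theorem Bin.low {t : Tree X Unit} (h : G.Bin t) : t.All G.Low := by
  induction h with
  | leaf => trivial
  | b _ _ h h' => exact Low.b h h'

end Gens

/-- The generators have the degrees and the differentials of the first generators of the
minimal model. -/
structure IsLow {X : ℕ → Type v} {deg : ∀ a, X a → ℤ} (θ : FreeDer k deg) (G : Gens X) : Prop where
  deg_two : deg 2 G.two = 0
  deg_three : deg 3 G.three = 1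
  deg_five : ∀ i, deg 5 (G.five i) = 2
  d_two : θ.1 2 (gen k G.two) = 0
  d_three : θ.1 3 (gen k G.three) =
    gen k G.two ∘[1] gen k G.two + gen k G.two ∘[2] gen k G.two
  d_five : ∀ i, θ.1 5 (gen k (G.five i)) = quintic (gen k G.two) (gen k G.three) i

/-- The only vertex precedes all leaves in planar order, so composing into a corolla produces no
sign. -/
theorem after_corolla {X : ℕ → Type v} (deg : ∀ a, X a → ℤ) {a : ℕ} (x : X a) (i : Fin a) :
    (LinTree.corolla x).tree.after deg i = 0 := by
  have h : (LinTree.corolla x).tree.word = .inl ⟨a, x⟩ :: (List.finRange a).map Sum.inr := by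
    simp only [LinTree.corolla, Tree.word]
    congr 1
    rw [List.ofFn_eq_map]
    induction List.finRange a <;> simp_all
  rw [Tree.after, h, Tree.wordAfter]
  induction List.finRange a with
  | nil => rfl
  | cons b L ih =>
    rw [List.map_cons, Tree.wordAfter]
    split_ifs
    · clear h ih
      induction L with
      | nil => rfl
      | cons c L ih => exact ih
    · exact ih

section

variable {X : ℕ → Type v} {deg : ∀ a, X a → ℤ}

theorem wordAfter_eq_zero (deg : ∀ a, X a → ℤ) {α : Type} [DecidableEq α] (a : α)
    {w : List ((Σ a, X a) ⊕ α)} (h : ∀ g, .inl g ∈ w → deg g.1 g.2 = 0) :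
    Tree.wordAfter deg a w = 0 := by
  have h' : ∀ w : List ((Σ a, X a) ⊕ α), (∀ g, .inl g ∈ w → deg g.1 g.2 = 0) →
      Tree.wordDeg deg w = 0 := by
    intro w h
    induction w with
    | nil => rfl
    | cons y w ih =>
      rcases y with y | y
      · rw [Tree.wordDeg, h y (by simp), ih fun g hg => h g (by simp [hg]), add_zero]
      · exact ih fun g hg => h g (by simp [hg])
  induction w with
  | nil => rfl
  | cons y w ih =>
    have ih := ih fun g hg => h g (by simp [hg])
    rcases y with y | y
    · exact ih
    · rw [Tree.wordAfter, ih, h' w fun g hg => h g (by simp [hg]), ite_self]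

theorem after_eq_zero (deg : ∀ a, X a → ℤ) {α : Type} [DecidableEq α] (a : α) {t : Tree X α}
    (h : t.All fun a x => deg a x = 0) : t.after deg a = 0 := by
  refine wordAfter_eq_zero deg a ?_
  induction t with
  | leaf => simp [Tree.word]
  | node x c ih =>
    intro g hg
    rw [word_node, List.mem_cons] at hg
    rcases hg with hg | hg
    · obtain rfl := Sum.inl.inj hg
      exact h.1
    · rw [List.mem_flatten] at hg
      obtain ⟨_, h1, h2⟩ := hg
      rw [List.mem_map] at h1
      obtain ⟨_, h3, rfl⟩ := h1
      rw [List.mem_ofFn] at h3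
      obtain ⟨i, rfl⟩ := h3
      exact ih i (h.2 i) g h2

theorem sub_circ_gen {p q : ℕ} {x : X p} {y : X q} {i : Fin p} {f : Fin (p + q - 1) → Tree X Unit}
    {t : Tree X Unit} (ht : .node x (ins i (LinTree.corolla y).tree f) = t) :
    sub f ((freeOperad k X deg).comp i (gen k x) (gen k y)) = Finsupp.single t 1 := by
  rw [gen_eq, gen_eq, sub_elem_comp i _ (after_corolla deg x i)]
  exact congrArg (Finsupp.single · (1 : k)) ht

/-- The two alternatives cover the terms of `quintic`: either the last factor is `μ₂`, or the last
factor is `μ₃` and the first two are `μ₂`. In neither case does an odd vertex pass another one, so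
no sign appears. -/
theorem sub_circ_circ_gen {p q r : ℕ} {x : X p} {y : X q} {z : X r} {i : Fin p}
    {j : Fin (p + q - 1)} {f : Fin (p + q - 1 + r - 1) → Tree X Unit} {t : Tree X Unit}
    (h : deg r z = 0 ∨ deg p x = 0 ∧ deg q y = 0)
    (ht : .node x (ins i (LinTree.corolla y).tree (ins j (LinTree.corolla z).tree f)) = t) :
    sub f ((freeOperad k X deg).comp j ((freeOperad k X deg).comp i (gen k x) (gen k y))
      (gen k z)) = Finsupp.single t 1 := by
  rcases h with h | ⟨h1, h2⟩
  · rw [gen_eq z, sub_comp_elem j _ ((degree_corolla deg z).trans h)]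
    exact sub_circ_gen ht
  · rw [gen_eq, gen_eq, gen_eq, comp_elem, degree_corolla, h2, zero_mul, ksign_zero, one_smul,
      sub_elem_comp]
    · refine congrArg (Finsupp.single · (1 : k)) (Eq.trans ?_ ht)
      exact graft_bind i _ _ _
    · refine after_eq_zero deg j (Tree.all_graft i ⟨h1, fun _ => trivial⟩ ⟨h2, fun _ => trivial⟩)

theorem sub_three_comp {G : Gens X} {p q : ℕ} {y : X p} {z : X q} {i : Fin 3} {j : Fin p}
    {f : Fin (3 + (p + q - 1) - 1) → Tree X Unit} {t : Tree X Unit} (h : deg q z = 0)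
    (ht : .node G.three (ins i ((LinTree.corolla y).graft j (LinTree.corolla z)).tree f) = t) :
    sub f ((freeOperad k X deg).comp i (gen k G.three)
      ((freeOperad k X deg).comp j (gen k y) (gen k z))) = Finsupp.single t 1 := by
  rw [gen_eq y, gen_eq z, comp_elem, degree_corolla, h, zero_mul, ksign_zero, one_smul, gen_eq,
    sub_elem_comp i _ (after_corolla deg _ i)]
  exact congrArg (Finsupp.single · (1 : k)) ht

theorem map_alternating {M N : Type*} [AddCommGroup M] [Module k M] [AddCommGroup N] [Module k N]
    (F : M →ₗ[k] N) {x₁ x₂ x₃ x₄ x₅ x₆ x₇ x₈ : M} {y₁ y₂ y₃ y₄ y₅ y₆ y₇ y₈ : N} (h₁ : F x₁ = y₁)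
    (h₂ : F x₂ = y₂) (h₃ : F x₃ = y₃) (h₄ : F x₄ = y₄) (h₅ : F x₅ = y₅) (h₆ : F x₆ = y₆)
    (h₇ : F x₇ = y₇) (h₈ : F x₈ = y₈) : F (x₁ - x₂ + x₃ - x₄ + x₅ - x₆ + x₇ - x₈) =
      y₁ - y₂ + y₃ - y₄ + y₅ - y₆ + y₇ - y₈ := by
  simp only [map_sub, map_add, h₁, h₂, h₃, h₄, h₅, h₆, h₇, h₈]

/-- A tree as an element of the space of trees. -/
abbrev s (k : Type u) [Field k] (t : Tree X Unit) : Tree X Unit →₀ k := Finsupp.single t 1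

end

namespace IsLow

variable {X : ℕ → Type v} {deg : ∀ a, X a → ℤ} {θ : FreeDer k deg} {G : Gens X} (H : IsLow θ G)

include H

theorem closed {t : Tree X Unit} (h : G.Bin t) : t.All (IsClosedGen θ) := by
  induction h with
  | leaf => trivial
  | b _ _ h h' => exact ⟨⟨H.deg_two, H.d_two⟩, fun i => by fin_cases i <;> assumption⟩

theorem dA_m {x y z : Tree X Unit} (hx : G.Bin x) (hy : G.Bin y) (hz : G.Bin z) :
    dA θ (s k (G.m x y z)) = s k (G.b (G.b x y) z) + s k (G.b x (G.b y z)) := by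
  have h := dA_sub θ (f := ![x, y, z])
    (fun i => by fin_cases i <;> exact H.closed (by assumption)) (gen k G.three)
  rw [sub_gen, H.d_three, map_add] at h
  refine h.trans (congrArg₂ (· + ·) (sub_circ_gen ?_) (sub_circ_gen ?_)) <;>
  · repeat' first
      | rfl
      | refine (G.node_two _).trans (G.b_congr ?_ ?_)

/-- This turns the formulas in partial compositions into explicit trees, on which linear algebra can
be done. The matching of trees is by computation. -/
theorem sub_quintic (x y z u v : Tree X Unit) (i : Fin 4) :
    sub ![x, y, z, u, v] (quintic (P := freeOperad k X deg) (gen k G.two) (gen k G.three) i) =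
    ![s k (G.b x (G.m y z (G.b u v))) - s k (G.m x y (G.b z (G.b u v)))
        + s k (G.b (G.b x y) (G.m z u v)) - s k (G.m (G.b x y) (G.b z u) v)
        + s k (G.b (G.m (G.b x y) z u) v) - s k (G.m (G.b (G.b x y) z) u v)
        + s k (G.b (G.m x y z) (G.b u v)) - s k (G.m x (G.b y z) (G.b u v)),
      s k (G.m (G.b (G.b x y) z) u v) - s k (G.b (G.m (G.b x y) z u) v)
        + s k (G.b (G.m x y (G.b z u)) v) - s k (G.m x (G.b y (G.b z u)) v)
        + s k (G.b x (G.m y (G.b z u) v)) - s k (G.m x y (G.b (G.b z u) v))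
        + s k (G.b (G.b x y) (G.m z u v)) - s k (G.m (G.b x y) z (G.b u v)),
      s k (G.m x (G.b y z) (G.b u v)) - s k (G.b x (G.m (G.b y z) u v))
        + s k (G.m x (G.b (G.b y z) u) v) - s k (G.b (G.b x (G.m y z u)) v)
        + s k (G.b (G.m x y (G.b z u)) v) - s k (G.b (G.m (G.b x y) z u) v)
        + s k (G.b (G.b (G.m x y z) u) v) - s k (G.m (G.b x (G.b y z)) u v),
      s k (G.m (G.b x y) (G.b z u) v) - s k (G.m x y (G.b (G.b z u) v))
        + s k (G.b x (G.m y (G.b z u) v)) - s k (G.m x (G.b y (G.b z u)) v)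
        + s k (G.b (G.b x (G.m y z u)) v) - s k (G.b (G.m x (G.b y z) u) v)
        + s k (G.b (G.b (G.m x y z) u) v) - s k (G.b (G.m (G.b x y) z u) v)] i := by
  have h2 := H.deg_two
  fin_cases i
  all_goals
    refine map_alternating _ (sub_circ_circ_gen ?_ ?_) (sub_circ_circ_gen ?_ ?_)
      (sub_circ_circ_gen ?_ ?_) (sub_circ_circ_gen ?_ ?_) (sub_circ_circ_gen ?_ ?_)
      (sub_circ_circ_gen ?_ ?_) (sub_circ_circ_gen ?_ ?_) (sub_circ_circ_gen ?_ ?_)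
    all_goals first
      | exact .inl h2
      | exact .inr ⟨h2, h2⟩
      | repeat' first
        | rfl
        | refine (G.node_two _).trans (G.b_congr ?_ ?_)
        | refine (G.node_three _).trans (G.m_congr ?_ ?_ ?_)

theorem dA_q {x y z u v : Tree X Unit} (hx : G.Bin x) (hy : G.Bin y) (hz : G.Bin z)
    (hu : G.Bin u) (hv : G.Bin v) (i : Fin 4) : dA θ (s k (G.q i x y z u v)) =
      sub ![x, y, z, u, v]
        (quintic (P := freeOperad k X deg) (gen k G.two) (gen k G.three) i) := by
  have h := dA_sub θ (f := ![x, y, z, u, v])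
    (fun i => by fin_cases i <;> exact H.closed (by assumption)) (gen k (G.five i))
  rw [sub_gen, H.d_five] at h
  exact h

/-- The Leibniz rule for `μ₃ ∘ μ₃`: the outer vertex is differentiated with sign `+1`, the inner one
with sign `-1`, because the outer `μ₃` is odd. The trees `t₁, …, t₄` are left as parameters so that
each of the three positions can insert its normal form. -/
theorem dA_mm (i : Fin 3) {f : Fin 5 → Tree X Unit} (hf : ∀ i, G.Bin (f i))
    {t t₁ t₂ t₃ t₄ : Tree X Unit}
    (h : .node G.three (ins i (LinTree.corolla G.three).tree f) = t)
    (h₁ : .node G.two (ins 0 (LinTree.corolla G.two).tree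
      (ins (m := 3) i (LinTree.corolla G.three).tree f)) = t₁)
    (h₂ : .node G.two (ins 1 (LinTree.corolla G.two).tree
      (ins (m := 3) i (LinTree.corolla G.three).tree f)) = t₂)
    (h₃ : .node G.three (ins i ((LinTree.corolla G.two).graft 0 (LinTree.corolla G.two)).tree f)
      = t₃)
    (h₄ : .node G.three (ins i ((LinTree.corolla G.two).graft 1 (LinTree.corolla G.two)).tree f)
      = t₄) :
    dA θ (s k t) = s k t₁ + s k t₂ - (s k t₃ + s k t₄) := by
  have h0 := dA_sub θ (f := f) (fun i => H.closed (hf i))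
    ((freeOperad k X deg).comp i (gen k G.three) (gen k G.three))
  have h5 : ksign k (1 * 1) = -1 := by simp [ksign]
  rw [sub_circ_gen h] at h0
  refine h0.trans ((congrArg (sub f) (freeDer_comp θ i (gen k G.three) (gen k G.three))).trans ?_)
  rw [sgn_of_mem 1 (gen_mem _), H.d_three, H.deg_three, map_add (sub f), sub_eq_add_neg, h5,
    neg_smul, one_smul, map_neg, LinearMap.neg_apply, map_neg, map_add, LinearMap.add_apply,
    map_add, map_add, map_add]
  have h2 := H.deg_two
  refine congrArg₂ (· + ·) (congrArg₂ (· + ·) ?_ ?_) (congrArg Neg.neg (congrArg₂ (· + ·) ?_ ?_))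
  · exact sub_circ_circ_gen (p := 2) (q := 2) (r := 3) (i := 0) (j := i) (.inr ⟨h2, h2⟩) h₁
  · exact sub_circ_circ_gen (p := 2) (q := 2) (r := 3) (i := 1) (j := i) (.inr ⟨h2, h2⟩) h₂
  · exact sub_three_comp (p := 2) (q := 2) (j := 0) (i := i) h2 h₃
  · exact sub_three_comp (p := 2) (q := 2) (j := 1) (i := i) h2 h₄

theorem dA_mm₁ {x y z u v : Tree X Unit} (hx : G.Bin x) (hy : G.Bin y) (hz : G.Bin z)
    (hu : G.Bin u) (hv : G.Bin v) : dA θ (s k (G.m (G.m x y z) u v)) =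
      s k (G.b (G.b (G.m x y z) u) v) + s k (G.b (G.m x y z) (G.b u v)) -
        (s k (G.m (G.b (G.b x y) z) u v) + s k (G.m (G.b x (G.b y z)) u v)) := by
  refine H.dA_mm 0 (f := ![x, y, z, u, v]) (fun i => by fin_cases i <;> assumption) ?_ ?_ ?_ ?_ ?_
  all_goals
    repeat' first
      | rfl
      | refine (G.node_two _).trans (G.b_congr ?_ ?_)
      | refine (G.node_three _).trans (G.m_congr ?_ ?_ ?_)

theorem dA_mm₂ {x y z u v : Tree X Unit} (hx : G.Bin x) (hy : G.Bin y) (hz : G.Bin z)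
    (hu : G.Bin u) (hv : G.Bin v) : dA θ (s k (G.m x (G.m y z u) v)) =
      s k (G.b (G.b x (G.m y z u)) v) + s k (G.b x (G.b (G.m y z u) v)) -
        (s k (G.m x (G.b (G.b y z) u) v) + s k (G.m x (G.b y (G.b z u)) v)) := by
  refine H.dA_mm 1 (f := ![x, y, z, u, v]) (fun i => by fin_cases i <;> assumption) ?_ ?_ ?_ ?_ ?_
  all_goals
    repeat' first
      | rfl
      | refine (G.node_two _).trans (G.b_congr ?_ ?_)
      | refine (G.node_three _).trans (G.m_congr ?_ ?_ ?_)

theorem dA_mm₃ {x y z u v : Tree X Unit} (hx : G.Bin x) (hy : G.Bin y) (hz : G.Bin z)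
    (hu : G.Bin u) (hv : G.Bin v) : dA θ (s k (G.m x y (G.m z u v))) =
      s k (G.b (G.b x y) (G.m z u v)) + s k (G.b x (G.b y (G.m z u v))) -
        (s k (G.m x y (G.b (G.b z u) v)) + s k (G.m x y (G.b z (G.b u v)))) := by
  refine H.dA_mm 2 (f := ![x, y, z, u, v]) (fun i => by fin_cases i <;> assumption) ?_ ?_ ?_ ?_ ?_
  all_goals
    repeat' first
      | rfl
      | refine (G.node_two _).trans (G.b_congr ?_ ?_)
      | refine (G.node_three _).trans (G.m_congr ?_ ?_ ?_)

end IsLow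

/-! ### Bracketing with binary trees -/

namespace Gens

variable {X : ℕ → Type v} {deg : ∀ a, X a → ℤ} (G : Gens X)

/-- The tree with a binary root and the subtrees `t`, at the input `i`, and `r`. -/
def ctx (i : Fin 2) (r t : Tree X Unit) : Tree X Unit := .node G.two fun a => if a = i then t else r

theorem ctx_zero (r t : Tree X Unit) : G.ctx 0 r t = G.b t r := G.node_two _

theorem ctx_one (r t : Tree X Unit) : G.ctx 1 r t = G.b r t := G.node_two _

/-- `G.ctx` for combinations of trees. -/
def ctxMap (k : Type u) [Field k] (i : Fin 2) (r : Tree X Unit) :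
    (Tree X Unit →₀ k) →ₗ[k] (Tree X Unit →₀ k) := Finsupp.lmapDomain k k (G.ctx i r)

theorem ctxMap_single (i : Fin 2) (r t : Tree X Unit) : G.ctxMap k i r (s k t) = s k (G.ctx i r t) :=
  Finsupp.mapDomain_single

end Gens

namespace IsLow

variable {X : ℕ → Type v} {deg : ∀ a, X a → ℤ} {θ : FreeDer k deg} {G : Gens X} (H : IsLow θ G)

include H

/-- The root `μ₂` and the binary branch `r` are cycles of degree zero, so the differential acts in
the remaining branch only, without a sign. -/
theorem dA_ctxMap (i : Fin 2) {r : Tree X Unit} (hr : G.Bin r) (y : Tree X Unit →₀ k) :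
    dA θ (G.ctxMap k i r y) = G.ctxMap k i r (dA θ y) := by
  induction y using finsupp_induction with
  | single t =>
    let f : Fin (2 + t.len - 1) → Tree X Unit := fun c =>
      Sum.elim (fun _ => r) (fun _ => .leaf ()) ((slot i t.len).symm c)
    have hf1 : ∀ a, f (slot i _ (.inl a)) = r := fun a => by simp [f]
    have hf2 : ∀ b, f (slot i _ (.inr b)) = .leaf () := fun b => by simp [f]
    have key : ∀ z : (freeOperad k X deg).obj t.len,
        sub f ((freeOperad k X deg).comp i (gen k G.two) z) =
          G.ctxMap k i r (forget k deg t.len z) := by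
      intro z
      induction z using free_induction with
      | elem w =>
        rw [gen_eq, sub_elem_comp i w (after_corolla deg _ i), forget_elem]
        refine Eq.trans ?_ (G.ctxMap_single i r _).symm
        refine congrArg (fun g => s k (Tree.node G.two g)) (funext fun a => ?_)
        by_cases ha : a = i
        · subst ha
          change ins a w.tree f a = _
          rw [ins, dif_pos rfl, if_pos rfl]
          simp only [hf2]
          rfl
        · change ins i w.tree f a = _
          rw [ins, dif_neg ha, if_neg ha, hf1]
      | zero => simp only [map_zero]
      | add x y hx hy => simp only [map_add, hx, hy]
      | smul c x hx => simp only [map_smul, hx]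
    have h1 : (Finsupp.single t 1 : Tree X Unit →₀ k) =
        forget k deg t.len (t.lab.elem k deg) := by rw [forget_elem, t.shape_lab]
    rw [h1, ← key, dA_forget, ← key, dA_sub]
    · rw [freeDer_comp, H.d_two, map_zero, LinearMap.zero_apply, zero_add,
        sgn_of_mem 1 (gen_mem _), H.deg_two, mul_zero, ksign_zero, one_smul]
    · intro c
      obtain ⟨c, rfl⟩ := (slot i _).surjective c
      rcases c with c | c
      · rw [hf1]; exact H.closed hr
      · rw [hf2]; trivial
  | zero => simp only [map_zero]
  | add x y hx hy => simp only [map_add, hx, hy]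
  | smul c x hx => simp only [map_smul, hx]

end IsLow

end

end AntiAss

namespace AntiAss

universe w

noncomputable section

variable {k : Type u} [Field k]

open Operad

/-! ### Contractions of binary trees -/

namespace Gens

variable {X : ℕ → Type v} (G : Gens X)

section

variable (k)

/-- The vertices of the pentagon are numbered as `((xy)z)u`, `(x(yz))u`, `(xy)(zu)`, `x((yz)u)`,
`x(y(zu))`. In `Hᵢ` the signs alternate around the pentagon except at the `i`-th vertex, where two
edges with sign `+1` meet. So everything cancels in the boundary of `Hᵢ` but twice the `i`-th
vertex. -/
def H1 (x y z u : Tree X Unit) : Tree X Unit →₀ k :=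
    s k (G.m (G.b x y) z u) + s k (G.b (G.m x y z) u) + s k (G.b x (G.m y z u))
    - s k (G.m x (G.b y z) u)
    - s k (G.m x y (G.b z u))

def H2 (x y z u : Tree X Unit) : Tree X Unit →₀ k :=
    s k (G.m x (G.b y z) u) + s k (G.m x y (G.b z u)) + s k (G.b (G.m x y z) u)
    - s k (G.m (G.b x y) z u)
    - s k (G.b x (G.m y z u))

def H3 (x y z u : Tree X Unit) : Tree X Unit →₀ k :=
    s k (G.m (G.b x y) z u) + s k (G.m x (G.b y z) u) + s k (G.m x y (G.b z u))
    - s k (G.b (G.m x y z) u)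
    - s k (G.b x (G.m y z u))

def H4 (x y z u : Tree X Unit) : Tree X Unit →₀ k :=
    s k (G.m (G.b x y) z u) + s k (G.m x (G.b y z) u) + s k (G.b x (G.m y z u))
    - s k (G.m x y (G.b z u))
    - s k (G.b (G.m x y z) u)

def H5 (x y z u : Tree X Unit) : Tree X Unit →₀ k :=
    s k (G.m x y (G.b z u)) + s k (G.b (G.m x y z) u) + s k (G.b x (G.m y z u))
    - s k (G.m (G.b x y) z u)
    - s k (G.m x (G.b y z) u)

/-- `Q0`, …, `Q3` are the boundaries of the four vertices `μ₅` with binary trees at their inputs. -/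
def Q0 (x y z u v : Tree X Unit) : Tree X Unit →₀ k :=
    s k (G.b x (G.m y z (G.b u v))) - s k (G.m x y (G.b z (G.b u v)))
        + s k (G.b (G.b x y) (G.m z u v)) - s k (G.m (G.b x y) (G.b z u) v)
        + s k (G.b (G.m (G.b x y) z u) v) - s k (G.m (G.b (G.b x y) z) u v)
        + s k (G.b (G.m x y z) (G.b u v)) - s k (G.m x (G.b y z) (G.b u v))

def Q1 (x y z u v : Tree X Unit) : Tree X Unit →₀ k :=
    s k (G.m (G.b (G.b x y) z) u v) - s k (G.b (G.m (G.b x y) z u) v)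
        + s k (G.b (G.m x y (G.b z u)) v) - s k (G.m x (G.b y (G.b z u)) v)
        + s k (G.b x (G.m y (G.b z u) v)) - s k (G.m x y (G.b (G.b z u) v))
        + s k (G.b (G.b x y) (G.m z u v)) - s k (G.m (G.b x y) z (G.b u v))

def Q2 (x y z u v : Tree X Unit) : Tree X Unit →₀ k :=
    s k (G.m x (G.b y z) (G.b u v)) - s k (G.b x (G.m (G.b y z) u v))
        + s k (G.m x (G.b (G.b y z) u) v) - s k (G.b (G.b x (G.m y z u)) v)
        + s k (G.b (G.m x y (G.b z u)) v) - s k (G.b (G.m (G.b x y) z u) v)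
        + s k (G.b (G.b (G.m x y z) u) v) - s k (G.m (G.b x (G.b y z)) u v)

def Q3 (x y z u v : Tree X Unit) : Tree X Unit →₀ k :=
    s k (G.m (G.b x y) (G.b z u) v) - s k (G.m x y (G.b (G.b z u) v))
        + s k (G.b x (G.m y (G.b z u) v)) - s k (G.m x (G.b y (G.b z u)) v)
        + s k (G.b (G.b x (G.m y z u)) v) - s k (G.b (G.m x (G.b y z) u) v)
        + s k (G.b (G.b (G.m x y z) u) v) - s k (G.b (G.m (G.b x y) z u) v)

/-- `M1`, `M2`, `M3` are the boundaries of the three trees with two vertices `μ₃`. They correspond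
to the three quadrangles of `K₅`. -/
def M1 (x y z u v : Tree X Unit) : Tree X Unit →₀ k :=
      s k (G.b (G.b (G.m x y z) u) v) + s k (G.b (G.m x y z) (G.b u v)) -
        (s k (G.m (G.b (G.b x y) z) u v) + s k (G.m (G.b x (G.b y z)) u v))

def M2 (x y z u v : Tree X Unit) : Tree X Unit →₀ k :=
      s k (G.b (G.b x (G.m y z u)) v) + s k (G.b x (G.b (G.m y z u) v)) -
        (s k (G.m x (G.b (G.b y z) u) v) + s k (G.m x (G.b y (G.b z u)) v))

def M3 (x y z u v : Tree X Unit) : Tree X Unit →₀ k :=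
      s k (G.b (G.b x y) (G.m z u v)) + s k (G.b x (G.b y (G.m z u v))) -
        (s k (G.m x y (G.b (G.b z u) v)) + s k (G.m x y (G.b z (G.b u v))))

end

end Gens

/-- The boundaries of the combinations of trees whose vertices are in `G`. -/
def boundaries {X : ℕ → Type v} {deg : ∀ a, X a → ℤ} (θ : FreeDer k deg) (G : Gens X) :
    Submodule k (Tree X Unit →₀ k) :=
  (Finsupp.supported k k {t | t.All G.Low}).map (dA θ)

theorem single_low {X : ℕ → Type v} {G : Gens X} {t : Tree X Unit} (h : t.All G.Low) :
    s k t ∈ Finsupp.supported k k {t | t.All G.Low} := Finsupp.single_mem_supported k 1 h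

namespace IsLow

open Gens

variable {X : ℕ → Type v} {deg : ∀ a, X a → ℤ} {θ : FreeDer k deg} {G : Gens X}

section

variable (H : IsLow θ G) {x y z u v : Tree X Unit} (hx : G.Bin x) (hy : G.Bin y) (hz : G.Bin z)
  (hu : G.Bin u) (hv : G.Bin v)

include H hx hy hz hu hv

theorem Q0_mem : G.Q0 k x y z u v ∈ boundaries θ G :=
  ⟨_, single_low (Low.q 0 hx.low hy.low hz.low hu.low hv.low),
    (H.dA_q hx hy hz hu hv 0).trans (H.sub_quintic x y z u v 0)⟩

theorem Q1_mem : G.Q1 k x y z u v ∈ boundaries θ G :=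
  ⟨_, single_low (Low.q 1 hx.low hy.low hz.low hu.low hv.low),
    (H.dA_q hx hy hz hu hv 1).trans (H.sub_quintic x y z u v 1)⟩

theorem Q2_mem : G.Q2 k x y z u v ∈ boundaries θ G :=
  ⟨_, single_low (Low.q 2 hx.low hy.low hz.low hu.low hv.low),
    (H.dA_q hx hy hz hu hv 2).trans (H.sub_quintic x y z u v 2)⟩

theorem Q3_mem : G.Q3 k x y z u v ∈ boundaries θ G :=
  ⟨_, single_low (Low.q 3 hx.low hy.low hz.low hu.low hv.low),
    (H.dA_q hx hy hz hu hv 3).trans (H.sub_quintic x y z u v 3)⟩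

theorem M1_mem : G.M1 k x y z u v ∈ boundaries θ G :=
  ⟨_, single_low (Low.m (Low.m hx.low hy.low hz.low) hu.low hv.low), H.dA_mm₁ hx hy hz hu hv⟩

theorem M2_mem : G.M2 k x y z u v ∈ boundaries θ G :=
  ⟨_, single_low (Low.m hx.low (Low.m hy.low hz.low hu.low) hv.low), H.dA_mm₂ hx hy hz hu hv⟩

theorem M3_mem : G.M3 k x y z u v ∈ boundaries θ G :=
  ⟨_, single_low (Low.m hx.low hy.low (Low.m hz.low hu.low hv.low)), H.dA_mm₃ hx hy hz hu hv⟩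

/-- Both terms contract the same bracketing `((xy)z)(uv)` of five trees, so both have twice this
bracketing as boundary, and their difference is a cycle of edges of `K₅`. The same happens in each
of the following identities. The seven cycles `Q0`, …, `Q3`, `M1`, `M2`, `M3` span all such cycles,
and the coefficients displayed express the difference in them; here the difference is a single
closed path. -/
theorem H1_sub_H3 : G.H1 k x y z (G.b u v) - G.H3 k (G.b x y) z u v ∈ boundaries θ G := by
  have h : G.H1 k x y z (G.b u v) - G.H3 k (G.b x y) z u v =
      G.Q0 k x y z u v := by
    simp only [H1, H3, Q0]
    abel
  rw [h]
  exact (H.Q0_mem hx hy hz hu hv)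

theorem H2_sub_H3 : G.H2 k x y z (G.b u v) - G.H3 k x (G.b y z) u v ∈ boundaries θ G := by
  have h : G.H2 k x y z (G.b u v) - G.H3 k x (G.b y z) u v =
      -G.Q0 k x y z u v + G.Q1 k x y z u v - G.Q2 k x y z u v - G.Q3 k x y z u v + G.M1 k x y z u v + G.M1 k x y z u v := by
    simp only [H2, H3, Q0, Q1, Q2, Q3, M1]
    abel
  rw [h]
  exact (add_mem (add_mem (sub_mem (sub_mem (add_mem (neg_mem (H.Q0_mem hx hy hz hu hv)) (H.Q1_mem hx hy hz hu hv)) (H.Q2_mem hx hy hz hu hv)) (H.Q3_mem hx hy hz hu hv)) (H.M1_mem hx hy hz hu hv)) (H.M1_mem hx hy hz hu hv))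

theorem H4_sub_H3 : G.H4 k (G.b x y) z u v - G.H3 k x y (G.b z u) v ∈ boundaries θ G := by
  have h : G.H4 k (G.b x y) z u v - G.H3 k x y (G.b z u) v =
      G.Q1 k x y z u v := by
    simp only [H3, H4, Q1]
    abel
  rw [h]
  exact (H.Q1_mem hx hy hz hu hv)

theorem H5_sub_H3 : G.H5 k (G.b x y) z u v - G.H3 k x y z (G.b u v) ∈ boundaries θ G := by
  have h : G.H5 k (G.b x y) z u v - G.H3 k x y z (G.b u v) =
      G.Q0 k x y z u v := by
    simp only [H3, H5, Q0]
    abel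
  rw [h]
  exact (H.Q0_mem hx hy hz hu hv)

theorem H1_sub_H2 : G.H1 k x y (G.b z u) v - G.H2 k (G.b x y) z u v ∈ boundaries θ G := by
  have h : G.H1 k x y (G.b z u) v - G.H2 k (G.b x y) z u v =
      G.Q1 k x y z u v := by
    simp only [H1, H2, Q1]
    abel
  rw [h]
  exact (H.Q1_mem hx hy hz hu hv)

theorem H4_sub_H5 : G.H4 k x y z (G.b u v) - G.H5 k x (G.b y z) u v ∈ boundaries θ G := by
  have h : G.H4 k x y z (G.b u v) - G.H5 k x (G.b y z) u v =
      G.Q0 k x y z u v - G.Q1 k x y z u v + G.Q2 k x y z u v + G.Q3 k x y z u v - G.M1 k x y z u v - G.M1 k x y z u v := by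
    simp only [H4, H5, Q0, Q1, Q2, Q3, M1]
    abel
  rw [h]
  exact (sub_mem (sub_mem (add_mem (add_mem (sub_mem (H.Q0_mem hx hy hz hu hv) (H.Q1_mem hx hy hz hu hv)) (H.Q2_mem hx hy hz hu hv)) (H.Q3_mem hx hy hz hu hv)) (H.M1_mem hx hy hz hu hv)) (H.M1_mem hx hy hz hu hv))

/-- For each of the five bracketings of the left branch, a contraction at the top of that branch is
homologous to one at the root of the whole tree. -/
theorem left_H1 : G.ctxMap k 0 v (G.H1 k x y z u) - G.H1 k (G.b x y) z u v ∈ boundaries θ G := by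
  have h : G.ctxMap k 0 v (G.H1 k x y z u) - G.H1 k (G.b x y) z u v =
      -G.Q1 k x y z u v + G.Q3 k x y z u v := by
    simp only [H1, Q1, Q3, map_add, map_sub, ctxMap_single, ctx_zero]
    abel
  rw [h]
  exact (add_mem (neg_mem (H.Q1_mem hx hy hz hu hv)) (H.Q3_mem hx hy hz hu hv))

theorem left_H2 : G.ctxMap k 0 v (G.H2 k x y z u) - G.H1 k x (G.b y z) u v ∈ boundaries θ G := by
  have h : G.ctxMap k 0 v (G.H2 k x y z u) - G.H1 k x (G.b y z) u v =
      G.Q2 k x y z u v := by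
    simp only [H1, H2, Q2, map_add, map_sub, ctxMap_single, ctx_zero]
    abel
  rw [h]
  exact (H.Q2_mem hx hy hz hu hv)

theorem left_H3 : G.ctxMap k 0 v (G.H3 k x y z u) - G.H1 k x y (G.b z u) v ∈ boundaries θ G := by
  have h : G.ctxMap k 0 v (G.H3 k x y z u) - G.H1 k x y (G.b z u) v =
      -G.Q3 k x y z u v := by
    simp only [H1, H3, Q3, map_add, map_sub, ctxMap_single, ctx_zero]
    abel
  rw [h]
  exact (neg_mem (H.Q3_mem hx hy hz hu hv))

theorem left_H4 : G.ctxMap k 0 v (G.H4 k x y z u) - G.H2 k x (G.b y z) u v ∈ boundaries θ G := by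
  have h : G.ctxMap k 0 v (G.H4 k x y z u) - G.H2 k x (G.b y z) u v =
      -G.Q2 k x y z u v := by
    simp only [H2, H4, Q2, map_add, map_sub, ctxMap_single, ctx_zero]
    abel
  rw [h]
  exact (neg_mem (H.Q2_mem hx hy hz hu hv))

theorem left_H5 : G.ctxMap k 0 v (G.H5 k x y z u) - G.H2 k x y (G.b z u) v ∈ boundaries θ G := by
  have h : G.ctxMap k 0 v (G.H5 k x y z u) - G.H2 k x y (G.b z u) v =
      G.Q3 k x y z u v := by
    simp only [H2, H5, Q3, map_add, map_sub, ctxMap_single, ctx_zero]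
    abel
  rw [h]
  exact (H.Q3_mem hx hy hz hu hv)

/-- The counterpart for the right branch, where the quadrangles `M1`, `M2`, `M3` enter as well. -/
theorem right_H1 : G.ctxMap k 1 x (G.H1 k y z u v) - G.H4 k x (G.b y z) u v ∈ boundaries θ G := by
  have h : G.ctxMap k 1 x (G.H1 k y z u v) - G.H4 k x (G.b y z) u v =
      -G.Q0 k x y z u v - G.Q3 k x y z u v + G.M1 k x y z u v + G.M2 k x y z u v + G.M3 k x y z u v := by
    simp only [H1, H4, Q0, Q3, M1, M2, M3, map_add, map_sub, ctxMap_single, ctx_one]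
    abel
  rw [h]
  exact (add_mem (add_mem (add_mem (sub_mem (neg_mem (H.Q0_mem hx hy hz hu hv)) (H.Q3_mem hx hy hz hu hv)) (H.M1_mem hx hy hz hu hv)) (H.M2_mem hx hy hz hu hv)) (H.M3_mem hx hy hz hu hv))

theorem right_H2 : G.ctxMap k 1 x (G.H2 k y z u v) - G.H4 k x y (G.b z u) v ∈ boundaries θ G := by
  have h : G.ctxMap k 1 x (G.H2 k y z u v) - G.H4 k x y (G.b z u) v =
      G.Q0 k x y z u v + G.Q2 k x y z u v - G.M1 k x y z u v + G.M2 k x y z u v - G.M3 k x y z u v := by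
    simp only [H2, H4, Q0, Q2, M1, M2, M3, map_add, map_sub, ctxMap_single, ctx_one]
    abel
  rw [h]
  exact (sub_mem (add_mem (sub_mem (add_mem (H.Q0_mem hx hy hz hu hv) (H.Q2_mem hx hy hz hu hv)) (H.M1_mem hx hy hz hu hv)) (H.M2_mem hx hy hz hu hv)) (H.M3_mem hx hy hz hu hv))

theorem right_H3 : G.ctxMap k 1 x (G.H3 k y z u v) - G.H5 k x (G.b y z) u v ∈ boundaries θ G := by
  have h : G.ctxMap k 1 x (G.H3 k y z u v) - G.H5 k x (G.b y z) u v =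
      G.Q0 k x y z u v + G.Q3 k x y z u v - G.M1 k x y z u v - G.M2 k x y z u v - G.M3 k x y z u v := by
    simp only [H3, H5, Q0, Q3, M1, M2, M3, map_add, map_sub, ctxMap_single, ctx_one]
    abel
  rw [h]
  exact (sub_mem (sub_mem (sub_mem (add_mem (H.Q0_mem hx hy hz hu hv) (H.Q3_mem hx hy hz hu hv)) (H.M1_mem hx hy hz hu hv)) (H.M2_mem hx hy hz hu hv)) (H.M3_mem hx hy hz hu hv))

theorem right_H4 : G.ctxMap k 1 x (G.H4 k y z u v) - G.H5 k x y (G.b z u) v ∈ boundaries θ G := by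
  have h : G.ctxMap k 1 x (G.H4 k y z u v) - G.H5 k x y (G.b z u) v =
      -G.Q0 k x y z u v - G.Q2 k x y z u v + G.M1 k x y z u v - G.M2 k x y z u v + G.M3 k x y z u v := by
    simp only [H4, H5, Q0, Q2, M1, M2, M3, map_add, map_sub, ctxMap_single, ctx_one]
    abel
  rw [h]
  exact (add_mem (sub_mem (add_mem (sub_mem (neg_mem (H.Q0_mem hx hy hz hu hv)) (H.Q2_mem hx hy hz hu hv)) (H.M1_mem hx hy hz hu hv)) (H.M2_mem hx hy hz hu hv)) (H.M3_mem hx hy hz hu hv))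

theorem right_H5 : G.ctxMap k 1 x (G.H5 k y z u v) - G.H5 k x y z (G.b u v) ∈ boundaries θ G := by
  have h : G.ctxMap k 1 x (G.H5 k y z u v) - G.H5 k x y z (G.b u v) =
      -G.Q1 k x y z u v + G.Q2 k x y z u v - G.M1 k x y z u v + G.M2 k x y z u v + G.M3 k x y z u v := by
    simp only [H5, Q1, Q2, M1, M2, M3, map_add, map_sub, ctxMap_single, ctx_one]
    abel
  rw [h]
  exact (add_mem (add_mem (sub_mem (add_mem (neg_mem (H.Q1_mem hx hy hz hu hv)) (H.Q2_mem hx hy hz hu hv)) (H.M1_mem hx hy hz hu hv)) (H.M2_mem hx hy hz hu hv)) (H.M3_mem hx hy hz hu hv))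

end

end IsLow

end

end AntiAss

/-! ### Vanishing of the homology in degrees zero and one -/

namespace AntiAss

universe w

noncomputable section

variable {k : Type u} [Field k]

open Operad

namespace Gens

variable {X : ℕ → Type v} {G : Gens X}

theorem b_inj {l r l' r' : Tree X Unit} : G.b l r = G.b l' r' ↔ l = l' ∧ r = r' := by
  refine ⟨fun h => ?_, fun ⟨h, h'⟩ => by rw [h, h']⟩
  simp only [b, Tree.node.injEq, heq_eq_eq, true_and] at h
  exact ⟨congrFun h 0, congrFun h 1⟩

theorem leaf_ne_b {l r : Tree X Unit} : Tree.leaf () ≠ G.b l r := nofun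

theorem len_b (l r : Tree X Unit) : (G.b l r).len = l.len + r.len := by
  rw [b, Tree.len_node, Fin.sum_univ_two]; rfl

theorem len_m (x y z : Tree X Unit) : (G.m x y z).len = x.len + y.len + z.len := by
  rw [m, Tree.len_node, Fin.sum_univ_three]; rfl

theorem Bin.cases' {t : Tree X Unit} (h : G.Bin t) :
    t = .leaf () ∨ ∃ l r, t = G.b l r ∧ G.Bin l ∧ G.Bin r := by
  cases h with
  | leaf => exact .inl rfl
  | b hl hr => exact .inr ⟨_, _, rfl, hl, hr⟩

theorem Bin.of_b {l r : Tree X Unit} (h : G.Bin (G.b l r)) : G.Bin l ∧ G.Bin r := by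
  rcases h.cases' with h | ⟨l', r', e, hl, hr⟩
  · exact absurd h.symm leaf_ne_b
  · obtain ⟨rfl, rfl⟩ := b_inj.1 e
    exact ⟨hl, hr⟩

theorem Bin.one_le {t : Tree X Unit} (h : G.Bin t) : 1 ≤ t.len := by
  induction h with
  | leaf => exact le_rfl
  | b _ _ h h' => rw [len_b]; omega

variable (k G) in
/-- The contractions at the root of the binary tree with the branches `l` and `r`, up to a
factor `2`. -/
inductive Root (l r : Tree X Unit) : (Tree X Unit →₀ k) → Prop
  | v1 {x y z : Tree X Unit} (hx : G.Bin x) (hy : G.Bin y) (hz : G.Bin z) (hr : G.Bin r)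
      (e : l = G.b (G.b x y) z) : Root l r (G.H1 k x y z r)
  | v2 {x y z : Tree X Unit} (hx : G.Bin x) (hy : G.Bin y) (hz : G.Bin z) (hr : G.Bin r)
      (e : l = G.b x (G.b y z)) : Root l r (G.H2 k x y z r)
  | v3 {x y z u : Tree X Unit} (hx : G.Bin x) (hy : G.Bin y) (hz : G.Bin z) (hu : G.Bin u)
      (e : l = G.b x y) (e' : r = G.b z u) : Root l r (G.H3 k x y z u)
  | v4 {y z u : Tree X Unit} (hl : G.Bin l) (hy : G.Bin y) (hz : G.Bin z) (hu : G.Bin u)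
      (e : r = G.b (G.b y z) u) : Root l r (G.H4 k l y z u)
  | v5 {y z u : Tree X Unit} (hl : G.Bin l) (hy : G.Bin y) (hz : G.Bin z) (hu : G.Bin u)
      (e : r = G.b y (G.b z u)) : Root l r (G.H5 k l y z u)

variable (k G) in
/-- The contractions of a binary tree. -/
inductive Fill : Tree X Unit → (Tree X Unit →₀ k) → Prop
  | root {t l r y} (e : t = G.b l r) (h : Root k G l r y) : Fill t y
  | left {t l r y} (e : t = G.b l r) (hr : G.Bin r) (h : Fill l y) : Fill t (G.ctxMap k 0 r y)
  | right {t l r y} (e : t = G.b l r) (hl : G.Bin l) (h : Fill r y) : Fill t (G.ctxMap k 1 l y)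

variable (G) in
/-- The trees of degree one, with their two resolutions. -/
inductive Edge : Tree X Unit → Tree X Unit → Tree X Unit → Prop
  | m {x y z} (hx : G.Bin x) (hy : G.Bin y) (hz : G.Bin z) :
      Edge (G.m x y z) (G.b (G.b x y) z) (G.b x (G.b y z))
  | left {u t t' r} (hr : G.Bin r) (h : Edge u t t') : Edge (G.b u r) (G.b t r) (G.b t' r)
  | right {u t t' l} (hl : G.Bin l) (h : Edge u t t') : Edge (G.b l u) (G.b l t) (G.b l t')

theorem Root.bin {l r : Tree X Unit} {y} (h : Root k G l r y) : G.Bin l ∧ G.Bin r := by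
  cases h with
  | v1 hx hy hz hr e => exact ⟨e ▸ .b (.b hx hy) hz, hr⟩
  | v2 hx hy hz hr e => exact ⟨e ▸ .b hx (.b hy hz), hr⟩
  | v3 hx hy hz hu e e' => exact ⟨e ▸ .b hx hy, e' ▸ .b hz hu⟩
  | v4 hl hy hz hu e => exact ⟨hl, e ▸ .b (.b hy hz) hu⟩
  | v5 hl hy hz hu e => exact ⟨hl, e ▸ .b hy (.b hz hu)⟩

theorem Root.len {l r : Tree X Unit} {y} (h : Root k G l r y) : 4 ≤ l.len + r.len := by
  cases h with
  | v1 hx hy hz hr e =>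
    rw [e, len_b, len_b]; have := hx.one_le; have := hy.one_le; have := hz.one_le
    have := hr.one_le; omega
  | v2 hx hy hz hr e =>
    rw [e, len_b, len_b]; have := hx.one_le; have := hy.one_le; have := hz.one_le
    have := hr.one_le; omega
  | v3 hx hy hz hu e e' =>
    rw [e, e', len_b, len_b]; have := hx.one_le; have := hy.one_le; have := hz.one_le
    have := hu.one_le; omega
  | v4 hl hy hz hu e =>
    rw [e, len_b, len_b]; have := hl.one_le; have := hy.one_le; have := hz.one_le
    have := hu.one_le; omega
  | v5 hl hy hz hu e =>
    rw [e, len_b, len_b]; have := hl.one_le; have := hy.one_le; have := hz.one_le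
    have := hu.one_le; omega

variable (k) in
-- With four leaves there are two further vertices that form a connected piece with the root: one in
-- each branch, or, if a branch is a leaf, two in the other branch. Their relative position is the
-- vertex of the pentagon.
theorem exists_root {l r : Tree X Unit} (hl : G.Bin l) (hr : G.Bin r) (h : 4 ≤ l.len + r.len) :
    ∃ y, Root k G l r y := by
  rcases hl.cases' with rfl | ⟨x, y, rfl, hx, hy⟩
  · rcases hr.cases' with rfl | ⟨z, u, rfl, hz, hu⟩
    · change 4 ≤ 1 + 1 at h; omega
    · rcases hz.cases' with rfl | ⟨z, z', rfl, hz, hz'⟩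
      · rcases hu.cases' with rfl | ⟨u, u', rfl, hu, hu'⟩
        · rw [len_b] at h; change 4 ≤ 1 + (1 + 1) at h; omega
        · exact ⟨_, .v5 hl hz hu hu' rfl⟩
      · exact ⟨_, .v4 hl hz hz' hu rfl⟩
  · rcases hr.cases' with rfl | ⟨z, u, rfl, hz, hu⟩
    · rcases hx.cases' with rfl | ⟨z, z', rfl, hz, hz'⟩
      · rcases hy.cases' with rfl | ⟨u, u', rfl, hu, hu'⟩
        · rw [len_b] at h; change 4 ≤ 1 + 1 + 1 at h; omega
        · exact ⟨_, .v2 hx hu hu' hr rfl⟩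
      · exact ⟨_, .v1 hz hz' hy hr rfl⟩
    · exact ⟨_, .v3 hx hy hz hu rfl rfl⟩

theorem Fill.bin {t : Tree X Unit} {y} (h : Fill k G t y) : G.Bin t ∧ 4 ≤ t.len := by
  induction h with
  | root e h => rw [e, len_b]; exact ⟨.b h.bin.1 h.bin.2, h.len⟩
  | left e hr h ih => rw [e, len_b]; exact ⟨.b ih.1 hr, by have := ih.2; omega⟩
  | right e hl h ih => rw [e, len_b]; exact ⟨.b hl ih.1, by have := ih.2; omega⟩

theorem Edge.len {u t t' : Tree X Unit} (h : G.Edge u t t') : 3 ≤ u.len := by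
  induction h with
  | m hx hy hz =>
    rw [len_m]; have := hx.one_le; have := hy.one_le; have := hz.one_le; omega
  | left hr h ih => rw [len_b]; omega
  | right hl h ih => rw [len_b]; omega

theorem ctxMap_low (i : Fin 2) {r : Tree X Unit} (hr : r.All G.Low) {y : Tree X Unit →₀ k}
    (hy : y ∈ Finsupp.supported k k {t | t.All G.Low}) :
    G.ctxMap k i r y ∈ Finsupp.supported k k {t | t.All G.Low} := by
  refine supported_induction
    (P := fun y => G.ctxMap k i r y ∈ Finsupp.supported k k {t | t.All G.Low}) hy
    (fun t ht => ?_) ?_ (fun x y hx hy => ?_) (fun c x hx => ?_)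
  · rw [ctxMap_single]
    refine single_low ⟨.two, fun j => ?_⟩
    change (if j = i then t else r).All G.Low
    split_ifs
    exacts [ht, hr]
  · rw [map_zero]; exact Submodule.zero_mem _
  · rw [map_add]; exact Submodule.add_mem _ hx hy
  · rw [map_smul]; exact Submodule.smul_mem _ _ hx

theorem Root.low {l r : Tree X Unit} {y} (h : Root k G l r y) :
    y ∈ Finsupp.supported k k {t | t.All G.Low} := by
  cases h with
  | @v1 x y z hx hy hz hu e =>
    have hx := hx.low; have hy := hy.low; have hz := hz.low; have hu := hu.low
    exact sub_mem (sub_mem (add_mem (add_mem (single_low (Low.m (Low.b hx hy) hz hu))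
      (single_low (Low.b (Low.m hx hy hz) hu))) (single_low (Low.b hx (Low.m hy hz hu))))
      (single_low (Low.m hx (Low.b hy hz) hu))) (single_low (Low.m hx hy (Low.b hz hu)))
  | @v2 x y z hx hy hz hu e =>
    have hx := hx.low; have hy := hy.low; have hz := hz.low; have hu := hu.low
    exact sub_mem (sub_mem (add_mem (add_mem (single_low (Low.m hx (Low.b hy hz) hu))
      (single_low (Low.m hx hy (Low.b hz hu)))) (single_low (Low.b (Low.m hx hy hz) hu)))
      (single_low (Low.m (Low.b hx hy) hz hu))) (single_low (Low.b hx (Low.m hy hz hu)))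
  | @v3 x y z u hx hy hz hu e e' =>
    have hx := hx.low; have hy := hy.low; have hz := hz.low; have hu := hu.low
    exact sub_mem (sub_mem (add_mem (add_mem (single_low (Low.m (Low.b hx hy) hz hu))
      (single_low (Low.m hx (Low.b hy hz) hu))) (single_low (Low.m hx hy (Low.b hz hu))))
      (single_low (Low.b (Low.m hx hy hz) hu))) (single_low (Low.b hx (Low.m hy hz hu)))
  | @v4 y z u hx hy hz hu e =>
    have hx := hx.low; have hy := hy.low; have hz := hz.low; have hu := hu.low
    exact sub_mem (sub_mem (add_mem (add_mem (single_low (Low.m (Low.b hx hy) hz hu))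
      (single_low (Low.m hx (Low.b hy hz) hu))) (single_low (Low.b hx (Low.m hy hz hu))))
      (single_low (Low.m hx hy (Low.b hz hu)))) (single_low (Low.b (Low.m hx hy hz) hu))
  | @v5 y z u hx hy hz hu e =>
    have hx := hx.low; have hy := hy.low; have hz := hz.low; have hu := hu.low
    exact sub_mem (sub_mem (add_mem (add_mem (single_low (Low.m hx hy (Low.b hz hu)))
      (single_low (Low.b (Low.m hx hy hz) hu))) (single_low (Low.b hx (Low.m hy hz hu))))
      (single_low (Low.m (Low.b hx hy) hz hu))) (single_low (Low.m hx (Low.b hy hz) hu))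

end Gens

section

variable {X : ℕ → Type v} {deg : ∀ a, X a → ℤ}

theorem boundaries_symm {θ : FreeDer k deg} {G : Gens X} {x y : Tree X Unit →₀ k} (h : x - y ∈ boundaries θ G) :
    y - x ∈ boundaries θ G := by
  rw [← neg_sub]; exact neg_mem h

theorem boundaries_trans {θ : FreeDer k deg} {G : Gens X} {x y z : Tree X Unit →₀ k} (h : x - y ∈ boundaries θ G)
    (h' : y - z ∈ boundaries θ G) : x - z ∈ boundaries θ G := by
  rw [← sub_add_sub_cancel x y z]; exact add_mem h h'

end

namespace IsLow

open Gens

variable {X : ℕ → Type v} {deg : ∀ a, X a → ℤ} {θ : FreeDer k deg} {G : Gens X} (H : IsLow θ G)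

include H

theorem ctxMap_boundaries (i : Fin 2) {r : Tree X Unit} (hr : G.Bin r) {y : Tree X Unit →₀ k}
    (hy : y ∈ boundaries θ G) : G.ctxMap k i r y ∈ boundaries θ G := by
  obtain ⟨w, hw, rfl⟩ := hy
  exact ⟨_, ctxMap_low i hr.low hw, H.dA_ctxMap i hr w⟩

theorem dA_left {t r : Tree X Unit} (hr : G.Bin r) :
    dA θ (s k (G.b t r)) = G.ctxMap k 0 r (dA θ (s k t)) := by
  rw [← H.dA_ctxMap 0 hr, ctxMap_single, ctx_zero]

theorem dA_right {t l : Tree X Unit} (hl : G.Bin l) :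
    dA θ (s k (G.b l t)) = G.ctxMap k 1 l (dA θ (s k t)) := by
  rw [← H.dA_ctxMap 1 hl, ctxMap_single, ctx_one]

/-- The computation in the pentagon: each edge contributes the sum of its two ends, and the signs in
`H1`, …, `H5` cancel all vertices except the chosen one. -/
theorem dA_root {l r : Tree X Unit} {y} (h : Root k G l r y) :
    dA θ y = (2 : k) • s k (G.b l r) := by
  rw [two_smul]
  rcases h with ⟨hx, hy, hz, hu, rfl⟩ | ⟨hx, hy, hz, hu, rfl⟩ | ⟨hx, hy, hz, hu, rfl, rfl⟩ |
    ⟨hx, hy, hz, hu, rfl⟩ | ⟨hx, hy, hz, hu, rfl⟩ <;>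
  · simp only [H1, H2, H3, H4, H5, map_sub, map_add, H.dA_m (.b hx hy) hz hu,
      H.dA_m hx (.b hy hz) hu, H.dA_m hx hy (.b hz hu), H.dA_left hu, H.dA_right hx,
      H.dA_m hx hy hz, H.dA_m hy hz hu, ctxMap_single, ctx_zero, ctx_one]
    abel

theorem dA_edge {u t t' : Tree X Unit} (h : G.Edge u t t') : dA θ (s k u) = s k t + s k t' := by
  induction h with
  | m hx hy hz => exact H.dA_m hx hy hz
  | left hr h ih => rw [H.dA_left hr, ih, map_add, ctxMap_single, ctxMap_single, ctx_zero, ctx_zero]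
  | right hl h ih =>
    rw [H.dA_right hl, ih, map_add, ctxMap_single, ctxMap_single, ctx_one, ctx_one]

/-- When neither branch is a leaf, the balanced contraction exists and serves as a common reference.
Any other contraction at the root splits one of the four subtrees once more, which makes it a
comparison of bracketings of five trees. -/
theorem root_sub_H3 {x y z u : Tree X Unit} {w} (h : Root k G (G.b x y) (G.b z u) w) :
    w - G.H3 k x y z u ∈ boundaries θ G := by
  rcases h with ⟨hx, hy, hz, hu, e⟩ | ⟨hx, hy, hz, hu, e⟩ | ⟨hx, hy, hz, hu, e, e'⟩ |
    ⟨hx, hy, hz, hu, e⟩ | ⟨hx, hy, hz, hu, e⟩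
  · obtain ⟨rfl, rfl⟩ := b_inj.1 e
    exact H.H1_sub_H3 hx hy hz hu.of_b.1 hu.of_b.2
  · obtain ⟨rfl, rfl⟩ := b_inj.1 e
    exact H.H2_sub_H3 hx hy hz hu.of_b.1 hu.of_b.2
  · obtain ⟨rfl, rfl⟩ := b_inj.1 e
    obtain ⟨rfl, rfl⟩ := b_inj.1 e'
    rw [sub_self]; exact zero_mem _
  · obtain ⟨rfl, rfl⟩ := b_inj.1 e
    exact H.H4_sub_H3 hx.of_b.1 hx.of_b.2 hy hz hu
  · obtain ⟨rfl, rfl⟩ := b_inj.1 e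
    exact H.H5_sub_H3 hx.of_b.1 hx.of_b.2 hy hz hu

/-- If a branch is a leaf, only two kinds of contraction at the root are possible, both in the other
branch, and they are compared directly. Otherwise both are compared with the balanced one. -/
theorem root_sub_root {l r : Tree X Unit} {y y'} (h : Root k G l r y) (h' : Root k G l r y') :
    y - y' ∈ boundaries θ G := by
  rcases h.bin.1.cases' with rfl | ⟨x, y, rfl, hx, hy⟩
  · rcases h with ⟨-, -, -, -, e⟩ | ⟨-, -, -, -, e⟩ | ⟨-, -, -, -, e, -⟩ |
      ⟨hx, hy, hz, hu, e⟩ | ⟨hx, hy, hz, hu, e⟩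
    · exact absurd e leaf_ne_b
    · exact absurd e leaf_ne_b
    · exact absurd e leaf_ne_b
    all_goals
      rcases h' with ⟨-, -, -, -, e'⟩ | ⟨-, -, -, -, e'⟩ | ⟨-, -, -, -, e', -⟩ |
        ⟨hx', hy', hz', hu', e'⟩ | ⟨hx', hy', hz', hu', e'⟩
      · exact absurd e' leaf_ne_b
      · exact absurd e' leaf_ne_b
      · exact absurd e' leaf_ne_b
    · obtain ⟨h1, rfl⟩ := b_inj.1 (e.symm.trans e')
      obtain ⟨rfl, rfl⟩ := b_inj.1 h1
      rw [sub_self]; exact zero_mem _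
    · obtain ⟨rfl, rfl⟩ := b_inj.1 (e.symm.trans e')
      exact H.H4_sub_H5 hx hy hz hz' hu'
    · obtain ⟨rfl, rfl⟩ := b_inj.1 (e'.symm.trans e)
      exact boundaries_symm (H.H4_sub_H5 hx hy' hz' hz hu)
    · obtain ⟨rfl, h1⟩ := b_inj.1 (e.symm.trans e')
      obtain ⟨rfl, rfl⟩ := b_inj.1 h1
      rw [sub_self]; exact zero_mem _
  · rcases h.bin.2.cases' with rfl | ⟨z, u, rfl, hz, hu⟩
    · rcases h with ⟨hx, hy, hz, hu, e⟩ | ⟨hx, hy, hz, hu, e⟩ | ⟨-, -, -, -, -, e⟩ |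
        ⟨-, -, -, -, e⟩ | ⟨-, -, -, -, e⟩
      case inr.inl.v3 | inr.inl.v4 | inr.inl.v5 => exact absurd e leaf_ne_b
      all_goals
        rcases h' with ⟨hx', hy', hz', hu', e'⟩ | ⟨hx', hy', hz', hu', e'⟩ | ⟨-, -, -, -, -, e'⟩ |
          ⟨-, -, -, -, e'⟩ | ⟨-, -, -, -, e'⟩
        iterate 3 (rotate_left 2; exact absurd e' leaf_ne_b; rotate_right 2)
      · obtain ⟨h1, rfl⟩ := b_inj.1 (e.symm.trans e')
        obtain ⟨rfl, rfl⟩ := b_inj.1 h1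
        rw [sub_self]; exact zero_mem _
      · obtain ⟨rfl, rfl⟩ := b_inj.1 (e.symm.trans e')
        exact H.H1_sub_H2 hx hy hy' hz' hu
      · obtain ⟨rfl, rfl⟩ := b_inj.1 (e'.symm.trans e)
        exact boundaries_symm (H.H1_sub_H2 hx' hy' hy hz hu)
      · obtain ⟨rfl, h1⟩ := b_inj.1 (e.symm.trans e')
        obtain ⟨rfl, rfl⟩ := b_inj.1 h1
        rw [sub_self]; exact zero_mem _
    · exact boundaries_trans (H.root_sub_H3 h) (boundaries_symm (H.root_sub_H3 h'))

/-- Moves a contraction up by one vertex; with `right_root` this is the inductive step of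
`fill_unique`. -/
theorem left_root {l l' r : Tree X Unit} {y} (h : Root k G l l' y) (hr : G.Bin r) :
    ∃ y', Root k G (G.b l l') r y' ∧ G.ctxMap k 0 r y - y' ∈ boundaries θ G := by
  rcases h with ⟨hx, hy, hz, hu, rfl⟩ | ⟨hx, hy, hz, hu, rfl⟩ | ⟨hx, hy, hz, hu, rfl, rfl⟩ |
    ⟨hx, hy, hz, hu, rfl⟩ | ⟨hx, hy, hz, hu, rfl⟩
  · exact ⟨_, .v1 (.b hx hy) hz hu hr rfl, H.left_H1 hx hy hz hu hr⟩
  · exact ⟨_, .v1 hx (.b hy hz) hu hr rfl, H.left_H2 hx hy hz hu hr⟩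
  · exact ⟨_, .v1 hx hy (.b hz hu) hr rfl, H.left_H3 hx hy hz hu hr⟩
  · exact ⟨_, .v2 hx (.b hy hz) hu hr rfl, H.left_H4 hx hy hz hu hr⟩
  · exact ⟨_, .v2 hx hy (.b hz hu) hr rfl, H.left_H5 hx hy hz hu hr⟩

theorem right_root {l r r' : Tree X Unit} {y} (h : Root k G r r' y) (hl : G.Bin l) :
    ∃ y', Root k G l (G.b r r') y' ∧ G.ctxMap k 1 l y - y' ∈ boundaries θ G := by
  rcases h with ⟨hx, hy, hz, hu, rfl⟩ | ⟨hx, hy, hz, hu, rfl⟩ | ⟨hx, hy, hz, hu, rfl, rfl⟩ |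
    ⟨hx, hy, hz, hu, rfl⟩ | ⟨hx, hy, hz, hu, rfl⟩
  · exact ⟨_, .v4 hl (.b hx hy) hz hu rfl, H.right_H1 hl hx hy hz hu⟩
  · exact ⟨_, .v4 hl hx (.b hy hz) hu rfl, H.right_H2 hl hx hy hz hu⟩
  · exact ⟨_, .v5 hl (.b hx hy) hz hu rfl, H.right_H3 hl hx hy hz hu⟩
  · exact ⟨_, .v5 hl hx (.b hy hz) hu rfl, H.right_H4 hl hx hy hz hu⟩
  · exact ⟨_, .v5 hl hx hy (.b hz hu) rfl, H.right_H5 hl hx hy hz hu⟩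

/-- Two contractions of a binary tree differ by a boundary. -/
theorem fill_unique {t : Tree X Unit} (ht : G.Bin t) : ∀ {y y'}, Fill k G t y → Fill k G t y' →
    y - y' ∈ boundaries θ G := by
  induction ht with
  | leaf =>
    intro y y' h
    have := h.bin.2
    change 4 ≤ 1 at this; omega
  | @b l r hl hr ihl ihr =>
    -- Every contraction can be moved to the root. By induction, a contraction inside a branch is
    -- homologous to any contraction at the top of that branch, which `left_root` or `right_root`
    -- lifts to the root; bracketing with the other branch preserves boundaries.
    have key : ∀ {y}, Fill k G (G.b l r) y →
        ∃ y', Root k G l r y' ∧ y - y' ∈ boundaries θ G := by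
      intro y h
      rcases h with ⟨e, h⟩ | ⟨e, hr, h⟩ | ⟨e, hl, h⟩
      · obtain ⟨rfl, rfl⟩ := b_inj.1 e
        exact ⟨_, h, by rw [sub_self]; exact zero_mem _⟩
      · obtain ⟨rfl, rfl⟩ := b_inj.1 e
        have h4 := h.bin.2
        rcases hl.cases' with rfl | ⟨x, x', rfl, hx, hx'⟩
        · change 4 ≤ 1 at h4; omega
        · rw [len_b] at h4
          obtain ⟨z, hz⟩ := exists_root k hx hx' h4
          obtain ⟨y', hy', h'⟩ := H.left_root hz hr
          refine ⟨y', hy', boundaries_trans ?_ h'⟩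
          rw [← map_sub]
          exact H.ctxMap_boundaries 0 hr (ihl h (.root rfl hz))
      · obtain ⟨rfl, rfl⟩ := b_inj.1 e
        have h4 := h.bin.2
        rcases hr.cases' with rfl | ⟨x, x', rfl, hx, hx'⟩
        · change 4 ≤ 1 at h4; omega
        · rw [len_b] at h4
          obtain ⟨z, hz⟩ := exists_root k hx hx' h4
          obtain ⟨y', hy', h'⟩ := H.right_root hz hl
          refine ⟨y', hy', boundaries_trans ?_ h'⟩
          rw [← map_sub]
          exact H.ctxMap_boundaries 1 hl (ihr h (.root rfl hz))
    intro y y' h h'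
    obtain ⟨z, hz, h1⟩ := key h
    obtain ⟨z', hz', h2⟩ := key h'
    exact boundaries_trans h1 (boundaries_trans (H.root_sub_root hz hz') (boundaries_symm h2))

omit H in
/-- A tree of degree one is homologous to the contraction of its boundary. -/
theorem edge_fill {u t t' : Tree X Unit} (h : G.Edge u t t') : 4 ≤ u.len →
    ∃ y y', Fill k G t y ∧ Fill k G t' y' ∧ (2 : k) • s k u = y + y' := by
  induction h with
  | m hx hy hz =>
    intro h4
    -- In a pentagon, the contractions of the two ends of an edge add up to twice this edge, as the
    -- other four edges occur with opposite signs. So it suffices to find a pentagon with the given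
    -- edge: with four leaves, one of the inputs of `μ₃` starts with a vertex `μ₂`.
    rcases hx.cases' with rfl | ⟨a, a', rfl, ha, ha'⟩
    · rcases hy.cases' with rfl | ⟨a, a', rfl, ha, ha'⟩
      · rcases hz.cases' with rfl | ⟨a, a', rfl, ha, ha'⟩
        · change 4 ≤ 3 at h4; omega
        · refine ⟨_, _, .root rfl (.v3 hx hy ha ha' rfl rfl), .root rfl (.v5 hx hy ha ha' rfl), ?_⟩
          rw [two_smul, H3, H5]; abel
      · refine ⟨_, _, .root rfl (.v2 hx ha ha' hz rfl), .root rfl (.v4 hx ha ha' hz rfl), ?_⟩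
        rw [two_smul, H2, H4]; abel
    · refine ⟨_, _, .root rfl (.v1 ha ha' hy hz rfl), .root rfl (.v3 ha ha' hy hz rfl rfl), ?_⟩
      rw [two_smul, H1, H3]; abel
  | @left u t t' r hr h ih =>
    intro h4
    by_cases hu : 4 ≤ u.len
    · obtain ⟨y, y', hy, hy', e⟩ := ih hu
      refine ⟨_, _, .left rfl hr hy, .left rfl hr hy', ?_⟩
      rw [← map_add, ← e, map_smul, ctxMap_single, ctx_zero]
    · rcases h with ⟨hx, hy, hz⟩ | ⟨hr', h⟩ | ⟨hl, h⟩
      · refine ⟨_, _, .root rfl (.v1 hx hy hz hr rfl), .root rfl (.v2 hx hy hz hr rfl), ?_⟩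
        rw [two_smul, H1, H2]; abel
      · have := h.len; have := hr'.one_le
        rw [len_b] at hu; omega
      · have := h.len; have := hl.one_le
        rw [len_b] at hu; omega
  | @right u t t' l hl h ih =>
    intro h4
    by_cases hu : 4 ≤ u.len
    · obtain ⟨y, y', hy, hy', e⟩ := ih hu
      refine ⟨_, _, .right rfl hl hy, .right rfl hl hy', ?_⟩
      rw [← map_add, ← e, map_smul, ctxMap_single, ctx_one]
    · rcases h with ⟨hx, hy, hz⟩ | ⟨hr', h⟩ | ⟨hl', h⟩
      · refine ⟨_, _, .root rfl (.v4 hl hx hy hz rfl), .root rfl (.v5 hl hx hy hz rfl), ?_⟩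
        rw [two_smul, H4, H5]; abel
      · have := h.len; have := hr'.one_le
        rw [len_b] at hu; omega
      · have := h.len; have := hl'.one_le
        rw [len_b] at hu; omega

/-- Half of a contraction has the tree as boundary. This is where products of four elements vanish
and where `2` has to be invertible. -/
theorem single_mem_boundaries (h2 : (2 : k) ≠ 0) {t : Tree X Unit}
    (ht : G.Bin t) (h4 : 4 ≤ t.len) :
    ∃ w ∈ Finsupp.supported k k {t | t.All G.Low}, dA θ w = s k t := by
  rcases ht.cases' with rfl | ⟨l, r, rfl, hl, hr⟩
  · change 4 ≤ 1 at h4; omega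
  · rw [len_b] at h4
    obtain ⟨y, hy⟩ := exists_root k hl hr h4
    refine ⟨(2 : k)⁻¹ • y, Submodule.smul_mem _ _ hy.low, ?_⟩
    rw [map_smul, H.dA_root hy, smul_smul, inv_mul_cancel₀ h2, one_smul]

theorem bin_mem_boundaries (h2 : (2 : k) ≠ 0) {z : Tree X Unit →₀ k}
    (hz : z ∈ Finsupp.supported k k {t | G.Bin t ∧ 4 ≤ t.len}) : z ∈ boundaries θ G := by
  refine supported_induction (P := fun z => z ∈ boundaries θ G) hz
    (fun t ht => H.single_mem_boundaries h2 ht.1 ht.2) (zero_mem _)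
    (fun _ _ => add_mem) (fun c _ => Submodule.smul_mem _ c)

/-- Choosing a contraction of each binary tree gives a linear map `h`. By `edge_fill` and the
uniqueness of contractions, `2 z` and `h (dA z)` agree modulo boundaries, first for single edges and
then by linearity. For a cycle the second term vanishes. -/
theorem edge_mem_boundaries (h2 : (2 : k) ≠ 0) {z : Tree X Unit →₀ k}
    (hz : z ∈ Finsupp.supported k k {u | (∃ t t', G.Edge u t t') ∧ 4 ≤ u.len})
    (hd : dA θ z = 0) : z ∈ boundaries θ G := by
  classical
  -- The default value zero is used for trees without contraction. It plays no role, since the ends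
  -- of the edges considered have contractions.
  let h : (Tree X Unit →₀ k) →ₗ[k] (Tree X Unit →₀ k) := Finsupp.linearCombination k fun t =>
    if h : ∃ y, Fill k G t y then h.choose else 0
  have hh : ∀ {t y}, Fill k G t y → y - h (s k t) ∈ boundaries θ G := by
    intro t y hy
    have h1 : ∃ y, Fill k G t y := ⟨y, hy⟩
    have h3 : h (s k t) = h1.choose := by
      simp only [h]
      rw [Finsupp.linearCombination_single, one_smul, dif_pos h1]
    rw [h3]
    exact H.fill_unique hy.bin.1 hy h1.choose_spec
  have key : (2 : k) • z - h (dA θ z) ∈ boundaries θ G := by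
    refine supported_induction (P := fun z => (2 : k) • z - h (dA θ z) ∈ boundaries θ G) hz
      ?_ ?_ (fun x y hx hy => ?_) (fun c x hx => ?_)
    · rintro u ⟨⟨t, t', hu⟩, h4⟩
      obtain ⟨y, y', hy, hy', e⟩ := edge_fill (k := k) hu h4
      rw [H.dA_edge hu, e, map_add, add_sub_add_comm]
      exact add_mem (hh hy) (hh hy')
    · simp only [map_zero, smul_zero, sub_zero]; exact zero_mem _
    · rw [map_add, map_add, smul_add, add_sub_add_comm]; exact add_mem hx hy
    · rw [map_smul, map_smul, smul_comm, ← smul_sub]; exact Submodule.smul_mem _ c hx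
  rw [hd, map_zero, sub_zero] at key
  have := Submodule.smul_mem _ (2 : k)⁻¹ key
  rwa [smul_smul, inv_mul_cancel₀ h2, one_smul] at this

end IsLow

end

end AntiAss

namespace AntiAss

universe w

noncomputable section

variable {k : Type u} [Field k]

open Operad

/-! ### Trees with restricted vertices -/

namespace Tree

variable {X : ℕ → Type v} {V : ∀ a, X a → Prop}

theorem one_le_len (hV : ∀ a x, V a x → 1 ≤ a) {t : Tree X Unit} (ht : t.All V) : 1 ≤ t.len := by
  induction t with
  | leaf => exact le_rfl
  | @node a x c ih =>
    rw [len_node]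
    have h := hV a x ht.1
    exact (ih ⟨0, h⟩ (ht.2 _)).trans
      (Finset.single_le_sum (f := fun i => (c i).len) (fun _ _ => Nat.zero_le _)
        (Finset.mem_univ _))

theorem child_bounds (hV : ∀ a x, V a x → 1 ≤ a) {a : ℕ} {x : X a} {c : Fin a → Tree X Unit}
    (ht : (node x c).All V) (i : Fin a) : (c i).len + a ≤ (node x c).len + 1 := by
  rw [len_node, ← Finset.add_sum_erase Finset.univ (fun i => (c i).len) (Finset.mem_univ i)]
  have h := Finset.card_nsmul_le_sum (Finset.univ.erase i) (fun i => (c i).len) 1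
    fun j _ => one_le_len hV (ht.2 j)
  rw [Finset.card_erase_of_mem (Finset.mem_univ i), Finset.card_univ, Fintype.card_fin,
    smul_eq_mul, mul_one] at h
  omega

theorem arity_le_len (hV : ∀ a x, V a x → 1 ≤ a) {a : ℕ} {x : X a} {c : Fin a → Tree X Unit}
    (ht : (node x c).All V) : a ≤ (node x c).len := by
  have h := child_bounds hV ht ⟨0, hV a x ht.1⟩
  have := one_le_len hV (ht.2 ⟨0, hV a x ht.1⟩)
  omega

theorem all_arity_le (hV : ∀ a x, V a x → 1 ≤ a) {t : Tree X Unit} (ht : t.All V) {n : ℕ}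
    (hn : t.len ≤ n) : t.All fun a x => V a x ∧ a ≤ n := by
  induction t with
  | leaf => trivial
  | @node a x c ih =>
    have h1 := hV a x ht.1
    refine ⟨⟨ht.1, (arity_le_len hV ht).trans hn⟩, fun i => ih i (ht.2 i) ?_⟩
    have := child_bounds hV ht i
    omega

theorem eq_leaf (hV : ∀ a x, V a x → 2 ≤ a) {t : Tree X Unit} (ht : t.All V) (h : t.len ≤ 1) :
    t = leaf () := by
  rcases t with _ | ⟨x, c⟩
  · rfl
  · have h1 := arity_le_len (fun a x h => (hV a x h).trans' one_le_two) ht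
    have := hV _ _ ht.1
    omega

/-- A tree with `n` leaves and a vertex with `n` inputs has just this vertex. -/
theorem all_lt_or_corolla (hV : ∀ a x, V a x → 2 ≤ a) {t : Tree X Unit} (ht : t.All V) {n : ℕ}
    (hn : t.len = n) : (t.All fun a x => V a x ∧ a < n) ∨
      ∃ x : X n, V n x ∧ t = node x fun _ => leaf () := by
  have hV1 : ∀ a x, V a x → 1 ≤ a := fun a x h => (hV a x h).trans' one_le_two
  rcases t with _ | @⟨a, x, c⟩
  · exact .inl trivial
  · have h2 := hV _ _ ht.1
    have h3 := arity_le_len hV1 ht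
    by_cases ha : a = n
    · subst ha
      refine .inr ⟨x, ht.1, congrArg _ (funext fun i => eq_leaf hV (ht.2 i) ?_)⟩
      have := child_bounds hV1 ht i
      omega
    · refine .inl ⟨⟨ht.1, by omega⟩, fun i => ?_⟩
      have := child_bounds hV1 ht i
      exact (all_arity_le (n := n - 1) hV1 (ht.2 i) (by omega)).imp
        fun b y h => ⟨h.1, by omega⟩

/-- As every vertex has at least two inputs, its arity is bounded by the number of leaves and each
branch has fewer leaves than the tree. The induction is on the number of leaves, and without
vertices of arity one it terminates. -/
theorem finite_trees (hV : ∀ a x, V a x → 2 ≤ a) (hf : ∀ a, {x | V a x}.Finite) (n : ℕ) :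
    {t : Tree X Unit | t.len ≤ n ∧ t.All V}.Finite := by
  induction n with
  | zero =>
    refine Set.Finite.subset Set.finite_empty fun t ht => ?_
    have := one_le_len (fun a x h => (hV a x h).trans' one_le_two) ht.2
    have := ht.1
    omega
  | succ n ih =>
    refine Set.Finite.subset ((Set.finite_singleton (leaf ())).union
      ((Set.finite_Iic (n + 1)).biUnion fun a _ => (hf a).biUnion fun x _ =>
        (Set.Finite.pi' fun _ : Fin a => ih).image (node x))) fun t ht => ?_
    rcases t with _ | @⟨a, x, c⟩
    · exact .inl rfl
    · right
      simp only [Set.mem_iUnion]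
      have hV1 : ∀ a x, V a x → 1 ≤ a := fun a x h => (hV a x h).trans' one_le_two
      refine ⟨a, (arity_le_len hV1 ht.2).trans ht.1, x, ht.2.1, c, fun i => ⟨?_, ht.2.2 i⟩, rfl⟩
      have := child_bounds hV1 ht.2 i
      have := hV _ _ ht.2.1
      have := ht.1
      omega

theorem degree_nonneg {deg : ∀ a, X a → ℤ} (h : ∀ a x, V a x → 0 ≤ deg a x) {t : Tree X Unit}
    (ht : t.All V) : 0 ≤ t.degree deg := by
  induction t with
  | leaf => exact le_rfl
  | node x c ih =>
    rw [degree_node]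
    exact add_nonneg (h _ _ ht.1) (Finset.sum_nonneg fun i _ => ih i (ht.2 i))

end Tree

section

variable {X : ℕ → Type v} {V : ∀ a, X a → Prop} {deg : ∀ a, X a → ℤ}

theorem aSpan_finite (hV : ∀ a x, V a x → 2 ≤ a) (hf : ∀ a, {x | V a x}.Finite) (n : ℕ) :
    FiniteDimensional k (aSpan k V n) := by
  have h : {t : Tree X Unit | t.len = n ∧ t.All V}.Finite :=
    (Tree.finite_trees hV hf n).subset fun t ht => ⟨ht.1.le, ht.2⟩
  have := h.to_subtype
  exact Module.Finite.equiv (Finsupp.supportedEquivFinsupp {t : Tree X Unit | t.len = n ∧ t.All V}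
    : aSpan k V n ≃ₗ[k] _).symm

theorem aSpan_mono {V W : ∀ a, X a → Prop} (h : ∀ a x, V a x → W a x) (n : ℕ) :
    aSpan k V n ≤ aSpan k W n :=
  Finsupp.supported_mono fun _ ht => ⟨ht.1, ht.2.imp h⟩

theorem aSpan_le_arity (hV : ∀ a x, V a x → 1 ≤ a) (n : ℕ) :
    aSpan k V n ≤ aSpan k (fun a x => V a x ∧ a ≤ n) n :=
  Finsupp.supported_mono fun _ ht => ⟨ht.1, Tree.all_arity_le hV ht.2 ht.1.le⟩

theorem sum_proj {n : ℕ} {z : Tree X Unit →₀ k} (hz : z ∈ aSpan k V n) :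
    ∃ S : Finset ℤ, z = ∑ d ∈ S, proj k deg n d z := by
  classical
  refine ⟨z.support.image fun t => t.degree deg, ?_⟩
  have key : ∀ t ∈ z.support, ∑ d ∈ z.support.image (fun t => t.degree deg),
      proj k deg n d (Finsupp.single t 1) = Finsupp.single t 1 := by
    intro t ht
    rw [Finset.sum_eq_single (t.degree deg)]
    · exact proj_eq_self (Finsupp.single_mem_supported k 1 ⟨(hz ht).1, rfl⟩)
    · intro d _ hd
      exact proj_eq_zero (Finsupp.single_mem_supported k 1 fun h => hd h.2.symm)
    · intro h
      exact absurd (Finset.mem_image_of_mem _ ht) h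
  generalize z.support.image (fun t => t.degree deg) = S at key ⊢
  have h1 : z = ∑ t ∈ z.support, z t • Finsupp.single t 1 := by
    conv_lhs => rw [← Finsupp.sum_single z]
    exact Finset.sum_congr rfl fun t _ => by rw [Finsupp.smul_single, smul_eq_mul, mul_one]
  conv_rhs => rw [h1]
  simp only [map_sum, map_smul]
  rw [Finset.sum_comm]
  conv_lhs => rw [h1]
  refine Finset.sum_congr rfl fun t ht => ?_
  rw [← Finset.smul_sum, key t ht]

theorem proj_mem_aSpan {n : ℕ} (d : ℤ) {z : Tree X Unit →₀ k} (hz : z ∈ aSpan k V n) :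
    proj k deg n d z ∈ aSpan k V n ∧ proj k deg n d z ∈ aGr k deg d :=
  ⟨Finsupp.supported_mono (fun _ h => h.1) (proj_mem hz),
    Finsupp.supported_mono (fun _ h => h.2.2) (proj_mem hz)⟩

theorem proj_of_mem {n : ℕ} {d : ℤ} {z : Tree X Unit →₀ k} (hz : z ∈ aSpan k V n)
    (hd : z ∈ aGr k deg d) : proj k deg n d z = z :=
  proj_eq_self fun _ ht => ⟨(hz ht).1, hd ht⟩

/-- It suffices to check exactness in each degree. -/
theorem exact_of_homogeneous {θ : FreeDer k deg} {n : ℕ}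
    (h : ∀ (d : ℤ) (z : Tree X Unit →₀ k), z ∈ aSpan k V n → z ∈ aGr k deg d → dA θ z = 0 →
      ∃ y ∈ aSpan k V n, dA θ y = z) {z : Tree X Unit →₀ k} (hz : z ∈ aSpan k V n)
    (hd : dA θ z = 0) : ∃ y ∈ aSpan k V n, dA θ y = z := by
  obtain ⟨S, hS⟩ := sum_proj (deg := deg) hz
  have h1 : ∀ d, ∃ y ∈ aSpan k V n, dA θ y = proj k deg n d z := fun d =>
    h d _ (proj_mem_aSpan d hz).1 (proj_mem_aSpan d hz).2 (by rw [dA_proj, hd, map_zero])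
  choose y hy hy' using h1
  exact ⟨∑ d ∈ S, y d, Submodule.sum_mem _ fun d _ => hy d, by
    rw [map_sum, Finset.sum_congr rfl fun d _ => hy' d, ← hS]⟩

/-- A homology basis by cycles from a spanning set of cycles. -/
theorem exists_homology_basis {M : Type*} [AddCommGroup M] [Module k M] [FiniteDimensional k M]
    (D : M →ₗ[k] M) (S : Set M) (hS : LinearMap.ker D ≤ Submodule.span k S) :
    ∃ (r : ℕ) (z : Fin r → M), (∀ j, z j ∈ S) ∧
      (∀ c : Fin r → k, ∑ j, c j • z j ∈ LinearMap.range D → c = 0) ∧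
      ∀ w, D w = 0 → ∃ (y : M) (c : Fin r → k), w = D y + ∑ j, c j • z j := by
  -- The images of the elements of `S` modulo boundaries contain a basis of their span; lifting it
  -- back to `S` keeps the chosen cycles in the given set, which will consist of homogeneous ones.
  obtain ⟨b, hbS, hspan, hli⟩ := exists_linearIndependent k ((LinearMap.range D).mkQ '' S)
  have hfin : b.Finite := hli.setFinite
  have := hfin.to_subtype
  let e := Finite.equivFin b
  have hb : ∀ j : b, ∃ z ∈ S, (LinearMap.range D).mkQ z = j := fun j => hbS j.2
  choose f hf hf' using hb
  have hsum : ∀ c : Fin (Nat.card b) → k, (LinearMap.range D).mkQ (∑ j, c j • f (e.symm j)) =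
      ∑ j, c j • ((e.symm j : b) : M ⧸ LinearMap.range D) := by
    intro c
    rw [map_sum]
    exact Finset.sum_congr rfl fun j _ => by rw [map_smul, hf']
  have hli' : LinearIndependent k fun j : Fin (Nat.card b) =>
      ((e.symm j : b) : M ⧸ LinearMap.range D) := hli.comp _ e.symm.injective
  refine ⟨Nat.card b, fun j => f (e.symm j), fun j => hf _, fun c hc => ?_, fun w hw => ?_⟩
  · have h0 : (LinearMap.range D).mkQ (∑ j, c j • f (e.symm j)) = 0 :=
      (Submodule.Quotient.mk_eq_zero _).2 hc
    rw [hsum] at h0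
    exact funext fun j => Fintype.linearIndependent_iff.1 hli' c h0 j
  · have h1 : (LinearMap.range D).mkQ w ∈ Submodule.span k b := by
      rw [hspan, Submodule.span_image]
      exact Submodule.mem_map_of_mem (hS hw)
    have h2 : b = Set.range fun j : Fin (Nat.card b) =>
        ((e.symm j : b) : M ⧸ LinearMap.range D) := by
      ext x
      exact ⟨fun hx => ⟨e ⟨x, hx⟩, congrArg Subtype.val (e.symm_apply_apply _)⟩, by rintro ⟨j, rfl⟩; exact (e.symm j).2⟩
    rw [h2, Submodule.mem_span_range_iff_exists_fun] at h1
    obtain ⟨c, hc⟩ := h1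
    have h3 : (LinearMap.range D).mkQ (w - ∑ j, c j • f (e.symm j)) = 0 := by
      rw [map_sub, hsum, hc, sub_self]
    obtain ⟨y, hy⟩ := (Submodule.Quotient.mk_eq_zero _).1 h3
    exact ⟨y, c, by rw [hy]; abel⟩

end

/-! ### Exactness in low degrees -/

section

variable {X : ℕ → Type v} {deg : ∀ a, X a → ℤ} {V : ∀ a, X a → Prop} {θ : FreeDer k deg}
  {G : Gens X}

open Gens

/-- Degrees are nonnegative, so total degree zero forces each vertex to have degree zero, that is,
to be `μ₂`. -/
theorem bin_of_degree (H : IsLow θ G)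
    (hV : ∀ a x, V a x → (⟨a, x⟩ : Σ a, X a) = ⟨2, G.two⟩ ∨ 1 ≤ deg a x)
    {t : Tree X Unit} (ht : t.All V) (hd : t.degree deg = 0) : G.Bin t := by
  have hnn : ∀ a x, V a x → 0 ≤ deg a x := by
    intro a x hx
    rcases hV a x hx with h | h
    · cases h; exact H.deg_two.ge
    · omega
  induction t with
  | leaf => exact .leaf
  | @node a x c ih =>
    rw [Tree.degree_node] at hd
    have h1 : 0 ≤ ∑ i, (c i).degree deg :=
      Finset.sum_nonneg fun i _ => Tree.degree_nonneg hnn (ht.2 i)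
    have h2 := hnn a x ht.1
    have h3 : ∀ i, (c i).degree deg = 0 := fun i =>
      (Finset.sum_eq_zero_iff_of_nonneg fun i _ => Tree.degree_nonneg hnn (ht.2 i)).1
        (by omega) i (Finset.mem_univ i)
    rcases hV a x ht.1 with h | h
    · cases h
      rw [node_two]
      exact .b (ih 0 (ht.2 0) (h3 0)) (ih 1 (ht.2 1) (h3 1))
    · omega

/-- Total degree one leaves room for a single vertex of positive degree, which must be `μ₃`; all
others are `μ₂`. -/
theorem edge_of_degree (H : IsLow θ G)
    (hV : ∀ a x, V a x → (⟨a, x⟩ : Σ a, X a) = ⟨2, G.two⟩ ∨ (⟨a, x⟩ : Σ a, X a) = ⟨3, G.three⟩ ∨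
      2 ≤ deg a x)
    {t : Tree X Unit} (ht : t.All V) (hd : t.degree deg = 1) : ∃ t₁ t₂, G.Edge t t₁ t₂ := by
  have hV' : ∀ a x, V a x → (⟨a, x⟩ : Σ a, X a) = ⟨2, G.two⟩ ∨ 1 ≤ deg a x := by
    intro a x hx
    rcases hV a x hx with h | h | h
    · exact .inl h
    · cases h; exact .inr H.deg_three.ge
    · exact .inr (by omega)
  have hnn : ∀ a x, V a x → 0 ≤ deg a x := by
    intro a x hx
    rcases hV' a x hx with h | h
    · cases h; exact H.deg_two.ge
    · omega
  induction t with
  | leaf => simp at hd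
  | @node a x c ih =>
    have hb : ∀ i, (c i).degree deg = 0 → G.Bin (c i) := fun i hi => bin_of_degree H hV' (ht.2 i) hi
    have h0 : ∀ i, 0 ≤ (c i).degree deg := fun i => Tree.degree_nonneg hnn (ht.2 i)
    rw [Tree.degree_node] at hd
    have h1 : 0 ≤ ∑ i, (c i).degree deg := Finset.sum_nonneg fun i _ => h0 i
    rcases hV a x ht.1 with h | h | h
    · cases h
      rw [H.deg_two, Fin.sum_univ_two] at hd
      have h2 := h0 0
      have h3 := h0 1
      rw [node_two]
      by_cases h4 : (c 0).degree deg = 0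
      · obtain ⟨t₁, t₂, h⟩ := ih 1 (ht.2 1) (by omega)
        exact ⟨_, _, .right (hb 0 h4) h⟩
      · obtain ⟨t₁, t₂, h⟩ := ih 0 (ht.2 0) (by omega)
        exact ⟨_, _, .left (hb 1 (by omega)) h⟩
    · cases h
      rw [H.deg_three, Fin.sum_univ_three] at hd
      have := h0 0; have := h0 1; have := h0 2
      rw [node_three]
      exact ⟨_, _, .m (hb 0 (by omega)) (hb 1 (by omega)) (hb 2 (by omega))⟩
    · omega

/-- There is no homology in the degrees `0` and `1`. -/
theorem exact_low (h2 : (2 : k) ≠ 0) (H : IsLow θ G) (hG : ∀ a x, G.Low a x → V a x)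
    (hV : ∀ a x, V a x → (⟨a, x⟩ : Σ a, X a) = ⟨2, G.two⟩ ∨ (⟨a, x⟩ : Σ a, X a) = ⟨3, G.three⟩ ∨
      2 ≤ deg a x) {n : ℕ} (hn : 4 ≤ n) {d : ℤ} (hd : d ≤ 1) {z : Tree X Unit →₀ k}
    (hz : z ∈ aSpan k V n) (hzd : z ∈ aGr k deg d) (hz0 : dA θ z = 0) :
    ∃ y ∈ aSpan k V n, dA θ y = z := by
  have hV' : ∀ a x, V a x → (⟨a, x⟩ : Σ a, X a) = ⟨2, G.two⟩ ∨ 1 ≤ deg a x := by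
    intro a x hx
    rcases hV a x hx with h | h | h
    · exact .inl h
    · cases h; exact .inr H.deg_three.ge
    · exact .inr (by omega)
  have hnn : ∀ a x, V a x → 0 ≤ deg a x := by
    intro a x hx
    rcases hV' a x hx with h | h
    · cases h; exact H.deg_two.ge
    · omega
  have key : z ∈ boundaries θ G := by
    by_cases h1 : d = 1
    · subst h1
      refine H.edge_mem_boundaries h2 (fun t ht => ?_) hz0
      exact ⟨edge_of_degree H hV (hz ht).2 (hzd ht), by rw [(hz ht).1]; exact hn⟩
    · refine H.bin_mem_boundaries h2 (fun t ht => ?_)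
      have h3 := Tree.degree_nonneg hnn (hz ht).2
      have h4 : t.degree deg = d := hzd ht
      exact ⟨bin_of_degree H hV' (hz ht).2 (by omega), by rw [(hz ht).1]; exact hn⟩
  obtain ⟨y, hy, rfl⟩ := key
  -- The filling found above may have parts in other arities and degrees. Its part in arity `n` and
  -- degree `d + 1` still has boundary `z`, because the differential respects the bigrading.
  refine ⟨proj k deg n (d + 1) y, fun t ht => ?_, ?_⟩
  · have := proj_mem hy ht
    exact ⟨this.2.1, this.1.imp hG⟩
  · rw [dA_proj, add_sub_cancel_right, proj_of_mem hz hzd]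

end

end

end AntiAss

namespace AntiAss

universe w

noncomputable section

variable {k : Type u} [Field k]

open Operad

/-! ### Squares of derivations -/

section

variable {X : ℕ → Type v} {deg : ∀ a, X a → ℤ}

/-- A derivation of odd degree anticommutes with the sign operator. This cancels the two mixed terms
when the Leibniz rule is applied twice. -/
theorem freeDer_sgn (θ : FreeDer k deg) {n : ℕ} (x : (freeOperad k X deg).obj n) :
    θ.1 n ((freeOperad k X deg).sgn 1 n x) = -(freeOperad k X deg).sgn 1 n (θ.1 n x) := by
  induction x using gr_induction with
  | mem d x hx =>
    rw [sgn_of_mem 1 hx, sgn_of_mem 1 (freeDer_mem θ hx), map_smul, ← neg_smul]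
    congr 1
    rw [one_mul, one_mul, sub_eq_add_neg, ksign_add]
    simp [ksign]
  | add x y hx hy => simp only [map_add, hx, hy, neg_add]

/-- A derivation of degree `-1` whose square vanishes on the generators has square zero. -/
theorem freeDer_sq {θ : FreeDer k deg} (h : ∀ a x, θ.1 a (θ.1 a (gen k x)) = 0) {n : ℕ}
    (z : (freeOperad k X deg).obj n) : θ.1 n (θ.1 n z) = 0 := by
  refine eq_top_of_gen (p := fun n => LinearMap.ker (θ.1 n ∘ₗ θ.1 n))
    ⟨?_, fun {m n} i x y hx hy => ?_⟩ (fun σ x hx => ?_) h z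
  · change θ.1 1 (θ.1 1 (freeOperad k X deg).one) = 0
    rw [derivation_one, map_zero]
  · change θ.1 _ (θ.1 _ ((freeOperad k X deg).comp i x y)) = 0
    change θ.1 _ (θ.1 _ x) = 0 at hx
    change θ.1 _ (θ.1 _ y) = 0 at hy
    rw [freeDer_comp, map_add, freeDer_comp, freeDer_comp, hx, hy, freeDer_sgn, map_zero, map_zero,
      map_neg, LinearMap.neg_apply, LinearMap.zero_apply, zero_add, add_zero, add_neg_cancel]
  · change θ.1 _ (θ.1 _ x) = 0 at hx
    change θ.1 _ (θ.1 _ ((freeOperad k X deg).relabel σ x)) = 0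
    rw [freeDer_relabel, freeDer_relabel, hx, map_zero]

theorem alternating_mem {M : Type*} [AddCommGroup M] [Module k M] {S : Submodule k M}
    {x₁ x₂ x₃ x₄ x₅ x₆ x₇ x₈ : M} (h₁ : x₁ ∈ S) (h₂ : x₂ ∈ S) (h₃ : x₃ ∈ S) (h₄ : x₄ ∈ S)
    (h₅ : x₅ ∈ S) (h₆ : x₆ ∈ S) (h₇ : x₇ ∈ S) (h₈ : x₈ ∈ S) :
    x₁ - x₂ + x₃ - x₄ + x₅ - x₆ + x₇ - x₈ ∈ S :=
  sub_mem (add_mem (sub_mem (add_mem (sub_mem (add_mem (sub_mem h₁ h₂) h₃) h₄) h₅) h₆) h₇) h₈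

theorem quintic_mem {p : ∀ n, Submodule k ((freeOperad k X deg).obj n)} (hp : CompClosed k deg p)
    {m₂ : (freeOperad k X deg).obj 2} {m₃ : (freeOperad k X deg).obj 3} (h2 : m₂ ∈ p 2)
    (h3 : m₃ ∈ p 3) (i : Fin 4) : quintic m₂ m₃ i ∈ p 5 := by
  have h (i j) (x : (freeOperad k X deg).obj 2) (y : (freeOperad k X deg).obj 3)
      (z : (freeOperad k X deg).obj 2) (hx : x ∈ p 2) (hy : y ∈ p 3) (hz : z ∈ p 2) :
      (freeOperad k X deg).comp (n := 2) j ((freeOperad k X deg).comp i x y) z ∈ p 5 :=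
    hp.comp j (hp.comp i hx hy) hz
  have h' (i j) (x : (freeOperad k X deg).obj 3) (y : (freeOperad k X deg).obj 2)
      (z : (freeOperad k X deg).obj 2) (hx : x ∈ p 3) (hy : y ∈ p 2) (hz : z ∈ p 2) :
      (freeOperad k X deg).comp (n := 2) j ((freeOperad k X deg).comp i x y) z ∈ p 5 :=
    hp.comp j (hp.comp i hx hy) hz
  have h'' (i j) (x : (freeOperad k X deg).obj 2) (y : (freeOperad k X deg).obj 2)
      (z : (freeOperad k X deg).obj 3) (hx : x ∈ p 2) (hy : y ∈ p 2) (hz : z ∈ p 3) :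
      (freeOperad k X deg).comp (n := 3) j ((freeOperad k X deg).comp i x y) z ∈ p 5 :=
    hp.comp j (hp.comp i hx hy) hz
  fin_cases i
  · exact alternating_mem (h _ _ _ _ _ h2 h3 h2) (h' _ _ _ _ _ h3 h2 h2) (h'' _ _ _ _ _ h2 h2 h3)
      (h' _ _ _ _ _ h3 h2 h2) (h _ _ _ _ _ h2 h3 h2) (h' _ _ _ _ _ h3 h2 h2)
      (h _ _ _ _ _ h2 h3 h2) (h' _ _ _ _ _ h3 h2 h2)
  · exact alternating_mem (h' _ _ _ _ _ h3 h2 h2) (h _ _ _ _ _ h2 h3 h2) (h _ _ _ _ _ h2 h3 h2)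
      (h' _ _ _ _ _ h3 h2 h2) (h _ _ _ _ _ h2 h3 h2) (h' _ _ _ _ _ h3 h2 h2)
      (h'' _ _ _ _ _ h2 h2 h3) (h' _ _ _ _ _ h3 h2 h2)
  · exact alternating_mem (h' _ _ _ _ _ h3 h2 h2) (h _ _ _ _ _ h2 h3 h2) (h' _ _ _ _ _ h3 h2 h2)
      (h'' _ _ _ _ _ h2 h2 h3) (h _ _ _ _ _ h2 h3 h2) (h _ _ _ _ _ h2 h3 h2)
      (h'' _ _ _ _ _ h2 h2 h3) (h' _ _ _ _ _ h3 h2 h2)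
  · exact alternating_mem (h' _ _ _ _ _ h3 h2 h2) (h' _ _ _ _ _ h3 h2 h2) (h _ _ _ _ _ h2 h3 h2)
      (h' _ _ _ _ _ h3 h2 h2) (h'' _ _ _ _ _ h2 h2 h3) (h _ _ _ _ _ h2 h3 h2)
      (h'' _ _ _ _ _ h2 h2 h3) (h _ _ _ _ _ h2 h3 h2)

theorem quintic_mem_gr {m₂ : (freeOperad k X deg).obj 2} {m₃ : (freeOperad k X deg).obj 3}
    (h2 : m₂ ∈ (freeOperad k X deg).gr 2 0) (h3 : m₃ ∈ (freeOperad k X deg).gr 3 1) (i : Fin 4) :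
    quintic m₂ m₃ i ∈ (freeOperad k X deg).gr 5 1 := by
  have h (i j) (x : (freeOperad k X deg).obj 2) (y : (freeOperad k X deg).obj 3)
      (z : (freeOperad k X deg).obj 2) (hx : x ∈ (freeOperad k X deg).gr 2 0)
      (hy : y ∈ (freeOperad k X deg).gr 3 1) (hz : z ∈ (freeOperad k X deg).gr 2 0) :
      (freeOperad k X deg).comp (n := 2) j ((freeOperad k X deg).comp i x y) z ∈
        (freeOperad k X deg).gr 5 1 :=
    (freeOperad k X deg).comp_mem j ((freeOperad k X deg).comp_mem i hx hy) hz
  have h' (i j) (x : (freeOperad k X deg).obj 3) (y : (freeOperad k X deg).obj 2)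
      (z : (freeOperad k X deg).obj 2) (hx : x ∈ (freeOperad k X deg).gr 3 1)
      (hy : y ∈ (freeOperad k X deg).gr 2 0) (hz : z ∈ (freeOperad k X deg).gr 2 0) :
      (freeOperad k X deg).comp (n := 2) j ((freeOperad k X deg).comp i x y) z ∈
        (freeOperad k X deg).gr 5 1 :=
    (freeOperad k X deg).comp_mem j ((freeOperad k X deg).comp_mem i hx hy) hz
  have h'' (i j) (x : (freeOperad k X deg).obj 2) (y : (freeOperad k X deg).obj 2)
      (z : (freeOperad k X deg).obj 3) (hx : x ∈ (freeOperad k X deg).gr 2 0)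
      (hy : y ∈ (freeOperad k X deg).gr 2 0) (hz : z ∈ (freeOperad k X deg).gr 3 1) :
      (freeOperad k X deg).comp (n := 3) j ((freeOperad k X deg).comp i x y) z ∈
        (freeOperad k X deg).gr 5 1 :=
    (freeOperad k X deg).comp_mem j ((freeOperad k X deg).comp_mem i hx hy) hz
  fin_cases i
  · exact alternating_mem (h _ _ _ _ _ h2 h3 h2) (h' _ _ _ _ _ h3 h2 h2) (h'' _ _ _ _ _ h2 h2 h3)
      (h' _ _ _ _ _ h3 h2 h2) (h _ _ _ _ _ h2 h3 h2) (h' _ _ _ _ _ h3 h2 h2)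
      (h _ _ _ _ _ h2 h3 h2) (h' _ _ _ _ _ h3 h2 h2)
  · exact alternating_mem (h' _ _ _ _ _ h3 h2 h2) (h _ _ _ _ _ h2 h3 h2) (h _ _ _ _ _ h2 h3 h2)
      (h' _ _ _ _ _ h3 h2 h2) (h _ _ _ _ _ h2 h3 h2) (h' _ _ _ _ _ h3 h2 h2)
      (h'' _ _ _ _ _ h2 h2 h3) (h' _ _ _ _ _ h3 h2 h2)
  · exact alternating_mem (h' _ _ _ _ _ h3 h2 h2) (h _ _ _ _ _ h2 h3 h2) (h' _ _ _ _ _ h3 h2 h2)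
      (h'' _ _ _ _ _ h2 h2 h3) (h _ _ _ _ _ h2 h3 h2) (h _ _ _ _ _ h2 h3 h2)
      (h'' _ _ _ _ _ h2 h2 h3) (h' _ _ _ _ _ h3 h2 h2)
  · exact alternating_mem (h' _ _ _ _ _ h3 h2 h2) (h' _ _ _ _ _ h3 h2 h2) (h _ _ _ _ _ h2 h3 h2)
      (h' _ _ _ _ _ h3 h2 h2) (h'' _ _ _ _ _ h2 h2 h3) (h _ _ _ _ _ h2 h3 h2)
      (h'' _ _ _ _ _ h2 h2 h3) (h _ _ _ _ _ h2 h3 h2)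

theorem label_proj_forget {V : ∀ a, X a → Prop} {n : ℕ} {d : ℤ}
    {w : (freeOperad k X deg).obj n} (hw : w ∈ pSpan k deg V n)
    (hd : w ∈ (freeOperad k X deg).gr n d) :
    label k deg n (proj k deg n d (forget k deg n w)) = w := by
  rw [proj_of_mem (forget_mem_of_vSpan (pSpan_le_vSpan _ _ hw)) (forget_mem_gr hd),
    label_forget hw]

end

/-! ### The construction of the generators -/

/-- The names of the possible generators of a given arity: a number and a degree. -/
abbrev UGen : ℕ → Type := fun _ => ℕ × ℤ

/-- The degree of a possible generator. -/
abbrev udeg : ∀ a, UGen a → ℤ := fun _ x => x.2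

variable (k) in
/-- A choice of generators, and of their boundaries. -/
structure Pre where
  gens : ℕ → Finset (ℕ × ℤ)
  bd : ℕ → ℕ × ℤ → Tree UGen Unit →₀ k

namespace Pre

variable (P : Pre k)

/-- The vertices decorated by the chosen generators. -/
def V (a : ℕ) (x : UGen a) : Prop := x ∈ P.gens a

/-- The prescribed boundary is projected to the required arity and degree, so that the derivation
exists for arbitrary data. For the data of a `Good` stage the projection changes nothing. All
possible generators are present from the start and the unused ones are sent to zero, so the operad
does not change during the construction. -/
theorem exists_der : ∃ θ : FreeDer k udeg, ∀ a (x : UGen a), θ.1 a (gen k x) =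
    if x ∈ P.gens a then label k udeg a (proj k udeg a (x.2 - 1) (P.bd a x)) else 0 := by
  refine exists_derivation _ 1 _ fun a x => ?_
  split_ifs
  · refine label_mem_gr ?_
    rw [aGr]
    exact Finsupp.supported_mono (fun _ h => h.2.2) (proj_mem (S := Set.univ)
      (by rw [Finsupp.supported_univ]; trivial))
  · exact Submodule.zero_mem _

/-- The derivation that sends the chosen generators to their boundaries. -/
def der : FreeDer k udeg := P.exists_der.choose

theorem der_gen {a : ℕ} {x : UGen a} (h : x ∈ P.gens a) :
    P.der.1 a (gen k x) = label k udeg a (proj k udeg a (x.2 - 1) (P.bd a x)) := by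
  rw [der, P.exists_der.choose_spec, if_pos h]

theorem der_gen_of_notMem {a : ℕ} {x : UGen a} (h : x ∉ P.gens a) :
    P.der.1 a (gen k x) = 0 := by
  rw [der, P.exists_der.choose_spec, if_neg h]

/-- The first generators. -/
def low : Gens UGen := ⟨(0, 0), (0, 1), fun i => ((i : ℕ), 2)⟩

variable (k) in
/-- The boundaries of the first generators. -/
def lowBd : ℕ → ℕ × ℤ → Tree UGen Unit →₀ k
  | 3, _ => forget k udeg 3 (gen k low.two ∘[1] gen k low.two + gen k low.two ∘[2] gen k low.two)
  | 5, x => if h : x.1 < 4 then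
      forget k udeg 5 (quintic (P := freeOperad k UGen udeg) (gen k low.two) (gen k low.three)
        ⟨x.1, h⟩) else 0
  | _, _ => 0

/-- The generators of arity at most five. -/
def lowGens : ℕ → Finset (ℕ × ℤ)
  | 2 => {(0, 0)}
  | 3 => {(0, 1)}
  | 5 => Finset.univ.map ⟨fun i : Fin 4 => ((i : ℕ), 2), fun _ _ h => Fin.ext (Prod.ext_iff.1 h).1⟩
  | _ => ∅

/-- The chosen generators of arity less than `n`. -/
def W (n a : ℕ) (x : UGen a) : Prop := P.V a x ∧ a < n

/-- The generators of arity less than `n` are those of a partial minimal model. -/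
structure Good (n : ℕ) : Prop where
  six_le : 6 ≤ n
  low_gens : ∀ a, a < 6 → P.gens a = lowGens a
  low_bd : ∀ a, a < 6 → P.bd a = lowBd k a
  deg_lt : ∀ a x, 6 ≤ a → P.W n a x → 2 < x.2
  bd_mem : ∀ a x, P.W n a x → P.bd a x ∈ aSpan k (P.W a) a
  bd_gr : ∀ a x, P.W n a x → P.bd a x ∈ aGr k udeg (x.2 - 1)
  bd_bd : ∀ a x, P.W n a x → dA P.der (P.bd a x) = 0
  exact : ∀ m, 4 ≤ m → m < n → ∀ z ∈ aSpan k (P.W n) m, dA P.der z = 0 →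
    ∃ y ∈ aSpan k (P.W n) m, dA P.der y = z

/-- The same generators of arity less than `n`, with the same boundaries. -/
def Agree (n : ℕ) (P Q : Pre k) : Prop := ∀ a, a < n → P.gens a = Q.gens a ∧ P.bd a = Q.bd a

variable {P} {Q : Pre k} {n : ℕ}

theorem Agree.W_eq (h : Agree n P Q) {m : ℕ} (hm : m ≤ n) : P.W m = Q.W m := by
  funext a x
  by_cases ha : a < m
  · simp only [W, V, (h a (ha.trans_le hm)).1]
  · simp only [W, ha, and_false]

/-- Later choices do not affect the differential of trees built from generators of smaller arity, so
the stages of the construction are compatible. -/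
theorem Agree.dA_eq (h : Agree n P Q) {m : ℕ} {z : Tree UGen Unit →₀ k}
    (hz : z ∈ aSpan k (P.W n) m) : dA P.der z = dA Q.der z := by
  rw [AntiAss.dA_eq hz, AntiAss.dA_eq hz]
  congr 1
  refine freeDer_congr (V := P.W n) (fun a x hx => ?_) (pSpan_le_vSpan _ _ (label_mem hz))
  have h1 : x ∈ Q.gens a := (h a hx.2).1 ▸ hx.1
  rw [P.der_gen hx.1, Q.der_gen h1, (h a hx.2).2]

theorem W_mono {m : ℕ} (h : m ≤ n) (a : ℕ) (x : UGen a) (hx : P.W m a x) : P.W n a x :=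
  ⟨hx.1, hx.2.trans_le h⟩

namespace Good

theorem congr (h : Good P n) (hPQ : Agree n P Q) : Good Q n where
  six_le := h.six_le
  low_gens a ha := by rw [← h.low_gens a ha, (hPQ a (ha.trans_le h.six_le)).1]
  low_bd a ha := by rw [← h.low_bd a ha, (hPQ a (ha.trans_le h.six_le)).2]
  deg_lt a x ha hx := h.deg_lt a x ha (by rwa [hPQ.W_eq le_rfl])
  bd_mem a x hx := by
    rw [← hPQ.W_eq hx.2.le, ← (hPQ a hx.2).2]
    exact h.bd_mem a x (by rwa [hPQ.W_eq le_rfl])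
  bd_gr a x hx := by
    rw [← (hPQ a hx.2).2]
    exact h.bd_gr a x (by rwa [hPQ.W_eq le_rfl])
  bd_bd a x hx := by
    have hx' : P.W n a x := by rwa [hPQ.W_eq le_rfl]
    rw [← (hPQ a hx.2).2, ← hPQ.dA_eq (aSpan_mono (W_mono hx.2.le) a (h.bd_mem a x hx'))]
    exact h.bd_bd a x hx'
  exact m hm hmn z hz hd := by
    rw [← hPQ.W_eq le_rfl] at hz ⊢
    rw [← hPQ.dA_eq hz] at hd
    obtain ⟨y, hy, hyz⟩ := h.exact m hm hmn z hz hd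
    exact ⟨y, hy, by rw [← hPQ.dA_eq hy, hyz]⟩

variable (h : Good P n)
include h

theorem two_le (a : ℕ) (x : UGen a) (hx : P.V a x) : 2 ≤ a := by
  by_contra ha
  have h1 : a = 0 ∨ a = 1 := by omega
  have h2 := h.low_gens a (by omega)
  rw [V, h2] at hx
  rcases h1 with rfl | rfl <;> simp [lowGens] at hx

theorem V_cases (a : ℕ) (x : UGen a) (hx : P.W n a x) :
    (⟨a, x⟩ : Σ a, UGen a) = ⟨2, low.two⟩ ∨ (⟨a, x⟩ : Σ a, UGen a) = ⟨3, low.three⟩ ∨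
      2 ≤ udeg a x := by
  by_cases ha : 6 ≤ a
  · exact .inr (.inr (h.deg_lt a x ha hx).le)
  · have h1 := hx.1
    rw [V, h.low_gens a (by omega)] at h1
    have h2 := h.two_le a x hx.1
    have h3 : a = 2 ∨ a = 3 ∨ a = 4 ∨ a = 5 := by omega
    rcases h3 with rfl | rfl | rfl | rfl
    · left
      rw [lowGens, Finset.mem_singleton] at h1
      subst h1; rfl
    · right; left
      rw [lowGens, Finset.mem_singleton] at h1
      subst h1; rfl
    · simp [lowGens] at h1
    · right; right
      simp only [lowGens, Finset.mem_map, Finset.mem_univ, true_and] at h1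
      obtain ⟨i, rfl⟩ := h1
      exact le_rfl

theorem low_mem (a : ℕ) (x : UGen a) (hx : low.Low a x) : P.W n a x := by
  have h6 := h.six_le
  rcases hx with _ | _ | i
  · exact ⟨by rw [V, h.low_gens 2 (by omega)]; simp [lowGens, low], by omega⟩
  · exact ⟨by rw [V, h.low_gens 3 (by omega)]; simp [lowGens, low], by omega⟩
  · exact ⟨by
      rw [V, h.low_gens 5 (by omega)]
      exact Finset.mem_map.2 ⟨i, Finset.mem_univ i, rfl⟩, by omega⟩

theorem der_gen {a : ℕ} {x : UGen a} (hx : P.W n a x) :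
    P.der.1 a (gen k x) = label k udeg a (P.bd a x) := by
  rw [P.der_gen hx.1, proj_of_mem (h.bd_mem a x hx) (h.bd_gr a x hx)]

theorem der_mem {a : ℕ} {x : UGen a} (hx : P.W n a x) {m : ℕ} (hm : a ≤ m) :
    P.der.1 a (gen k x) ∈ pSpan k udeg (P.W m) a := by
  rw [h.der_gen hx]
  exact label_mem (aSpan_mono (W_mono hm) a (h.bd_mem a x hx))

theorem dA_mem {m l : ℕ} (hm : m ≤ n) {z : Tree UGen Unit →₀ k} (hz : z ∈ aSpan k (P.W m) l) :
    dA P.der z ∈ aSpan k (P.W m) l :=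
  dA_mem_aSpan P.der (fun _ _ h => h) (fun _ _ hx => pSpan_le_vSpan _ _
    (h.der_mem (W_mono hm _ _ hx) hx.2.le)) hz

end Good

end Pre

end

end AntiAss

namespace AntiAss

universe w

noncomputable section

variable {k : Type u} [Field k]

open Operad

namespace Pre

/-! ### The inductive step -/

theorem lowBd_three (x : ℕ × ℤ) : lowBd k 3 x =
    forget k udeg 3 (gen k low.two ∘[1] gen k low.two + gen k low.two ∘[2] gen k low.two) := rfl

theorem lowBd_five (i : Fin 4) : lowBd k 5 (low.five i) =
    forget k udeg 5 (quintic (P := freeOperad k UGen udeg) (gen k low.two) (gen k low.three) i) :=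
  dif_pos i.2

theorem gen_mem_pSpan {X : ℕ → Type v} {deg : ∀ a, X a → ℤ} {V : ∀ a, X a → Prop} {a : ℕ} {x : X a}
    (h : V a x) : gen k x ∈ pSpan k deg V a :=
  elem_mem_spanOf ⟨LinTree.planar_corolla x, all_corolla h⟩

theorem cubic_mem {V : ∀ a, UGen a → Prop} (h : V 2 low.two) :
    (gen k low.two ∘[1] gen k low.two + gen k low.two ∘[2] gen k low.two :
      (freeOperad k UGen udeg).obj 3) ∈ pSpan k udeg V 3 :=
  add_mem ((compClosed_pSpan V).comp 0 (gen_mem_pSpan h) (gen_mem_pSpan h))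
    ((compClosed_pSpan V).comp 1 (gen_mem_pSpan h) (gen_mem_pSpan h))

theorem cubic_mem_gr : (gen k low.two ∘[1] gen k low.two + gen k low.two ∘[2] gen k low.two :
      (freeOperad k UGen udeg).obj 3) ∈ (freeOperad k UGen udeg).gr 3 0 :=
  add_mem ((freeOperad k UGen udeg).comp_mem 0 (gen_mem low.two) (gen_mem low.two))
    ((freeOperad k UGen udeg).comp_mem 1 (gen_mem low.two) (gen_mem low.two))

theorem isLow_of {P : Pre k} (h : ∀ a, a < 6 → P.gens a = lowGens a)
    (h' : ∀ a, a < 6 → P.bd a = lowBd k a) : IsLow P.der low where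
  deg_two := rfl
  deg_three := rfl
  deg_five _ := rfl
  d_two := by
    rw [P.der_gen (by rw [h 2 (by omega)]; simp [lowGens, low]), h' 2 (by omega)]
    change label k udeg 2 (proj k udeg 2 _ 0) = 0
    rw [map_zero, map_zero]
  d_three := by
    rw [P.der_gen (by rw [h 3 (by omega)]; simp [lowGens, low]), h' 3 (by omega), lowBd_three]
    exact label_proj_forget (cubic_mem (V := fun _ _ => True) trivial) cubic_mem_gr
  d_five i := by
    rw [P.der_gen (by rw [h 5 (by omega)]; exact Finset.mem_map.2 ⟨i, Finset.mem_univ i, rfl⟩),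
      h' 5 (by omega), lowBd_five]
    exact label_proj_forget (quintic_mem (compClosed_pSpan fun _ _ => True)
      (gen_mem_pSpan trivial) (gen_mem_pSpan trivial) i) (quintic_mem_gr (gen_mem _) (gen_mem _) i)

theorem Good.isLow {P : Pre k} {n : ℕ} (h : Good P n) : IsLow P.der low :=
  isLow_of h.low_gens h.low_bd

/-- The possible generators with a given arity replaced. -/
def update (P : Pre k) (n : ℕ) (s : Finset (ℕ × ℤ)) (b : ℕ × ℤ → Tree UGen Unit →₀ k) : Pre k :=
  ⟨Function.update P.gens n s, Function.update P.bd n b⟩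

theorem agree_update (P : Pre k) (n : ℕ) (s b) : Agree n P (P.update n s b) := fun a ha => by
  simp [update, Function.update_of_ne ha.ne]

/-- The corolla with the vertex `x`. -/
def cor {a : ℕ} (x : UGen a) : Tree UGen Unit := .node x fun _ => .leaf ()

theorem len_cor {a : ℕ} (x : UGen a) : (cor x).len = a := by
  simp [cor, Tree.len_node]

theorem dA_cor (θ : FreeDer k udeg) {a : ℕ} (x : UGen a) :
    dA θ (s k (cor x)) = forget k udeg a (θ.1 a (gen k x)) := by
  rw [← dA_forget]
  congr 1
  rw [gen_eq, forget_elem]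
  rfl

/-- New generators of arity `n` that kill the homology. -/
theorem Good.exists_cycles (h2 : (2 : k) ≠ 0) {P : Pre k} {n : ℕ} (h : Good P n) (hn : 6 ≤ n) :
    ∃ (r : ℕ) (z : Fin r → Tree UGen Unit →₀ k) (d : Fin r → ℤ), (∀ j, 1 < d j) ∧
      (∀ j, z j ∈ aSpan k (P.W n) n ∧ z j ∈ aGr k udeg (d j) ∧ dA P.der (z j) = 0) ∧
      (∀ c : Fin r → k, (∃ y ∈ aSpan k (P.W n) n, dA P.der y = ∑ j, c j • z j) → c = 0) ∧
      ∀ w ∈ aSpan k (P.W n) n, dA P.der w = 0 → ∃ y ∈ aSpan k (P.W n) n, ∃ c : Fin r → k,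
        w = dA P.der y + ∑ j, c j • z j := by
  have hf : FiniteDimensional k (aSpan k (P.W n) n) :=
    aSpan_finite (fun a x hx => h.two_le a x hx.1)
      (fun a => (P.gens a).finite_toSet.subset fun x hx => hx.1) n
  let D : aSpan k (P.W n) n →ₗ[k] aSpan k (P.W n) n :=
    (dA P.der).restrict fun z hz => h.dA_mem le_rfl hz
  -- The basis of the homology is taken among homogeneous cycles, so that each new generator gets a
  -- degree. They span all cycles because the components of a cycle are cycles.
  let S : Set (aSpan k (P.W n) n) := {z | D z = 0 ∧ ∃ d, z.1 ∈ aGr k udeg d}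
  have hS : LinearMap.ker D ≤ Submodule.span k S := by
    intro z hz
    obtain ⟨T, hT⟩ := sum_proj (deg := udeg) z.2
    have h1 : dA P.der z.1 = 0 := congrArg Subtype.val (LinearMap.mem_ker.1 hz)
    have : z = ∑ d ∈ T, (⟨proj k udeg n d z.1, (proj_mem_aSpan d z.2).1⟩ :
        aSpan k (P.W n) n) := by
      refine Subtype.ext ?_
      rw [AddSubmonoidClass.coe_finsetSum]
      exact hT
    rw [this]
    refine Submodule.sum_mem _ fun d _ => Submodule.subset_span ⟨Subtype.ext ?_, d,
      (proj_mem_aSpan d z.2).2⟩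
    change dA P.der (proj k udeg n d z.1) = 0
    rw [dA_proj, h1, map_zero]
  obtain ⟨r, z, hz, hli, hsp⟩ := exists_homology_basis D S hS
  choose hz0 d hd using hz
  refine ⟨r, fun j => (z j).1, d, fun j => ?_, fun j => ⟨(z j).2, hd j,
    congrArg Subtype.val (hz0 j)⟩, fun c ⟨y, hy, hyc⟩ => hli c ⟨⟨y, hy⟩, Subtype.ext ?_⟩,
    fun w hw hw0 => ?_⟩
  -- A basis element of degree at most one would be a boundary by `exact_low`, against the
  -- independence modulo boundaries.
  · by_contra hj
    have hiso : IsLow P.der low := h.isLow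
    obtain ⟨y, hy, hyz⟩ := exact_low h2 hiso h.low_mem h.V_cases (by omega) (not_lt.1 hj)
      (z j).2 (hd j) (congrArg Subtype.val (hz0 j))
    have := hli (Pi.single j 1) ⟨⟨y, hy⟩, Subtype.ext (hyz.trans ?_)⟩
    · have e := congrFun this j
      rw [Pi.single_eq_same] at e
      exact one_ne_zero e
    · rw [Finset.sum_eq_single j, Pi.single_eq_same, one_smul]
      · intro i _ hi
        rw [Pi.single_eq_of_ne hi, zero_smul]
      · simp
  · rw [AddSubmonoidClass.coe_finsetSum]
    exact hyc
  · obtain ⟨y, c, hy⟩ := hsp ⟨w, hw⟩ (Subtype.ext hw0)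
    refine ⟨y.1, y.2, c, (congrArg Subtype.val hy).trans ?_⟩
    rw [Submodule.coe_add, AddSubmonoidClass.coe_finsetSum]
    rfl

/-- The new generators of arity `n` have as boundaries a basis of the homology in arity `n`. Since
the basis spans, all old cycles become boundaries; since it is independent, no new cycle appears.
Cycles of degree greater than one yield generators of degree greater than two. -/
theorem Good.step (h2 : (2 : k) ≠ 0) {P : Pre k} {n : ℕ} (h : Good P n) :
    ∃ Q : Pre k, Agree n P Q ∧ Good Q (n + 1) := by
  have h6 := h.six_le
  obtain ⟨r, z, d, hd, hz, hli, hsp⟩ := h.exists_cycles h2 h6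
  -- The names of the new generators: the number keeps generators of equal degree apart, and the
  -- degree is one more than that of the cycle to be killed.
  let g : Fin r ↪ ℕ × ℤ := ⟨fun j => ((j : ℕ), d j + 1), fun i j e => Fin.ext (Prod.ext_iff.1 e).1⟩
  let Q := P.update n (Finset.univ.map g) fun x => if hx : x.1 < r then z ⟨x.1, hx⟩ else 0
  have hPQ : Agree n P Q := agree_update _ _ _ _
  have hQ : Good Q n := h.congr hPQ
  have hg : Q.gens n = Finset.univ.map g := by simp [Q, update]
  have hb : ∀ j, Q.bd n (g j) = z j := fun j => by
    simp only [Q, update, Function.update_self]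
    exact dif_pos j.2
  have hW : P.W n = Q.W n := hPQ.W_eq le_rfl
  have hnew : ∀ x, Q.W (n + 1) n x → ∃ j, x = g j := by
    intro x hx
    have := hx.1
    rw [V, hg, Finset.mem_map] at this
    obtain ⟨j, -, rfl⟩ := this
    exact ⟨j, rfl⟩
  have hgW : ∀ j, Q.W (n + 1) n (g j) := fun j =>
    ⟨by rw [V, hg]; exact Finset.mem_map_of_mem _ (Finset.mem_univ j), n.lt_succ_self⟩
  have hold : ∀ a x, Q.W (n + 1) a x → a ≠ n → Q.W n a x := fun a x hx ha =>
    ⟨hx.1, by have := hx.2; omega⟩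
  have hzQ : ∀ j, z j ∈ aSpan k (Q.W n) n ∧ z j ∈ aGr k udeg (d j) ∧ dA Q.der (z j) = 0 :=
    fun j => ⟨hW ▸ (hz j).1, (hz j).2.1, by rw [← hPQ.dA_eq (hz j).1, (hz j).2.2]⟩
  refine ⟨Q, hPQ, ⟨by omega, hQ.low_gens, hQ.low_bd, ?_, ?_, ?_, ?_, ?_⟩⟩
  · intro a x ha hx
    by_cases han : a = n
    · subst han
      obtain ⟨j, rfl⟩ := hnew x hx
      have := hd j
      change 2 < d j + 1
      omega
    · exact hQ.deg_lt a x ha (hold a x hx han)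
  · intro a x hx
    by_cases han : a = n
    · subst han
      obtain ⟨j, rfl⟩ := hnew x hx
      rw [hb]; exact (hzQ j).1
    · exact hQ.bd_mem a x (hold a x hx han)
  · intro a x hx
    by_cases han : a = n
    · subst han
      obtain ⟨j, rfl⟩ := hnew x hx
      rw [hb, show (g j).2 - 1 = d j from add_sub_cancel_right _ _]; exact (hzQ j).2.1
    · exact hQ.bd_gr a x (hold a x hx han)
  · intro a x hx
    by_cases han : a = n
    · subst han
      obtain ⟨j, rfl⟩ := hnew x hx
      rw [hb]; exact (hzQ j).2.2
    · exact hQ.bd_bd a x (hold a x hx han)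
  · intro m hm hmn w hw hw0
    have h2le := hQ.two_le
    by_cases han : m = n
    · subst han
      have hcor : ∀ j, s k (cor (a := m) (g j)) ∈ aSpan k (Q.W (m + 1)) m := fun j =>
        mem_aSpan_single (len_cor _) ⟨hgW j, fun _ => trivial⟩
      have hdc : ∀ j, dA Q.der (s k (cor (a := m) (g j))) = z j := by
        intro j
        rw [dA_cor, Q.der_gen (hgW j).1, hb,
          show (g j).2 - 1 = d j from add_sub_cancel_right _ _, proj_of_mem (hzQ j).1 (hzQ j).2.1,
          forget_label (hzQ j).1]
      -- A tree with `m` leaves that contains a vertex of arity `m` is the corolla of this vertex,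
      -- so a new generator occurs in arity `m` only by itself.
      have hsplit : ∃ w₀ ∈ aSpan k (Q.W m) m, ∃ c : Fin r → k,
          w = w₀ + ∑ j, c j • s k (cor (a := m) (g j)) := by
        refine supported_induction (P := fun w => ∃ w₀ ∈ aSpan k (Q.W m) m, ∃ c : Fin r → k,
          w = w₀ + ∑ j, c j • s k (cor (a := m) (g j))) hw (fun t ht => ?_) ?_ ?_ ?_
        · rcases Tree.all_lt_or_corolla (fun a x hx => h2le a x hx.1) ht.2 ht.1 with h | ⟨x, hx, rfl⟩
          · exact ⟨_, mem_aSpan_single ht.1 (h.imp fun a x hx => ⟨hx.1.1, hx.2⟩), 0, by simp⟩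
          · obtain ⟨j, rfl⟩ := hnew x hx
            refine ⟨0, zero_mem _, Pi.single j 1, ?_⟩
            rw [zero_add, Finset.sum_eq_single j, Pi.single_eq_same, one_smul]
            · rfl
            · intro i _ hi
              rw [Pi.single_eq_of_ne hi, zero_smul]
            · simp
        · exact ⟨0, zero_mem _, 0, by simp⟩
        · rintro x y ⟨x₀, hx₀, c, rfl⟩ ⟨y₀, hy₀, c', rfl⟩
          refine ⟨_, add_mem hx₀ hy₀, c + c', ?_⟩
          simp only [Pi.add_apply, add_smul, Finset.sum_add_distrib]
          abel
        · rintro a x ⟨x₀, hx₀, c, rfl⟩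
          refine ⟨_, Submodule.smul_mem _ a hx₀, a • c, ?_⟩
          simp only [Pi.smul_apply, smul_add, Finset.smul_sum, smul_assoc]
      obtain ⟨w₀, hw₀, c, rfl⟩ := hsplit
      simp only [map_add, map_sum, map_smul, hdc] at hw0
      -- The boundary of `-w₀` is the combination of basis cycles with coefficients `c`, so
      -- independence modulo old boundaries removes the new corollas from a cycle.
      have hc : c = 0 := by
        refine hli c ⟨-w₀, neg_mem (hW ▸ hw₀), ?_⟩
        rw [map_neg, hPQ.dA_eq (hW ▸ hw₀)]
        exact neg_eq_of_add_eq_zero_right hw0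
      subst hc
      simp only [Pi.zero_apply, zero_smul, Finset.sum_const_zero, add_zero] at hw0 ⊢
      rw [← hPQ.dA_eq (hW ▸ hw₀)] at hw0
      obtain ⟨y, hy, c, hyc⟩ := hsp w₀ (hW ▸ hw₀) hw0
      refine ⟨y + ∑ j, c j • s k (cor (a := m) (g j)), add_mem (aSpan_mono (W_mono (m.le_succ)) m
        (hW ▸ hy)) (sum_mem fun j _ => Submodule.smul_mem _ _ (hcor j)), ?_⟩
      simp only [map_add, map_sum, map_smul, hdc]
      rw [hyc, hPQ.dA_eq hy]
    · have hmn : m < n := by omega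
      -- Trees with fewer than `n` leaves cannot contain a vertex of arity `n`, so nothing changes
      -- in these arities.
      have hle : aSpan k (Q.W (n + 1)) m ≤ aSpan k (Q.W n) m :=
        (aSpan_le_arity (fun a x hx => (h2le a x hx.1).trans' one_le_two) m).trans
          (aSpan_mono (fun a x hx => ⟨hx.1.1, hx.2.trans_lt hmn⟩) m)
      obtain ⟨y, hy, hyw⟩ := hQ.exact m hm hmn w (hle hw) hw0
      exact ⟨y, aSpan_mono (W_mono n.le_succ) m hy, hyw⟩

/-- There is a system of generators that is good in all arities. -/
theorem exists_good (h2 : (2 : k) ≠ 0) (h : ∃ P : Pre k, Good P 6) :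
    ∃ P : Pre k, ∀ n, 6 ≤ n → Good P n := by
  have h1 : ∀ n, ∀ P : {P : Pre k // Good P (6 + n)}, ∃ Q : {P : Pre k // Good P (6 + (n + 1))},
      Agree (6 + n) P.1 Q.1 := fun n P => by
    obtain ⟨Q, hQ, hQ'⟩ := P.2.step h2
    exact ⟨⟨Q, hQ'⟩, hQ⟩
  choose f hf using h1
  let F : ∀ n, {P : Pre k // Good P (6 + n)} := fun n => Nat.rec ⟨h.choose, h.choose_spec⟩ f n
  have hF : ∀ n, Agree (6 + n) (F n).1 (F (n + 1)).1 := fun n => hf n (F n)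
  have hF' : ∀ m n, m ≤ n → Agree (6 + m) (F m).1 (F n).1 := by
    intro m n hmn
    induction n, hmn using Nat.le_induction with
    | base => exact fun _ _ => ⟨rfl, rfl⟩
    | succ n hn ih => exact fun a ha =>
        ⟨(ih a ha).1.trans (hF n a (by omega)).1, (ih a ha).2.trans (hF n a (by omega)).2⟩
  -- A diagonal choice: the `a`-th stage is good below arity `6 + a`, so its generators of arity `a`
  -- are final.
  refine ⟨⟨fun a => (F a).1.gens a, fun a => (F a).1.bd a⟩, fun n hn => ?_⟩
  obtain ⟨n, rfl⟩ := Nat.exists_eq_add_of_le hn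
  refine (F n).2.congr fun a ha => ?_
  rcases le_total a n with h | h
  · exact ⟨(hF' a n h a (by omega)).1.symm, (hF' a n h a (by omega)).2.symm⟩
  · exact hF' n a h a ha

end Pre

end

end AntiAss

namespace AntiAss

universe w

noncomputable section

variable {k : Type u} [Field k]

open Operad

/-! ### Arities at most five -/

/-- The arities of the vertices, with `0` for a leaf, in planar order. -/
def Tree.code {X : ℕ → Type v} : Tree X Unit → List ℕ
  | leaf _ => [0]
  | @node _ _ a _ c => a :: (List.ofFn fun i => (c i).code).flatten

namespace Gens

variable {X : ℕ → Type v} (G : Gens X)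

theorem code_b (l r : Tree X Unit) : (G.b l r).code = 2 :: (l.code ++ r.code) := by
  simp [b, Tree.code]

theorem code_m (x y z : Tree X Unit) :
    (G.m x y z).code = 3 :: (x.code ++ y.code ++ z.code) := by
  simp [m, Tree.code]

variable (k X) in
/-- The coefficient of the trees with a given code. -/
def coeff (L : List ℕ) : (Tree X Unit →₀ k) →ₗ[k] k :=
  Finsupp.linearCombination k fun t => if t.code = L then 1 else 0

theorem coeff_single (L : List ℕ) (t : Tree X Unit) :
    coeff k X L (s k t) = if t.code = L then 1 else 0 := by
  rw [coeff, Finsupp.linearCombination_single, one_smul]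

end Gens

namespace IsLow

open Gens

variable {X : ℕ → Type v} {deg : ∀ a, X a → ℤ} {θ : FreeDer k deg} {G : Gens X} (H : IsLow θ G)

include H

/-- There are no cycles of arity five and degree two. -/
theorem arity_five_injective (c : Fin 4 → k) (c₁ c₂ c₃ : k)
    (h : dA θ (∑ i, c i • s k (G.q i (.leaf ()) (.leaf ()) (.leaf ()) (.leaf ()) (.leaf ()))
      + c₁ • s k (G.m (G.m (.leaf ()) (.leaf ()) (.leaf ())) (.leaf ()) (.leaf ()))
      + c₂ • s k (G.m (.leaf ()) (G.m (.leaf ()) (.leaf ()) (.leaf ())) (.leaf ()))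
      + c₃ • s k (G.m (.leaf ()) (.leaf ()) (G.m (.leaf ()) (.leaf ()) (.leaf ())))) = 0) :
    (∀ i, c i = 0) ∧ c₁ = 0 ∧ c₂ = 0 ∧ c₃ = 0 := by
  have hl : G.Bin (.leaf ()) := .leaf
  have hq : ∀ i, dA θ (s k (G.q i (.leaf ()) (.leaf ()) (.leaf ()) (.leaf ()) (.leaf ()))) =
      ![G.Q0 k, G.Q1 k, G.Q2 k, G.Q3 k] i (.leaf ()) (.leaf ()) (.leaf ()) (.leaf ()) (.leaf ()) := by
    intro i
    rw [H.dA_q hl hl hl hl hl, H.sub_quintic]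
    fin_cases i <;> rfl
  simp only [map_add, map_smul, hq, Fin.sum_univ_four, H.dA_mm₁ hl hl hl hl hl,
    H.dA_mm₂ hl hl hl hl hl, H.dA_mm₃ hl hl hl hl hl] at h
  have e := fun L => congrArg (coeff k X L) h
  simp only [Q0, Q1, Q2, Q3, map_add, map_sub, map_smul, map_zero, coeff_single, code_b, code_m,
    Tree.code, Matrix.cons_val] at e
  -- Seven edges of `K₅` whose coefficients in the seven boundaries form an invertible system. The
  -- edges in `e0`, `e1`, `e2`, `e5`, `e6` occur in only one of the boundaries; `e3` occurs in those
  -- of `μ₅²` and `μ₅⁴`, and `e4` in those of `μ₅¹` and of the first composition of `μ₃` with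
  -- itself.
  have e0 := e [2, 0, 3, 0, 0, 2, 0, 0]
  have e1 := e [3, 2, 0, 0, 0, 2, 0, 0]
  have e2 := e [2, 0, 3, 2, 0, 0, 0, 0]
  have e3 := e [2, 0, 3, 0, 2, 0, 0, 0]
  have e4 := e [2, 3, 0, 0, 0, 2, 0, 0]
  have e5 := e [2, 0, 2, 3, 0, 0, 0, 0]
  have e6 := e [2, 0, 2, 0, 3, 0, 0, 0]
  clear e h
  simp at e0 e1 e2 e3 e4 e5 e6
  refine ⟨fun i => ?_, by linear_combination e4 - e0, e5, e6⟩
  have e3' : c 3 = 0 := by linear_combination e3 - e1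
  fin_cases i
  exacts [e0, e1, e2, e3']

end IsLow

/-! ### The first generators -/

namespace Pre

open Gens

/-- The generators of arity two and three. -/
def Two3 (a : ℕ) (x : UGen a) : Prop :=
  (⟨a, x⟩ : Σ a, UGen a) = ⟨2, low.two⟩ ∨ (⟨a, x⟩ : Σ a, UGen a) = ⟨3, low.three⟩

theorem Two3.two_le (a : ℕ) (x : UGen a) (h : Two3 a x) : 2 ≤ a := by
  rcases h with h | h <;> cases h <;> omega

/-- Each vertex `μ₂` adds one leaf and each `μ₃` adds two leaves and one degree, starting from a
single leaf of degree zero. -/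
theorem two_mul_degree_lt {t : Tree UGen Unit} (ht : t.All Two3) :
    2 * t.degree udeg + 1 ≤ t.len := by
  induction t with
  | leaf => simp
  | @node a x c ih =>
    rw [Tree.degree_node, Tree.len_node]
    rcases ht.1 with h | h <;> cases h
    · have h0 := ih 0 (ht.2 0); have h1 := ih 1 (ht.2 1)
      rw [Fin.sum_univ_two, Fin.sum_univ_two]
      change 2 * (0 + _) + 1 ≤ _
      push_cast
      omega
    · have h0 := ih 0 (ht.2 0); have h1 := ih 1 (ht.2 1); have h2 := ih 2 (ht.2 2)
      rw [Fin.sum_univ_three, Fin.sum_univ_three]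
      change 2 * (1 + _) + 1 ≤ _
      push_cast
      omega

theorem eq_leaf_of_len {t : Tree UGen Unit} (ht : t.All Two3) (h : t.len ≤ 1) : t = .leaf () :=
  Tree.eq_leaf Two3.two_le ht h

theorem eq_m_of_degree {t : Tree UGen Unit} (ht : t.All Two3) (hl : t.len ≤ 3)
    (hd : 1 ≤ t.degree udeg) : t = low.m (.leaf ()) (.leaf ()) (.leaf ()) := by
  rcases t with _ | @⟨a, x, c⟩
  · simp at hd
  · rw [Tree.degree_node] at hd
    rw [Tree.len_node] at hl
    rcases ht.1 with h | h <;> cases h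
    · have h0 := two_mul_degree_lt (ht.2 0); have h1 := two_mul_degree_lt (ht.2 1)
      rw [Fin.sum_univ_two] at hd hl
      change 1 ≤ 0 + _ at hd
      omega
    · have h0 := Tree.one_le_len (fun a x h => (Two3.two_le a x h).trans' one_le_two) (ht.2 0)
      have h1 := Tree.one_le_len (fun a x h => (Two3.two_le a x h).trans' one_le_two) (ht.2 1)
      have h2 := Tree.one_le_len (fun a x h => (Two3.two_le a x h).trans' one_le_two) (ht.2 2)
      rw [Fin.sum_univ_three] at hl
      rw [node_three]
      refine m_congr _ (eq_leaf_of_len (ht.2 0) ?_) (eq_leaf_of_len (ht.2 1) ?_)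
        (eq_leaf_of_len (ht.2 2) ?_) <;> omega

/-- Two vertices `μ₃` already use up five leaves, so there is no room for a vertex `μ₂`, and the
second `μ₃` sits at one of the three inputs of the first. -/
theorem cases_of_degree_two {t : Tree UGen Unit} (ht : t.All Two3) (hl : t.len ≤ 5)
    (hd : 2 ≤ t.degree udeg) :
    t = low.m (low.m (.leaf ()) (.leaf ()) (.leaf ())) (.leaf ()) (.leaf ()) ∨
    t = low.m (.leaf ()) (low.m (.leaf ()) (.leaf ()) (.leaf ())) (.leaf ()) ∨
    t = low.m (.leaf ()) (.leaf ()) (low.m (.leaf ()) (.leaf ()) (.leaf ())) := by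
  rcases t with _ | @⟨a, x, c⟩
  · simp at hd
  · rw [Tree.degree_node] at hd
    rw [Tree.len_node] at hl
    rcases ht.1 with h | h <;> cases h
    · have h0 := two_mul_degree_lt (ht.2 0); have h1 := two_mul_degree_lt (ht.2 1)
      rw [Fin.sum_univ_two] at hd hl
      change 2 ≤ 0 + _ at hd
      omega
    · have h0 := two_mul_degree_lt (ht.2 0); have h1 := two_mul_degree_lt (ht.2 1)
      have h2 := two_mul_degree_lt (ht.2 2)
      rw [Fin.sum_univ_three] at hl hd
      change 2 ≤ 1 + _ at hd
      rw [node_three]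
      have hnn : ∀ i, 0 ≤ (c i).degree udeg := fun i => Tree.degree_nonneg (V := Two3)
        (fun a x h => by rcases h with h | h <;> cases h <;> decide) (ht.2 i)
      have n0 := hnn 0; have n1 := hnn 1; have n2 := hnn 2
      have h3 : 1 ≤ (c 0).degree udeg ∨ 1 ≤ (c 1).degree udeg ∨ 1 ≤ (c 2).degree udeg := by omega
      rcases h3 with h3 | h3 | h3
      · exact .inl (m_congr _ (eq_m_of_degree (ht.2 0) (by omega) h3)
          (eq_leaf_of_len (ht.2 1) (by omega)) (eq_leaf_of_len (ht.2 2) (by omega)))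
      · exact .inr (.inl (m_congr _ (eq_leaf_of_len (ht.2 0) (by omega))
          (eq_m_of_degree (ht.2 1) (by omega) h3) (eq_leaf_of_len (ht.2 2) (by omega))))
      · exact .inr (.inr (m_congr _ (eq_leaf_of_len (ht.2 0) (by omega))
          (eq_leaf_of_len (ht.2 1) (by omega)) (eq_m_of_degree (ht.2 2) (by omega) h3)))

variable (k) in
/-- The generators of arity at most five, with their boundaries. -/
def first : Pre k := ⟨lowGens, lowBd k⟩

theorem isLow_first : IsLow (first k).der low := isLow_of (fun _ _ => rfl) fun _ _ => rfl

theorem first_cases {a : ℕ} {x : UGen a} (h : (first k).V a x) :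
    Two3 a x ∨ ∃ i, (⟨a, x⟩ : Σ a, UGen a) = ⟨5, low.five i⟩ := by
  change x ∈ lowGens a at h
  match a, x, h with
  | 2, x, h => rw [lowGens, Finset.mem_singleton] at h; subst h; exact .inl (.inl rfl)
  | 3, x, h => rw [lowGens, Finset.mem_singleton] at h; subst h; exact .inl (.inr rfl)
  | 5, x, h =>
    obtain ⟨i, -, rfl⟩ := Finset.mem_map.1 h
    exact .inr ⟨i, rfl⟩
  | 0, x, h => simp [lowGens] at h
  | 1, x, h => simp [lowGens] at h
  | 4, x, h => simp [lowGens] at h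
  | n + 6, x, h => simp [lowGens] at h

theorem first_low {a : ℕ} {x : UGen a} (h : low.Low a x) : (first k).W 6 a x := by
  rcases h with _ | _ | i
  · exact ⟨by change _ ∈ lowGens 2; simp [lowGens, low], by omega⟩
  · exact ⟨by change _ ∈ lowGens 3; simp [lowGens, low], by omega⟩
  · exact ⟨Finset.mem_map.2 ⟨i, Finset.mem_univ i, rfl⟩, by omega⟩

theorem two_mem_W {n : ℕ} (hn : 2 < n) : (first k).W n 2 low.two :=
  ⟨(first_low .two).1, hn⟩

theorem three_mem_W {n : ℕ} (hn : 3 < n) : (first k).W n 3 low.three :=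
  ⟨(first_low .three).1, hn⟩

/-- There are no cycles of degree at least two in the arities four and five. -/
theorem first_exact {m : ℕ} (hm : 4 ≤ m) (hm' : m < 6) {d : ℤ} (hd : 2 ≤ d)
    {z : Tree UGen Unit →₀ k} (hz : z ∈ aSpan k ((first k).W 6) m) (hzd : z ∈ aGr k udeg d)
    (hz0 : dA (first k).der z = 0) : z = 0 := by
  have h2le : ∀ a x, (first k).W 6 a x → 2 ≤ a := by
    intro a x hx
    rcases first_cases hx.1 with h | ⟨i, h⟩
    · exact h.two_le
    · cases h; omega
  have key : z ∈ Submodule.span k (Set.range fun i =>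
      s k (low.q i (.leaf ()) (.leaf ()) (.leaf ()) (.leaf ()) (.leaf ()))) ⊔
      (Submodule.span k {s k (low.m (low.m (.leaf ()) (.leaf ()) (.leaf ())) (.leaf ()) (.leaf ()))} ⊔
      (Submodule.span k {s k (low.m (.leaf ()) (low.m (.leaf ()) (.leaf ()) (.leaf ())) (.leaf ()))} ⊔
      Submodule.span k
        {s k (low.m (.leaf ()) (.leaf ()) (low.m (.leaf ()) (.leaf ()) (.leaf ())))})) := by
    have hz' : z ∈ Finsupp.supported k k
        {t : Tree UGen Unit | (t.len = m ∧ t.All ((first k).W 6)) ∧ t.degree udeg = d} :=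
      fun t ht => ⟨hz ht, hzd ht⟩
    refine supported_induction (P := fun z => z ∈ _) hz' (fun t ht => ?_) (zero_mem _)
      (fun _ _ => add_mem) fun c _ => Submodule.smul_mem _ c
    obtain ⟨⟨hl, hV⟩, htd⟩ := ht
    -- With at most five leaves, a vertex `μ₅` can occur only as the whole tree.
    have h5 : t.All Two3 ∨ ∃ i, t = low.q i (.leaf ()) (.leaf ()) (.leaf ()) (.leaf ()) (.leaf ()) := by
      rcases Nat.lt_or_ge m 5 with h | h
      · refine .inl ((Tree.all_arity_le (n := m) (fun a x h => (h2le a x h).trans' one_le_two) hV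
          hl.le).imp fun a x hx => ?_)
        rcases first_cases hx.1.1 with h' | ⟨i, h'⟩
        · exact h'
        · cases h'; have := hx.2; omega
      · obtain rfl : m = 5 := by omega
        rcases Tree.all_lt_or_corolla h2le hV hl with h | ⟨x, hx, rfl⟩
        · refine .inl (h.imp fun a x hx => ?_)
          rcases first_cases hx.1.1 with h' | ⟨i, h'⟩
          · exact h'
          · cases h'; have := hx.2; omega
        · rcases first_cases hx.1 with h' | ⟨i, h'⟩
          · rcases h' with h' | h' <;> cases h'
          · cases h'
            exact .inr ⟨i, congrArg _ (funext fun j => by fin_cases j <;> rfl)⟩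
    rcases h5 with h5 | ⟨i, rfl⟩
    · rcases cases_of_degree_two h5 (by omega) (by omega) with rfl | rfl | rfl
      · exact Submodule.mem_sup_right (Submodule.mem_sup_left (Submodule.mem_span_singleton_self _))
      · exact Submodule.mem_sup_right (Submodule.mem_sup_right
          (Submodule.mem_sup_left (Submodule.mem_span_singleton_self _)))
      · exact Submodule.mem_sup_right (Submodule.mem_sup_right
          (Submodule.mem_sup_right (Submodule.mem_span_singleton_self _)))
    · exact Submodule.mem_sup_left (Submodule.subset_span ⟨i, rfl⟩)
  obtain ⟨y, hy, y', hy', rfl⟩ := Submodule.mem_sup.1 key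
  obtain ⟨z₁, hz₁, y₂, hy₂, rfl⟩ := Submodule.mem_sup.1 hy'
  obtain ⟨z₂, hz₂, z₃, hz₃, rfl⟩ := Submodule.mem_sup.1 hy₂
  obtain ⟨c, rfl⟩ := (Submodule.mem_span_range_iff_exists_fun k).1 hy
  obtain ⟨c₁, rfl⟩ := Submodule.mem_span_singleton.1 hz₁
  obtain ⟨c₂, rfl⟩ := Submodule.mem_span_singleton.1 hz₂
  obtain ⟨c₃, rfl⟩ := Submodule.mem_span_singleton.1 hz₃
  obtain ⟨h0, rfl, rfl, rfl⟩ := isLow_first.arity_five_injective c c₁ c₂ c₃ (by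
    rw [← hz0]; simp only [add_assoc])
  simp [h0]

/-- The start of the induction. The points with content are that the prescribed boundaries of the
`μ₅ⁱ` are cycles, and that the arities four and five have no homology. -/
theorem good_first (h2 : (2 : k) ≠ 0) : Good (first k) 6 where
  six_le := le_rfl
  low_gens _ _ := rfl
  low_bd _ _ := rfl
  deg_lt a x ha hx := absurd hx.2 (by omega)
  bd_mem a x hx := by
    rcases first_cases hx.1 with (h | h) | ⟨i, h⟩ <;> cases h
    · exact zero_mem _
    · exact forget_mem_of_vSpan (pSpan_le_vSpan _ _ (cubic_mem (two_mem_W (by omega))))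
    · change lowBd k 5 (low.five i) ∈ _
      rw [lowBd_five]
      exact forget_mem_of_vSpan (pSpan_le_vSpan _ _ (quintic_mem (compClosed_pSpan _)
        (gen_mem_pSpan (two_mem_W (by omega))) (gen_mem_pSpan (three_mem_W (by omega))) i))
  bd_gr a x hx := by
    rcases first_cases hx.1 with (h | h) | ⟨i, h⟩ <;> cases h
    · exact zero_mem _
    · exact forget_mem_gr cubic_mem_gr
    · change lowBd k 5 (low.five i) ∈ _
      rw [lowBd_five]
      exact forget_mem_gr (quintic_mem_gr (gen_mem _) (gen_mem _) i)
  bd_bd a x hx := by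
    have H : IsLow (first k).der low := isLow_first
    have hl : low.Bin (.leaf ()) := .leaf
    rcases first_cases hx.1 with (h | h) | ⟨i, h⟩ <;> cases h
    · exact map_zero _
    · change dA _ (lowBd k 3 low.three) = 0
      rw [lowBd_three, dA_forget, map_add]
      have h (i : Fin 2) : (first k).der.1 3 ((freeOperad k UGen udeg).comp i (gen k low.two)
          (gen k low.two)) = 0 := by
        refine (freeDer_comp (first k).der i (gen k low.two) (gen k low.two)).trans ?_
        rw [H.d_two, map_zero, map_zero, LinearMap.zero_apply, add_zero]
      exact (congrArg (forget k udeg 3) ((congrArg₂ (· + ·) (h 0) (h 1)).trans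
        (add_zero _))).trans (map_zero _)
    · change dA _ (lowBd k 5 (low.five i)) = 0
      have e : (fun _ : Fin 5 => (Tree.leaf () : Tree UGen Unit)) =
        ![.leaf (), .leaf (), .leaf (), .leaf (), .leaf ()] :=
          funext fun j => by fin_cases j <;> rfl
      -- Around a closed path with alternating signs, each vertex is shared by two consecutive edges
      -- of opposite sign, also at the start since the length is even. Here this is an explicit
      -- cancellation.
      rw [lowBd_five, ← sub_leaf, e, H.sub_quintic]
      fin_cases i
      all_goals
        simp only [Fin.zero_eta, Fin.mk_one, Fin.reduceFinMk, Matrix.cons_val, map_add, map_sub,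
          H.dA_m hl hl hl, H.dA_m (.b hl hl) hl hl, H.dA_m hl (.b hl hl) hl,
          H.dA_m hl hl (.b hl hl), H.dA_m (.b (.b hl hl) hl) hl hl,
          H.dA_m (.b hl (.b hl hl)) hl hl, H.dA_m hl (.b (.b hl hl) hl) hl,
          H.dA_m hl (.b hl (.b hl hl)) hl, H.dA_m hl hl (.b (.b hl hl) hl),
          H.dA_m hl hl (.b hl (.b hl hl)), H.dA_m (.b hl hl) (.b hl hl) hl,
          H.dA_m (.b hl hl) hl (.b hl hl), H.dA_m hl (.b hl hl) (.b hl hl),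
          H.dA_left hl, H.dA_right hl, H.dA_left (.b hl hl), H.dA_right (.b hl hl),
          ctxMap_single, ctx_zero, ctx_one]
        abel
  exact m hm hm' z hz hz0 := by
    have H : IsLow (first k).der low := isLow_first
    -- In degrees at most one the contractions apply; in degrees at least two there are no nonzero
    -- cycles at all.
    refine exact_of_homogeneous (deg := udeg) (fun d z hz hzd hz0 => ?_) hz hz0
    rcases Int.lt_or_le 1 d with hd | hd
    · rw [first_exact hm hm' hd hz hzd hz0]
      exact ⟨0, zero_mem _, map_zero _⟩
    · refine exact_low h2 H (fun a x => first_low) (fun a x hx => ?_) hm hd hz hzd hz0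
      rcases first_cases hx.1 with (h | h) | ⟨i, h⟩
      · exact .inl h
      · exact .inr (.inl h)
      · cases h; exact .inr (.inr le_rfl)

end Pre

end

end AntiAss

namespace AntiAss

universe w

noncomputable section

variable {k : Type u} [Field k]

open Operad

/-! ### The labellings of a planar tree -/

section

variable {X : ℕ → Type v} {deg : ∀ a, X a → ℤ}

theorem pSpan_mono {V W : ∀ a, X a → Prop} (h : ∀ a x, V a x → W a x) (n : ℕ) :
    pSpan k deg V n ≤ pSpan k deg W n := spanOf_mono fun _ ht => ⟨ht.1, ht.2.imp h⟩

variable (k deg) in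
/-- The part of an element that consists of the trees labelled by the permutation `σ`. -/
def part (n : ℕ) (σ : Fin n ≃ Fin n) : (freeOperad k X deg).obj n →ₗ[k] (Tree X Unit →₀ k) :=
  (freeBasis k X deg n).constr k fun t =>
    if t.perm = σ then Finsupp.single t.tree.shape 1 else 0

theorem part_elem {n : ℕ} (σ : Fin n ≃ Fin n) (t : LinTree X n) :
    part k deg n σ (t.elem k deg) = if t.perm = σ then Finsupp.single t.tree.shape 1 else 0 :=
  (freeBasis k X deg n).constr_basis k _ t

theorem LinTree.perm_map_planar {n : ℕ} {s : LinTree X n} (hs : s.Planar) (τ : Fin n ≃ Fin n) :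
    (s.map τ).perm = τ := by
  ext i
  rw [LinTree.perm_map, hs.perm]
  rfl

theorem part_relabel {V : ∀ a, X a → Prop} {n : ℕ} (σ τ : Fin n ≃ Fin n)
    {x : (freeOperad k X deg).obj n} (hx : x ∈ pSpan k deg V n) :
    part k deg n σ ((freeOperad k X deg).relabel τ x) = if τ = σ then forget k deg n x else 0 := by
  refine spanOf_induction (P := fun x => part k deg n σ ((freeOperad k X deg).relabel τ x) =
    if τ = σ then forget k deg n x else 0) hx (fun s hs => ?_) ?_ (fun x y hx hy => ?_)
    (fun c x hx => ?_)
  · rw [relabel_elem, part_elem, forget_elem, LinTree.perm_map_planar hs.1]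
    refine if_congr Iff.rfl (congrArg (Finsupp.single · (1 : k)) (Tree.shape_map τ s.tree)) rfl
  · simp only [map_zero, ite_self]
  · simp only [map_add, hx, hy]
    split_ifs
    · rfl
    · rw [add_zero]
  · simp only [map_smul, hx]
    split_ifs
    · rfl
    · rw [smul_zero]

/-- A labelled tree is a planar tree together with a permutation, so the free operad in arity `n` is
a sum of copies of the unlabelled trees indexed by permutations. -/
theorem sum_part {n : ℕ} (x : (freeOperad k X deg).obj n) :
    ∑ σ, (freeOperad k X deg).relabel σ (label k deg n (part k deg n σ x)) = x := by
  induction x using free_induction with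
  | elem t =>
    rw [Finset.sum_eq_single t.perm]
    · rw [part_elem, if_pos rfl, ← Tree.shape_map t.perm.symm t.tree]
      have := label_shape (k := k) (deg := deg) t.planar_planarize
      refine (congrArg _ this).trans ?_
      rw [relabel_elem, t.planarize_map]
    · intro σ _ h
      rw [part_elem, if_neg (Ne.symm h), map_zero, map_zero]
    · simp
  | zero => simp only [map_zero, Finset.sum_const_zero]
  | add x y hx hy => simp only [map_add, Finset.sum_add_distrib, hx, hy]
  | smul c x hx => simp only [map_smul, ← Finset.smul_sum, hx]

theorem part_mem {V : ∀ a, X a → Prop} {n : ℕ} (σ : Fin n ≃ Fin n)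
    {x : (freeOperad k X deg).obj n} (hx : x ∈ vSpan k deg V n) :
    part k deg n σ x ∈ aSpan k V n := by
  refine spanOf_induction (P := fun x => part k deg n σ x ∈ aSpan k V n) hx
    (fun s hs => ?_) ?_ (fun x y hx hy => ?_) (fun c x hx => ?_)
  · rw [part_elem]
    split_ifs
    · exact mem_aSpan_single s.len_shape (Tree.all_map.2 hs)
    · exact Submodule.zero_mem _
  · rw [map_zero]; exact Submodule.zero_mem _
  · rw [map_add]; exact Submodule.add_mem _ hx hy
  · rw [map_smul]; exact Submodule.smul_mem _ c hx

/-- The boundaries of the generators are planar, so the differential does not mix labellings. The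
symmetric complex is a sum of copies of the planar one, in any characteristic. -/
theorem part_der {θ : FreeDer k deg} {V : ∀ a, X a → Prop}
    (h : ∀ a x, θ.1 a (gen k x) ∈ pSpan k deg V a) (hV : ∀ a x, V a x) {n : ℕ}
    (σ : Fin n ≃ Fin n) (x : (freeOperad k X deg).obj n) :
    part k deg n σ (θ.1 n x) = dA θ (part k deg n σ x) := by
  induction x using free_induction with
  | elem t =>
    have h1 : t.planarize.elem k deg ∈ pSpan k deg V n :=
      elem_mem_spanOf ⟨t.planar_planarize, (all_true _).imp fun a x _ => hV a x⟩
    have h2 := freeDer_mem_pSpan θ (V := V) (fun _ _ h => h) (fun a x _ => h a x) h1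
    have h3 : t.elem k deg = (freeOperad k X deg).relabel t.perm (t.planarize.elem k deg) := by
      rw [relabel_elem, t.planarize_map]
    rw [h3, freeDer_relabel, part_relabel σ _ h2, part_relabel σ _ h1]
    split_ifs
    · rw [dA_forget]
    · rw [map_zero]
  | zero => simp only [map_zero]
  | add x y hx hy => simp only [map_add, hx, hy]
  | smul c x hx => simp only [map_smul, hx]

end

/-! ### Square zero and exactness for the complete system of generators -/

namespace Pre

variable {P : Pre k} (h : ∀ n, 6 ≤ n → Good P n)

include h

theorem V_low {a : ℕ} {x : UGen a} (hx : low.Low a x) : P.V a x :=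
  ((h 6 le_rfl).low_mem a x hx).1

theorem V_two_le {a : ℕ} {x : UGen a} (hx : P.V a x) : 2 ≤ a :=
  (h 6 le_rfl).two_le a x hx

theorem V_degree_lt {a : ℕ} {x : UGen a} (hx : P.V a x) (ha : 6 ≤ a) : 2 < x.2 :=
  (h (a + 1) (by omega)).deg_lt a x ha ⟨hx, a.lt_succ_self⟩

theorem der_mem {a : ℕ} {x : UGen a} (hx : P.V a x) :
    P.der.1 a (gen k x) ∈ pSpan k udeg (P.W a) a :=
  (h (a + 6) (by omega)).der_mem ⟨hx, by omega⟩ le_rfl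

theorem der_mem_V (a : ℕ) (x : UGen a) : P.der.1 a (gen k x) ∈ pSpan k udeg P.V a := by
  by_cases hx : P.V a x
  · exact pSpan_mono (fun _ _ h => h.1) a (der_mem h hx)
  · rw [P.der_gen_of_notMem hx]; exact Submodule.zero_mem _

theorem der_mem_true (a : ℕ) (x : UGen a) :
    P.der.1 a (gen k x) ∈ pSpan k udeg (fun _ _ => True) a :=
  pSpan_mono (fun _ _ _ => trivial) a (der_mem_V h a x)

/-- It suffices to look at generators, whose boundaries were chosen as cycles; the possible
generators that were not chosen are sent to zero. -/
theorem der_der {n : ℕ} (z : (freeOperad k UGen udeg).obj n) : P.der.1 n (P.der.1 n z) = 0 := by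
  refine freeDer_sq (fun a x => ?_) z
  by_cases hx : P.V a x
  · have hg := h (a + 6) (by omega)
    rw [hg.der_gen ⟨hx, by omega⟩, ← label_dA P.der (V := P.V) (W := P.V) (fun _ _ h => h)
      (fun a x _ => der_mem_V h a x)
      (aSpan_mono (fun _ _ h => h.1) a (hg.bd_mem a x ⟨hx, by omega⟩)),
      hg.bd_bd a x ⟨hx, by omega⟩, map_zero]
  · rw [P.der_gen_of_notMem hx, map_zero]

/-- Trees with `m` leaves involve only generators of arity at most `m`, so a single finite stage
decides about them. Adding `6` just makes the stage large enough. -/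
theorem exact_shape {m : ℕ} (hm : 4 ≤ m) {z : Tree UGen Unit →₀ k} (hz : z ∈ aSpan k P.V m)
    (hz0 : dA P.der z = 0) : ∃ y ∈ aSpan k P.V m, dA P.der y = z := by
  have hz' : z ∈ aSpan k (P.W (m + 6)) m :=
    aSpan_mono (fun a x hx => ⟨hx.1, by have := hx.2; omega⟩) m
      (aSpan_le_arity (fun a x hx => (V_two_le h hx).trans' one_le_two) m hz)
  obtain ⟨y, hy, e⟩ := (h (m + 6) (by omega)).exact m hm (by omega) z hz' hz0
  exact ⟨y, aSpan_mono (fun _ _ h => h.1) m hy, e⟩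

/-- Each labelling contributes a cycle of unlabelled trees, which is filled separately; the fillings
are relabelled and added. -/
theorem exact {m : ℕ} (hm : 4 ≤ m) {z : (freeOperad k UGen udeg).obj m}
    (hz : z ∈ vSpan k udeg P.V m) (hz0 : P.der.1 m z = 0) :
    ∃ y ∈ vSpan k udeg P.V m, P.der.1 m y = z := by
  have h1 : ∀ σ, ∃ y ∈ aSpan k P.V m, dA P.der y = part k udeg m σ z := fun σ =>
    exact_shape h hm (part_mem σ hz) (by
      rw [← part_der (der_mem_true h) (fun _ _ => trivial), hz0, map_zero])
  choose y hy e using h1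
  refine ⟨∑ σ, (freeOperad k UGen udeg).relabel σ (label k udeg m (y σ)),
    Submodule.sum_mem _ fun σ _ => relabel_vSpan P.V σ
      (pSpan_le_vSpan _ _ (label_mem (hy σ))), ?_⟩
  rw [map_sum]
  refine Eq.trans (Finset.sum_congr rfl fun σ _ => ?_) (sum_part z)
  rw [freeDer_relabel, ← label_dA P.der (V := P.V) (W := P.V) (fun _ _ h => h)
    (fun a x _ => der_mem_V h a x) (hy σ), e]

end Pre

end

end AntiAss

namespace AntiAss

universe w

noncomputable section

variable {k : Type u} [Field k]

open Operad

/-! ### Euler characteristics -/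

/-- Exactness over a field yields a contraction `c` with `D c + c D = 1`, constructed from a section
`r` of `D` onto its kernel. Then `S = S D c + S c D`, and by cyclicity the trace of `S c D` is that
of `D S c = -S D c`, so the two terms cancel. No finite range of degrees has to be handled. -/
theorem trace_eq_zero_of_exact {M : Type*} [AddCommGroup M] [Module k M] [FiniteDimensional k M]
    {D S : M →ₗ[k] M} (hD : ∀ z, D (D z) = 0) (hex : ∀ z, D z = 0 → ∃ y, D y = z)
    (hS : ∀ z, S (D z) = -D (S z)) : LinearMap.trace k M S = 0 := by
  let D' : M →ₗ[k] LinearMap.ker D := D.codRestrict _ hD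
  obtain ⟨r, hr⟩ := D'.exists_rightInverse_of_surjective (LinearMap.range_eq_top.2 fun z => by
    obtain ⟨y, hy⟩ := hex z z.2
    exact ⟨y, Subtype.ext hy⟩)
  have hr' : ∀ z : LinearMap.ker D, D (r z) = z := fun z => congrArg Subtype.val
    (LinearMap.congr_fun hr z)
  let q : M →ₗ[k] LinearMap.ker D := (LinearMap.id - r ∘ₗ D').codRestrict _ fun z => by
    rw [LinearMap.mem_ker, LinearMap.sub_apply, map_sub]
    exact sub_eq_zero.2 (hr' (D' z)).symm
  let c : M →ₗ[k] M := r ∘ₗ q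
  have h1 : ∀ z, D (c z) + c (D z) = z := by
    intro z
    have h2 : q (D z) = D' z := Subtype.ext (by
      change D z - r (D' (D z)) = D z
      rw [show D' (D z) = 0 from Subtype.ext (hD z), map_zero, sub_zero])
    change D (r (q z)) + r (q (D z)) = z
    rw [hr', h2]
    exact sub_add_cancel z _
  have h3 : S = S ∘ₗ (D ∘ₗ c) + (S ∘ₗ c) ∘ₗ D := LinearMap.ext fun z => by
    change S z = S (D (c z)) + S (c (D z))
    rw [← map_add, h1]
  have h4 : D ∘ₗ (S ∘ₗ c) = -(S ∘ₗ (D ∘ₗ c)) := LinearMap.ext fun z => by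
    change D (S (c z)) = -S (D (c z))
    rw [hS, neg_neg]
  rw [h3, map_add, LinearMap.trace_comp_comm' D (S ∘ₗ c), h4, map_neg, add_neg_cancel]

section

variable {X : ℕ → Type v}

variable (k) in
/-- The trees in `S`, as a basis of the combinations of trees in `S`. -/
def supportedBasis {ι : Type*} (S : Set ι) : Module.Basis S k (Finsupp.supported k k S) :=
  ⟨Finsupp.supportedEquivFinsupp S⟩

theorem supportedBasis_apply {ι : Type*} (S : Set ι) (i : S) :
    (supportedBasis k S i : ι →₀ k) = Finsupp.single i.1 1 := by
  change ((Finsupp.supportedEquivFinsupp (M := k) (R := k) S).symm (Finsupp.single i 1)).1 = _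
  rw [Finsupp.supportedEquivFinsupp_symm_single]

theorem trace_diagonal {ι : Type*} {S : Set ι} [Fintype S] (w : ι → k)
    {f : Finsupp.supported k k S →ₗ[k] Finsupp.supported k k S}
    (hf : ∀ (i : S) (z : Finsupp.supported k k S), z.1 = Finsupp.single i.1 1 →
      f z = w i • z) : LinearMap.trace k _ f = ∑ i : S, w i := by
  classical
  rw [LinearMap.trace_eq_matrix_trace k (supportedBasis k S), Matrix.trace]
  refine Finset.sum_congr rfl fun i _ => ?_
  rw [Matrix.diag_apply, LinearMap.toMatrix_apply, hf i _ (supportedBasis_apply S i), map_smul,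
    Module.Basis.repr_self, Finsupp.smul_apply, Finsupp.single_eq_same, smul_eq_mul, mul_one]

variable (k) in
/-- The sign involution on combinations of trees. -/
def signMap (deg : ∀ a, X a → ℤ) : (Tree X Unit →₀ k) →ₗ[k] (Tree X Unit →₀ k) :=
  Finsupp.linearCombination k fun t => ksign k (t.degree deg) • Finsupp.single t 1

theorem signMap_of_mem {deg : ∀ a, X a → ℤ} {d : ℤ} {z : Tree X Unit →₀ k}
    (hz : z ∈ aGr k deg d) : signMap k deg z = ksign k d • z := by
  refine supported_induction (P := fun z => signMap k deg z = ksign k d • z) hz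
    (fun t ht => ?_) ?_ (fun x y hx hy => ?_) (fun c x hx => ?_)
  · rw [signMap, Finsupp.linearCombination_single, one_smul, show t.degree deg = d from ht]
  · rw [map_zero, smul_zero]
  · rw [map_add, hx, hy, smul_add]
  · rw [map_smul, hx, smul_comm]

/-- The differential changes the parity of the degree, so it anticommutes with the sign involution,
as the vanishing of the trace requires. -/
theorem signMap_dA {deg : ∀ a, X a → ℤ} (θ : FreeDer k deg) (z : Tree X Unit →₀ k) :
    signMap k deg (dA θ z) = -dA θ (signMap k deg z) := by
  induction z using finsupp_induction with
  | single t =>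
    have h1 : (Finsupp.single t 1 : Tree X Unit →₀ k) ∈ aGr k deg (t.degree deg) :=
      Finsupp.single_mem_supported k _ rfl
    rw [signMap_of_mem h1, signMap_of_mem (dA_mem_aGr θ h1), map_smul, ← neg_smul, sub_eq_add_neg,
      ksign_add]
    simp [ksign]
  | zero => simp only [map_zero, neg_zero]
  | add x y hx hy => simp only [map_add, hx, hy, neg_add]
  | smul c x hx => simp only [map_smul, hx, smul_neg]

end

namespace Pre

/-- The sign of a degree, as an integer. -/
def sg (n : ℤ) : ℤ := (n.negOnePow : ℤ)

theorem sg_add (m n : ℤ) : sg (m + n) = sg m * sg n := by simp [sg, Int.negOnePow_add]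

theorem sg_sum {ι : Type*} (s : Finset ι) (f : ι → ℤ) : sg (∑ i ∈ s, f i) = ∏ i ∈ s, sg (f i) := by
  classical
  induction s using Finset.induction_on with
  | empty => simp [sg]
  | insert a s ha ih => rw [Finset.sum_insert ha, Finset.prod_insert ha, sg_add, ih]

variable {P : Pre k} (h : ∀ n, 6 ≤ n → Good P n)

include h

theorem finite_trees (n : ℕ) : {t : Tree UGen Unit | t.len ≤ n ∧ t.All P.V}.Finite :=
  Tree.finite_trees (fun _ _ hx => V_two_le h hx) (fun a => (P.gens a).finite_toSet) n

/-- The trees with at most `n` leaves. -/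
def trees (n : ℕ) : Finset (Tree UGen Unit) := (finite_trees h n).toFinset

theorem mem_trees {n : ℕ} {t : Tree UGen Unit} : t ∈ trees h n ↔ t.len ≤ n ∧ t.All P.V :=
  (finite_trees h n).mem_toFinset

/-- The Euler characteristic is the trace of the sign involution on the complex of trees with `m`
leaves, which is exact for `m ≥ 4`. -/
theorem euler_eq_zero [CharZero k] {m n : ℕ} (hm : 4 ≤ m) (hmn : m ≤ n) :
    ∑ t ∈ trees h n with t.len = m, sg (t.degree udeg) = 0 := by
  let S : Set (Tree UGen Unit) := {t | t.len = m ∧ t.All P.V}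
  have hS : S.Finite := (finite_trees h m).subset fun t ht => ⟨ht.1.le, ht.2⟩
  let _ : Fintype S := hS.fintype
  have hfd : FiniteDimensional k (aSpan k P.V m) :=
    aSpan_finite (fun _ _ hx => V_two_le h hx) (fun a => (P.gens a).finite_toSet) m
  have hDm : ∀ z ∈ aSpan k P.V m, dA P.der z ∈ aSpan k P.V m := fun z hz =>
    dA_mem_aSpan P.der (fun _ _ h => h) (fun a x _ => pSpan_le_vSpan _ _ (der_mem_V h a x)) hz
  have hSm : ∀ z ∈ aSpan k P.V m, signMap k udeg z ∈ aSpan k P.V m := fun z hz => by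
    refine supported_induction (P := fun z => signMap k udeg z ∈ aSpan k P.V m) hz
      (fun t ht => ?_) ?_ (fun x y hx hy => ?_) (fun c x hx => ?_)
    · rw [signMap, Finsupp.linearCombination_single, one_smul]
      exact Submodule.smul_mem _ _ (mem_aSpan_single ht.1 ht.2)
    · rw [map_zero]; exact zero_mem _
    · rw [map_add]; exact add_mem hx hy
    · rw [map_smul]; exact Submodule.smul_mem _ _ hx
  have h0 := trace_eq_zero_of_exact (k := k) (M := aSpan k P.V m) (D := (dA P.der).restrict hDm)
    (S := (signMap k udeg).restrict hSm) (fun z => Subtype.ext ?_) (fun z hz => ?_)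
    (fun z => Subtype.ext ?_)
  · have h1 := trace_diagonal (k := k) (S := S) (fun t => ksign k (t.degree udeg))
      (f := (signMap k udeg).restrict hSm) fun t z hz => Subtype.ext (by
        change signMap k udeg z.1 = ksign k _ • z.1
        rw [hz, signMap, Finsupp.linearCombination_single, one_smul])
    have h2 := h1.symm.trans h0
    -- The trace computes the integer only after mapping it to `k`; characteristic zero recovers it.
    have h3 : ((∑ t ∈ trees h n with t.len = m, sg (t.degree udeg) : ℤ) : k) = 0 := by
      rw [← h2, Int.cast_sum]
      refine (Finset.sum_subtype _ (fun t => ?_) fun t : Tree UGen Unit => ((sg (t.degree udeg) : ℤ) : k))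
      rw [Finset.mem_filter, mem_trees]
      exact ⟨fun ht => ⟨ht.2, ht.1.2⟩, fun ht => ⟨⟨ht.1.le.trans hmn, ht.2⟩, ht.1⟩⟩
    exact_mod_cast h3
  · change dA P.der (dA P.der z.1) = 0
    rw [dA_eq (hDm _ z.2), label_dA P.der (V := P.V) (W := P.V) (fun _ _ h => h)
      (fun a x _ => der_mem_V h a x) z.2, der_der h, map_zero]
  · obtain ⟨y, hy, e⟩ := exact_shape h hm z.2 (congrArg Subtype.val hz)
    exact ⟨⟨y, hy⟩, Subtype.ext e⟩
  · exact signMap_dA P.der z.1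

open Polynomial in
/-- The generating function of the Euler characteristics of the trees with at most `n` leaves. -/
def series (n : ℕ) : ℤ[X] := ∑ t ∈ trees h n, monomial t.len (sg (t.degree udeg))

omit h in
/-- The Euler characteristic of the generators of arity `a`. -/
def chi (P : Pre k) (a : ℕ) : ℤ := ∑ x ∈ P.gens a, sg x.2

theorem coeff_series (n m : ℕ) :
    (series h n).coeff m = ∑ t ∈ trees h n with t.len = m, sg (t.degree udeg) := by
  rw [series, Polynomial.finsetSum_coeff, Finset.sum_filter]
  exact Finset.sum_congr rfl fun t _ => Polynomial.coeff_monomial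

/-- The `a`-th power enumerates families of `a` branches: leaves add up and signs multiply. -/
theorem coeff_series_pow (n m a : ℕ) : (series h n ^ a).coeff m =
    ∑ c ∈ Fintype.piFinset (fun _ : Fin a => trees h n) with ∑ i, (c i).len = m,
      ∏ i, sg ((c i).degree udeg) := by
  have h1 : series h n ^ a = ∏ _i : Fin a, series h n := by simp
  have h2 : ∀ c : Fin a → Tree UGen Unit,
      ∏ i, Polynomial.monomial (c i).len (sg ((c i).degree udeg)) =
        Polynomial.monomial (∑ i, (c i).len) (∏ i, sg ((c i).degree udeg)) := fun c => by
    simp only [← Polynomial.C_mul_X_pow_eq_monomial, Finset.prod_mul_distrib,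
      Finset.prod_pow_eq_pow_sum, map_prod]
  rw [h1]
  simp only [series]
  rw [Finset.prod_univ_sum, Polynomial.finsetSum_coeff, Finset.sum_filter]
  refine Finset.sum_congr rfl fun c _ => ?_
  rw [h2, Polynomial.coeff_monomial]

/-- The decomposition of a tree at its root. -/
theorem coeff_series_eq {m n : ℕ} (hm : 2 ≤ m) (hmn : m ≤ n) :
    (series h n).coeff m = ∑ a ∈ Finset.range (n + 1), P.chi a * (series h n ^ a).coeff m := by
  have h1 : ∀ a x, P.V a x → 1 ≤ a := fun a x hx => (V_two_le h hx).trans' one_le_two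
  simp only [coeff_series, coeff_series_pow, chi, Finset.sum_mul_sum]
  simp only [← Finset.sum_product']
  rw [Finset.sum_sigma' (Finset.range (n + 1))
    (fun a => P.gens a ×ˢ {c ∈ Fintype.piFinset (fun _ : Fin a => trees h n) | ∑ i, (c i).len = m})
    (fun a xc => sg xc.1.2 * ∏ i, sg ((xc.2 i).degree udeg))]
  symm
  -- A tree with at least two leaves has a root vertex and is given by this vertex and its branches.
  -- Truncation at `n` does no harm, since arity and branches are bounded by the number of leaves,
  -- which is at most `n`.
  refine Finset.sum_bij (fun y _ => Tree.node (X := UGen) (a := y.1) y.2.1 y.2.2) ?_ ?_ ?_ ?_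
  · rintro ⟨a, x, c⟩ hy
    simp only [Finset.mem_sigma, Finset.mem_product, Finset.mem_filter, Fintype.mem_piFinset,
      mem_trees] at hy ⊢
    rw [Tree.len_node]
    exact ⟨⟨by omega, hy.2.1, fun i => (hy.2.2.1 i).2⟩, hy.2.2.2⟩
  · rintro ⟨a, x, c⟩ _ ⟨a', x', c'⟩ _ e
    cases e
    rfl
  · intro t ht
    rw [Finset.mem_filter, mem_trees] at ht
    rcases t with _ | @⟨a, x, c⟩
    · rw [Tree.len_leaf] at ht; omega
    · have h2 := ht.1.2
      refine ⟨⟨a, x, c⟩, ?_, rfl⟩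
      simp only [Finset.mem_sigma, Finset.mem_product, Finset.mem_filter, Fintype.mem_piFinset,
        mem_trees, Finset.mem_range]
      have h3 := Tree.arity_le_len h1 h2
      refine ⟨by omega, h2.1, fun i => ⟨?_, h2.2 i⟩, by rw [← ht.2, Tree.len_node]⟩
      have := Tree.child_bounds h1 h2 i
      have := h1 _ _ h2.1
      omega
  · rintro ⟨a, x, c⟩ _
    rw [Tree.degree_node, sg_add, sg_sum]

theorem coeff_series_zero (n : ℕ) : (series h n).coeff 0 = 0 := by
  rw [coeff_series, Finset.filter_eq_empty_iff.2, Finset.sum_empty]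
  intro t ht h0
  have := Tree.one_le_len (fun a x hx => (V_two_le h hx).trans' one_le_two) ((mem_trees h).1 ht).2
  omega

theorem coeff_series_one {n : ℕ} (hn : 1 ≤ n) : (series h n).coeff 1 = 1 := by
  have h1 : (trees h n).filter (fun t => t.len = 1) = {.leaf ()} := by
    ext t
    rw [Finset.mem_filter, mem_trees, Finset.mem_singleton]
    constructor
    · rintro ⟨⟨-, h1⟩, h2⟩
      exact Tree.eq_leaf (fun a x hx => V_two_le h hx) h1 h2.le
    · rintro rfl
      exact ⟨⟨hn, trivial⟩, rfl⟩
  rw [coeff_series, h1, Finset.sum_singleton]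
  rfl

theorem chi_low {a : ℕ} (ha : a < 6) : P.chi a = ∑ x ∈ lowGens a, sg x.2 := by
  rw [chi, (h 6 le_rfl).low_gens a ha]

theorem chi_zero : P.chi 0 = 0 := by rw [chi_low h (by omega)]; rfl
theorem chi_one : P.chi 1 = 0 := by rw [chi_low h (by omega)]; rfl
theorem chi_two : P.chi 2 = 1 := by rw [chi_low h (by omega)]; simp [lowGens, sg]
theorem chi_three : P.chi 3 = -1 := by rw [chi_low h (by omega)]; simp [lowGens, sg]
theorem chi_four : P.chi 4 = 0 := by rw [chi_low h (by omega)]; rfl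
theorem chi_five : P.chi 5 = 4 := by
  rw [chi_low h (by omega), lowGens, Finset.sum_map]
  rfl

/-- There is no tree without leaves, so the series is divisible by `X` and its `a`-th power by `Xᵃ`.
-/
theorem coeff_series_pow_of_lt {n m a : ℕ} (ha : m < a) : (series h n ^ a).coeff m = 0 :=
  Polynomial.X_pow_dvd_iff.1 (pow_dvd_pow_of_dvd
    (Polynomial.X_dvd_iff.2 (coeff_series_zero h n)) a) m ha

open Polynomial in
-- From arity four on, exactness makes the coefficients vanish. The lower ones come from the
-- decomposition at the root: one leaf, one tree with two leaves, and `2 - 1 = 1` for three leaves,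
-- from two binary trees and the corolla of `μ₃`.
theorem series_nine [CharZero k] : series h 9 = X + X ^ 2 + X ^ 3 := by
  have h0 := coeff_series_zero h 9
  have h1 := coeff_series_one h (n := 9) (by omega)
  have h2 : (series h 9).coeff 2 = 1 := by
    rw [coeff_series_eq h le_rfl (by omega)]
    have e : ∀ a, 2 < a → (series h 9 ^ a).coeff 2 = 0 := fun a => coeff_series_pow_of_lt h
    simp only [Finset.sum_range_succ, Finset.sum_range_zero, chi_zero h, chi_one h, chi_two h]
    rw [e 3, e 4, e 5, e 6, e 7, e 8, e 9, sq, coeff_mul] <;> try omega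
    simp [Finset.Nat.antidiagonal_succ, h0, h1]
  have h3 : (series h 9).coeff 3 = 1 := by
    rw [coeff_series_eq h (by omega) (by omega)]
    have e : ∀ a, 3 < a → (series h 9 ^ a).coeff 3 = 0 := fun a => coeff_series_pow_of_lt h
    simp only [Finset.sum_range_succ, Finset.sum_range_zero, chi_zero h, chi_one h, chi_two h,
      chi_three h]
    rw [e 4, e 5, e 6, e 7, e 8, e 9, pow_succ (series h 9) 2, sq, coeff_mul, coeff_mul]
      <;> try omega
    simp [Finset.Nat.antidiagonal_succ, coeff_mul, h0, h1, h2]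
  ext m
  have hX : (X + X ^ 2 + X ^ 3 : ℤ[X]).coeff m =
      (if m = 1 then 1 else 0) + (if m = 2 then 1 else 0) + if m = 3 then 1 else 0 := by
    simp only [coeff_add, coeff_X_pow, coeff_X, eq_comm (a := 1)]
  rw [hX]
  match m with
  | 0 => simpa using h0
  | 1 => simpa using h1
  | 2 => simpa using h2
  | 3 => simpa using h3
  | m + 4 =>
    rw [if_neg (by omega), if_neg (by omega), if_neg (by omega)]
    rcases Nat.lt_or_ge 9 (m + 4) with hm | hm
    · rw [coeff_series, Finset.filter_eq_empty_iff.2, Finset.sum_empty]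
      · rfl
      · intro t ht ht'
        have := ((mem_trees h).1 ht).1
        omega
    · rw [coeff_series, euler_eq_zero h (by omega) hm]
      rfl

open Polynomial in
-- Comparing coefficients in `f = X + ∑ χ(a) fᵃ` gives a triangular system, as `fᵃ` begins with
-- `Xᵃ`. For instance the coefficient of `X⁶` reads `0 = 1 - 7 + 4 · 5 + χ(6)`.
theorem chi_high [CharZero k] : P.chi 6 = -14 ∧ P.chi 7 = 30 ∧ P.chi 8 = -33 ∧ P.chi 9 = -55 := by
  have e : ∀ m, 4 ≤ m → m ≤ 9 →
      0 = ∑ a ∈ Finset.range 10, P.chi a * ((X + X ^ 2 + X ^ 3 : ℤ[X]) ^ a).coeff m := by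
    intro m hm hm'
    rw [← series_nine h, ← coeff_series_eq h (by omega) hm', coeff_series,
      euler_eq_zero h hm hm']
  simp only [Finset.sum_range_succ, Finset.sum_range_zero, chi_zero h, chi_one h, chi_two h,
    chi_three h, chi_four h, chi_five h] at e
  have p2 : (X + X ^ 2 + X ^ 3 : ℤ[X]) ^ 2 =
      X ^ 2 + 2 * X ^ 3 + 3 * X ^ 4 + 2 * X ^ 5 + X ^ 6 := by ring
  have p3 : (X + X ^ 2 + X ^ 3 : ℤ[X]) ^ 3 =
      X ^ 3 + 3 * X ^ 4 + 6 * X ^ 5 + 7 * X ^ 6 + 6 * X ^ 7 + 3 * X ^ 8 + X ^ 9 := by ring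
  have p5 : (X + X ^ 2 + X ^ 3 : ℤ[X]) ^ 5 =
      X ^ 5 + 5 * X ^ 6 + 15 * X ^ 7 + 30 * X ^ 8 + 45 * X ^ 9 + 51 * X ^ 10 + 45 * X ^ 11 +
      30 * X ^ 12 + 15 * X ^ 13 + 5 * X ^ 14 + X ^ 15 := by ring
  have p6 : (X + X ^ 2 + X ^ 3 : ℤ[X]) ^ 6 =
      X ^ 6 + 6 * X ^ 7 + 21 * X ^ 8 + 50 * X ^ 9 + 90 * X ^ 10 + 126 * X ^ 11 + 141 * X ^ 12 +
      126 * X ^ 13 + 90 * X ^ 14 + 50 * X ^ 15 + 21 * X ^ 16 + 6 * X ^ 17 + X ^ 18 := by ring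
  have p7 : (X + X ^ 2 + X ^ 3 : ℤ[X]) ^ 7 =
      X ^ 7 + 7 * X ^ 8 + 28 * X ^ 9 + 77 * X ^ 10 + 161 * X ^ 11 + 266 * X ^ 12 + 357 * X ^ 13 +
      393 * X ^ 14 + 357 * X ^ 15 + 266 * X ^ 16 + 161 * X ^ 17 + 77 * X ^ 18 + 28 * X ^ 19 +
      7 * X ^ 20 + X ^ 21 := by ring
  have p8 : (X + X ^ 2 + X ^ 3 : ℤ[X]) ^ 8 =
      X ^ 8 + 8 * X ^ 9 + 36 * X ^ 10 + 112 * X ^ 11 + 266 * X ^ 12 + 504 * X ^ 13 +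
      784 * X ^ 14 + 1016 * X ^ 15 + 1107 * X ^ 16 + 1016 * X ^ 17 + 784 * X ^ 18 +
      504 * X ^ 19 + 266 * X ^ 20 + 112 * X ^ 21 + 36 * X ^ 22 + 8 * X ^ 23 + X ^ 24 := by ring
  have p9 : (X + X ^ 2 + X ^ 3 : ℤ[X]) ^ 9 =
      X ^ 9 + 9 * X ^ 10 + 45 * X ^ 11 + 156 * X ^ 12 + 414 * X ^ 13 + 882 * X ^ 14 +
      1554 * X ^ 15 + 2304 * X ^ 16 + 2907 * X ^ 17 + 3139 * X ^ 18 + 2907 * X ^ 19 +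
      2304 * X ^ 20 + 1554 * X ^ 21 + 882 * X ^ 22 + 414 * X ^ 23 + 156 * X ^ 24 + 45 * X ^ 25 +
      9 * X ^ 26 + X ^ 27 := by ring
  have e6 := e 6 (by omega) (by omega)
  have e7 := e 7 (by omega) (by omega)
  have e8 := e 8 (by omega) (by omega)
  have e9 := e 9 (by omega) (by omega)
  simp only [p2, p3, p5, p6, p7, p8, p9, coeff_add, coeff_ofNat_mul, coeff_X_pow] at e6 e7 e8 e9
  norm_num at e6 e7 e8 e9
  omega

end Pre

end

end AntiAss

namespace AntiAss

universe w

noncomputable section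

variable {k : Type u} [Field k]

open Operad

/-! ### The number of vertices -/

namespace Tree

variable {X : ℕ → Type v} {α β : Type}

theorem size_bind (t : Tree X α) (f : α → Tree X β) :
    (t.bind f).size = t.size + (t.labels.map fun a => (f a).size).sum := by
  induction t with
  | leaf a => simp [bind, size]
  | node x c ih =>
    rw [labels_node, List.map_flatten, List.sum_flatten, List.map_map, List.map_ofFn,
      List.sum_ofFn]
    simp only [bind, size, ih, Finset.sum_add_distrib, add_assoc]
    rfl

theorem size_map (t : Tree X α) (f : α → β) : (t.map f).size = t.size := by
  rw [map, size_bind]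
  simp [size]

end Tree

theorem LinTree.size_graft {X : ℕ → Type v} {m n : ℕ} (i : Fin m) (s : LinTree X m)
    (t : LinTree X n) : (s.graft i t).tree.size = s.tree.size + t.tree.size := by
  change (s.tree.bind _).size = _
  rw [Tree.size_bind, (s.labels_perm.map _).sum_eq, ← List.ofFn_eq_map, List.sum_ofFn,
    Finset.sum_eq_single i]
  · rw [Tree.plug_self, Tree.size_map]
  · intro j _ hj
    rw [Tree.plug_ne _ hj]; rfl
  · simp

theorem LinTree.eq_one_of_size {X : ℕ → Type v} {n : ℕ} {t : LinTree X n} (h : t.tree.size = 0) :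
    n = 1 := by
  have h1 := t.length_labels
  rcases ht : t.tree with b | ⟨x, c⟩
  · rw [ht] at h1; exact h1.symm
  · rw [ht] at h; simp [Tree.size] at h

section

variable {X : ℕ → Type v} {deg : ∀ a, X a → ℤ}

theorem elem_mem_decomposables {n : ℕ} {t : LinTree X n} (h : 2 ≤ t.tree.size) :
    t.elem k deg ∈ decomposables k X deg n := Finsupp.single_mem_supported k _ h

theorem spanOf_le_decomposables (n : ℕ) :
    spanOf k deg {t : LinTree X n | 2 ≤ t.tree.size} ≤ decomposables k X deg n := by
  refine Submodule.span_le.2 ?_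
  rintro _ ⟨t, ht, rfl⟩
  exact elem_mem_decomposables ht

theorem spanOf_comp {m n : ℕ} {S : Set (LinTree X m)} {T : Set (LinTree X n)}
    {R : Set (LinTree X (m + n - 1))} (i : Fin m)
    (h : ∀ s ∈ S, ∀ t ∈ T, s.graft i t ∈ R) {x : (freeOperad k X deg).obj m}
    {y : (freeOperad k X deg).obj n} (hx : x ∈ spanOf k deg S) (hy : y ∈ spanOf k deg T) :
    (freeOperad k X deg).comp i x y ∈ spanOf k deg R := by
  refine spanOf_induction (P := fun x => (freeOperad k X deg).comp i x y ∈ spanOf k deg R) hx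
    (fun s hs => ?_) ?_ (fun x y hx hy => ?_) (fun c x hx => ?_)
  · refine spanOf_induction (P := fun y => (freeOperad k X deg).comp i _ y ∈ spanOf k deg R) hy
      (fun t ht => ?_) ?_ (fun x y hx hy => ?_) (fun c x hx => ?_)
    · rw [comp_elem]; exact Submodule.smul_mem _ _ (elem_mem_spanOf (h s hs t ht))
    · rw [map_zero]; exact Submodule.zero_mem _
    · rw [map_add]; exact Submodule.add_mem _ hx hy
    · rw [map_smul]; exact Submodule.smul_mem _ c hx
  · rw [map_zero]; exact Submodule.zero_mem _
  · rw [map_add]; exact Submodule.add_mem _ hx hy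
  · rw [map_smul]; exact Submodule.smul_mem _ c hx

theorem mem_spanOf_univ {n : ℕ} (x : (freeOperad k X deg).obj n) :
    x ∈ spanOf k deg (Set.univ : Set (LinTree X n)) :=
  free_induction (P := fun x => x ∈ spanOf k deg Set.univ) x
    (fun _ => elem_mem_spanOf (Set.mem_univ _)) (Submodule.zero_mem _)
    (fun _ _ => Submodule.add_mem _) fun c _ => Submodule.smul_mem _ c

theorem relabel_spanOf {m n : ℕ} (σ : Fin m ≃ Fin n) {S : Set (LinTree X m)}
    {T : Set (LinTree X n)} (h : ∀ s ∈ S, s.map σ ∈ T) {x : (freeOperad k X deg).obj m}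
    (hx : x ∈ spanOf k deg S) : (freeOperad k X deg).relabel σ x ∈ spanOf k deg T := by
  refine spanOf_induction (P := fun x => (freeOperad k X deg).relabel σ x ∈ spanOf k deg T) hx
    (fun s hs => ?_) ?_ (fun x y hx hy => ?_) (fun c x hx => ?_)
  · rw [relabel_elem]; exact elem_mem_spanOf (h s hs)
  · rw [map_zero]; exact Submodule.zero_mem _
  · rw [map_add]; exact Submodule.add_mem _ hx hy
  · rw [map_smul]; exact Submodule.smul_mem _ c hx

/-- A differential has decomposable values if it has decomposable values on the generators. -/
theorem decomposable_of_gen (d : (freeOperad k X deg).Differential)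
    (h : ∀ a (x : X a), d.d a (gen k x) ∈ spanOf k deg {t : LinTree X a | 2 ≤ t.tree.size})
    {n : ℕ} (x : (freeOperad k X deg).obj n) : d.d n x ∈ decomposables k X deg n := by
  refine spanOf_le_decomposables n ?_
  have hc : ∀ {m n} (i : Fin m) (x : (freeOperad k X deg).obj m) (y : (freeOperad k X deg).obj n),
      d.d _ ((freeOperad k X deg).comp i x y) = (freeOperad k X deg).comp i (d.d m x) y +
        (freeOperad k X deg).comp i ((freeOperad k X deg).sgn 1 m x) (d.d n y) := by
    intro m n i x y
    induction x using gr_induction with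
    | mem p x hx =>
      rw [d.d_comp i y hx, sgn_of_mem 1 hx, one_mul, map_smul, LinearMap.smul_apply]
    | add x x' hx hx' =>
      simp only [map_add, LinearMap.add_apply, hx, hx']
      exact add_add_add_comm _ _ _ _
  refine eq_top_of_gen (p := fun n => (spanOf k deg {t : LinTree X n | 2 ≤ t.tree.size}).comap
    (d.d n)) ⟨?_, fun {m n} i x y hx hy => ?_⟩ (fun {n} σ x hx => ?_) h x
  -- As for derivations, `1 ∘ 1 = 1` and the Leibniz rule show that the differential kills the unit.
  · have e := hc 0 (freeOperad k X deg).one (freeOperad k X deg).one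
    have h1 := congrArg ((freeOperad k X deg).relabel (finCongr (by omega : 1 + 1 - 1 = 1))) e
    rw [← d.d_relabel, one_comp, map_add, comp_one, sgn_of_mem 1 (freeOperad k X deg).one_mem,
      mul_zero, ksign_zero, one_smul, one_comp] at h1
    rw [Submodule.mem_comap, left_eq_add.1 h1]
    exact Submodule.zero_mem _
  · rw [Submodule.mem_comap, hc]
    exact Submodule.add_mem _
      (spanOf_comp i (fun s hs t _ => by
        change 2 ≤ _
        rw [LinTree.size_graft]
        exact (show 2 ≤ s.tree.size from hs).trans (Nat.le_add_right _ _)) hx (mem_spanOf_univ y))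
      (spanOf_comp i (fun s _ t ht => by
        change 2 ≤ _
        rw [LinTree.size_graft]
        exact (show 2 ≤ t.tree.size from ht).trans (Nat.le_add_left _ _)) (mem_spanOf_univ _) hy)
  · rw [Submodule.mem_comap, d.d_relabel]
    refine relabel_spanOf σ (fun s hs => ?_) hx
    change 2 ≤ (s.tree.map σ).size
    rwa [Tree.size_map]

end

/-! ### The free operad on the chosen generators as a retract -/

namespace Pre

variable (P : Pre k)

/-- The generators of the minimal model. -/
abbrev Gen (a : ℕ) : Type := {x : UGen a // x ∈ P.gens a}

/-- The degrees of the generators of the minimal model. -/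
abbrev gdeg : ∀ a, P.Gen a → ℤ := fun _ x => x.1.2

/-- The inclusion of the chosen generators. -/
def incl : (freeOperad k P.Gen P.gdeg).Hom (freeOperad k UGen udeg) :=
  freeHom (f := fun _ x => gen k (X := UGen) (deg := udeg) x.1) fun _ _ => gen_mem _

/-- The projection that kills the other generators. -/
def retr : (freeOperad k UGen udeg).Hom (freeOperad k P.Gen P.gdeg) :=
  freeHom (f := fun a x => if h : x ∈ P.gens a then
    gen k (X := P.Gen) (deg := P.gdeg) ⟨x, h⟩ else 0) fun a x => by
    split_ifs with h
    · exact gen_mem (X := P.Gen) (deg := P.gdeg) ⟨x, h⟩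
    · exact Submodule.zero_mem _

theorem incl_gen {a : ℕ} (x : P.Gen a) : P.incl.app a (gen k x) = gen k (X := UGen) x.1 :=
  freeHom_gen _ x

theorem retr_gen {a : ℕ} (x : P.Gen a) : P.retr.app a (gen k (X := UGen) x.1) = gen k x :=
  (freeHom_gen _ _).trans (dif_pos x.2)

theorem retr_incl {n : ℕ} (x : (freeOperad k P.Gen P.gdeg).obj n) :
    P.retr.app n (P.incl.app n x) = x :=
  freeHom_ext (f := P.incl.trans P.retr) (g := Operad.Hom.id _) (fun a x => by
    change P.retr.app a (P.incl.app a (gen k x)) = gen k x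
    rw [incl_gen, retr_gen]) n x

theorem incl_mem {n : ℕ} (x : (freeOperad k P.Gen P.gdeg).obj n) :
    P.incl.app n x ∈ vSpan k udeg P.V n :=
  eq_top_of_gen (p := fun n => (vSpan k udeg P.V n).comap (P.incl.app n))
    ⟨by
      rw [Submodule.mem_comap, P.incl.app_one]; exact (compClosed_vSpan P.V).one, fun i x y hx hy => by
      rw [Submodule.mem_comap, P.incl.app_comp]; exact (compClosed_vSpan P.V).comp i hx hy⟩
    (fun σ x hx => by
      rw [Submodule.mem_comap, P.incl.app_relabel]; exact relabel_vSpan P.V σ hx)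
    (fun a x => by
      rw [Submodule.mem_comap, incl_gen]
      exact pSpan_le_vSpan _ _ (gen_mem_pSpan x.2)) x

/-- With `retr_incl`, this identifies the model with the span of the trees that use chosen
generators only. This span is stable under the differential, so the differential and the exactness
are inherited. -/
theorem incl_retr {n : ℕ} {z : (freeOperad k UGen udeg).obj n} (hz : z ∈ vSpan k udeg P.V n) :
    P.incl.app n (P.retr.app n z) = z := by
  refine spanOf_induction (P := fun z => P.incl.app n (P.retr.app n z) = z) hz
    (fun s hs => ?_) ?_ (fun x y hx hy => ?_) (fun c x hx => ?_)
  · refine tree_mem (p := fun n => LinearMap.eqLocus (P.incl.app n ∘ₗ P.retr.app n) LinearMap.id)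
      ⟨?_, fun i x y hx hy => ?_⟩ (fun σ x hx => ?_) s (hs.imp fun a x hx => ?_)
    · change P.incl.app _ (P.retr.app _ _) = _
      rw [P.retr.app_one, P.incl.app_one]; rfl
    · change P.incl.app _ (P.retr.app _ _) = _
      rw [P.retr.app_comp, P.incl.app_comp, show P.incl.app _ (P.retr.app _ x) = x from hx,
        show P.incl.app _ (P.retr.app _ y) = y from hy]; rfl
    · change P.incl.app _ (P.retr.app _ _) = _
      rw [P.retr.app_relabel, P.incl.app_relabel, show P.incl.app _ (P.retr.app _ x) = x from hx]
      rfl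
    · change P.incl.app _ (P.retr.app _ (gen k x)) = _
      have := P.retr_gen ⟨x, hx⟩
      rw [this, incl_gen]
      rfl
  · simp only [map_zero]
  · simp only [map_add, hx, hy]
  · simp only [map_smul, hx]

variable {P} (h : ∀ n, 6 ≤ n → Good P n)

include h

theorem der_mem_vSpan {n : ℕ} {z : (freeOperad k UGen udeg).obj n}
    (hz : z ∈ vSpan k udeg P.V n) : P.der.1 n z ∈ vSpan k udeg P.V n :=
  freeDer_mem_vSpan P.der (fun _ _ h => h) (fun a x _ => pSpan_le_vSpan _ _ (der_mem_V h a x)) hz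

theorem incl_retr_der {n : ℕ} (x : (freeOperad k P.Gen P.gdeg).obj n) :
    P.incl.app n (P.retr.app n (P.der.1 n (P.incl.app n x))) = P.der.1 n (P.incl.app n x) :=
  P.incl_retr (der_mem_vSpan h (P.incl_mem x))

/-- The differential of the minimal model. -/
def diff : (freeOperad k P.Gen P.gdeg).Differential where
  d n := P.retr.app n ∘ₗ P.der.1 n ∘ₗ P.incl.app n
  d_mem hx := P.retr.app_mem (freeDer_mem P.der (P.incl.app_mem hx))
  d_relabel σ x := by
    simp only [LinearMap.comp_apply, P.incl.app_relabel, freeDer_relabel, P.retr.app_relabel]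
  d_comp i p x y hx := by
    simp only [LinearMap.comp_apply]
    rw [P.incl.app_comp, freeDer_comp, sgn_of_mem 1 (P.incl.app_mem hx), map_add, P.retr.app_comp,
      P.retr.app_comp, map_smul, P.retr_incl, P.retr_incl, one_mul, map_smul, LinearMap.smul_apply]
  d_d x := by
    simp only [LinearMap.comp_apply]
    rw [incl_retr_der h, der_der h, map_zero]

theorem diff_apply {n : ℕ} (x : (freeOperad k P.Gen P.gdeg).obj n) :
    (diff h).d n x = P.retr.app n (P.der.1 n (P.incl.app n x)) := rfl

theorem incl_diff {n : ℕ} (x : (freeOperad k P.Gen P.gdeg).obj n) :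
    P.incl.app n ((diff h).d n x) = P.der.1 n (P.incl.app n x) := incl_retr_der h x

omit h in
-- The boundary of a generator of arity `a` involves only generators of smaller arity, so no tree in
-- it has just one vertex; and a tree without vertices has arity one. This is the minimality of the
-- model.
theorem retr_mem {a : ℕ} (ha : 2 ≤ a) {z : (freeOperad k UGen udeg).obj a}
    (hz : z ∈ vSpan k udeg (P.W a) a) :
    P.retr.app a z ∈ spanOf k P.gdeg {t : LinTree P.Gen a | 2 ≤ t.tree.size} := by
  -- The case `n = a` of the condition that a tree of arity `n` with one vertex satisfies `n < a`.
  -- For varying `n` it is stable under grafting, because grafting on or with a tree without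
  -- vertices does not change the arity.
  have h1 : P.retr.app a z ∈ spanOf k P.gdeg {t : LinTree P.Gen a | t.tree.size = 1 → a < a} := by
    refine spanOf_induction (P := fun z => P.retr.app a z ∈ spanOf k P.gdeg
      {t : LinTree P.Gen a | t.tree.size = 1 → a < a}) hz
      (fun s hs => ?_) ?_ (fun x y hx hy => ?_) (fun c x hx => ?_)
    · refine tree_mem (p := fun n => (spanOf k P.gdeg
        {t : LinTree P.Gen n | t.tree.size = 1 → n < a}).comap (P.retr.app n))
        ⟨?_, fun {m n} i x y hx hy => ?_⟩ (fun σ x hx => ?_) s (hs.imp fun b x hx => ?_)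
      · rw [Submodule.mem_comap, P.retr.app_one]
        exact elem_mem_spanOf fun h => absurd h (by simp [LinTree.unit, Tree.size])
      · rw [Submodule.mem_comap, P.retr.app_comp]
        refine spanOf_comp i ?_ hx hy
        intro s hs t ht hst
        rw [LinTree.size_graft] at hst
        have h3 : s.tree.size = 0 ∧ t.tree.size = 1 ∨ s.tree.size = 1 ∧ t.tree.size = 0 := by
          omega
        rcases h3 with ⟨h3, h4⟩ | ⟨h3, h4⟩
        · have := LinTree.eq_one_of_size h3
          have := ht h4
          omega
        · have := LinTree.eq_one_of_size h4
          have := hs h3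
          omega
      · rw [Submodule.mem_comap, P.retr.app_relabel]
        refine relabel_spanOf σ (fun s hs => ?_) hx
        change (s.tree.map σ).size = 1 → _
        rwa [Tree.size_map]
      · have := P.retr_gen ⟨x, hx.1⟩
        rw [Submodule.mem_comap, this]
        exact elem_mem_spanOf fun _ => hx.2
    · rw [map_zero]; exact Submodule.zero_mem _
    · rw [map_add]; exact Submodule.add_mem _ hx hy
    · rw [map_smul]; exact Submodule.smul_mem _ c hx
  refine spanOf_mono (fun t ht => ?_) h1
  have h2 : t.tree.size ≠ 1 := fun e => lt_irrefl _ (ht e)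
  have h3 : t.tree.size ≠ 0 := fun e => by have := LinTree.eq_one_of_size e; omega
  change 2 ≤ t.tree.size
  omega

theorem diff_mem_decomposables {n : ℕ} (x : (freeOperad k P.Gen P.gdeg).obj n) :
    (diff h).d n x ∈ decomposables k P.Gen P.gdeg n :=
  decomposable_of_gen (diff h) (fun a x => by
    rw [diff_apply, incl_gen]
    exact retr_mem (V_two_le h x.2) (pSpan_le_vSpan _ _ (der_mem h x.2))) x

end Pre

end

end AntiAss

namespace AntiAss

universe w

noncomputable section

variable {k : Type u} [Field k]

open Operad

/-! ### The augmentation -/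

theorem mem_trivGr_zero {M : Type v} [AddCommGroup M] [Module k M] (x : M) : x ∈ trivGr k M 0 := by
  rw [trivGr, if_pos rfl]; trivial

theorem eq_zero_of_mem_trivGr {M : Type v} [AddCommGroup M] [Module k M] {d : ℤ} (hd : d ≠ 0) {x : M}
    (hx : x ∈ trivGr k M d) : x = 0 := by
  rwa [trivGr, if_neg hd, Submodule.mem_bot] at hx

theorem magma_induction {p : ∀ n, Submodule k ((magma k).obj n)} (one : (magma k).one ∈ p 1)
    (comp : ∀ {m n} (i : Fin m) {x y}, x ∈ p m → y ∈ p n → (magma k).comp i x y ∈ p _)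
    (relabel : ∀ {n} (σ : Fin n ≃ Fin n) {x}, x ∈ p n → (magma k).relabel σ x ∈ p n)
    (mu : gen k .mu ∈ p 2) {n : ℕ} (x : (magma k).obj n) : x ∈ p n :=
  eq_top_of_gen (X := BinaryGen) (deg := fun _ _ => 0) (p := p) ⟨one, comp⟩ relabel
    (fun _ x => match x with | .mu => mu) x

variable (k) in
/-- The projection to the operad of anti-associative algebras. -/
def quotHom : (magma k).Hom (antiAss k) where
  app n := ((magma k).ideal (AntiAssRel k) n).mkQ
  app_mem {n p x} hx := by
    by_cases hp : p = 0
    · subst hp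
      exact mem_trivGr_zero _
    · have h1 : (magma k).gr n 0 ⊓ (magma k).gr n p = ⊥ :=
        (((DirectSum.isInternal_submodule_iff_iSupIndep_and_iSup_eq_top _).1
          ((magma k).gr_isInternal n)).1.pairwiseDisjoint (Ne.symm hp)).eq_bot
      have h2 : x ∈ (magma k).gr n 0 ⊓ (magma k).gr n p := ⟨by rw [magma_gr]; trivial, hx⟩
      rw [h1, Submodule.mem_bot] at h2
      subst h2
      exact Submodule.zero_mem ((antiAss k).gr n p)
  app_relabel _ _ := rfl
  app_one := rfl
  app_comp _ _ _ := rfl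

theorem quotHom_surjective (n : ℕ) : Function.Surjective ((quotHom k).app n) :=
  Submodule.mkQ_surjective _

theorem quotHom_eq_zero {n : ℕ} {x : (magma k).obj n} (h : (quotHom k).app n x = 0) :
    (magma k).InIdeal (AntiAssRel k) n x :=
  (Submodule.Quotient.mk_eq_zero ((magma k).ideal (AntiAssRel k) n)).1 h

theorem quotHom_of_inIdeal {n : ℕ} {x : (magma k).obj n}
    (h : (magma k).InIdeal (AntiAssRel k) n x) : (quotHom k).app n x = 0 :=
  (Submodule.Quotient.mk_eq_zero ((magma k).ideal (AntiAssRel k) n)).2 h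

theorem antiAssMul_mem : antiAssMul k ∈ (antiAss k).gr 2 0 :=
  mem_trivGr_zero _

theorem antiAssMul_comp : (antiAss k).comp (0 : Fin 2) (antiAssMul k) (antiAssMul k) +
    (antiAss k).comp (1 : Fin 2) (antiAssMul k) (antiAssMul k) = 0 :=
  quotHom_of_inIdeal (.of _ .mk)

namespace Pre

open Gens

/-- The values of the augmentation on the generators. -/
def augGen (k : Type u) [Field k] : ∀ a, UGen a → (antiAss k).obj a
  | 2, x => if x = low.two then antiAssMul k else 0
  | _, _ => 0

theorem augGen_mem (a : ℕ) (x : UGen a) : augGen k a x ∈ (antiAss k).gr a (udeg a x) := by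
  unfold augGen
  split
  · split_ifs with h
    · rw [h]; exact antiAssMul_mem
    · exact Submodule.zero_mem _
  · exact Submodule.zero_mem _

variable (k) in
/-- The augmentation, on the operad with all possible generators. -/
def aug : (freeOperad k UGen udeg).Hom (antiAss k) := freeHom augGen_mem

theorem augGen_two : augGen k 2 low.two = antiAssMul k := by
  rw [augGen, if_pos rfl]

theorem aug_two : (aug k).app 2 (gen k low.two) = antiAssMul k :=
  (freeHom_gen augGen_mem low.two).trans augGen_two

theorem aug_eq_zero {n : ℕ} {d : ℤ} (hd : d ≠ 0) {z : (freeOperad k UGen udeg).obj n}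
    (hz : z ∈ (freeOperad k UGen udeg).gr n d) : (aug k).app n z = 0 :=
  eq_zero_of_mem_trivGr hd ((aug k).app_mem hz)

variable (k) in
/-- The inclusion of the binary trees. -/
def mag : (magma k).Hom (freeOperad k UGen udeg) :=
  freeHom (X := BinaryGen) (deg := fun _ _ => 0) (f := fun _ x => match x with
    | .mu => gen k low.two) fun _ x => match x with
    | .mu => gen_mem low.two

theorem mag_mu : (mag k).app 2 (gen k BinaryGen.mu) = gen k low.two :=
  freeHom_gen (X := BinaryGen) (deg := fun _ _ => 0) _ BinaryGen.mu

theorem mag_mem_gr {n : ℕ} (x : (magma k).obj n) :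
    (mag k).app n x ∈ (freeOperad k UGen udeg).gr n 0 :=
  (mag k).app_mem (by rw [magma_gr]; trivial)

theorem aug_mag {n : ℕ} (x : (magma k).obj n) :
    (aug k).app n ((mag k).app n x) = (quotHom k).app n x :=
  freeHom_ext (X := BinaryGen) (deg := fun _ _ => 0) (f := (mag k).trans (aug k)) (g := quotHom k)
    (fun _ x => match x with
      | .mu => (congrArg ((aug k).app 2) mag_mu).trans aug_two) n x

/-- The generator of arity two. -/
def Two (a : ℕ) (x : UGen a) : Prop := (⟨a, x⟩ : Σ a, UGen a) = ⟨2, low.two⟩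

theorem bin_two {t : Tree UGen Unit} (ht : low.Bin t) : t.All Two := by
  induction ht with
  | leaf => trivial
  | b _ _ h h' => exact ⟨rfl, fun i => by fin_cases i <;> assumption⟩

theorem exists_mag {n : ℕ} {z : (freeOperad k UGen udeg).obj n} (hz : z ∈ vSpan k udeg Two n) :
    ∃ w, (mag k).app n w = z := by
  change z ∈ LinearMap.range ((mag k).app n)
  refine spanOf_induction (P := fun z => z ∈ LinearMap.range ((mag k).app n)) hz
    (fun s hs => ?_) (Submodule.zero_mem _) (fun _ _ => Submodule.add_mem _)
    (fun c _ => Submodule.smul_mem _ c)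
  refine tree_mem (p := fun n => LinearMap.range ((mag k).app n)) ⟨⟨_, (mag k).app_one⟩, ?_⟩ ?_ s
    (hs.imp fun a x hx => ?_)
  · rintro m n i _ _ ⟨x, rfl⟩ ⟨y, rfl⟩
    exact ⟨_, (mag k).app_comp i x y⟩
  · rintro n σ _ ⟨x, rfl⟩
    exact ⟨_, (mag k).app_relabel σ x⟩
  · cases hx
    exact ⟨_, mag_mu⟩

variable {P : Pre k} (h : ∀ n, 6 ≤ n → Good P n)

include h

theorem isLow : IsLow P.der low := (h 6 le_rfl).isLow

/-- Binary trees are built from the cycle `μ₂`, so they are cycles. -/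
theorem der_mag {n : ℕ} (x : (magma k).obj n) : P.der.1 n ((mag k).app n x) = 0 := by
  refine magma_induction (p := fun n => LinearMap.ker (P.der.1 n ∘ₗ (mag k).app n)) ?_
    (fun {m n} i x y hx hy => ?_) (fun {n} σ x hx => ?_) ?_ x
  · change P.der.1 1 ((mag k).app 1 (magma k).one) = 0
    rw [(mag k).app_one, derivation_one]
  · change P.der.1 _ ((mag k).app _ ((magma k).comp i x y)) = 0
    rw [(mag k).app_comp, freeDer_comp, show P.der.1 m ((mag k).app m x) = 0 from hx,
      show P.der.1 n ((mag k).app n y) = 0 from hy, map_zero, map_zero, LinearMap.zero_apply,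
      add_zero]
  · change P.der.1 _ ((mag k).app _ ((magma k).relabel σ x)) = 0
    rw [(mag k).app_relabel, freeDer_relabel, show P.der.1 n ((mag k).app n x) = 0 from hx,
      map_zero]
  · change P.der.1 2 ((mag k).app 2 (gen k BinaryGen.mu)) = 0
    rw [mag_mu, (isLow h).d_two]

theorem mag_mem {n : ℕ} (x : (magma k).obj n) : (mag k).app n x ∈ vSpan k udeg P.V n := by
  refine magma_induction (p := fun n => (vSpan k udeg P.V n).comap ((mag k).app n)) ?_
    (fun {m n} i x y hx hy => ?_) (fun {n} σ x hx => ?_) ?_ x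
  · rw [Submodule.mem_comap, (mag k).app_one]; exact (compClosed_vSpan P.V).one
  · rw [Submodule.mem_comap, (mag k).app_comp]; exact (compClosed_vSpan P.V).comp i hx hy
  · rw [Submodule.mem_comap, (mag k).app_relabel]; exact relabel_vSpan P.V σ hx
  · change (mag k).app 2 (gen k BinaryGen.mu) ∈ vSpan k udeg P.V 2
    rw [mag_mu]
    exact pSpan_le_vSpan _ _ (gen_mem_pSpan (V_low h .two))

/-- The defining relation is the boundary of `μ₃`, and since binary trees are cycles, boundaries
among them are closed under composition with binary trees. So the whole ideal bounds. -/
theorem exists_of_inIdeal {n : ℕ} {x : (magma k).obj n}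
    (hx : (magma k).InIdeal (AntiAssRel k) n x) :
    ∃ y ∈ vSpan k udeg P.V n, P.der.1 n y = (mag k).app n x := by
  induction hx with
  | of x hx =>
    cases hx
    refine ⟨gen k low.three, pSpan_le_vSpan _ _ (gen_mem_pSpan (V_low h .three)), ?_⟩
    rw [(isLow h).d_three, map_add]
    refine congrArg₂ (· + ·) ?_ ?_
    · refine Eq.trans ?_ ((mag k).app_comp (0 : Fin 2) (gen k .mu) (gen k .mu)).symm
      rw [mag_mu]; rfl
    · refine Eq.trans ?_ ((mag k).app_comp (1 : Fin 2) (gen k .mu) (gen k .mu)).symm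
      rw [mag_mu]; rfl
  | zero n => exact ⟨0, Submodule.zero_mem _, by rw [map_zero, map_zero]⟩
  | add x y _ _ hx hy =>
    obtain ⟨a, ha, ea⟩ := hx
    obtain ⟨b, hb, eb⟩ := hy
    exact ⟨a + b, Submodule.add_mem _ ha hb, by rw [map_add, map_add, ea, eb]⟩
  | smul c x _ hx =>
    obtain ⟨a, ha, ea⟩ := hx
    exact ⟨c • a, Submodule.smul_mem _ c ha, by rw [map_smul, map_smul, ea]⟩
  | relabel σ x _ hx =>
    obtain ⟨a, ha, ea⟩ := hx
    exact ⟨_, relabel_vSpan P.V σ ha, by rw [freeDer_relabel, ea, (mag k).app_relabel]⟩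
  | comp_left i x y _ hx =>
    obtain ⟨a, ha, ea⟩ := hx
    refine ⟨_, (compClosed_vSpan P.V).comp i ha (mag_mem h y), ?_⟩
    rw [freeDer_comp, ea, der_mag h, map_zero, add_zero, (mag k).app_comp]
  | comp_right i x y _ hy =>
    obtain ⟨a, ha, ea⟩ := hy
    refine ⟨_, (compClosed_vSpan P.V).comp i (mag_mem h x) ha, ?_⟩
    rw [freeDer_comp, ea, der_mag h, map_zero, LinearMap.zero_apply, zero_add,
      sgn_of_mem 1 (mag_mem_gr x), mul_zero, ksign_zero, one_smul, (mag k).app_comp]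

/-- On generators: `μ₂` is a cycle, the boundary of `μ₃` is the defining relation, and the other
boundaries have positive degree, where the target is zero. -/
theorem aug_der {n : ℕ} (z : (freeOperad k UGen udeg).obj n) :
    (aug k).app n (P.der.1 n z) = 0 :=
  eq_top_of_gen (p := fun n => LinearMap.ker ((aug k).app n ∘ₗ P.der.1 n))
    ⟨by
      change (aug k).app 1 (P.der.1 1 _) = 0
      rw [derivation_one, map_zero], fun {m n} i x y hx hy => by
      change (aug k).app _ (P.der.1 _ _) = 0
      rw [freeDer_comp, map_add, (aug k).app_comp, (aug k).app_comp,
        show (aug k).app m (P.der.1 m x) = 0 from hx,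
        show (aug k).app n (P.der.1 n y) = 0 from hy, map_zero, map_zero, LinearMap.zero_apply,
        add_zero]⟩
    (fun {n} σ x hx => by
      change (aug k).app _ (P.der.1 _ _) = 0
      rw [freeDer_relabel, (aug k).app_relabel, show (aug k).app n (P.der.1 n x) = 0 from hx,
        map_zero])
    (fun a x => by
      change (aug k).app a (P.der.1 a (gen k x)) = 0
      by_cases hx : P.V a x
      · rcases (h (a + 6) (by omega)).V_cases a x ⟨hx, by omega⟩ with hx | hx | hx
        · cases hx
          rw [(isLow h).d_two, map_zero]
        · cases hx
          rw [(isLow h).d_three]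
          refine (map_add ((aug k).app 3) _ _).trans (Eq.trans (congrArg₂ (· + ·) ?_ ?_)
            antiAssMul_comp)
          · refine ((aug k).app_comp (0 : Fin 2) _ _).trans ?_
            rw [aug_two]
          · refine ((aug k).app_comp (1 : Fin 2) _ _).trans ?_
            rw [aug_two]
        · exact aug_eq_zero (d := udeg a x - 1) (by omega) (freeDer_mem P.der (gen_mem x))
      · rw [P.der_gen_of_notMem hx, map_zero]) z

theorem V_two3 {a : ℕ} {x : UGen a} (hx : P.V a x) (ha : a ≤ 3) : Two3 a x := by
  have hx' : (first k).V a x := by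
    rw [V, (h 6 le_rfl).low_gens a (by omega)] at hx
    exact hx
  rcases first_cases hx' with h | ⟨i, h⟩
  · exact h
  · cases h; omega

/-- With at most three leaves, the corolla of `μ₃` is the only tree of positive degree, and its
boundary is not zero. So a cycle consists of binary trees. -/
theorem low_arity_shape {n : ℕ} (hn : n ≤ 3) {y : Tree UGen Unit →₀ k} (hy : y ∈ aSpan k P.V n)
    (hy0 : dA P.der y = 0) : y ∈ aSpan k Two n := by
  have h1 : ∃ y' ∈ aSpan k Two n, ∃ c : k,
      y = y' + c • s k (low.m (.leaf ()) (.leaf ()) (.leaf ())) := by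
    refine supported_induction (P := fun y => ∃ y' ∈ aSpan k Two n, ∃ c : k,
      y = y' + c • s k (low.m (.leaf ()) (.leaf ()) (.leaf ()))) hy (fun t ht => ?_) ?_ ?_ ?_
    · have h3 : t.All Two3 := (Tree.all_arity_le (n := 3)
        (fun a x hx => (V_two_le h hx).trans' one_le_two) ht.2 (ht.1.le.trans hn)).imp
          fun a x hx => V_two3 h hx.1 hx.2
      rcases Int.lt_or_le (t.degree udeg) 1 with hd | hd
      · have h4 : 0 ≤ t.degree udeg := Tree.degree_nonneg (V := Two3)
          (fun a x h => by rcases h with h | h <;> cases h <;> decide) h3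
        have h5 : low.Bin t := bin_of_degree (isLow h) (V := Two3) (fun a x hx => by
          rcases hx with hx | hx
          · exact .inl hx
          · cases hx; exact .inr le_rfl) h3 (by omega)
        exact ⟨_, mem_aSpan_single ht.1 (bin_two h5), 0, by rw [zero_smul, add_zero]⟩
      · refine ⟨0, Submodule.zero_mem _, 1, ?_⟩
        rw [eq_m_of_degree h3 (by have := ht.1; omega) hd, zero_add, one_smul]
    · exact ⟨0, Submodule.zero_mem _, 0, by simp⟩
    · rintro _ _ ⟨x, hx, c, rfl⟩ ⟨y, hy, d, rfl⟩
      exact ⟨x + y, add_mem hx hy, c + d, by rw [add_smul]; abel⟩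
    · rintro a _ ⟨x, hx, c, rfl⟩
      exact ⟨a • x, Submodule.smul_mem _ a hx, a * c, by rw [smul_add, mul_smul]⟩
  obtain ⟨y', hy', c, rfl⟩ := h1
  obtain ⟨w, hw⟩ := exists_mag (pSpan_le_vSpan _ _ (label_mem hy'))
  have h2 : dA P.der y' = 0 := by
    rw [dA_eq hy', ← hw, der_mag h, map_zero]
  rw [map_add, h2, zero_add, map_smul, (isLow h).dA_m .leaf .leaf .leaf] at hy0
  -- The code of the tree `(xy)z`, which occurs in the boundary of `μ₃` with coefficient one.
  have h3 := congrArg (coeff k UGen [2, 2, 0, 0, 0]) hy0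
  rw [map_smul, map_add, coeff_single, coeff_single, code_b, code_b, code_b, code_b, map_zero] at h3
  have hc : c = 0 := by simpa [Tree.code] using h3
  rwa [hc, zero_smul, add_zero]

theorem low_arity {n : ℕ} (hn : n ≤ 3) {z : (freeOperad k UGen udeg).obj n}
    (hz : z ∈ vSpan k udeg P.V n) (hz0 : P.der.1 n z = 0) : ∃ w, (mag k).app n w = z := by
  refine exists_mag ?_
  rw [← sum_part z]
  refine Submodule.sum_mem _ fun σ _ => relabel_vSpan Two σ (pSpan_le_vSpan _ _ (label_mem
    (low_arity_shape h hn (part_mem σ hz) ?_)))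
  rw [← part_der (der_mem_true h) (fun _ _ => trivial), hz0, map_zero]

variable (P) in
omit h in
/-- The augmentation of the minimal model. -/
def rho : (freeOperad k P.Gen P.gdeg).Hom (antiAss k) := P.incl.trans (aug k)

/-- Surjectivity in homology holds since binary trees are cycles that represent everything in the
quotient. For injectivity, from arity four on all cycles are boundaries. In arities at most three a
cycle is a combination of binary trees; if the augmentation kills it, it lies in the ideal and
bounds. -/
theorem isMinimalModel : IsMinimalModel (antiAss k) (diff h) P.rho where
  two_le a ha := ⟨fun x => by have := V_two_le h x.2; omega⟩
  minimal n x := diff_mem_decomposables h x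
  quasiIso :=
    { comm := fun n x => by
        change (aug k).app n (P.incl.app n ((diff h).d n x)) = 0
        rw [incl_diff, aug_der h]
      injective := fun n x hx hx' => by
        have h1 : P.der.1 n (P.incl.app n x) = 0 := by rw [← incl_diff h, hx, map_zero]
        have h2 : (aug k).app n (P.incl.app n x) = 0 := hx'.choose_spec
        have h3 : ∃ y ∈ vSpan k udeg P.V n, P.der.1 n y = P.incl.app n x := by
          rcases Nat.lt_or_ge 3 n with hn | hn
          · exact exact h hn (P.incl_mem x) h1
          · obtain ⟨w, hw⟩ := low_arity h hn (P.incl_mem x) h1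
            rw [← hw, aug_mag] at h2
            rw [← hw]
            exact exists_of_inIdeal h (quotHom_eq_zero h2)
        obtain ⟨y, hy, e⟩ := h3
        refine ⟨P.retr.app n y, ?_⟩
        rw [diff_apply, P.incl_retr hy, e, P.retr_incl]
      surjective := fun n y _ => by
        obtain ⟨w, rfl⟩ := quotHom_surjective n y
        refine ⟨P.retr.app n ((mag k).app n w), ?_, 0, ?_⟩
        · rw [diff_apply, P.incl_retr (mag_mem h w), der_mag h, map_zero]
        · change (aug k).app n (P.incl.app n (P.retr.app n ((mag k).app n w))) = _
          rw [P.incl_retr (mag_mem h w), aug_mag, map_zero, add_zero] }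

end Pre

end

end AntiAss

namespace AntiAss
universe w
noncomputable section
variable {k : Type u} [Field k]
open Operad Pre

/-! ### Edge paths in the associahedron `K₅` -/

namespace Bracketing

/-- The edges of the four closed paths. -/
def edge : Fin 4 → Fin 8 → Bracketing :=
  ![![two dot (three dot dot (two dot dot)), three dot dot (two dot (two dot dot)),
      two (two dot dot) (three dot dot dot), three (two dot dot) (two dot dot) dot,
      two (three (two dot dot) dot dot) dot, three (two (two dot dot) dot) dot dot,
      two (three dot dot dot) (two dot dot), three dot (two dot dot) (two dot dot)],
    ![three (two (two dot dot) dot) dot dot, two (three (two dot dot) dot dot) dot,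
      two (three dot dot (two dot dot)) dot, three dot (two dot (two dot dot)) dot,
      two dot (three dot (two dot dot) dot), three dot dot (two (two dot dot) dot),
      two (two dot dot) (three dot dot dot), three (two dot dot) dot (two dot dot)],
    ![three dot (two dot dot) (two dot dot), two dot (three (two dot dot) dot dot),
      three dot (two (two dot dot) dot) dot, two (two dot (three dot dot dot)) dot,
      two (three dot dot (two dot dot)) dot, two (three (two dot dot) dot dot) dot,
      two (two (three dot dot dot) dot) dot, three (two dot (two dot dot)) dot dot],
    ![three (two dot dot) (two dot dot) dot, three dot dot (two (two dot dot) dot),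
      two dot (three dot (two dot dot) dot), three dot (two dot (two dot dot)) dot,
      two (two dot (three dot dot dot)) dot, two (three dot (two dot dot) dot) dot,
      two (two (three dot dot dot) dot) dot, two (three (two dot dot) dot dot) dot]]

/-- The vertices of the four closed paths. -/
def vertex : Fin 4 → Fin 8 → Bracketing :=
  ![![two dot (two (two dot dot) (two dot dot)), two dot (two dot (two dot (two dot dot))),
      two (two dot dot) (two dot (two dot dot)), two (two dot dot) (two (two dot dot) dot),
      two (two (two dot dot) (two dot dot)) dot, two (two (two (two dot dot) dot) dot) dot,
      two (two (two dot dot) dot) (two dot dot), two (two dot (two dot dot)) (two dot dot)],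
    ![two (two (two dot dot) dot) (two dot dot), two (two (two (two dot dot) dot) dot) dot,
      two (two (two dot dot) (two dot dot)) dot, two (two dot (two dot (two dot dot))) dot,
      two dot (two (two dot (two dot dot)) dot), two dot (two dot (two (two dot dot) dot)),
      two (two dot dot) (two (two dot dot) dot), two (two dot dot) (two dot (two dot dot))],
    ![two (two dot (two dot dot)) (two dot dot), two dot (two (two dot dot) (two dot dot)),
      two dot (two (two (two dot dot) dot) dot), two (two dot (two (two dot dot) dot)) dot,
      two (two dot (two dot (two dot dot))) dot, two (two (two dot dot) (two dot dot)) dot,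
      two (two (two (two dot dot) dot) dot) dot, two (two (two dot (two dot dot)) dot) dot],
    ![two (two (two dot dot) (two dot dot)) dot, two (two dot dot) (two (two dot dot) dot),
      two dot (two dot (two (two dot dot) dot)), two dot (two (two dot (two dot dot)) dot),
      two (two dot (two dot (two dot dot))) dot, two (two dot (two (two dot dot) dot)) dot,
      two (two (two dot (two dot dot)) dot) dot, two (two (two (two dot dot) dot) dot) dot]]

theorem isClosedEdgePath_edge (i : Fin 4) : IsClosedEdgePath 5 (edge i) := by
  refine ⟨vertex i, fun j => ?_⟩
  fin_cases i
  all_goals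
    fin_cases j
    all_goals
      refine ⟨⟨rfl, rfl⟩, ?_⟩
      first
        | simp [edge, vertex, endpoints, Set.image_pair]; done
        | simp [edge, vertex, endpoints, Set.image_pair, Set.pair_comm]

section trees
variable {X : ℕ → Type v} {deg : ∀ a, X a → ℤ} (G : Gens X)

/-- The tree of a bracketing. -/
def tree : Bracketing → Tree X Unit
  | dot => .leaf ()
  | two x y => G.b x.tree y.tree
  | three x y z => G.m x.tree y.tree z.tree

variable {G} (h2 : deg 2 G.two = 0) (h3 : deg 3 G.three = 1)

theorem _root_.AntiAss.LinTree.planar_cast {m n : ℕ} (h : m = n) {t : LinTree X m}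
    (ht : t.Planar) : (t.map (finCongr h)).Planar := by
  subst h
  rwa [show finCongr (rfl : m = m) = Equiv.refl _ from rfl, LinTree.map_refl]

theorem comp_elem_of_even {m n : ℕ} (i : Fin m) (s : LinTree X m) (t : LinTree X n)
    (h : t.tree.degree deg * s.tree.after deg i = 0) :
    (freeOperad k X deg).comp i (s.elem k deg) (t.elem k deg) = (s.graft i t).elem k deg := by
  rw [comp_elem, h, ksign_zero, one_smul]

theorem _root_.AntiAss.ins_self {m n : ℕ} (i : Fin m) (t : Tree X (Fin n))
    (f : Fin (m + n - 1) → Tree X Unit) : ins i t f i = t.bind fun b => f (slot i n (.inr b)) :=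
  dif_pos rfl

theorem _root_.AntiAss.ins_ne {m n : ℕ} {i : Fin m} (t : Tree X (Fin n))
    (f : Fin (m + n - 1) → Tree X Unit) {a : Fin m} (h : a ≠ i) :
    ins i t f a = f (slot i n (.inl ⟨a, h⟩)) := dif_neg h

include h2 h3 in
-- With at most one ternary bracket there is at most one vertex of odd degree, so the compositions
-- in `eval` never interchange two odd vertices and the value is a planar tree with coefficient one.
theorem exists_tree (b : Bracketing) (hb : b.ternaries ≤ 1) : ∃ t : LinTree X b.length,
    t.Planar ∧ t.tree.degree deg = b.ternaries ∧ t.tree.shape = b.tree G ∧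
    b.eval (P := freeOperad k X deg) (gen k G.two) (gen k G.three) = t.elem k deg := by
  induction b with
  | dot => exact ⟨LinTree.unit, LinTree.planar_unit, Tree.degree_leaf _ _, rfl, rfl⟩
  | two x y ihx ihy =>
    rw [ternaries] at hb
    obtain ⟨t, ht, dt, st, et⟩ := ihx (by omega)
    obtain ⟨s, hs, ds, ss, es⟩ := ihy (by omega)
    have e1 := comp_elem_of_even (k := k) (deg := deg) (1 : Fin 2) (LinTree.corolla G.two) s
      (by rw [after_corolla, mul_zero])
    have e2 := comp_elem_of_even (k := k) (deg := deg)
      (slot (1 : Fin 2) y.length (.inl ⟨0, by decide⟩)) ((LinTree.corolla G.two).graft 1 s) t (by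
        rcases Tree.after_graft_inl deg (show (1 : Fin 2) ≠ 0 by decide)
          (LinTree.corolla G.two).isLinear with ⟨h, -⟩ | ⟨h, -⟩
        · refine (congrArg _ ((h s.tree).trans (after_corolla deg G.two 0))).trans (mul_zero _)
        · refine (congrArg _ ((h s.tree).trans (congrArg (· + _)
            (after_corolla deg G.two 0)))).trans ?_
          rw [zero_add, dt, ds]
          norm_cast
          -- The sign exponent is the product of the degrees of the two branches, and at most one of
          -- them contains the ternary bracket.
          rcases Nat.eq_zero_or_pos x.ternaries with h0 | h0
          · rw [h0, zero_mul]
          · rw [show y.ternaries = 0 by omega, mul_zero])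
    refine ⟨(((LinTree.corolla G.two).graft 1 s).graft
      (slot (1 : Fin 2) y.length (.inl ⟨0, by decide⟩)) t).map (finCongr (by
        simp only [length]; omega)), LinTree.planar_cast _ (LinTree.planar_graft _
        (LinTree.planar_graft _ (LinTree.planar_corolla _) hs) ht), ?_, ?_, ?_⟩
    · refine (Tree.degree_map deg _ _).trans ((Tree.degree_graft deg _ (LinTree.isLinear _) _).trans
        ((congrArg (· + _) (Tree.degree_graft deg _ (LinTree.isLinear _) _)).trans ?_))
      rw [degree_corolla, h2, dt, ds, ternaries]
      push_cast
      ring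
    · refine (Tree.shape_map _ _).trans ((graft_bind _ _ _ _).trans
        ((graft_bind _ _ _ _).trans ((G.node_two _).trans (G.b_congr ?_ ?_))))
      · exact st
      · refine Eq.trans (ins_self 1 s.tree _) (Eq.trans (b := s.tree.bind fun _ => .leaf ()) ?_ ss)
        refine congrArg s.tree.bind (funext fun b => ?_)
        exact ins_ne _ _ (by simp)
    · rw [← relabel_elem, ← e2, ← e1, ← es, ← et]
      rfl
  | three x y z ihx ihy ihz =>
    rw [ternaries] at hb
    obtain ⟨t, ht, dt, st, et⟩ := ihx (by omega)
    obtain ⟨s, hs, ds, ss, es⟩ := ihy (by omega)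
    obtain ⟨r, hr, dr, sr, er⟩ := ihz (by omega)
    rw [show x.ternaries = 0 by omega, Nat.cast_zero] at dt
    rw [show y.ternaries = 0 by omega, Nat.cast_zero] at ds
    have e1 := comp_elem_of_even (k := k) (deg := deg) (2 : Fin 3) (LinTree.corolla G.three) r
      (by rw [after_corolla, mul_zero])
    have e2 := comp_elem_of_even (k := k) (deg := deg)
      (slot (2 : Fin 3) z.length (.inl ⟨1, by decide⟩)) ((LinTree.corolla G.three).graft 2 r) s
      (by rw [ds, zero_mul])
    have e3 := comp_elem_of_even (k := k) (deg := deg)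
      (slot (slot (2 : Fin 3) z.length (.inl ⟨1, by decide⟩)) y.length
        (.inl ⟨slot (2 : Fin 3) z.length (.inl ⟨0, by decide⟩), by simp⟩))
      (((LinTree.corolla G.three).graft 2 r).graft
        (slot (2 : Fin 3) z.length (.inl ⟨1, by decide⟩)) s) t (by rw [dt, zero_mul])
    refine ⟨((((LinTree.corolla G.three).graft 2 r).graft
      (slot (2 : Fin 3) z.length (.inl ⟨1, by decide⟩)) s).graft
      (slot (slot (2 : Fin 3) z.length (.inl ⟨1, by decide⟩)) y.length
        (.inl ⟨slot (2 : Fin 3) z.length (.inl ⟨0, by decide⟩), by simp⟩)) t).map (finCongr (by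
        simp only [length]; omega)), LinTree.planar_cast _ (LinTree.planar_graft _
        (LinTree.planar_graft _ (LinTree.planar_graft _ (LinTree.planar_corolla _) hr) hs) ht),
        ?_, ?_, ?_⟩
    · refine (Tree.degree_map deg _ _).trans ((Tree.degree_graft deg _ (LinTree.isLinear _) _).trans
        ((congrArg (· + _) ((Tree.degree_graft deg _ (LinTree.isLinear _) _).trans
          (congrArg (· + _) (Tree.degree_graft deg _ (LinTree.isLinear _) _)))).trans ?_))
      rw [degree_corolla, h3, dt, ds, dr, ternaries]
      push_cast [show x.ternaries = 0 by omega, show y.ternaries = 0 by omega]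
      ring
    · refine (Tree.shape_map _ _).trans ((graft_bind _ _ _ _).trans ((graft_bind _ _ _ _).trans
        ((graft_bind _ _ _ _).trans ((G.node_three _).trans (G.m_congr ?_ ?_ ?_)))))
      · refine (ins_ne r.tree _ (show (0 : Fin 3) ≠ 2 by decide)).trans
          ((ins_ne s.tree _ ?_).trans ((ins_self _ t.tree _).trans st))
        simp
      · refine (ins_ne r.tree _ (show (1 : Fin 3) ≠ 2 by decide)).trans
          ((ins_self _ s.tree _).trans (Eq.trans (b := s.tree.bind fun _ => .leaf ()) ?_ ss))
        refine congrArg s.tree.bind (funext fun b => ?_)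
        exact ins_ne _ _ (by simp)
      · refine (ins_self 2 r.tree _).trans (Eq.trans (b := r.tree.bind fun _ => .leaf ()) ?_ sr)
        refine congrArg r.tree.bind (funext fun b => ?_)
        refine (ins_ne _ _ ?_).trans (ins_ne _ _ ?_)
        · simp
        · simp
    · rw [← relabel_elem, ← e3, ← e2, ← e1, ← es, ← et, ← er]
      rfl

include h2 h3 in
theorem exists_elem (b : Bracketing) {n : ℕ} (hn : b.length = n) (hb : b.ternaries ≤ 1) :
    ∃ t : LinTree X n, t.Planar ∧ t.tree.shape = b.tree G ∧
    b.elem (P := freeOperad k X deg) (gen k G.two) (gen k G.three) n = t.elem k deg := by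
  obtain ⟨t, ht, -, st, et⟩ := exists_tree (k := k) h2 h3 b hb
  refine ⟨t.map (finCongr hn), LinTree.planar_cast hn ht, (Tree.shape_map _ _).trans st, ?_⟩
  rw [elem, dif_pos hn, et, relabel_elem]

include h2 h3 in
theorem forget_bracketing (b : Bracketing) {n : ℕ} (hn : b.length = n) (hb : b.ternaries ≤ 1) :
    forget k deg n (b.elem (P := freeOperad k X deg) (gen k G.two) (gen k G.three) n) =
      s k (b.tree G) := by
  obtain ⟨t, -, st, et⟩ := exists_elem (k := k) h2 h3 b hn hb
  rw [et, forget_elem, st]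

include h2 h3 in
theorem elem_mem_pSpan (b : Bracketing) {n : ℕ} (hn : b.length = n) (hb : b.ternaries ≤ 1) :
    b.elem (P := freeOperad k X deg) (gen k G.two) (gen k G.three) n ∈
      pSpan k deg (fun _ _ => True) n := by
  obtain ⟨t, ht, -, et⟩ := exists_elem (k := k) h2 h3 b hn hb
  rw [et]
  exact elem_mem_spanOf ⟨ht, all_true _⟩

end trees

section transfer
variable {P : Operad.{u, v} k} {Q : Operad.{u, w} k} (f : P.Hom Q) (m₂ : P.obj 2) (m₃ : P.obj 3)

theorem map_eval (b : Bracketing) :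
    f.app _ (b.eval m₂ m₃) = b.eval (f.app 2 m₂) (f.app 3 m₃) := by
  induction b with
  | dot => exact f.app_one
  | two x y ihx ihy =>
    simp only [eval]
    rw [f.app_relabel, f.app_comp, f.app_comp, ihx, ihy]
  | three x y z ihx ihy ihz =>
    simp only [eval]
    rw [f.app_relabel, f.app_comp, f.app_comp, f.app_comp, ihx, ihy, ihz]

theorem map_elem (n : ℕ) (b : Bracketing) :
    f.app n (b.elem m₂ m₃ n) = b.elem (f.app 2 m₂) (f.app 3 m₃) n := by
  unfold elem
  split
  · rw [f.app_relabel, map_eval]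
  · exact map_zero _

end transfer
theorem edge_length (i j) : (edge i j).length = 5 := by
  fin_cases i <;> fin_cases j <;> rfl

theorem edge_ternaries (i j) : (edge i j).ternaries = 1 := by
  fin_cases i <;> fin_cases j <;> rfl

end Bracketing

/-- Only linearity and the values on the three types of double compositions are used, so this serves
for morphisms of operads as well as for derivations. -/
theorem quintic_congr {P : Operad.{u, v} k} {Q : Operad.{u, w} k} (F : P.obj 5 →ₗ[k] Q.obj 5)
    {m₂ : P.obj 2} {m₃ : P.obj 3} {m₂' : Q.obj 2} {m₃' : Q.obj 3}
    (h22 : ∀ i j hi hj, F (circ (circ m₂ i m₂ hi) j m₃ hj) = circ (circ m₂' i m₂' hi) j m₃' hj)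
    (h23 : ∀ i j hi hj, F (circ (circ m₂ i m₃ hi) j m₂ hj) = circ (circ m₂' i m₃' hi) j m₂' hj)
    (h32 : ∀ i j hi hj, F (circ (circ m₃ i m₂ hi) j m₂ hj) = circ (circ m₃' i m₂' hi) j m₂' hj)
    (i : Fin 4) : F (quintic m₂ m₃ i) = quintic m₂' m₃' i := by
  fin_cases i
  all_goals
    refine map_alternating F ?_ ?_ ?_ ?_ ?_ ?_ ?_ ?_
    all_goals first
      | exact h22 _ _ _ _
      | exact h23 _ _ _ _
      | exact h32 _ _ _ _

theorem map_circ_circ {P : Operad.{u, v} k} {Q : Operad.{u, w} k} (f : P.Hom Q)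
    {l m n : ℕ} (x : P.obj l) (y : P.obj m) (z : P.obj n) (i j : ℕ) (hi) (hj) :
    f.app _ (circ (circ x i y hi) j z hj) =
      circ (circ (f.app l x) i (f.app m y) hi) j (f.app n z) hj :=
  (f.app_comp _ _ _).trans (congrArg (fun t => circ t j (f.app n z) hj) (f.app_comp _ _ _))

theorem map_quintic {P : Operad.{u, v} k} {Q : Operad.{u, w} k} (f : P.Hom Q) (m₂ : P.obj 2)
    (m₃ : P.obj 3) (i : Fin 4) :
    f.app 5 (quintic m₂ m₃ i) = quintic (f.app 2 m₂) (f.app 3 m₃) i :=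
  quintic_congr (f.app 5) (map_circ_circ f m₂ m₂ m₃) (map_circ_circ f m₂ m₃ m₂)
    (map_circ_circ f m₃ m₂ m₂) i

theorem sum_alternating {M : Type*} [AddCommGroup M] [Module k M] (x : Fin 8 → M) :
    ∑ j : Fin 8, (-1 : k) ^ (j : ℕ) • x j =
      x 0 - x 1 + x 2 - x 3 + x 4 - x 5 + x 6 - x 7 := by
  rw [Fin.sum_univ_eight]
  change (-1 : k) ^ 0 • _ + (-1 : k) ^ 1 • _ + (-1 : k) ^ 2 • _ + (-1 : k) ^ 3 • _ +
      (-1 : k) ^ 4 • _ + (-1 : k) ^ 5 • _ + (-1 : k) ^ 6 • _ + (-1 : k) ^ 7 • _ = _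
  norm_num [← sub_eq_add_neg]

/-- Both sides are planar, so it is enough to compare them after forgetting the labels, where both
are explicit sums of eight trees. -/
theorem IsLow.quintic_eq_sum {X : ℕ → Type v} {deg : ∀ a, X a → ℤ} {G : Gens X}
    {θ : derivations (Hom.id (freeOperad k X deg)) 1} (H : IsLow θ G) (i : Fin 4) :
    quintic (P := freeOperad k X deg) (gen k G.two) (gen k G.three) i =
      ∑ j : Fin 8, (-1 : k) ^ (j : ℕ) •
        (Bracketing.edge i j).elem (P := freeOperad k X deg) (gen k G.two) (gen k G.three) 5 := by
  have h1 := label_forget (k := k) (quintic_mem (compClosed_pSpan fun _ _ => True)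
    (gen_mem_pSpan (k := k) (deg := deg) (x := G.two) trivial)
    (gen_mem_pSpan (x := G.three) trivial) i)
  have h2 := label_forget (k := k) (Submodule.sum_mem (pSpan k deg (fun _ _ => True) 5)
    (t := Finset.univ) fun (j : Fin 8) _ => Submodule.smul_mem _ ((-1 : k) ^ (j : ℕ))
    (Bracketing.elem_mem_pSpan (k := k) H.deg_two H.deg_three (Bracketing.edge i j)
      (Bracketing.edge_length i j) (Bracketing.edge_ternaries i j).le))
  rw [← h1, ← h2]
  refine congrArg _ ?_
  rw [map_sum]
  simp only [map_smul]
  rw [Finset.sum_congr rfl fun j _ => by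
    rw [Bracketing.forget_bracketing H.deg_two H.deg_three _ (Bracketing.edge_length i j)
      (Bracketing.edge_ternaries i j).le]]
  have e : (fun _ => .leaf () : Fin 5 → Tree X Unit) =
      ![.leaf (), .leaf (), .leaf (), .leaf (), .leaf ()] := by
    funext i; fin_cases i <;> rfl
  rw [← sub_leaf, e, H.sub_quintic]
  refine Eq.trans ?_ (sum_alternating fun j => s k ((Bracketing.edge i j).tree G)).symm
  fin_cases i <;> rfl

end
end AntiAss

namespace AntiAss
universe w
noncomputable section
variable {k : Type u} [Field k]
open Operad

/-! ### Anti-associative algebras -/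

section algebra
variable {V : Type w} [AddCommGroup V] [Module k V]

theorem endOperad_ext {n : ℕ} {f g : (endOperad k V).obj n} (h : ∀ v, endEval f v = endEval g v) :
    f = g := MultilinearMap.ext h

variable (mul : V →ₗ[k] V →ₗ[k] V)

/-- A bilinear product as an element of the endomorphism operad. -/
def mulEnd : (endOperad k V).obj 2 :=
  show MultilinearMap k (fun _ : Fin 2 => V) V from
  { toFun := fun v => mul (v 0) (v 1)
    map_update_add' := fun v i x y => by fin_cases i <;> simp
    map_update_smul' := fun v i c x => by fin_cases i <;> simp }

theorem endEval_mulEnd (v : Fin 2 → V) : endEval (mulEnd mul) v = mul (v 0) (v 1) := rfl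

theorem eq_mulEnd {f : (endOperad k V).obj 2} (h : ∀ a b, endEval f ![a, b] = mul a b) :
    f = mulEnd mul :=
  endOperad_ext fun v => by
    rw [endEval_mulEnd, ← h]
    exact congrArg _ (funext fun i => by fin_cases i <;> rfl)

/-- The algebra structure over the operad of all binary operations. -/
def magmaAlg : (magma k).Hom (endOperad k V) :=
  freeHom (X := BinaryGen) (deg := fun _ _ => 0) (f := fun _ x => match x with
    | .mu => mulEnd mul) fun _ _ => mem_trivGr_zero _

theorem magmaAlg_mu : (magmaAlg mul).app 2 (gen k BinaryGen.mu) = mulEnd mul :=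
  freeHom_gen (X := BinaryGen) (deg := fun _ _ => 0) _ BinaryGen.mu

variable (h : ∀ a b c, mul a (mul b c) + mul (mul a b) c = 0)
include h

/-- The generating relation evaluates to the identity of anti-associativity, and a morphism of
operads respects all operations that generate the ideal. -/
theorem magmaAlg_of_inIdeal {n : ℕ} {x : (magma k).obj n}
    (hx : (magma k).InIdeal (AntiAssRel k) n x) : (magmaAlg mul).app n x = 0 := by
  induction hx with
  | of x hx =>
    cases hx
    refine (map_add ((magmaAlg mul).app 3) _ _).trans (Eq.trans (congrArg₂ (· + ·)
      ((magmaAlg mul).app_comp (0 : Fin 2) _ _) ((magmaAlg mul).app_comp (1 : Fin 2) _ _)) ?_)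
    rw [magmaAlg_mu]
    refine endOperad_ext (n := 3) fun v => ?_
    exact (add_comm _ _).trans (h (v 0) (v 1) (v 2))
  | zero n => exact map_zero _
  | add x y _ _ hx hy => rw [map_add, hx, hy, add_zero]
  | smul c x _ hx => rw [map_smul, hx, smul_zero]
  | relabel σ x _ hx => rw [(magmaAlg mul).app_relabel, hx, map_zero]
  | comp_left i x y _ hx => rw [(magmaAlg mul).app_comp, hx, map_zero, LinearMap.zero_apply]
  | comp_right i x y _ hy => rw [(magmaAlg mul).app_comp, hy, map_zero]

/-- An anti-associative algebra as an algebra over the operad. -/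
def alg : (antiAss k).Hom (endOperad k V) where
  app n := ((magma k).ideal (AntiAssRel k) n).liftQ ((magmaAlg mul).app n)
    fun _ hx => magmaAlg_of_inIdeal mul h hx
  app_mem {n p x} hx := by
    by_cases hp : p = 0
    · subst hp
      exact mem_trivGr_zero _
    · obtain ⟨x, rfl⟩ := quotHom_surjective n x
      change (magmaAlg mul).app n x ∈ _
      rw [magmaAlg_of_inIdeal mul h (quotHom_eq_zero (eq_zero_of_mem_trivGr hp hx))]
      exact Submodule.zero_mem _
  app_relabel {m n} σ x := by
    obtain ⟨x, rfl⟩ := quotHom_surjective m x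
    exact (magmaAlg mul).app_relabel σ x
  app_one := (magmaAlg mul).app_one
  app_comp {m n} i x y := by
    obtain ⟨x, rfl⟩ := quotHom_surjective m x
    obtain ⟨y, rfl⟩ := quotHom_surjective n y
    exact (magmaAlg mul).app_comp i x y

theorem alg_mul : (alg mul h).app 2 (antiAssMul k) = mulEnd mul := magmaAlg_mu mul

/-- The quotient map is onto and its source is free on `μ`, so a morphism is determined by its value
at `μ`. -/
theorem eq_alg (α : (antiAss k).Hom (endOperad k V))
    (hα : ∀ a b, endEval (α.app 2 (antiAssMul k)) ![a, b] = mul a b) : α = alg mul h :=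
  Operad.Hom.ext' fun n x => by
    obtain ⟨x, rfl⟩ := quotHom_surjective n x
    exact freeHom_ext (X := BinaryGen) (deg := fun _ _ => 0) (f := (quotHom k).trans α)
      (g := (quotHom k).trans (alg mul h))
      (fun _ x => match x with
        | .mu => (eq_mulEnd mul hα).trans (alg_mul mul h).symm) n x

end algebra

/-! ### Cochains -/

section cochains
variable {X : ℕ → Type v} {deg : ∀ a, X a → ℤ} {V : Type w} [AddCommGroup V] [Module k V]
  {β : (freeOperad k X deg).Hom (endOperad k V)}

/-- A derivation of degree `-p` sends a generator of degree other than `p` to a nonzero degree,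
where the endomorphism operad vanishes. -/
theorem derivation_gen_eq_zero {p : ℤ} (θ : derivations β p) {a : ℕ} {x : X a}
    (hx : deg a x ≠ p) : θ.1 a (gen k x) = 0 :=
  eq_zero_of_mem_trivGr (sub_ne_zero.2 hx) (θ.2.1 a _ _ (gen_mem x))

variable (β) in
-- A derivation is determined by its values on generators, which can be prescribed subject only to
-- the degrees; outside degree `p` the values are zero for degree reasons.
theorem restriction_bijective (p : ℤ) : Function.Bijective
    fun (θ : derivations β p) (x : Σ a, {x : X a // deg a x = p}) => θ.1 x.1 (gen k x.2.1) := by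
  constructor
  · intro θ θ' e
    refine derivation_ext fun a x => ?_
    by_cases hx : deg a x = p
    · exact congrFun e ⟨a, x, hx⟩
    · rw [derivation_gen_eq_zero θ hx, derivation_gen_eq_zero θ' hx]
  · intro F
    obtain ⟨θ, hθ⟩ := exists_derivation (β := β) (p := p)
      (fun a x => if hx : deg a x = p then F ⟨a, x, hx⟩ else 0) fun a x => by
        split_ifs with hx
        · rw [hx, sub_self]; exact mem_trivGr_zero _
        · exact Submodule.zero_mem _
    exact ⟨θ, funext fun x => (hθ x.1 x.2.1).trans (dif_pos x.2.2)⟩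

variable (β) in
theorem restriction_bijective_of_bijective {p : ℤ} {I : Type*} {a : ℕ} (e : I → X a)
    (he : Function.Injective e) (hp : ∀ i, deg a (e i) = p)
    (hs : ∀ b (x : X b), deg b x = p → ∃ i, (⟨a, e i⟩ : Σ a, X a) = ⟨b, x⟩) :
    Function.Bijective fun (θ : derivations β p) (i : I) => θ.1 a (gen k (e i)) := by
  let E : I → Σ a, {x : X a // deg a x = p} := fun i => ⟨a, e i, hp i⟩
  have hE : Function.Bijective E := by
    refine ⟨fun i j h => he ?_, fun ⟨b, x, hx⟩ => ?_⟩
    · simpa [E] using h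
    · obtain ⟨i, hi⟩ := hs b x hx
      cases hi
      exact ⟨i, rfl⟩
  exact ((Equiv.piCongrLeft (fun s : Σ a, {x : X a // deg a x = p} => (endOperad k V).obj s.1)
    (Equiv.ofBijective E hE)).symm.bijective).comp (restriction_bijective β p)

variable (β) in
theorem restriction_bijective_of_unique {p : ℤ} {a : ℕ} (x₀ : X a) (hp : deg a x₀ = p)
    (hs : ∀ b (x : X b), deg b x = p → (⟨a, x₀⟩ : Σ a, X a) = ⟨b, x⟩) :
    Function.Bijective fun θ : derivations β p => θ.1 a (gen k x₀) :=
  (Equiv.funUnique Unit _).bijective.comp (restriction_bijective_of_bijective β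
    (fun _ : Unit => x₀) (fun _ _ _ => rfl) (fun _ => hp) fun b x hx => ⟨(), hs b x hx⟩)

variable {μ₂ : X 2} {μ₃ : X 3} {mul : V →ₗ[k] V →ₗ[k] V}

theorem delta₁_formula (hβ : β.app 2 (gen k μ₂) = mulEnd mul) (φ : V →ₗ[k] V) (a b : V) :
    endEval ((delta₁ β φ).1 2 (gen k μ₂)) ![a, b] =
      mul a (φ b) - φ (mul a b) + mul (φ a) b := by
  change innerEnd φ 2 (β.app 2 (gen k μ₂)) ![a, b] = _
  rw [hβ]
  refine (innerEnd_apply φ (n := 2) (mulEnd mul) ![a, b]).trans ?_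
  rw [Fin.sum_univ_two]
  change mul (φ a) b + mul a (φ b) - φ (mul a b) = _
  abel

theorem delta₂_formula (hβ : β.app 2 (gen k μ₂) = mulEnd mul)
    (θ : derivations β 0) {f : V → V → V}
    (hf : ∀ a b, f a b = endEval (θ.1 2 (gen k μ₂)) ![a, b]) (a b c : V) :
    endEval (θ.1 3 (gen k μ₂ ∘[1] gen k μ₂ + gen k μ₂ ∘[2] gen k μ₂)) ![a, b, c] =
      mul a (f b c) + f (mul a b) c + f a (mul b c) + mul (f a b) c := by
  have hf' (v : Fin 2 → V) : endEval (θ.1 2 (gen k μ₂)) v = f (v 0) (v 1) := by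
    rw [hf]
    exact congrArg _ (funext fun i => by fin_cases i <;> rfl)
  have hc (i : Fin 2) : θ.1 3 ((freeOperad k X deg).comp i (gen k μ₂) (gen k μ₂)) =
      (endOperad k V).comp i (θ.1 2 (gen k μ₂)) (mulEnd mul) +
        (endOperad k V).comp i (mulEnd mul) (θ.1 2 (gen k μ₂)) := by
    have := θ.2.2.2 2 2 i _ (gen k μ₂) (gen k μ₂) (gen_mem μ₂)
    rwa [hβ, zero_mul, ksign_zero, one_smul] at this
  have he (i : Fin 2) := congrArg (fun z => endEval (n := 3) z ![a, b, c]) (hc i)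
  have e0 : endEval (n := 3) (θ.1 3 ((freeOperad k X deg).comp (0 : Fin 2) (gen k μ₂) (gen k μ₂)))
      ![a, b, c] = f (mul a b) c + mul (f a b) c :=
    (he 0).trans (congrArg₂ (· + ·) (hf' _) (congrArg (fun z => mul z c) (hf' _)))
  have e1 : endEval (n := 3) (θ.1 3 ((freeOperad k X deg).comp (1 : Fin 2) (gen k μ₂) (gen k μ₂)))
      ![a, b, c] = f a (mul b c) + mul a (f b c) :=
    (he 1).trans (congrArg₂ (· + ·) (hf' _) (congrArg (fun z => mul a z) (hf' _)))
  refine (congrArg (fun z => endEval (n := 3) z ![a, b, c]) (map_add (θ.1 3) _ _)).trans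
    (Eq.trans (congrArg₂ (· + ·) e0 e1) ?_)
  abel

/-- A derivation of degree `-1` vanishes on `μ₂`, so in each term only the vertex `μ₃` is
differentiated. The factors to the left of it that are not differentiated have degree zero, hence
there are no further signs. -/
theorem derivation_quintic (h2 : deg 2 μ₂ = 0) (θ : derivations β 1)
    (i : Fin 4) : θ.1 5 (quintic (gen k μ₂) (gen k μ₃) i) =
      quintic (β.app 2 (gen k μ₂)) (θ.1 3 (gen k μ₃)) i := by
  have t2 : θ.1 2 (gen k μ₂) = 0 := derivation_gen_eq_zero θ (by omega)
  have m2 : gen k μ₂ ∈ (freeOperad k X deg).gr 2 0 := h2 ▸ gen_mem μ₂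
  have hl {m n : ℕ} (i : Fin m) (x : (freeOperad k X deg).obj m) {y : (freeOperad k X deg).obj n}
      (hy : θ.1 n y = 0) : θ.1 _ ((freeOperad k X deg).comp i x y) =
        (endOperad k V).comp i (θ.1 m x) (β.app n y) := by
    rw [derivation_comp, hy, map_zero, add_zero]
  have hr {m n : ℕ} (i : Fin m) {x : (freeOperad k X deg).obj m} (y : (freeOperad k X deg).obj n)
      (hx : x ∈ (freeOperad k X deg).gr m 0) (hx0 : θ.1 m x = 0) :
      θ.1 _ ((freeOperad k X deg).comp i x y) =
        (endOperad k V).comp i (β.app m x) (θ.1 n y) := by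
    rw [θ.2.2.2 m n i 0 x y hx, hx0, map_zero, LinearMap.zero_apply, zero_add, mul_zero,
      ksign_zero, one_smul]
  refine quintic_congr (θ.1 5) (fun i j hi hj => ?_) (fun i j hi hj => ?_) (fun i j hi hj => ?_) i
  · refine (hr (n := 3) _ _ ((freeOperad k X deg).comp_mem _ m2 m2) ?_).trans ?_
    · exact (hl _ _ t2).trans (by rw [t2, map_zero, LinearMap.zero_apply])
    · exact congrArg (fun z => (endOperad k V).comp (n := 3) _ z _) (β.app_comp _ _ _)
  · exact (hl (n := 2) _ _ t2).trans
      (congrArg (fun z => (endOperad k V).comp (n := 2) _ z _) (hr (n := 3) _ _ m2 t2))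
  · exact (hl (n := 2) _ _ t2).trans
      (congrArg (fun z => (endOperad k V).comp (n := 2) _ z _) (hl (n := 2) _ _ t2))

/-- The evaluation at given inputs. -/
def endEvalAt {n : ℕ} (v : Fin n → V) : (endOperad k V).obj n →ₗ[k] V where
  toFun f := endEval f v
  map_add' _ _ := rfl
  map_smul' _ _ := rfl

/-- Each of the eight terms is a double composition, evaluated from the outside in; which inputs go
where is settled by computation. -/
theorem endEval_quintic {M : (endOperad k V).obj 2} (h : M = mulEnd mul)
    (G : (endOperad k V).obj 3) {g : V → V → V → V}
    (hg : ∀ a b c, g a b c = endEval G ![a, b, c]) (i : Fin 4) (a b c d e : V) :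
    endEval (quintic M G i) ![a, b, c, d, e] =
      ![mul a (g b c (mul d e)) - g a b (mul c (mul d e)) + mul (mul a b) (g c d e)
          - g (mul a b) (mul c d) e + mul (g (mul a b) c d) e - g (mul (mul a b) c) d e
          + mul (g a b c) (mul d e) - g a (mul b c) (mul d e),
        g (mul (mul a b) c) d e - mul (g (mul a b) c d) e + mul (g a b (mul c d)) e
          - g a (mul b (mul c d)) e + mul a (g b (mul c d) e) - g a b (mul (mul c d) e)
          + mul (mul a b) (g c d e) - g (mul a b) c (mul d e),
        g a (mul b c) (mul d e) - mul a (g (mul b c) d e) + g a (mul (mul b c) d) e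
          - mul (mul a (g b c d)) e + mul (g a b (mul c d)) e - mul (g (mul a b) c d) e
          + mul (mul (g a b c) d) e - g (mul a (mul b c)) d e,
        g (mul a b) (mul c d) e - g a b (mul (mul c d) e) + mul a (g b (mul c d) e)
          - g a (mul b (mul c d)) e + mul (mul a (g b c d)) e - mul (g a (mul b c) d) e
          + mul (mul (g a b c) d) e - mul (g (mul a b) c d) e] i := by
  have hG {v : Fin 3 → V} {x y z : V} (hx : x = v 0) (hy : y = v 1) (hz : z = v 2) :
      g x y z = endEval G v := by
    rw [hg, hx, hy, hz]
    exact congrArg _ (funext fun i => by fin_cases i <;> rfl)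
  have hM {v : Fin 2 → V} {x y : V} (hx : x = v 0) (hy : y = v 1) :
      mul x y = endEval M v := by
    rw [h, endEval_mulEnd, hx, hy]
  clear hg h
  have E {l m n : ℕ} (x : (endOperad k V).obj l) (y : (endOperad k V).obj m)
      (z : (endOperad k V).obj n) {i j : ℕ} {hi hj} {v : Fin (l + m - 1 + n - 1) → V} {r : V}
      (h : r = endEval x (endInputs ⟨i - 1, by omega⟩ (endEval y)
        (endInputs ⟨j - 1, by omega⟩ (endEval z) v))) :
      endEvalAt v (circ (circ x i y hi) j z hj) = r := h.symm
  fin_cases i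
  · refine map_alternating (endEvalAt ![a, b, c, d, e])
      (E M G M ?_) (E G M M ?_) (E M M G ?_) (E G M M ?_)
      (E M G M ?_) (E G M M ?_) (E M G M ?_) (E G M M ?_)
    all_goals
      repeat' first
        | refine hM ?_ ?_
        | refine hG ?_ ?_ ?_
        | rfl
  · refine map_alternating (endEvalAt ![a, b, c, d, e])
      (E G M M ?_) (E M G M ?_) (E M G M ?_) (E G M M ?_)
      (E M G M ?_) (E G M M ?_) (E M M G ?_) (E G M M ?_)
    all_goals
      repeat' first
        | refine hM ?_ ?_
        | refine hG ?_ ?_ ?_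
        | rfl
  · refine map_alternating (endEvalAt ![a, b, c, d, e])
      (E G M M ?_) (E M G M ?_) (E G M M ?_) (E M M G ?_)
      (E M G M ?_) (E M G M ?_) (E M M G ?_) (E G M M ?_)
    all_goals
      repeat' first
        | refine hM ?_ ?_
        | refine hG ?_ ?_ ?_
        | rfl
  · refine map_alternating (endEvalAt ![a, b, c, d, e])
      (E G M M ?_) (E G M M ?_) (E M G M ?_) (E G M M ?_)
      (E M M G ?_) (E M G M ?_) (E M M G ?_) (E M G M ?_)
    all_goals
      repeat' first
        | refine hM ?_ ?_
        | refine hG ?_ ?_ ?_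
        | rfl

end cochains

end
end AntiAss

namespace AntiAss
universe w
noncomputable section
variable {k : Type u} [Field k]
open Operad

/-! ### The generators of low degree -/

namespace Pre

open Gens

variable {P : Pre k} (h : ∀ n, 6 ≤ n → Good P n)
include h

theorem low_or_degree_lt {a : ℕ} {x : UGen a} (hx : P.V a x) : low.Low a x ∨ 6 ≤ a ∧ 2 < x.2 := by
  rcases Nat.lt_or_ge a 6 with ha | ha
  · left
    have h2 := V_two_le h hx
    rw [V, (h 6 le_rfl).low_gens a ha] at hx
    have h3 : a = 2 ∨ a = 3 ∨ a = 4 ∨ a = 5 := by omega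
    rcases h3 with rfl | rfl | rfl | rfl
    · obtain rfl : x = low.two := by simpa [lowGens, low] using hx
      exact .two
    · obtain rfl : x = low.three := by simpa [lowGens, low] using hx
      exact .three
    · simp [lowGens] at hx
    · obtain ⟨i, -, rfl⟩ := Finset.mem_map.1 hx
      exact .five i
  · exact .inr ⟨ha, V_degree_lt h hx ha⟩

/-- The generator `μ₂` of the minimal model. -/
def mu₂ : P.Gen 2 := ⟨low.two, V_low h .two⟩

/-- The generator `μ₃` of the minimal model. -/
def mu₃ : P.Gen 3 := ⟨low.three, V_low h .three⟩

/-- The generators `μ₅¹, …, μ₅⁴` of the minimal model. -/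
def mu₅ (i : Fin 4) : P.Gen 5 := ⟨low.five i, V_low h (.five i)⟩

theorem mu₅_injective : Function.Injective (mu₅ h) := fun i j e => by
  have := congrArg (fun x : P.Gen 5 => x.1.1) e
  exact Fin.ext (by simpa [mu₅, low] using this)

/-- The generators of degree at most two. -/
theorem gen_cases {a : ℕ} (x : P.Gen a) : (⟨2, mu₂ h⟩ : Σ a, P.Gen a) = ⟨a, x⟩ ∨
    (⟨3, mu₃ h⟩ : Σ a, P.Gen a) = ⟨a, x⟩ ∨ (∃ i, (⟨5, mu₅ h i⟩ : Σ a, P.Gen a) = ⟨a, x⟩) ∨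
    6 ≤ a ∧ 2 < P.gdeg a x := by
  obtain ⟨x, hx⟩ := x
  rcases low_or_degree_lt h hx with h' | h'
  · cases h' with
    | two => exact .inl rfl
    | three => exact .inr (.inl rfl)
    | five i => exact .inr (.inr (.inl ⟨i, rfl⟩))
  · exact .inr (.inr (.inr h'))

variable (P) in
omit h in
theorem finsum_gen (a : ℕ) : ∑ᶠ x : P.Gen a, ((P.gdeg a x).negOnePow : ℤ) = P.chi a := by
  rw [finsum_eq_sum_of_fintype]
  exact Finset.sum_coe_sort (P.gens a) fun x => sg x.2

theorem rho_mu₂ : P.rho.app 2 (gen k (mu₂ h)) = antiAssMul k :=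
  (congrArg ((aug k).app 2) (P.incl_gen (mu₂ h))).trans aug_two

theorem diff_mu₂ : (diff h).d 2 (gen k (mu₂ h)) = 0 := by
  rw [diff_apply, incl_gen]
  exact (congrArg (P.retr.app 2) (isLow h).d_two).trans (map_zero _)

theorem retr_mu₂ : P.retr.app 2 (gen k low.two) = gen k (mu₂ h) := P.retr_gen (mu₂ h)

theorem retr_mu₃ : P.retr.app 3 (gen k low.three) = gen k (mu₃ h) := P.retr_gen (mu₃ h)

theorem diff_mu₃ : (diff h).d 3 (gen k (mu₃ h)) =
    gen k (mu₂ h) ∘[1] gen k (mu₂ h) + gen k (mu₂ h) ∘[2] gen k (mu₂ h) := by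
  rw [diff_apply, incl_gen]
  refine (congrArg (P.retr.app 3) (isLow h).d_three).trans ((map_add (P.retr.app 3) _ _).trans
    (congrArg₂ (· + ·) ?_ ?_))
  · refine (P.retr.app_comp (0 : Fin 2) _ _).trans ?_
    rw [retr_mu₂ h]; rfl
  · refine (P.retr.app_comp (1 : Fin 2) _ _).trans ?_
    rw [retr_mu₂ h]; rfl

theorem diff_mu₅ (i : Fin 4) : (diff h).d 5 (gen k (mu₅ h i)) =
    quintic (gen k (mu₂ h)) (gen k (mu₃ h)) i := by
  rw [diff_apply, incl_gen]
  refine (congrArg (P.retr.app 5) ((isLow h).d_five i)).trans ?_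
  rw [map_quintic, retr_mu₂ h, retr_mu₃ h]

theorem diff_mu₅_eq_sum (i : Fin 4) : (diff h).d 5 (gen k (mu₅ h i)) =
    ∑ j : Fin 8, (-1 : k) ^ (j : ℕ) •
      (Bracketing.edge i j).elem (gen k (mu₂ h)) (gen k (mu₃ h)) 5 := by
  rw [diff_mu₅, ← retr_mu₂ h, ← retr_mu₃ h, ← map_quintic, (isLow h).quintic_eq_sum, map_sum]
  simp only [map_smul, Bracketing.map_elem]

end Pre

end
end AntiAss

theorem mainTheorem5 (k : Type u) [Field k] [CharZero k] :
    ∃ (X : ℕ → Type) (deg : ∀ a, X a → ℤ) (dR : (freeOperad k X deg).Differential)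
      (ρ : (freeOperad k X deg).Hom (antiAss k)) (hρ : IsMinimalModel (antiAss k) dR ρ)
      (μ₂ : X 2) (μ₃ : X 3) (μ₅ : Fin 4 → X 5),
      -- the generators
      ((∀ x : X 2, x = μ₂) ∧ deg 2 μ₂ = 0) ∧
      ((∀ x : X 3, x = μ₃) ∧ deg 3 μ₃ = 1) ∧
      IsEmpty (X 4) ∧
      (Function.Bijective μ₅ ∧ ∀ i, deg 5 (μ₅ i) = 2) ∧
      (∀ a, 6 ≤ a → ∀ x : X a, 2 < deg a x) ∧
      -- the Euler characteristics of the spaces of generators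
      (∀ a, Finite (X a)) ∧
      (∑ᶠ x : X 6, ((deg 6 x).negOnePow : ℤ) = -14) ∧
      (∑ᶠ x : X 7, ((deg 7 x).negOnePow : ℤ) = 30) ∧
      (∑ᶠ x : X 8, ((deg 8 x).negOnePow : ℤ) = -33) ∧
      (∑ᶠ x : X 9, ((deg 9 x).negOnePow : ℤ) = -55) ∧
      -- the augmentation and the differential
      ρ.app 2 (gen k μ₂) = antiAssMul k ∧
      dR.d 2 (gen k μ₂) = 0 ∧
      dR.d 3 (gen k μ₃) = gen k μ₂ ∘[1] gen k μ₂ + gen k μ₂ ∘[2] gen k μ₂ ∧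
      (∀ i, dR.d 5 (gen k (μ₅ i)) = quintic (gen k μ₂) (gen k μ₃) i) ∧
      (∀ i, ∃ e : Fin 8 → Bracketing, Bracketing.IsClosedEdgePath 5 e ∧
        dR.d 5 (gen k (μ₅ i)) =
          ∑ j : Fin 8, (-1 : k) ^ (j : ℕ) • (e j).elem (gen k μ₂) (gen k μ₃) 5) ∧
      -- the deformation complex of an anti-associative algebra `(V, mul)`
      ∀ (V : Type v) [AddCommGroup V] [Module k V] (mul : V →ₗ[k] V →ₗ[k] V),
        (∀ a b c, mul a (mul b c) + mul (mul a b) c = 0) →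
        ∃ α : (antiAss k).Hom (endOperad k V),
          (∀ a b, endEval (α.app 2 (antiAssMul k)) ![a, b] = mul a b) ∧
          (∀ α' : (antiAss k).Hom (endOperad k V),
            (∀ a b, endEval (α'.app 2 (antiAssMul k)) ![a, b] = mul a b) → α' = α) ∧
          -- the cochains of degree `p + 2` are the maps on the generators of degree `p`
          (∀ p : ℤ, Function.Bijective
            fun (θ : derivations (ρ.trans α) p) (x : Σ a, {x : X a // deg a x = p}) =>
              θ.1 x.1 (gen k x.2.1)) ∧
          (Function.Bijective fun θ : derivations (ρ.trans α) 0 => θ.1 2 (gen k μ₂)) ∧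
          (Function.Bijective fun θ : derivations (ρ.trans α) 1 => θ.1 3 (gen k μ₃)) ∧
          (Function.Bijective fun (θ : derivations (ρ.trans α) 2) (i : Fin 4) =>
            θ.1 5 (gen k (μ₅ i))) ∧
          -- `δ¹`
          (∀ (φ : V →ₗ[k] V) (a b : V),
            endEval ((delta₁ (ρ.trans α) φ).1 2 (gen k μ₂)) ![a, b] =
              mul a (φ b) - φ (mul a b) + mul (φ a) b) ∧
          -- `δ²`
          (∀ (θ : derivations (ρ.trans α) 0) (f : V → V → V),
            (∀ a b, f a b = endEval (θ.1 2 (gen k μ₂)) ![a, b]) →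
            ∀ a b c, endEval ((delta dR (hρ.app_d α) 0 θ).1 3 (gen k μ₃)) ![a, b, c] =
              mul a (f b c) + f (mul a b) c + f a (mul b c) + mul (f a b) c) ∧
          -- `δ³`
          ∀ (θ : derivations (ρ.trans α) 1) (g : V → V → V → V),
            (∀ a b c, g a b c = endEval (θ.1 3 (gen k μ₃)) ![a, b, c]) →
            ∀ (i : Fin 4) (a b c d e : V),
              endEval ((delta dR (hρ.app_d α) 1 θ).1 5 (gen k (μ₅ i))) ![a, b, c, d, e] =
              ![mul a (g b c (mul d e)) - g a b (mul c (mul d e)) + mul (mul a b) (g c d e)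
                  - g (mul a b) (mul c d) e + mul (g (mul a b) c d) e - g (mul (mul a b) c) d e
                  + mul (g a b c) (mul d e) - g a (mul b c) (mul d e),
                g (mul (mul a b) c) d e - mul (g (mul a b) c d) e + mul (g a b (mul c d)) e
                  - g a (mul b (mul c d)) e + mul a (g b (mul c d) e) - g a b (mul (mul c d) e)
                  + mul (mul a b) (g c d e) - g (mul a b) c (mul d e),
                g a (mul b c) (mul d e) - mul a (g (mul b c) d e) + g a (mul (mul b c) d) e
                  - mul (mul a (g b c d)) e + mul (g a b (mul c d)) e - mul (g (mul a b) c d) e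
                  + mul (mul (g a b c) d) e - g (mul a (mul b c)) d e,
                g (mul a b) (mul c d) e - g a b (mul (mul c d) e) + mul a (g b (mul c d) e)
                  - g a (mul b (mul c d)) e + mul (mul a (g b c d)) e - mul (g a (mul b c) d) e
                  + mul (mul (g a b c) d) e - mul (g (mul a b) c d) e] i := by
  -- The construction of the generators uses only that `2` is invertible; characteristic zero enters
  -- once more in the Euler characteristics.
  obtain ⟨P, h⟩ := Pre.exists_good (k := k) two_ne_zero ⟨Pre.first k, Pre.good_first two_ne_zero⟩
  obtain ⟨h6, h7, h8, h9⟩ := Pre.chi_high h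
  have hc {a : ℕ} (x : P.Gen a) := Pre.gen_cases h x
  refine ⟨P.Gen, P.gdeg, Pre.diff h, P.rho, Pre.isMinimalModel h, Pre.mu₂ h, Pre.mu₃ h, Pre.mu₅ h,
    ⟨fun x => ?_, rfl⟩, ⟨fun x => ?_, rfl⟩, ⟨fun x => ?_⟩,
    ⟨⟨Pre.mu₅_injective h, fun x => ?_⟩, fun _ => rfl⟩, fun a ha x => Pre.V_degree_lt h x.2 ha,
    fun a => inferInstance, (P.finsum_gen 6).trans h6, (P.finsum_gen 7).trans h7,
    (P.finsum_gen 8).trans h8, (P.finsum_gen 9).trans h9, Pre.rho_mu₂ h, Pre.diff_mu₂ h,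
    Pre.diff_mu₃ h, Pre.diff_mu₅ h,
    fun i => ⟨_, Bracketing.isClosedEdgePath_edge i, Pre.diff_mu₅_eq_sum h i⟩, ?_⟩
  · rcases hc x with e | e | ⟨i, e⟩ | ⟨e, -⟩ <;> first | omega | (cases e; rfl) | cases e
  · rcases hc x with e | e | ⟨i, e⟩ | ⟨e, -⟩ <;> first | omega | (cases e; rfl) | cases e
  · rcases hc x with e | e | ⟨i, e⟩ | ⟨e, -⟩ <;> first | omega | cases e
  · rcases hc x with e | e | ⟨i, e⟩ | ⟨e, -⟩ <;> first | omega | (cases e; exact ⟨i, rfl⟩) | cases e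
  intro V _ _ mul hmul
  -- The composite `β` sends `μ₂` to the given product, which is all that the formulas for the
  -- differentials need to know about it.
  have hβ : (P.rho.trans (alg mul hmul)).app 2 (gen k (Pre.mu₂ h)) = mulEnd mul :=
    (congrArg ((alg mul hmul).app 2) (Pre.rho_mu₂ h)).trans (alg_mul mul hmul)
  refine ⟨alg mul hmul, fun a b => ?_, fun α hα => eq_alg mul hmul α hα,
    restriction_bijective _, restriction_bijective_of_unique _ _ rfl fun a x hx => ?_,
    restriction_bijective_of_unique _ _ rfl fun a x hx => ?_,
    restriction_bijective_of_bijective _ _ (Pre.mu₅_injective h) (fun _ => rfl) fun a x hx => ?_,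
    delta₁_formula hβ, fun θ f hf a b c => ?_, fun θ g hg i a b c d e => ?_⟩
  · rw [alg_mul]; rfl
  · rcases hc x with e | e | ⟨i, e⟩ | ⟨-, e⟩
    · exact e
    · cases e; exact absurd hx (by decide : (1 : ℤ) ≠ 0)
    · cases e; exact absurd hx (by decide : (2 : ℤ) ≠ 0)
    · omega
  · rcases hc x with e | e | ⟨i, e⟩ | ⟨-, e⟩
    · cases e; exact absurd hx (by decide : (0 : ℤ) ≠ 1)
    · exact e
    · cases e; exact absurd hx (by decide : (2 : ℤ) ≠ 1)
    · omega
  · rcases hc x with e | e | e | ⟨-, e⟩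
    · cases e; exact absurd hx (by decide : (0 : ℤ) ≠ 2)
    · cases e; exact absurd hx (by decide : (1 : ℤ) ≠ 2)
    · exact e
    · omega
  · refine Eq.trans ?_ (delta₂_formula hβ θ hf a b c)
    exact congrArg (fun z => endEval (θ.1 3 z) ![a, b, c]) (Pre.diff_mu₃ h)
  · refine Eq.trans ?_ (endEval_quintic hβ _ hg i a b c d e)
    exact congrArg (fun z => endEval z ![a, b, c, d, e])
      ((congrArg (θ.1 5) (Pre.diff_mu₅ h i)).trans (derivation_quintic rfl θ i))
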